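/- Let $S$ be a connected oriented surface obtained from a closed surface by removing finitely many (at least one) points, called punctures, and assume $\chi(S)<-2$. An indexed ideal triangulation $\lambda$ of $S$ is a family of disjoint simple arcs $\lambda_1,\dots,\lambda_n$ going from puncture to puncture and cutting $S$ into ideal triangles; $\Lambda(S)$ is the set of isotopy classes of these. The components of $S-\lambda$ have $2n$ spikes; let $a_{ij}$ be the number of spikes delimited on the left by $\lambda_i$ and on the right by $\lambda_j$ (looking towards the puncture), and $\sigma_{ij}=a_{ij}-a_{ji}$. The Chekhov–Fock algebra of $\lambda$ is the algebra over $\mathbb C(q)$ ($q$ an indeterminate) of Laurent polynomials in $X_1,\dots,X_n$ with $X_iX_jX_i^{-1}X_j^{-1}=q^{2\sigma_{ij}}$, and $\mathbb C(X_1,\dots,X_n)^q_\lambda$ is its division algebra of fractions. The discrepancy span $D(\lambda,\lambda')$ is the closure in $S$ of the union of the components of $S-\lambda$ that are not isotopic to a component of $S-\lambda'$. A rational function $f$ in $k$ variables is a formal quotient $PQ^{-1}$ of Laurent polynomials over $\mathbb C(q)$ with $Q\neq0$; in $f(X_1,\dots,X_k)$ the variables of each monomial of $P$ and $Q$ are multiplied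 in increasing order of their indices. Let $\Psi_{\lambda\lambda'}:\mathbb C(X_1',\dots,X_n')^q_{\lambda'}\to\mathbb C(X_1,\dots,X_n)^q_{\lambda}$, $\lambda,\lambda'\in\Lambda(S)$, be a family of isomorphisms of $\mathbb C(q)$-algebras such that (a) $\Psi_{\lambda\lambda''}=\Psi_{\lambda\lambda'}\circ\Psi_{\lambda'\lambda''}$ for all $\lambda,\lambda',\lambda''$; (b) if $\lambda'_i=\lambda_{\sigma(i)}$ for all $i$, for a permutation $\sigma$ of $\{1,\dots,n\}$, then $\Psi_{\lambda\lambda'}(X_i')=X_{\sigma(i)}$ for all $i$; (c) (Locality Condition) whenever $\lambda,\lambda'$ are indexed so that $\lambda_i\subset D(\lambda,\lambda')$ exactly for $i\le k$, and $\lambda'_i=\lambda_i$ for $i>k$, one has $\Psi_{\lambda\lambda'}(X_i')=X_i$ for $i>k$ and $\Psi_{\lambda\lambda'}(X_i')=f_i(X_1,\dots,X_k)$ for $i\le k$, where the rational function $f_i$ can be chosen to be the same for any other pair $(\lambda'',\lambda''')$, indexed in the same way with the same $k$, for which there is an orientation preserving diffeomorphism $D(\lambda,\lambda')\to D(\lambda'',\lambda''')$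 sending $\lambda_j$ to $\lambda''_j$ and $\lambda'_j$ to $\lambda'''_j$ (up to isotopy) for all $j\le k$. Then there are a non-zero $\xi\in\mathbb C(q)$ and a sign $\varepsilon=\pm1$, independent of $\lambda$, and for each $\lambda\in\Lambda(S)$ an algebra automorphism $\Theta_\lambda$ of $\mathbb C(X_1,\dots,X_n)^q_\lambda$ with $\Theta_\lambda(X_k)=\xi X_k^{\varepsilon}$ for every $k$, such that the following holds. Let $\lambda'$ be obtained from $\lambda$ by an embedded $i$-th diagonal exchange: $\lambda_i$ is a diagonal of a square formed by two triangles of $\lambda$, whose sides are, in counterclockwise order, distinct arcs $\lambda_a,\lambda_b,\lambda_c,\lambda_d$, and $\lambda'$ is obtained by replacing $\lambda_i$ by the other diagonal $\lambda_i'$ of the square; the labels are placed so that, in the triangle of $\lambda$ with sides $\lambda_i$ and $\lambda_a$, the spike between these two sides has $\lambda_a$ on its left and $\lambda_i$ on its right. Then $\Psi^\Theta=\Theta_\lambda^{-1}\circ\Psi_{\lambda\lambda'}\circ\Theta_{\lambda'}$ satisfies $$\Psi^\Theta(X_a')=(1+qX_i)X_a,\quad \Psi^\Theta(X_b')=(1+qX_i^{-1})^{-1}X_b,\quad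 \Psi^\Theta(X_c')=(1+qX_i)X_c,\quad \Psi^\Theta(X_d')=(1+qX_i^{-1})^{-1}X_d,\quad \Psi^\Theta(X_i')=X_i^{-1}.$$ -/

import Mathlib

open Matrix
open scoped nonZeroDivisors MatrixGroups OnePoint

noncomputable section

namespace QuantumTeichmuller

/-! ## Chekhov–Fock algebras and their fraction division algebras -/

/-- The ground field `ℂ(q)`. -/
abbrev Cq : Type := RatFunc ℂ

/-- The indeterminate `q`. -/
abbrev q : Cq := RatFunc.X

theorem q_ne_zero : q ≠ 0 := RatFunc.X_ne_zero

/-- Formal Laurent polynomials in `n` variables over `ℂ(q)`. The element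
`Finsupp.single v c` stands for `c X₁^{v₁} X₂^{v₂} ⋯ Xₙ^{vₙ}`, with the variables written in
increasing order of their indices. -/
abbrev Laurent (n : ℕ) : Type := (Fin n → ℤ) →₀ Cq

/-- The exponent of `q` produced when the product
`(X₁^{v₁} ⋯ Xₙ^{vₙ}) (X₁^{w₁} ⋯ Xₙ^{wₙ})` is put in increasing order by means of
`X_i X_j = q^{2σ_{ij}} X_j X_i`. -/
def twist {n : ℕ} (σ : Fin n → Fin n → ℤ) (v w : Fin n → ℤ) : ℤ :=
  2 * ∑ i, ∑ j, if j < i then σ i j * v i * w j else 0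

/-- The Chekhov–Fock algebra `ℂ[X₁, …, Xₙ]^q` with relations
`X_i X_j X_i⁻¹ X_j⁻¹ = q^{2σ_{ij}}`: formal Laurent polynomials in the skew-commuting
variables `X_i`. -/
def CFAlgebra {n : ℕ} (_σ : Fin n → Fin n → ℤ) : Type := Laurent n

section CFAlgebra

variable {n : ℕ} (σ : Fin n → Fin n → ℤ)

instance : AddCommGroup (CFAlgebra σ) := inferInstanceAs (AddCommGroup (Laurent n))
instance : Module Cq (CFAlgebra σ) where
  smul c f := (c • (id f : Laurent n) : Laurent n)
  one_smul f := one_smul Cq (id f : Laurent n)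
  mul_smul c d f := mul_smul c d (id f : Laurent n)
  smul_zero c := smul_zero (A := Laurent n) c
  smul_add c f g := smul_add c (id f : Laurent n) (id g : Laurent n)
  add_smul c d f := add_smul c d (id f : Laurent n)
  zero_smul f := zero_smul Cq (id f : Laurent n)

/-- The identification of the underlying vector space with the space of formal Laurent
polynomials. -/
def toLaurent : CFAlgebra σ ≃ₗ[Cq] Laurent n where
  toFun f := f
  invFun f := f
  map_add' _ _ := rfl
  map_smul' _ _ := rfl
  left_inv _ := rfl
  right_inv _ := rfl

/-- The monomial `c X₁^{v₁} ⋯ Xₙ^{vₙ}`. -/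
def mono (v : Fin n → ℤ) (c : Cq) : CFAlgebra σ :=
  (toLaurent σ).symm (Finsupp.single v c)

/-- The multiplication of the Chekhov–Fock algebra, as a bilinear map. -/
def mulMap : CFAlgebra σ →ₗ[Cq] CFAlgebra σ →ₗ[Cq] CFAlgebra σ :=
  (Finsupp.linearCombination Cq fun v : Fin n → ℤ =>
    (Finsupp.linearCombination Cq fun w : Fin n → ℤ => mono σ (v + w) (q ^ twist σ v w)) ∘ₗ
      (toLaurent σ).toLinearMap) ∘ₗ (toLaurent σ).toLinearMap

instance : Mul (CFAlgebra σ) := ⟨fun f g => mulMap σ f g⟩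
instance : One (CFAlgebra σ) := ⟨mono σ 0 1⟩

theorem mul_def (f g : CFAlgebra σ) : f * g = mulMap σ f g := rfl
theorem one_def : (1 : CFAlgebra σ) = mono σ 0 1 := rfl

theorem smul_mono (c d : Cq) (v : Fin n → ℤ) : c • mono σ v d = mono σ v (c * d) := by
  rw [mono, mono, ← Finsupp.smul_single', LinearEquiv.map_smul]

theorem mono_mul_mono (v w : Fin n → ℤ) (c d : Cq) :
    mono σ v c * mono σ w d = mono σ (v + w) (c * d * q ^ twist σ v w) := by
  have h : mulMap σ (mono σ v c) (mono σ w d)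
      = c • d • mono σ (v + w) (q ^ twist σ v w) := by
    simp [mulMap, mono]
  rw [mul_def, h, smul_mono, smul_mono, mul_assoc]

theorem cf_induction {p : CFAlgebra σ → Prop} (f : CFAlgebra σ) (h0 : p 0)
    (hadd : ∀ f g, p f → p g → p (f + g)) (hm : ∀ v c, p (mono σ v c)) : p f :=
  Finsupp.induction_linear (motive := p) f h0 hadd hm

theorem twist_add_left (u v w : Fin n → ℤ) :
    twist σ (u + v) w = twist σ u w + twist σ v w := by
  unfold twist
  rw [← mul_add, ← Finset.sum_add_distrib]
  congr 1
  refine Finset.sum_congr rfl fun i _ => ?_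
  rw [← Finset.sum_add_distrib]
  refine Finset.sum_congr rfl fun j _ => ?_
  split_ifs
  · simp only [Pi.add_apply]; ring
  · simp

theorem twist_add_right (u v w : Fin n → ℤ) :
    twist σ u (v + w) = twist σ u v + twist σ u w := by
  unfold twist
  rw [← mul_add, ← Finset.sum_add_distrib]
  congr 1
  refine Finset.sum_congr rfl fun i _ => ?_
  rw [← Finset.sum_add_distrib]
  refine Finset.sum_congr rfl fun j _ => ?_
  split_ifs
  · simp only [Pi.add_apply]; ring
  · simp

theorem twist_zero_left (w : Fin n → ℤ) : twist σ 0 w = 0 := by simp [twist]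
theorem twist_zero_right (w : Fin n → ℤ) : twist σ w 0 = 0 := by simp [twist]

theorem cf_add_mul (f g h : CFAlgebra σ) : (f + g) * h = f * h + g * h := by
  simp only [mul_def, map_add, LinearMap.add_apply]

theorem cf_mul_add (f g h : CFAlgebra σ) : f * (g + h) = f * g + f * h := by
  simp only [mul_def, map_add]

theorem cf_zero_mul (f : CFAlgebra σ) : 0 * f = 0 := by
  simp only [mul_def, map_zero, LinearMap.zero_apply]

theorem cf_mul_zero (f : CFAlgebra σ) : f * 0 = 0 := by
  simp only [mul_def, map_zero]

theorem cf_one_mul (f : CFAlgebra σ) : 1 * f = f := by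
  induction f using cf_induction with
  | h0 => exact cf_mul_zero σ 1
  | hadd f g hf hg => rw [cf_mul_add, hf, hg]
  | hm v c => rw [one_def, mono_mul_mono, twist_zero_left]; simp

theorem cf_mul_one (f : CFAlgebra σ) : f * 1 = f := by
  induction f using cf_induction with
  | h0 => exact cf_zero_mul σ 1
  | hadd f g hf hg => rw [cf_add_mul, hf, hg]
  | hm v c => rw [one_def, mono_mul_mono, twist_zero_right]; simp

theorem cf_mul_assoc (f g h : CFAlgebra σ) : f * g * h = f * (g * h) := by
  induction f using cf_induction with
  | h0 => simp only [cf_zero_mul]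
  | hadd f₁ f₂ h₁ h₂ => simp only [cf_add_mul, h₁, h₂]
  | hm u a =>
    induction g using cf_induction with
    | h0 => simp only [cf_zero_mul, cf_mul_zero]
    | hadd g₁ g₂ h₁ h₂ => simp only [cf_add_mul, cf_mul_add, h₁, h₂]
    | hm v b =>
      induction h using cf_induction with
      | h0 => simp only [cf_mul_zero]
      | hadd k₁ k₂ h₁ h₂ => simp only [cf_mul_add, h₁, h₂]
      | hm w c =>
        simp only [mono_mul_mono, twist_add_left, twist_add_right, zpow_add₀ q_ne_zero,
          add_assoc]
        congr 1
        ring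

instance : Ring (CFAlgebra σ) :=
  { (inferInstance : AddCommGroup (CFAlgebra σ)),
    (inferInstance : Mul (CFAlgebra σ)), (inferInstance : One (CFAlgebra σ)) with
    left_distrib := cf_mul_add σ
    right_distrib := cf_add_mul σ
    zero_mul := cf_zero_mul σ
    mul_zero := cf_mul_zero σ
    mul_assoc := cf_mul_assoc σ
    one_mul := cf_one_mul σ
    mul_one := cf_mul_one σ }

instance : Algebra Cq (CFAlgebra σ) :=
  Algebra.ofModule (fun r f g => by simp only [mul_def, map_smul, LinearMap.smul_apply])
    (fun r f g => by simp only [mul_def, map_smul])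

/-- The coefficient of `X₁^{v₁} ⋯ Xₙ^{vₙ}`. -/
def coeff (v : Fin n → ℤ) : CFAlgebra σ →ₗ[Cq] Cq :=
  Finsupp.lapply v ∘ₗ (toLaurent σ).toLinearMap

theorem coeff_mono (u v : Fin n → ℤ) (c : Cq) :
    coeff σ u (mono σ v c) = if v = u then c else 0 := by
  simp [coeff, mono, Finsupp.single_apply]

theorem cf_ext {f g : CFAlgebra σ} (h : ∀ v, coeff σ v f = coeff σ v g) : f = g :=
  (toLaurent σ).injective (Finsupp.ext h)

/-- The set of exponents that occur. -/
def supp (f : CFAlgebra σ) : Finset (Fin n → ℤ) := (toLaurent σ f).support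

theorem mem_supp {f : CFAlgebra σ} {v : Fin n → ℤ} : v ∈ supp σ f ↔ coeff σ v f ≠ 0 :=
  Finsupp.mem_support_iff

theorem supp_nonempty {f : CFAlgebra σ} (hf : f ≠ 0) : (supp σ f).Nonempty :=
  Finsupp.support_nonempty_iff.2 fun h => hf ((toLaurent σ).map_eq_zero_iff.1 h)

theorem sum_mono (f : CFAlgebra σ) : f = ∑ v ∈ supp σ f, mono σ v (coeff σ v f) := by
  apply (toLaurent σ).injective
  rw [map_sum]
  exact (Finsupp.sum_single (toLaurent σ f)).symm

theorem coeff_mul (f g : CFAlgebra σ) (u : Fin n → ℤ) :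
    coeff σ u (f * g) = ∑ v ∈ supp σ f, ∑ w ∈ supp σ g,
      if v + w = u then coeff σ v f * coeff σ w g * q ^ twist σ v w else 0 := by
  conv_lhs => rw [sum_mono σ f, sum_mono σ g]
  simp only [Finset.sum_mul, Finset.mul_sum, mono_mul_mono, map_sum, coeff_mono]
  exact Finset.sum_comm

instance : Nontrivial (CFAlgebra σ) := (toLaurent σ).toEquiv.nontrivial

instance : NoZeroDivisors (CFAlgebra σ) where
  eq_zero_or_eq_zero_of_mul_eq_zero {f g} hfg := by
    by_contra! hne
    obtain ⟨a, ha, b, hb, hu⟩ :=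
      UniqueSums.uniqueAdd_of_nonempty (supp_nonempty σ hne.1) (supp_nonempty σ hne.2)
    have h := coeff_mul σ f g (a + b)
    rw [hfg, map_zero, Finset.sum_eq_single_of_mem a ha, Finset.sum_eq_single_of_mem b hb,
      if_pos rfl] at h
    · exact mul_ne_zero (mul_ne_zero ((mem_supp σ).1 ha) ((mem_supp σ).1 hb))
        (zpow_ne_zero _ q_ne_zero) h.symm
    · exact fun w hw hwb => if_neg fun hab => hwb (hu ha hw hab).2
    · exact fun v hv hva => Finset.sum_eq_zero fun w hw =>
        if_neg fun hab => hva (hu hv hw hab).1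

/-- The box `[-N, N]ⁿ` of exponents. -/
def box (n N : ℕ) : Finset (Fin n → ℤ) :=
  Fintype.piFinset fun _ => Finset.Icc (-(N : ℤ)) N

theorem card_box (n N : ℕ) : (box n N).card = (2 * N + 1) ^ n := by
  have h : ((N : ℤ) + 1 - -(N : ℤ)).toNat = 2 * N + 1 := by omega
  rw [box, Fintype.card_piFinset, Finset.prod_const, Int.card_Icc, h, Finset.card_univ,
    Fintype.card_fin]

theorem exists_box (s : Finset (Fin n → ℤ)) : ∃ m : ℕ, s ⊆ box n m := by
  refine ⟨s.sup fun v => Finset.univ.sup fun i => (v i).natAbs, fun v hv => ?_⟩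
  rw [box, Fintype.mem_piFinset]
  intro i
  have h1 : (v i).natAbs ≤ Finset.univ.sup fun i => (v i).natAbs :=
    Finset.le_sup (f := fun i => (v i).natAbs) (Finset.mem_univ i)
  have h2 := Finset.le_sup (f := fun v : Fin n → ℤ => Finset.univ.sup fun i => (v i).natAbs) hv
  rw [Finset.mem_Icc]
  have h3 := h1.trans h2
  omega

theorem add_mem_box {N m : ℕ} {v w : Fin n → ℤ} (hv : v ∈ box n N) (hw : w ∈ box n m) :
    v + w ∈ box n (N + m) := by
  rw [box, Fintype.mem_piFinset] at *
  intro i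
  have h1 := Finset.mem_Icc.1 (hv i)
  have h2 := Finset.mem_Icc.1 (hw i)
  rw [Finset.mem_Icc, Pi.add_apply]
  push_cast
  omega

theorem exists_growth (n m : ℕ) :
    ∃ N : ℕ, (2 * (N + m) + 1) ^ n < 2 * (2 * N + 1) ^ n := by
  obtain ⟨N, hN⟩ : ∃ N : ℕ, 4 * m * n < 2 * N + 1 := ⟨2 * m * n, by nlinarith⟩
  refine ⟨N, ?_⟩
  have hB : (0 : ℝ) < 2 * ((N : ℝ) + m) + 1 := by positivity
  have hN' : (4 : ℝ) * m * n < 2 * N + 1 := by exact_mod_cast hN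
  set x : ℝ := -(2 * m / (2 * ((N : ℝ) + m) + 1)) with hx
  have hx2 : -2 ≤ x := by
    rw [hx, neg_le_neg_iff, div_le_iff₀ hB]
    have : (0 : ℝ) ≤ N := by positivity
    have : (0 : ℝ) ≤ m := by positivity
    linarith
  have hb := one_add_mul_le_pow hx2 n
  have h1 : 1 + x = (2 * (N : ℝ) + 1) / (2 * ((N : ℝ) + m) + 1) := by
    rw [hx]; field_simp; ring
  have h2 : (1 : ℝ) / 2 < 1 + n * x := by
    have : (n : ℝ) * (2 * m / (2 * ((N : ℝ) + m) + 1)) < 1 / 2 := by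
      rw [← mul_div_assoc, div_lt_iff₀ hB]
      have : (0 : ℝ) ≤ m := by positivity
      linarith
    rw [hx]; linarith
  rw [h1, div_pow] at hb
  have h3 := lt_of_lt_of_le h2 hb
  rw [lt_div_iff₀ (by positivity)] at h3
  have h4 : (2 * ((N : ℝ) + m) + 1) ^ n < 2 * (2 * (N : ℝ) + 1) ^ n := by linarith
  exact_mod_cast h4

/-- The Laurent polynomials with exponents in a box. -/
def fromBox (N : ℕ) : (box n N → Cq) →ₗ[Cq] CFAlgebra σ :=
  (toLaurent σ).symm.toLinearMap ∘ₗ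
    ∑ v : box n N, (Finsupp.lsingle (v : Fin n → ℤ)) ∘ₗ LinearMap.proj v

theorem coeff_fromBox (N : ℕ) (c : box n N → Cq) (u : Fin n → ℤ) :
    coeff σ u (fromBox σ N c) = if h : u ∈ box n N then c ⟨u, h⟩ else 0 := by
  have h1 : coeff σ u (fromBox σ N c)
      = ∑ v : box n N, if (v : Fin n → ℤ) = u then c v else 0 := by
    simp [coeff, fromBox, Finsupp.single_apply]
  rw [h1]
  split_ifs with h
  · rw [Finset.sum_eq_single_of_mem ⟨u, h⟩ (Finset.mem_univ _)]
    · simp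
    · exact fun b _ hb => if_neg fun hbu => hb (Subtype.ext hbu)
  · exact Finset.sum_eq_zero fun v _ => if_neg fun hv : (v : Fin n → ℤ) = u => h (hv ▸ v.2)

theorem coeff_mul_eq_zero {N m : ℕ} {f g : CFAlgebra σ}
    (hf : supp σ f ⊆ box n N) (hg : supp σ g ⊆ box n m)
    {u : Fin n → ℤ} (hu : u ∉ box n (N + m)) : coeff σ u (f * g) = 0 := by
  rw [coeff_mul]
  exact Finset.sum_eq_zero fun v hv => Finset.sum_eq_zero fun w hw =>
    if_neg fun hvw : v + w = u => hu (hvw ▸ add_mem_box (hf hv) (hg hw))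

/-- The Ore condition, by comparison of dimensions. -/
theorem ore_condition (r s : CFAlgebra σ) (hs : s ≠ 0) :
    ∃ c d : CFAlgebra σ, c ≠ 0 ∧ c * r = d * s := by
  obtain ⟨m, hm⟩ := exists_box (supp σ r ∪ supp σ s)
  have hr := Finset.union_subset_left hm
  have hs' := Finset.union_subset_right hm
  obtain ⟨N, hN⟩ := exists_growth n m
  let M : ((box n N → Cq) × (box n N → Cq)) →ₗ[Cq] CFAlgebra σ :=
    (LinearMap.mulRight Cq r ∘ₗ fromBox σ N).coprod (-(LinearMap.mulRight Cq s ∘ₗ fromBox σ N))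
  let L : ((box n N → Cq) × (box n N → Cq)) →ₗ[Cq] (box n (N + m) → Cq) :=
    LinearMap.pi fun u => coeff σ u ∘ₗ M
  have hM : ∀ p, M p = fromBox σ N p.1 * r - fromBox σ N p.2 * s := fun p => by
    simp [M, sub_eq_add_neg]
  have hdim : Module.finrank Cq (box n (N + m) → Cq)
      < Module.finrank Cq ((box n N → Cq) × (box n N → Cq)) := by
    rw [Module.finrank_prod, Module.finrank_fintype_fun_eq_card,
      Module.finrank_fintype_fun_eq_card, Fintype.card_coe, Fintype.card_coe, card_box, card_box]
    omega
  obtain ⟨p, hpL, hp⟩ := Submodule.exists_mem_ne_zero_of_ne_bot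
    (LinearMap.ker_ne_bot_of_finrank_lt (f := L) hdim)
  have hbox : ∀ c : box n N → Cq, supp σ (fromBox σ N c) ⊆ box n N := fun c v hv => by
    by_contra h
    exact (mem_supp σ).1 hv (by rw [coeff_fromBox, dif_neg h])
  have hinj : ∀ c : box n N → Cq, fromBox σ N c = 0 → c = 0 := fun c hc => by
    funext v
    have h := coeff_fromBox σ N c v
    rw [hc, dif_pos v.2, map_zero] at h
    exact h.symm
  have heq : fromBox σ N p.1 * r = fromBox σ N p.2 * s := by
    rw [← sub_eq_zero, ← hM]
    refine cf_ext σ fun u => ?_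
    by_cases hu : u ∈ box n (N + m)
    · exact congrFun (LinearMap.mem_ker.1 hpL) ⟨u, hu⟩
    · rw [hM, map_sub, coeff_mul_eq_zero σ (hbox p.1) hr hu,
        coeff_mul_eq_zero σ (hbox p.2) hs' hu, sub_zero, map_zero]
  refine ⟨_, _, fun h0 => hp ?_, heq⟩
  have h1 := hinj _ h0
  rw [h0, zero_mul] at heq
  have h2 := hinj _ ((mul_eq_zero.1 heq.symm).resolve_right hs)
  exact Prod.ext h1 h2

instance : OreLocalization.OreSet (CFAlgebra σ)⁰ :=
  Classical.choice <| OreLocalization.nonempty_oreSet_iff_of_noZeroDivisors.2 fun r s => by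
    obtain ⟨c, d, hc, h⟩ := ore_condition σ r s (nonZeroDivisors.ne_zero s.2)
    exact ⟨d, ⟨c, mem_nonZeroDivisors_of_ne_zero hc⟩, h⟩

/-- The fraction division algebra `ℂ(X₁, …, Xₙ)^q` of the Chekhov–Fock algebra. -/
abbrev CFField : Type := OreLocalization (CFAlgebra σ)⁰ (CFAlgebra σ)

/-- A formal Laurent polynomial, evaluated at the generators `X₁, …, Xₙ`. -/
def evalLaurent (f : Laurent n) : CFField σ :=
  OreLocalization.numeratorRingHom ((toLaurent σ).symm f)

/-- The generator `X_i`. -/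
def gen (i : Fin n) : CFField σ := evalLaurent σ (Finsupp.single (Pi.single i 1) 1)

end CFAlgebra

/-- A multi-variable rational function `f = P Q⁻¹` in the first `k` of `n` variables: a quotient
of formal Laurent polynomials, the variables in each monomial being written in increasing order
of their indices. It is a formal object, that can be evaluated at the generators
of any Chekhov–Fock algebra. -/
structure RationalFunction (n k : ℕ) where
  num : Laurent n
  den : Laurent n
  den_ne_zero : den ≠ 0
  num_vars : ∀ v ∈ num.support, ∀ j : Fin n, k ≤ (j : ℕ) → v j = 0
  den_vars : ∀ v ∈ den.support, ∀ j : Fin n, k ≤ (j : ℕ) → v j = 0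

/-- The value `f(X₁, …, X_k) = P(X₁, …, X_k) Q(X₁, …, X_k)⁻¹`. -/
def RationalFunction.eval {n k : ℕ} (f : RationalFunction n k) (σ : Fin n → Fin n → ℤ) :
    CFField σ :=
  evalLaurent σ f.num * (evalLaurent σ f.den)⁻¹

/-! ## Punctured surfaces and their ideal triangulations

A connected oriented punctured surface `S` of negative Euler characteristic is presented as the
quotient of the hyperbolic plane `ℍ` by a discrete torsion-free group `Γ` of orientation
preserving isometries. The lifts to `ℍ` of the punctures are the cusps of `Γ`, which are points
of the circle at infinity `ℝ ∪ {∞}`. An isotopy class of arcs going from puncture to puncture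
has a unique geodesic representative, so that it is the same thing as a `Γ`-orbit of unordered
pairs of distinct cusps (the end points of the lifts of the arc). Simple arcs, and disjoint
arcs, are those whose lifts do not cross. -/

/-- `Γ` is discrete, torsion-free and contained in `SL(2, ℝ)`: the quotient of the hyperbolic
plane by `Γ` is an oriented surface with fundamental group `Γ`. -/
structure IsSurfaceGroup (Γ : Subgroup (GL (Fin 2) ℝ)) : Prop where
  det_eq_one : ∀ γ ∈ Γ, γ.det = 1
  discrete : DiscreteTopology Γ
  torsionFree : ∀ γ ∈ Γ, ∀ m : ℕ, 0 < m → γ ^ m = 1 → γ = 1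

/-- The Euler characteristic of the (connected, non-compact) surface with fundamental group `Γ`,
namely `1 - b₁` where `b₁` is the rank of the first homology group, the abelianization
of `Γ`. -/
def eulerChar (Γ : Subgroup (GL (Fin 2) ℝ)) : ℤ :=
  1 - (Module.finrank ℤ (Additive (Abelianization Γ)) : ℤ)

/-- Homogeneous coordinates of a point of `ℝ ∪ {∞}`. -/
def homog : OnePoint ℝ → ℝ × ℝ
  | ∞ => (1, 0)
  | (t : ℝ) => (t, 1)

/-- The determinant of the homogeneous coordinates of two points. -/
def hdet (x y : OnePoint ℝ) : ℝ := (homog x).1 * (homog y).2 - (homog y).1 * (homog x).2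

/-- The points `x`, `y`, `z` of the circle at infinity are distinct and occur in this order when
one goes counterclockwise around `ℍ`, such as `0`, `1`, `∞`. -/
def Ccw (x y z : OnePoint ℝ) : Prop := 0 < hdet x y * hdet y z * hdet z x

variable {Γ : Subgroup (GL (Fin 2) ℝ)} {n : ℕ}

/-- The isotopy class of an indexed ideal triangulation `λ₁, …, λₙ` of the surface `ℍ / Γ`.
Here `edge i x y` means that the geodesic with end points `x` and `y` is a lift of `λ_i`. -/
@[ext]
structure IdealTriangulation (Γ : Subgroup (GL (Fin 2) ℝ)) (n : ℕ) where
  edge : Fin n → OnePoint ℝ → OnePoint ℝ → Prop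
  /-- The lifts of `λ_i` form one `Γ`-orbit of unordered pairs of distinct cusps. -/
  isArc : ∀ i, ∃ x y, x ≠ y ∧ IsCusp x Γ ∧ IsCusp y Γ ∧
    ∀ u v, edge i u v ↔ ∃ γ ∈ Γ, (u = γ • x ∧ v = γ • y) ∨ (u = γ • y ∧ v = γ • x)
  /-- Arcs with different indices are different. -/
  edge_inj : ∀ i j x y, edge i x y → edge j x y → i = j
  /-- The arcs are simple and pairwise disjoint. -/
  noncrossing : ∀ i j x y z w, edge i x y → edge j z w → ¬ (Ccw x y z ∧ Ccw y x w)
  /-- On both sides of each lift of an arc there is a triangle bounded by lifts of arcs. -/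
  triangle : ∀ i x y, edge i x y → ∃ z, Ccw x y z ∧ (∃ j, edge j y z) ∧ ∃ k, edge k z x
  /-- There is at least one arc. -/
  pos : 0 < n
  /-- The triangles fill up the surface: any two lifts of arcs are connected by a chain of lifts
  in which consecutive ones are sides of the same triangle. -/
  connected : ∀ i x y j z w, edge i x y → edge j z w →
    Relation.ReflTransGen
      (fun a b : OnePoint ℝ × OnePoint ℝ => (∃ k, edge k b.1 b.2) ∧
        (b = (a.2, a.1) ∨
          (b.1 = a.2 ∧ Ccw a.1 a.2 b.2 ∧ ∃ k, edge k b.2 a.1))) (x, y) (z, w)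

namespace IdealTriangulation

/-- `x`, `y`, `z` are the vertices, in counterclockwise order, of a lift of a component of the
complement of the triangulation. -/
def IsFace (T : IdealTriangulation Γ n) (x y z : OnePoint ℝ) : Prop :=
  Ccw x y z ∧ (∃ i, T.edge i x y) ∧ (∃ i, T.edge i y z) ∧ ∃ i, T.edge i z x

/-- The number `a_{ij}` of spikes of `S - λ` that are delimited on the left by `λ_i` and on the
right by `λ_j`, when one looks towards the puncture. A spike is a `Γ`-orbit of lifted triangles
`(x, y, z)` with a preferred vertex `x`. -/
def spikes (T : IdealTriangulation Γ n) (i j : Fin n) : ℕ :=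
  Set.ncard {c : MulAction.orbitRel.Quotient Γ (OnePoint ℝ × OnePoint ℝ × OnePoint ℝ) |
    ∃ x y z, c = Quotient.mk'' (x, y, z) ∧ T.IsFace x y z ∧ T.edge i x y ∧ T.edge j x z}

/-- The integers `σ_{ij} = a_{ij} - a_{ji}`. -/
def sigma (T : IdealTriangulation Γ n) (i j : Fin n) : ℤ :=
  (T.spikes i j : ℤ) - (T.spikes j i : ℤ)

/-- The Chekhov–Fock division algebra `ℂ(X₁, …, Xₙ)^q_λ` of a triangulation. -/
abbrev K (T : IdealTriangulation Γ n) : Type := CFField T.sigma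

/-- The generator `X_i` associated to the `i`-th arc. -/
abbrev X (T : IdealTriangulation Γ n) (i : Fin n) : T.K := gen T.sigma i

/-- The reindexed triangulation, whose `i`-th arc is `λ_{π(i)}`. -/
def reindex (T : IdealTriangulation Γ n) (π : Equiv.Perm (Fin n)) : IdealTriangulation Γ n where
  edge i := T.edge (π i)
  isArc i := T.isArc (π i)
  edge_inj i j x y hi hj := π.injective (T.edge_inj _ _ x y hi hj)
  noncrossing i j := T.noncrossing (π i) (π j)
  triangle i x y h := by
    obtain ⟨z, hz, ⟨j, hj⟩, k, hk⟩ := T.triangle (π i) x y h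
    exact ⟨z, hz, ⟨π.symm j, by simpa using hj⟩, π.symm k, by simpa using hk⟩
  pos := T.pos
  connected i x y j z w hi hj := by
    refine Relation.ReflTransGen.mono ?_ _ _ (T.connected (π i) x y (π j) z w hi hj)
    rintro a b ⟨⟨k, hk⟩, h⟩
    refine ⟨⟨π.symm k, by simpa using hk⟩, h.imp id ?_⟩
    rintro ⟨h1, h2, l, hl⟩
    exact ⟨h1, h2, π.symm l, by simpa using hl⟩

/-- `T'` is obtained from `T` by an embedded `i`-th diagonal exchange: `λ_i` is the diagonal of a
square with sides `λ_a, λ_b, λ_c, λ_d`, in counterclockwise order, which are distinct components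
of `T`, and `T'` is obtained by replacing `λ_i` by the other diagonal. Of the two possible
positions of the labels, the sides labelled `a` and `c` are those for which
`X_a X_i = q² X_i X_a` and `X_c X_i = q² X_i X_c`. -/
structure EmbeddedExchange (T T' : IdealTriangulation Γ n) (a b c d i : Fin n) : Prop where
  distinct : [a, b, c, d, i].Nodup
  others : ∀ j, j ≠ i → T'.edge j = T.edge j
  square : ∃ x w y z, Ccw x y z ∧ Ccw y x w ∧ T.edge i x y ∧
    T.edge a x w ∧ T.edge b w y ∧ T.edge c y z ∧ T.edge d z x ∧ T'.edge i w z

/-! ## The discrepancy span and the Locality Condition -/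

/-- The triangle `x y z` is a lift of a component of `S - λ` that is not isotopic to a component
of `S - λ'`; the discrepancy span `D(λ, λ')` is the closure of the union of these components. -/
def InSpan (T T' : IdealTriangulation Γ n) (x y z : OnePoint ℝ) : Prop :=
  T.IsFace x y z ∧ ¬ T'.IsFace x y z

/-- The arc `λ_i` is contained in `D(λ, λ')`. -/
def EdgeInSpan (T T' : IdealTriangulation Γ n) (i : Fin n) : Prop :=
  ∃ x y z, InSpan T T' x y z ∧ T.edge i x y

/-- The triangulations are indexed in such a way that exactly the first `k` arcs of `λ` are
contained in `D(λ, λ')`, and that `λ'_i = λ_i` for the other indices. -/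
def SpanIndexed (k : ℕ) (T T' : IdealTriangulation Γ n) : Prop :=
  k ≤ n ∧ (∀ i : Fin n, (i : ℕ) < k ↔ EdgeInSpan T T' i) ∧
    ∀ i : Fin n, k ≤ (i : ℕ) → T'.edge i = T.edge i

/-- The triangles of `λ` that lie in the same component of the preimage of `D(λ, λ')` in `ℍ` as
the triangle `x y z`. -/
inductive SpanReach (T T' : IdealTriangulation Γ n) (x y z : OnePoint ℝ) :
    OnePoint ℝ → OnePoint ℝ → OnePoint ℝ → Prop
  | base : SpanReach T T' x y z x y z
  | rotate {u v w : OnePoint ℝ} : SpanReach T T' x y z u v w → SpanReach T T' x y z v w u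
  | cross {u v w s : OnePoint ℝ} : SpanReach T T' x y z u v w → InSpan T T' v u s →
      SpanReach T T' x y z v u s

/-- The set of ideal vertices of the component of the preimage of `D(λ, λ')` that contains the
triangle `x y z`. -/
def spanVertices (T T' : IdealTriangulation Γ n) (x y z : OnePoint ℝ) : Set (OnePoint ℝ) :=
  {u | ∃ v w, SpanReach T T' x y z u v w}

/-- There is an orientation preserving diffeomorphism `ψ` from `D(λ, λ')` to `D(λ'', λ''')` that
sends `λ_j` to `λ''_j` and `λ'_j` to `λ'''_j`, up to isotopy, for each of the first `k` indices
`j`. It is described through its lifts to the components of the preimages in `ℍ`: such a lift is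
determined up to isotopy by its effect `φ` on ideal vertices, which preserves the cyclic order,
respects the lifts of the arcs, and conjugates the deck transformations. -/
def SpanDiffeo (k : ℕ) (T T' U U' : IdealTriangulation Γ n) : Prop :=
  ∀ x y z, InSpan T T' x y z → ∃ (φ : OnePoint ℝ → OnePoint ℝ) (u v w : OnePoint ℝ),
    InSpan U U' u v w ∧
    Set.BijOn φ (spanVertices T T' x y z) (spanVertices U U' u v w) ∧
    (∀ r ∈ spanVertices T T' x y z, ∀ s ∈ spanVertices T T' x y z,
      ∀ t ∈ spanVertices T T' x y z, Ccw r s t → Ccw (φ r) (φ s) (φ t)) ∧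
    (∀ j : Fin n, (j : ℕ) < k → ∀ r ∈ spanVertices T T' x y z, ∀ s ∈ spanVertices T T' x y z,
      (T.edge j r s ↔ U.edge j (φ r) (φ s)) ∧ (T'.edge j r s ↔ U'.edge j (φ r) (φ s))) ∧
    (∀ γ ∈ Γ, (∀ r ∈ spanVertices T T' x y z, γ • r ∈ spanVertices T T' x y z) →
      ∃ δ ∈ Γ, ∀ r ∈ spanVertices T T' x y z, φ (γ • r) = δ • φ r) ∧
    ∀ δ ∈ Γ, (∀ s ∈ spanVertices U U' u v w, δ • s ∈ spanVertices U U' u v w) →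
      ∃ γ ∈ Γ, ∀ r ∈ spanVertices T T' x y z,
        γ • r ∈ spanVertices T T' x y z ∧ φ (γ • r) = δ • φ r

/-- The Locality Condition for a family of isomorphisms
`Ψ_{λλ'} : ℂ(X'₁, …, X'ₙ)_{λ'} → ℂ(X₁, …, Xₙ)_λ`. -/
def LocalityCondition
    (Ψ : ∀ T T' : IdealTriangulation Γ n, T'.K ≃ₐ[Cq] T.K) : Prop :=
  ∀ (k : ℕ) (T T' : IdealTriangulation Γ n), SpanIndexed k T T' →
    (∀ i : Fin n, k ≤ (i : ℕ) → Ψ T T' (T'.X i) = T.X i) ∧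
    ∀ i : Fin n, (i : ℕ) < k → ∃ f : RationalFunction n k,
      Ψ T T' (T'.X i) = f.eval T.sigma ∧
      ∀ U U' : IdealTriangulation Γ n, SpanIndexed k U U' → SpanDiffeo k T T' U U' →
        Ψ U U' (U'.X i) = f.eval U.sigma

end IdealTriangulation

end QuantumTeichmuller

end

open QuantumTeichmuller

/-!
The proof first produces enough topology to turn the locality condition into functional equations
for one rational function, and then solves these equations.

*Topology.* An ideal triangulation is a family of arcs that is invariant under the surface group.
A `Fan` is an embedded polygon, triangulated from one of its vertices. As long as it has at most
seven sides, `χ < -2` implies that one of its sides is not glued to another one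
(`Fan.exists_free_side`), so that the triangle behind this side can be added; an embedded square is
thus enlarged to an octagon (`EmbeddedExchange.exists_octagon`). By a case distinction on the way
the sides of the octagon are glued, some sequence of diagonal exchanges in it leads to a square and
an outer arc `x` whose adjacency numbers with the four sides are in general position
(`Fan.hasSeparatingSquare`), to a square and an outer arc adjacent to exactly one of its sides, and
to an embedded pentagon (`Fan.hasUnitSquare`).

*Reduction to one variable.* The discrepancy span of an embedded diagonal exchange is its square
(`EmbeddedExchange.spanIndexed`), and any two such spans are diffeomorphic
(`EmbeddedExchange.spanDiffeo`). Hence `Ψ(X_i')` and `Ψ(X_a')` are given by the same rational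
functions of `X_a, X_b, X_c, X_d, X_i` for all embedded diagonal exchanges. The generators outside
the square are fixed by `Ψ`, and the adjacency numbers of an outer arc `x` with the sides of the
square do not change, so that `Ψ(X_i')` and `Ψ(X_a') X_a⁻¹` commute with `X_x`. Conjugation by `X_x`
grades the algebra by the adjacency numbers of `x`, and these rational functions are compatible with
this grading. As they are the same for all squares and for all four rotations of a square, the
squares found before leave functions of `X_i` only (`exists_one_variable`,
`IsCoordinateChange.exists_transition`).
The commutation relation of `X_a'` and `X_i'` then yields a constant `c` and a rational function `g`
with `Ψ(X_i') = c X_i⁻¹` and `Ψ(X_a') = g(X_i) X_a` (`IsCoordinateChange.exists_hasTransition`);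
`Ψ(X_b')` is determined by the inverse exchange (`IsCoordinateChange.apply_second`).

*Functional equations.* The commutation relation between `X_a'` and `X_b'` is the `SideRelation` of
`g`. Five diagonal exchanges in a pentagon bring its triangulation back, up to a transposition of
the two diagonals (`Pentagon.exists_cycle`); this is the `PentagonRelation`
(`IsCoordinateChange.exists_pentagonRelation`), an identity between functions of two elements with
`B A = q² A B`.

*Classification.* Both sides of the pentagon relation are brought into normal order, with functions
of `B` on the left and functions of `A` on the right. A relation between normally ordered products
is an identity in the tensor product of two fields of rational functions, to which linear
functionals may be applied (`QuantumPair.contract_aeval`). Up to the symmetry `opposite`, the order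
of `g` at the origin is at most zero. The leading terms show that it is zero
(`PentagonRelation.not_neg`) and that `g` is symmetric under an inversion of the variable
(`PentagonRelation.flip_eq`); together with the side relation, this gives `g(0) = 1`
(`SideRelation.value_eq_one`). If `b X^m` is the first non-constant term of `g`, the coefficient of
`A^m` in the pentagon relation is the identity `∏ g(q^{2j} X) = 1 + k X^m`, where `0 ≤ j < m`
(`prod_dilate_eq`). It forces `g(ζ X) = g(X)` for a primitive root of unity `ζ` of order `m`; as `g`
has a simple pole at infinity, `m = 1`. Therefore `g = 1 + k X` with `k² c = q²`, or, after
`opposite`, `g = (1 + k q⁻² X⁻¹)⁻¹` with `k² = q² c` (`PentagonRelation.classification`).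

*Normalization.* The automorphisms `X_j ↦ ξ X_j` in the first case and `X_j ↦ ξ X_j⁻¹` in the
second, with `ξ = k q⁻¹`, transform the coordinate changes into the Chekhov–Fock formulas
(`IsCoordinateChange.chekhovFockFormula_one`, `IsCoordinateChange.chekhovFockFormula_neg_one`).
-/

noncomputable section

namespace QuantumTeichmuller

/-! ### The cyclic order on the circle at infinity -/

theorem hdet_swap (x y : OnePoint ℝ) : hdet y x = -hdet x y := by
  unfold hdet; ring

theorem hdet_eq_zero {x y : OnePoint ℝ} : hdet x y = 0 ↔ x = y := by
  induction x using OnePoint.rec <;> induction y using OnePoint.rec <;>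
    simp [hdet, homog, sub_eq_zero]

/-- The Plücker relation between the determinants of four points. -/
theorem hdet_plucker (x y z w : OnePoint ℝ) :
    hdet x y * hdet z w - hdet x z * hdet y w + hdet x w * hdet y z = 0 := by
  unfold hdet; ring

namespace Ccw

variable {x y z w o : OnePoint ℝ}

theorem rot (h : Ccw x y z) : Ccw y z x := by
  unfold Ccw at *; linarith

theorem rot' (h : Ccw x y z) : Ccw z x y := h.rot.rot

theorem ne₁₂ (h : Ccw x y z) : x ≠ y := by
  rintro rfl
  simp [Ccw, hdet_eq_zero.2] at h

theorem ne₂₃ (h : Ccw x y z) : y ≠ z := h.rot.ne₁₂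

theorem ne₁₃ (h : Ccw x y z) : x ≠ z := h.rot'.ne₁₂.symm

theorem asymm (h : Ccw x y z) : ¬ Ccw y x z := by
  unfold Ccw at *
  rw [hdet_swap y x, hdet_swap z x, hdet_swap y z] at *
  intro h'
  nlinarith

theorem total (h₁ : x ≠ y) (h₂ : y ≠ z) (h₃ : x ≠ z) : Ccw x y z ∨ Ccw y x z := by
  have h : hdet x y * hdet y z * hdet z x ≠ 0 :=
    mul_ne_zero (mul_ne_zero (hdet_eq_zero.not.2 h₁) (hdet_eq_zero.not.2 h₂))
      (hdet_eq_zero.not.2 h₃.symm)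
  rcases h.lt_or_gt with h | h
  · right
    unfold Ccw
    rw [hdet_swap x y, hdet_swap z x, hdet_swap y z]
    linarith
  · exact Or.inl h

theorem trans (h₁ : Ccw o x y) (h₂ : Ccw o y z) : Ccw o x z := by
  have h₀ := h₂.ne₁₂
  have hp := hdet_plucker o x y z
  unfold Ccw at *
  rw [hdet_swap o y] at h₁
  rw [hdet_swap o z] at *
  have hc : 0 < hdet o y ^ 2 := by
    have := hdet_eq_zero.not.2 h₀
    positivity
  have ha : hdet o x ≠ 0 := by rintro h; simp [h] at h₁
  have hb : hdet o z ≠ 0 := by rintro h; simp [h] at h₂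
  have ha' : 0 < hdet o x ^ 2 := by positivity
  have hb' : 0 < hdet o z ^ 2 := by positivity
  refine (pos_iff_pos_of_mul_pos (a := hdet o y ^ 2) ?_).1 hc
  have e : hdet o y * hdet x z = hdet o x * hdet y z + hdet o z * hdet x y := by linarith
  have : hdet o y ^ 2 * (hdet o x * hdet x z * -hdet o z)
      = hdet o x ^ 2 * (hdet o y * hdet y z * -hdet o z)
        + hdet o z ^ 2 * (hdet o x * hdet x y * -hdet o y) := by
    linear_combination (- hdet o y * hdet o x * hdet o z) * e
  rw [this]
  positivity

theorem trans_last (h₁ : Ccw o x y) (h₂ : Ccw o y z) : Ccw x y z := by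
  have h₃ := h₂.rot
  have h₄ := h₁.rot'
  -- relative to `y`, the order is `z`, `o`, `x`
  exact (trans h₃ h₄).rot'

end Ccw

variable {Γ : Subgroup (GL (Fin 2) ℝ)} {n : ℕ}

theorem homog_smul (g : GL (Fin 2) ℝ) (x : OnePoint ℝ) : ∃ t : ℝ, t ≠ 0 ∧
    g 0 0 * (homog x).1 + g 0 1 * (homog x).2 = t * (homog (g • x)).1 ∧
    g 1 0 * (homog x).1 + g 1 1 * (homog x).2 = t * (homog (g • x)).2 := by
  have hdet : g 0 0 * g 1 1 - g 0 1 * g 1 0 ≠ 0 := by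
    rw [← Matrix.det_fin_two]; exact g.det_ne_zero
  induction x using OnePoint.rec with
  | infty =>
    rw [OnePoint.smul_infty_eq_ite]
    split_ifs with h
    · refine ⟨g 0 0, fun h0 => hdet (by rw [h, h0]; ring), ?_, ?_⟩ <;> simp [homog, h]
    · refine ⟨g 1 0, h, ?_, ?_⟩ <;> simp [homog]
      field_simp
  | coe r =>
    rw [OnePoint.smul_some_eq_ite]
    split_ifs with h
    · refine ⟨g 0 0 * r + g 0 1, fun h0 => hdet ?_, ?_, ?_⟩
      · by_cases h1 : g 1 0 = 0
        · have h2 : g 1 1 = 0 := by simpa [h1] using h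
          rw [h1, h2]; ring
        · have : g 1 0 * (g 0 0 * g 1 1 - g 0 1 * g 1 0) = 0 := by
            linear_combination (g 0 0 * g 1 0) * h - (g 1 0 ^ 2) * h0
          exact (mul_eq_zero.1 this).resolve_left h1
      · simp [homog]
      · simpa [homog] using h
    · exact ⟨g 1 0 * r + g 1 1, h, by simp [homog, mul_div_cancel₀ _ h], by simp [homog]⟩

theorem Ccw.smul {g : GL (Fin 2) ℝ} (hg : g.det = 1) {x y z : OnePoint ℝ} (h : Ccw x y z) :
    Ccw (g • x) (g • y) (g • z) := by
  obtain ⟨a, ha, ha1, ha2⟩ := homog_smul g x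
  obtain ⟨b, hb, hb1, hb2⟩ := homog_smul g y
  obtain ⟨c, hc, hc1, hc2⟩ := homog_smul g z
  have hd : g 0 0 * g 1 1 - g 0 1 * g 1 0 = 1 := by
    rw [← Matrix.det_fin_two]
    simpa using congrArg Units.val hg
  have key : ∀ (u v : OnePoint ℝ) (s t : ℝ),
      g 0 0 * (homog u).1 + g 0 1 * (homog u).2 = s * (homog (g • u)).1 →
      g 1 0 * (homog u).1 + g 1 1 * (homog u).2 = s * (homog (g • u)).2 →
      g 0 0 * (homog v).1 + g 0 1 * (homog v).2 = t * (homog (g • v)).1 →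
      g 1 0 * (homog v).1 + g 1 1 * (homog v).2 = t * (homog (g • v)).2 →
      hdet u v = s * t * hdet (g • u) (g • v) := by
    intro u v s t h1 h2 h3 h4
    unfold hdet
    have : s * t * ((homog (g • u)).1 * (homog (g • v)).2 - (homog (g • v)).1 * (homog (g • u)).2)
      = (s * (homog (g • u)).1) * (t * (homog (g • v)).2)
        - (t * (homog (g • v)).1) * (s * (homog (g • u)).2) := by ring
    rw [this, ← h1, ← h2, ← h3, ← h4]
    linear_combination (-(homog u).1 * (homog v).2 + (homog v).1 * (homog u).2) * hd
  unfold Ccw at *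
  rw [key x y a b ha1 ha2 hb1 hb2, key y z b c hb1 hb2 hc1 hc2, key z x c a hc1 hc2 ha1 ha2] at h
  have h1 : 0 < (a * b * c) ^ 2 * (hdet (g • x) (g • y) * hdet (g • y) (g • z) *
      hdet (g • z) (g • x)) := by
    convert h using 1; ring
  exact pos_of_mul_pos_right h1 (by positivity)

/-- A matrix of determinant one that fixes three points at infinity is `1` or `-1`. -/
theorem sq_eq_one_of_fix {g : GL (Fin 2) ℝ} (hg : g.det = 1) {x y z : OnePoint ℝ}
    (hxy : x ≠ y) (hyz : y ≠ z) (hxz : x ≠ z) (hx : g • x = x) (hy : g • y = y)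
    (hz : g • z = z) : g ^ 2 = 1 := by
  obtain ⟨a, ha, ha1, ha2⟩ := homog_smul g x
  obtain ⟨b, hb, hb1, hb2⟩ := homog_smul g y
  obtain ⟨c, hc, hc1, hc2⟩ := homog_smul g z
  rw [hx] at ha1 ha2
  rw [hy] at hb1 hb2
  rw [hz] at hc1 hc2
  have hd : g 0 0 * g 1 1 - g 0 1 * g 1 0 = 1 := by
    rw [← Matrix.det_fin_two]
    simpa using congrArg Units.val hg
  have h1 := hdet_eq_zero.not.2 hxy
  have h2 := hdet_eq_zero.not.2 hyz
  have h3 := hdet_eq_zero.not.2 hxz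
  -- the quadratic form `v ↦ det(v, g v)` vanishes at three points, hence identically
  have key : ∀ u : OnePoint ℝ, ∀ t : ℝ,
      g 0 0 * (homog u).1 + g 0 1 * (homog u).2 = t * (homog u).1 →
      g 1 0 * (homog u).1 + g 1 1 * (homog u).2 = t * (homog u).2 →
      g 1 0 * (homog u).1 ^ 2 + (g 1 1 - g 0 0) * (homog u).1 * (homog u).2
        - g 0 1 * (homog u).2 ^ 2 = 0 := by
    intro u t h1 h2
    linear_combination (homog u).1 * h2 - (homog u).2 * h1
  have kx := key x a ha1 ha2
  have ky := key y b hb1 hb2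
  have kz := key z c hc1 hc2
  unfold hdet at h1 h2 h3
  set p := homog x
  set r := homog y
  set s := homog z
  have e : (p.1 * r.2 - r.1 * p.2) * (r.1 * s.2 - s.1 * r.2) * (p.1 * s.2 - s.1 * p.2) ≠ 0 :=
    mul_ne_zero (mul_ne_zero h1 h2) h3
  have e10 : g 1 0 = 0 := by
    apply (mul_eq_zero.1 (?_ : _ * g 1 0 = 0)).resolve_left e
    linear_combination (r.1 * s.2 - s.1 * r.2) * r.2 * s.2 * kx
      - (p.1 * s.2 - s.1 * p.2) * p.2 * s.2 * ky + (p.1 * r.2 - r.1 * p.2) * p.2 * r.2 * kz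
  have e01 : g 0 1 = 0 := by
    apply (mul_eq_zero.1 (?_ : _ * g 0 1 = 0)).resolve_left e
    linear_combination -((r.1 * s.2 - s.1 * r.2) * r.1 * s.1 * kx
      - (p.1 * s.2 - s.1 * p.2) * p.1 * s.1 * ky + (p.1 * r.2 - r.1 * p.2) * p.1 * r.1 * kz)
  have e11 : g 1 1 - g 0 0 = 0 := by
    apply (mul_eq_zero.1 (?_ : _ * (g 1 1 - g 0 0) = 0)).resolve_left e
    linear_combination -((r.1 * s.2 - s.1 * r.2) * (r.1 * s.2 + s.1 * r.2) * kx
      - (p.1 * s.2 - s.1 * p.2) * (p.1 * s.2 + s.1 * p.2) * ky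
      + (p.1 * r.2 - r.1 * p.2) * (p.1 * r.2 + r.1 * p.2) * kz)
  have e11' : g 1 1 = g 0 0 := by linarith
  rw [e10, e01, e11'] at hd
  apply Units.ext
  rw [pow_two, Units.val_mul, Units.val_one]
  ext i j
  fin_cases i <;> fin_cases j <;> simp [Matrix.mul_apply, Fin.sum_univ_two, e10, e01, e11']
  all_goals linarith

theorem IsSurfaceGroup.eq_one_of_fix (hΓ : IsSurfaceGroup Γ) {g : GL (Fin 2) ℝ} (hg : g ∈ Γ)
    {x y z : OnePoint ℝ} (h : Ccw x y z) (hx : g • x = x) (hy : g • y = y) (hz : g • z = z) :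
    g = 1 :=
  hΓ.torsionFree g hg 2 two_pos
    (sq_eq_one_of_fix (hΓ.det_eq_one g hg) h.ne₁₂ h.ne₂₃ h.ne₁₃ hx hy hz)

namespace IdealTriangulation

variable (T : IdealTriangulation Γ n)

/-! ### Lifted arcs and lifted triangles -/

/-- The geodesic with end points `x` and `y` is a lift of one of the arcs. -/
def IsEdge (x y : OnePoint ℝ) : Prop := ∃ i, T.edge i x y

variable {T}

theorem edge_symm {i : Fin n} {x y : OnePoint ℝ} (h : T.edge i x y) : T.edge i y x := by
  obtain ⟨a, b, -, -, -, H⟩ := T.isArc i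
  obtain ⟨g, hg, h⟩ := (H x y).1 h
  exact (H y x).2 ⟨g, hg, h.symm.imp (fun h => ⟨h.2, h.1⟩) (fun h => ⟨h.2, h.1⟩)⟩

theorem edge_ne {i : Fin n} {x y : OnePoint ℝ} (h : T.edge i x y) : x ≠ y := by
  obtain ⟨a, b, hab, -, -, H⟩ := T.isArc i
  obtain ⟨g, hg, ⟨rfl, rfl⟩ | ⟨rfl, rfl⟩⟩ := (H x y).1 h
  · exact fun h => hab (MulAction.injective g h)
  · exact fun h => hab (MulAction.injective g h).symm

theorem edge_isCusp {i : Fin n} {x y : OnePoint ℝ} (h : T.edge i x y) : IsCusp x Γ := by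
  obtain ⟨a, b, hab, ha, hb, H⟩ := T.isArc i
  obtain ⟨g, hg, ⟨rfl, rfl⟩ | ⟨rfl, rfl⟩⟩ := (H x y).1 h
  · exact ha.smul_of_mem hg
  · exact hb.smul_of_mem hg

theorem edge_smul {i : Fin n} {x y : OnePoint ℝ} (h : T.edge i x y) {g : GL (Fin 2) ℝ}
    (hg : g ∈ Γ) : T.edge i (g • x) (g • y) := by
  obtain ⟨a, b, -, -, -, H⟩ := T.isArc i
  obtain ⟨k, hk, h⟩ := (H x y).1 h
  refine (H _ _).2 ⟨g * k, mul_mem hg hk, ?_⟩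
  rcases h with ⟨rfl, rfl⟩ | ⟨rfl, rfl⟩ <;> simp [mul_smul]

theorem edge_smul_iff {i : Fin n} {x y : OnePoint ℝ} {g : GL (Fin 2) ℝ} (hg : g ∈ Γ) :
    T.edge i (g • x) (g • y) ↔ T.edge i x y :=
  ⟨fun h => by simpa using edge_smul h (inv_mem hg), fun h => edge_smul h hg⟩

theorem exists_smul_of_edge {i : Fin n} {x y u v : OnePoint ℝ} (h : T.edge i x y)
    (h' : T.edge i u v) :
    ∃ g ∈ Γ, (u = g • x ∧ v = g • y) ∨ (u = g • y ∧ v = g • x) := by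
  obtain ⟨a, b, -, -, -, H⟩ := T.isArc i
  obtain ⟨k, hk, hk'⟩ := (H x y).1 h
  obtain ⟨l, hl, hl'⟩ := (H u v).1 h'
  refine ⟨l * k⁻¹, mul_mem hl (inv_mem hk), ?_⟩
  rcases hk' with ⟨rfl, rfl⟩ | ⟨rfl, rfl⟩ <;> rcases hl' with ⟨rfl, rfl⟩ | ⟨rfl, rfl⟩ <;>
    simp [mul_smul]

theorem edge_iff_of_edge {i : Fin n} {x y : OnePoint ℝ} (h : T.edge i x y) (j : Fin n) :
    T.edge j x y ↔ j = i :=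
  ⟨fun h' => T.edge_inj _ _ _ _ h' h, fun h' => h' ▸ h⟩

theorem IsFace.rot {x y z : OnePoint ℝ} (h : T.IsFace x y z) : T.IsFace y z x :=
  ⟨h.1.rot, h.2.2.1, h.2.2.2, h.2.1⟩

theorem IsFace.rot' {x y z : OnePoint ℝ} (h : T.IsFace x y z) : T.IsFace z x y := h.rot.rot

theorem isFace_of_edge {x y z : OnePoint ℝ} {i j k : Fin n} (h : Ccw x y z) (hi : T.edge i x y)
    (hj : T.edge j y z) (hk : T.edge k z x) : T.IsFace x y z :=
  ⟨h, ⟨i, hi⟩, ⟨j, hj⟩, ⟨k, hk⟩⟩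

theorem exists_face {i : Fin n} {x y : OnePoint ℝ} (h : T.edge i x y) : ∃ z, T.IsFace x y z := by
  obtain ⟨z, hz, hj, hk⟩ := T.triangle i x y h
  exact ⟨z, hz, ⟨i, h⟩, hj, hk⟩

theorem IsFace.smul (hΓ : IsSurfaceGroup Γ) {x y z : OnePoint ℝ} (h : T.IsFace x y z)
    {g : GL (Fin 2) ℝ} (hg : g ∈ Γ) : T.IsFace (g • x) (g • y) (g • z) := by
  obtain ⟨h, ⟨i, hi⟩, ⟨j, hj⟩, k, hk⟩ := h
  exact isFace_of_edge (h.smul (hΓ.det_eq_one g hg)) (edge_smul hi hg) (edge_smul hj hg)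
    (edge_smul hk hg)

theorem IsFace.not_ccw_apex {x y z z' : OnePoint ℝ} (h : T.IsFace x y z) (h' : T.IsFace x y z') :
    ¬ Ccw x z z' := by
  intro hz
  obtain ⟨k, hk⟩ := h.2.2.2
  obtain ⟨j, hj⟩ := h'.2.2.1
  -- the side `z x` would separate the end points of the side `y z'`
  exact T.noncrossing k j z x y z' hk hj ⟨h.1.rot', hz⟩

/-- An oriented lifted arc bounds exactly one lifted triangle on its left. -/
theorem IsFace.apex_unique {x y z z' : OnePoint ℝ} (h : T.IsFace x y z) (h' : T.IsFace x y z') :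
    z = z' := by
  by_contra hne
  rcases Ccw.total h.1.ne₁₃ hne h'.1.ne₁₃ with h2 | h2
  · exact h.not_ccw_apex h' h2
  · exact h'.not_ccw_apex h h2.rot

/-! ### Freeness of the action on oriented lifted arcs -/

theorem eq_one_of_fix_edge (hΓ : IsSurfaceGroup Γ) {i : Fin n} {x y : OnePoint ℝ}
    (h : T.edge i x y) {g : GL (Fin 2) ℝ} (hg : g ∈ Γ) (hx : g • x = x) (hy : g • y = y) :
    g = 1 := by
  obtain ⟨z, hz⟩ := exists_face h
  have h2 := hz.smul hΓ hg
  rw [hx, hy] at h2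
  exact hΓ.eq_one_of_fix hg hz.1 hx hy (h2.apex_unique hz)

theorem not_swap_edge (hΓ : IsSurfaceGroup Γ) {i : Fin n} {x y : OnePoint ℝ}
    (h : T.edge i x y) {g : GL (Fin 2) ℝ} (hg : g ∈ Γ) (hx : g • x = y) (hy : g • y = x) :
    False := by
  have h2 : g ^ 2 = 1 := eq_one_of_fix_edge hΓ h (pow_mem hg 2)
    (by rw [pow_two, mul_smul, hx, hy]) (by rw [pow_two, mul_smul, hy, hx])
  have := hΓ.torsionFree g hg 2 two_pos h2
  rw [this, one_smul] at hx
  exact edge_ne h hx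

theorem not_rotate_face (hΓ : IsSurfaceGroup Γ) {x y z : OnePoint ℝ}
    (h : Ccw x y z) {g : GL (Fin 2) ℝ} (hg : g ∈ Γ) (hx : g • x = y) (hy : g • y = z)
    (hz : g • z = x) : False := by
  have h3 : g ^ 3 = 1 := hΓ.eq_one_of_fix (pow_mem hg 3) h
    (by rw [pow_succ, pow_two, mul_smul, mul_smul, hx, hy, hz])
    (by rw [pow_succ, pow_two, mul_smul, mul_smul, hy, hz, hx])
    (by rw [pow_succ, pow_two, mul_smul, mul_smul, hz, hx, hy])
  have := hΓ.torsionFree g hg 3 three_pos h3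
  rw [this, one_smul] at hx
  exact h.ne₁₂ hx

/-- An element of `Γ` that maps one oriented lifted arc to another maps the triangle on the left
of the former to the triangle on the left of the latter. -/
theorem IsFace.smul_apex (hΓ : IsSurfaceGroup Γ) {x y z x' y' z' : OnePoint ℝ}
    (h : T.IsFace x y z) (h' : T.IsFace x' y' z') {g : GL (Fin 2) ℝ} (hg : g ∈ Γ)
    (hx : g • x = x') (hy : g • y = y') : g • z = z' := by
  have h2 := h.smul hΓ hg
  rw [hx, hy] at h2
  exact h2.apex_unique h'

/-- A lifted arc has exactly two orientations up to the action of `Γ`. -/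
theorem edge_dichotomy {i : Fin n} {x y x' y' : OnePoint ℝ} (h : T.edge i x y)
    (h' : T.edge i x' y') (hne : ∀ g ∈ Γ, ¬ (g • x = x' ∧ g • y = y')) {u v : OnePoint ℝ}
    (huv : T.edge i u v) :
    (∃ g ∈ Γ, u = g • x ∧ v = g • y) ∨ ∃ g ∈ Γ, u = g • x' ∧ v = g • y' := by
  obtain ⟨g, hg, hg' | hg'⟩ := exists_smul_of_edge h huv
  · exact Or.inl ⟨g, hg, hg'⟩
  · obtain ⟨k, hk, hk' | hk'⟩ := exists_smul_of_edge h h'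
    · exact absurd ⟨hk'.1.symm, hk'.2.symm⟩ (hne k hk)
    · refine Or.inr ⟨g * k⁻¹, mul_mem hg (inv_mem hk), ?_, ?_⟩
      · rw [hk'.1, mul_smul, inv_smul_smul, hg'.1]
      · rw [hk'.2, mul_smul, inv_smul_smul, hg'.2]

theorem not_smul_reverse (hΓ : IsSurfaceGroup Γ) {i : Fin n} {x y : OnePoint ℝ}
    (h : T.edge i x y) : ∀ g ∈ Γ, ¬ (g • x = y ∧ g • y = x) :=
  fun _ hg h' => not_swap_edge hΓ h hg h'.1 h'.2

theorem mk_eq_mk {α : Type*} [MulAction (GL (Fin 2) ℝ) α] {a b : α} :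
    (Quotient.mk'' a : MulAction.orbitRel.Quotient Γ α) = Quotient.mk'' b ↔
      ∃ g ∈ Γ, g • b = a := by
  rw [Quotient.eq'', MulAction.orbitRel_apply]
  constructor
  · rintro ⟨⟨g, hg⟩, h⟩
    exact ⟨g, hg, h⟩
  · rintro ⟨g, hg, h⟩
    exact ⟨⟨g, hg⟩, h⟩

theorem ncard_pair_filter {α : Type*} {A B : α} (hAB : A ≠ B) (p r : Prop) [Decidable p]
    [Decidable r] : Set.ncard {c | (c = A ∧ p) ∨ (c = B ∧ r)} =
      (if p then 1 else 0) + if r then 1 else 0 := by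
  by_cases hp : p <;> by_cases hr : r
  · have : {c | (c = A ∧ p) ∨ (c = B ∧ r)} = {A, B} := by ext c; simp [hp, hr]
    rw [this, Set.ncard_pair hAB]; simp [hp, hr]
  all_goals simp [hp, hr]

/-- The arcs adjacent to `λ_i` are read off from the two triangles on the left of the two
orientations of `λ_i`. The oriented lifts `x y` and `x' y'` represent these orientations: they are
not equivalent under `Γ`. -/
theorem sigma_eq (hΓ : IsSurfaceGroup Γ) {i : Fin n} {x y z x' y' z' : OnePoint ℝ}
    (hi : T.edge i x y) (h : T.IsFace x y z) (hi' : T.edge i x' y') (h' : T.IsFace x' y' z')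
    (hne : ∀ g ∈ Γ, ¬ (g • x = x' ∧ g • y = y')) (j : Fin n)
    [Decidable (T.edge j x z)] [Decidable (T.edge j x' z')]
    [Decidable (T.edge j y z)] [Decidable (T.edge j y' z')] :
    T.sigma i j = (if T.edge j x z then 1 else 0) + (if T.edge j x' z' then 1 else 0)
      - (if T.edge j y z then 1 else 0) - (if T.edge j y' z' then 1 else 0) := by
  have e1 : T.spikes i j = (if T.edge j x z then 1 else 0) + if T.edge j x' z' then 1 else 0 := by
    rw [spikes, ← ncard_pair_filter (A := (Quotient.mk'' (x, y, z) :
      MulAction.orbitRel.Quotient Γ (OnePoint ℝ × OnePoint ℝ × OnePoint ℝ)))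
      (B := Quotient.mk'' (x', y', z'))]
    · congr 1
      ext c
      constructor
      · rintro ⟨u, v, w, rfl, hf, hu, hv⟩
        rcases edge_dichotomy hi hi' hne hu with ⟨g, hg, rfl, rfl⟩ | ⟨g, hg, rfl, rfl⟩
        · obtain rfl := h.smul_apex hΓ hf hg rfl rfl
          exact Or.inl ⟨mk_eq_mk.2 ⟨g, hg, rfl⟩, (edge_smul_iff hg).1 hv⟩
        · obtain rfl := h'.smul_apex hΓ hf hg rfl rfl
          exact Or.inr ⟨mk_eq_mk.2 ⟨g, hg, rfl⟩, (edge_smul_iff hg).1 hv⟩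
      · rintro (⟨rfl, hj⟩ | ⟨rfl, hj⟩)
        · exact ⟨x, y, z, rfl, h, hi, hj⟩
        · exact ⟨x', y', z', rfl, h', hi', hj⟩
    · intro hc
      obtain ⟨g, hg, hc⟩ := mk_eq_mk.1 hc.symm
      exact hne g hg ⟨congrArg Prod.fst hc, congrArg (fun c => c.2.1) hc⟩
  have e2 : T.spikes j i = (if T.edge j y z then 1 else 0) + if T.edge j y' z' then 1 else 0 := by
    rw [spikes, ← ncard_pair_filter (A := (Quotient.mk'' (y, z, x) :
      MulAction.orbitRel.Quotient Γ (OnePoint ℝ × OnePoint ℝ × OnePoint ℝ)))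
      (B := Quotient.mk'' (y', z', x'))]
    · congr 1
      ext c
      constructor
      · rintro ⟨u, v, w, rfl, hf, hu, hv⟩
        rcases edge_dichotomy hi hi' hne (edge_symm hv) with
          ⟨g, hg, rfl, rfl⟩ | ⟨g, hg, rfl, rfl⟩
        · obtain rfl := h.smul_apex hΓ hf.rot' hg rfl rfl
          exact Or.inl ⟨mk_eq_mk.2 ⟨g, hg, rfl⟩, (edge_smul_iff hg).1 hu⟩
        · obtain rfl := h'.smul_apex hΓ hf.rot' hg rfl rfl
          exact Or.inr ⟨mk_eq_mk.2 ⟨g, hg, rfl⟩, (edge_smul_iff hg).1 hu⟩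
      · rintro (⟨rfl, hj⟩ | ⟨rfl, hj⟩)
        · exact ⟨y, z, x, rfl, h.rot, hj, edge_symm hi⟩
        · exact ⟨y', z', x', rfl, h'.rot, hj, edge_symm hi'⟩
    · intro hc
      obtain ⟨g, hg, hc⟩ := mk_eq_mk.1 hc.symm
      exact hne g hg ⟨congrArg (fun c => c.2.2) hc, congrArg Prod.fst hc⟩
  rw [sigma, e1, e2]
  push_cast
  ring

theorem sigma_swap (i j : Fin n) : T.sigma j i = -T.sigma i j := by
  unfold sigma; ring

end IdealTriangulation
end QuantumTeichmuller

namespace QuantumTeichmuller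
variable {Γ : Subgroup (GL (Fin 2) ℝ)} {n : ℕ}

theorem det_inv_eq_one (hΓ : IsSurfaceGroup Γ) {g : GL (Fin 2) ℝ} (hg : g ∈ Γ) :
    (g⁻¹).det = 1 := hΓ.det_eq_one _ (inv_mem hg)

theorem ccw_smul_iff (hΓ : IsSurfaceGroup Γ) {g : GL (Fin 2) ℝ} (hg : g ∈ Γ)
    {x y z : OnePoint ℝ} : Ccw (g • x) (g • y) (g • z) ↔ Ccw x y z :=
  ⟨fun h => by simpa using h.smul (det_inv_eq_one hΓ hg), fun h => h.smul (hΓ.det_eq_one g hg)⟩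

theorem cyclic_iff_of_neg (a b c : ℝ) : (b - a) * (c - b) * (a - c) < 0 ↔
    (a < b ∧ b < c) ∨ (b < c ∧ c < a) ∨ (c < a ∧ a < b) := by
  constructor
  · intro h
    by_contra! hn
    obtain ⟨h1, h2, h3⟩ := hn
    rcases lt_or_ge a b with hab | hab
    · have hcb := h1 hab
      have hac : a ≤ c := by
        by_contra! hca
        exact absurd (h3 hca) (not_le.2 hab)
      nlinarith [mul_nonneg (mul_nonneg (sub_nonneg.2 hab.le) (sub_nonneg.2 hcb))
        (sub_nonneg.2 hac)]
    · rcases lt_or_ge b c with hbc | hbc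
      · have := h2 hbc
        nlinarith [mul_nonneg (mul_nonneg (sub_nonneg.2 hab) (sub_nonneg.2 hbc.le))
          (sub_nonneg.2 this)]
      · have hac : c ≤ a := hbc.trans hab
        nlinarith [mul_nonneg (mul_nonneg (sub_nonneg.2 hab) (sub_nonneg.2 hbc))
          (sub_nonneg.2 hac)]
  · rintro (⟨h1, h2⟩ | ⟨h1, h2⟩ | ⟨h1, h2⟩)
    · nlinarith [mul_pos (mul_pos (sub_pos.2 h1) (sub_pos.2 h2)) (sub_pos.2 (h1.trans h2))]
    · nlinarith [mul_pos (mul_pos (sub_pos.2 h1) (sub_pos.2 h2)) (sub_pos.2 (h1.trans h2))]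
    · nlinarith [mul_pos (mul_pos (sub_pos.2 h1) (sub_pos.2 h2)) (sub_pos.2 (h1.trans h2))]

/-- Cutting the circle at infinity open at the point `o` turns the cyclic order into the
order of the real line. -/
theorem exists_coordinate (o : OnePoint ℝ) : ∃ f : OnePoint ℝ → ℝ,
    (∀ a b, a ≠ o → b ≠ o → (Ccw o a b ↔ f a < f b)) ∧
    ∀ a b c, a ≠ o → b ≠ o → c ≠ o → (Ccw a b c ↔
      (f a < f b ∧ f b < f c) ∨ (f b < f c ∧ f c < f a) ∨ (f c < f a ∧ f a < f b)) := by
  set r := (homog o).1 ^ 2 + (homog o).2 ^ 2 with hr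
  have hr0 : 0 < r := by
    have : homog o ≠ 0 := by
      induction o using OnePoint.rec <;> simp [homog]
    rcases eq_or_ne (homog o).1 0 with h1 | h1
    · have h2 : (homog o).2 ≠ 0 := fun h2 => this (Prod.ext h1 h2)
      positivity
    · positivity
  let f : OnePoint ℝ → ℝ := fun x =>
    ((homog o).1 * (homog x).1 + (homog o).2 * (homog x).2) / hdet o x
  have hd : ∀ a, a ≠ o → hdet o a ≠ 0 := fun a ha => hdet_eq_zero.not.2 ha.symm
  have hf : ∀ a b, a ≠ o → b ≠ o →
      r * hdet a b = -((f b - f a) * (hdet o a * hdet o b)) := by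
    intro a b ha hb
    have h1 := hd a ha
    have h2 := hd b hb
    simp only [f]
    field_simp
    simp only [hr, hdet]
    ring
  refine ⟨f, fun a b ha hb => ?_, fun a b c ha hb hc => ?_⟩
  · have h1 := hd a ha
    have h2 := hd b hb
    have : r * (hdet o a * hdet a b * hdet b o)
        = (hdet o a * hdet o b) ^ 2 * (f b - f a) := by
      rw [hdet_swap o b]
      linear_combination (- hdet o a * hdet o b) * hf a b ha hb
    unfold Ccw
    rw [← mul_pos_iff_of_pos_left hr0, this, mul_pos_iff_of_pos_left (by positivity), sub_pos]
  · have h1 := hd a ha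
    have h2 := hd b hb
    have h3 := hd c hc
    have : r ^ 3 * (hdet a b * hdet b c * hdet c a)
        = (hdet o a * hdet o b * hdet o c) ^ 2 * -((f b - f a) * (f c - f b) * (f a - f c)) := by
      have : r ^ 3 * (hdet a b * hdet b c * hdet c a)
        = (r * hdet a b) * (r * hdet b c) * (r * hdet c a) := by ring
      rw [this, hf a b ha hb, hf b c hb hc, hf c a hc ha]
      ring
    unfold Ccw
    rw [← mul_pos_iff_of_pos_left (pow_pos hr0 3), this,
      mul_pos_iff_of_pos_left (by positivity), neg_pos, cyclic_iff_of_neg]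

theorem Ccw.cross_symm {p r u v : OnePoint ℝ} (h₁ : Ccw p r u) (h₂ : Ccw r p v) :
    Ccw u v r ∧ Ccw v u p :=
  ⟨(Ccw.trans_last h₂.rot h₁).rot', (Ccw.trans h₂.rot h₁).rot⟩

/-- A chord that crosses a diagonal of an ideal square and none of its sides is the other
diagonal. -/
theorem eq_of_cross {x w y z u v : OnePoint ℝ} (h₁ : Ccw x y z) (h₂ : Ccw y x w)
    (hu : Ccw w z u) (hv : Ccw z w v)
    (hx : ¬ (Ccw x z u ∧ Ccw z x v)) (hx' : ¬ (Ccw w x u ∧ Ccw x w v))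
    (hy : ¬ (Ccw y w v ∧ Ccw w y u)) (hy' : ¬ (Ccw z y v ∧ Ccw y z u)) : u = x ∧ v = y := by
  obtain ⟨f, hf, hf'⟩ := exists_coordinate z
  have hxz := h₁.ne₁₃
  have hyz := h₁.ne₂₃
  have hwz := hu.ne₁₂
  have huz := hu.ne₂₃.symm
  have hvz := hv.ne₁₃.symm
  have e1 := (hf _ _ hxz hyz).1 h₁.rot'
  have e2 := (hf _ _ huz hwz).1 hu.rot
  have e3 := (hf _ _ hwz hvz).1 hv
  have e4 := (hf' _ _ _ hyz hxz hwz).1 h₂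
  have hw : f x < f w ∧ f w < f y := by
    rcases e4 with h | h | h
    · exact absurd (h.1.trans e1) (lt_irrefl _)
    · exact h
    · exact absurd (h.2.trans e1) (lt_irrefl _)
  constructor
  · by_contra hne
    rcases Ccw.total hxz.symm (Ne.symm hne) huz.symm with h | h
    · have h' := (hf _ _ hxz huz).1 h
      exact hx' ⟨(hf' _ _ _ hwz hxz huz).2 (Or.inr (Or.inl ⟨h', e2⟩)),
        (hf' _ _ _ hxz hwz hvz).2 (Or.inl ⟨hw.1, e3⟩)⟩
    · exact hx ⟨h, (hf _ _ hxz hvz).2 (hw.1.trans e3)⟩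
  · by_contra hne
    rcases Ccw.total hyz.symm (Ne.symm hne) hvz.symm with h | h
    · refine hy' ⟨h, ?_⟩
      exact ((hf _ _ huz hyz).2 (e2.trans hw.2)).rot'
    · have h' := (hf _ _ hvz hyz).1 h.rot'.rot'
      exact hy ⟨(hf' _ _ _ hyz hwz hvz).2 (Or.inr (Or.inl ⟨e3, h'⟩)),
        (hf' _ _ _ hwz hyz huz).2 (Or.inr (Or.inr ⟨e2, hw.2⟩))⟩

namespace IdealTriangulation

variable {T : IdealTriangulation Γ n}

/-- The steps that relate the oriented lifted arcs in the connectedness axiom. -/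
def DartStep (T : IdealTriangulation Γ n) (a b : OnePoint ℝ × OnePoint ℝ) : Prop :=
  (∃ k, T.edge k b.1 b.2) ∧
    (b = (a.2, a.1) ∨ (b.1 = a.2 ∧ Ccw a.1 a.2 b.2 ∧ ∃ k, T.edge k b.2 a.1))

/-- An embedded ideal square: `λ_i` is the geodesic `x y`, and the vertices of the square are
`x`, `w`, `y`, `z` in counterclockwise order, its sides being labelled by `a`, `b`, `c`, `d`. -/
structure Square (T : IdealTriangulation Γ n) (a b c d i : Fin n) (x w y z : OnePoint ℝ) :
    Prop where
  ccw₁ : Ccw x y z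
  ccw₂ : Ccw y x w
  diag : T.edge i x y
  side_a : T.edge a x w
  side_b : T.edge b w y
  side_c : T.edge c y z
  side_d : T.edge d z x
  ne_a : a ≠ i
  ne_b : b ≠ i
  ne_c : c ≠ i
  ne_d : d ≠ i

namespace Square

variable {a b c d i : Fin n} {x w y z : OnePoint ℝ}

theorem ccw₃ (h : T.Square a b c d i x w y z) : Ccw w y z :=
  Ccw.trans_last h.ccw₂.rot h.ccw₁

theorem ccw₄ (h : T.Square a b c d i x w y z) : Ccw x w z :=
  Ccw.trans h.ccw₂.rot h.ccw₁

/-- The square seen from the other end of its diagonal. -/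
theorem symm (h : T.Square a b c d i x w y z) : T.Square c d a b i y z x w :=
  ⟨h.ccw₂, h.ccw₁, edge_symm h.diag, h.side_c, h.side_d, h.side_a, h.side_b, h.ne_c, h.ne_d,
    h.ne_a, h.ne_b⟩

theorem face₁ (h : T.Square a b c d i x w y z) : T.IsFace x y z :=
  isFace_of_edge h.ccw₁ h.diag h.side_c h.side_d

theorem face₂ (h : T.Square a b c d i x w y z) : T.IsFace x w y :=
  isFace_of_edge h.ccw₂.rot h.side_a h.side_b (edge_symm h.diag)

/-- The lifts of the new diagonal. -/
def newEdge (_ : T.Square a b c d i x w y z) (u v : OnePoint ℝ) : Prop :=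
  ∃ γ ∈ Γ, (u = γ • w ∧ v = γ • z) ∨ (u = γ • z ∧ v = γ • w)

theorem newEdge_smul (h : T.Square a b c d i x w y z) {u v : OnePoint ℝ}
    (h' : h.newEdge u v) {k : GL (Fin 2) ℝ} (hk : k ∈ Γ) : h.newEdge (k • u) (k • v) := by
  obtain ⟨g, hg, h'⟩ := h'
  refine ⟨k * g, mul_mem hk hg, ?_⟩
  rcases h' with ⟨rfl, rfl⟩ | ⟨rfl, rfl⟩ <;> simp [mul_smul]

theorem newEdge_symm (h : T.Square a b c d i x w y z) {u v : OnePoint ℝ}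
    (h' : h.newEdge u v) : h.newEdge v u := by
  obtain ⟨g, hg, h'⟩ := h'
  exact ⟨g, hg, h'.symm.imp And.symm And.symm⟩

theorem not_edge (h : T.Square a b c d i x w y z) (j : Fin n) : ¬ T.edge j w z :=
  fun h' => T.noncrossing i j x y z w h.diag (edge_symm h') ⟨h.ccw₁, h.ccw₂⟩

theorem not_edge_newEdge (h : T.Square a b c d i x w y z) {j : Fin n} {u v : OnePoint ℝ}
    (h' : T.edge j u v) : ¬ h.newEdge u v := by
  rintro ⟨g, hg, ⟨rfl, rfl⟩ | ⟨rfl, rfl⟩⟩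
  · exact h.not_edge j ((edge_smul_iff hg).1 h')
  · exact h.not_edge j (edge_symm ((edge_smul_iff hg).1 h'))

/-- A chord that crosses the new diagonal and none of the sides is the old diagonal. -/
theorem edge_of_cross (h : T.Square a b c d i x w y z) {u v : OnePoint ℝ}
    (hn : ∀ j p r, j ≠ i → T.edge j p r → ¬ (Ccw p r u ∧ Ccw r p v))
    (hu : Ccw w z u) (hv : Ccw z w v) : u = x ∧ v = y := by
  have hn' : ∀ j p r, j ≠ i → T.edge j p r → ¬ (Ccw p r v ∧ Ccw r p u) :=
    fun j p r hj hp ⟨h1, h2⟩ => hn j r p hj (edge_symm hp) ⟨h2, h1⟩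
  exact eq_of_cross h.ccw₁ h.ccw₂ hu hv (hn d _ _ h.ne_d (edge_symm h.side_d))
    (hn a _ _ h.ne_a (edge_symm h.side_a)) (hn' b _ _ h.ne_b (edge_symm h.side_b))
    (hn' c _ _ h.ne_c (edge_symm h.side_c))

/-- The lifts of the new diagonal do not cross those of the other arcs: a lift of another arc
that crosses the new diagonal would have to be the old diagonal. -/
theorem not_cross_old (hΓ : IsSurfaceGroup Γ) (h : T.Square a b c d i x w y z) {j : Fin n}
    (hj : j ≠ i) {p r u v : OnePoint ℝ} (hp : h.newEdge p r) (hu : T.edge j u v) :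
    ¬ (Ccw p r u ∧ Ccw r p v) := by
  have key : ∀ u v, T.edge j u v → ¬ (Ccw w z u ∧ Ccw z w v) := by
    rintro u v huv ⟨h1, h2⟩
    obtain ⟨rfl, rfl⟩ := h.edge_of_cross
      (fun k p r _ hp => T.noncrossing k j p r u v hp huv) h1 h2
    exact hj (T.edge_inj _ _ _ _ huv h.diag)
  obtain ⟨g, hg, ⟨rfl, rfl⟩ | ⟨rfl, rfl⟩⟩ := hp
  · have e := (edge_smul_iff (inv_mem hg)).2 hu
    intro ⟨h1, h2⟩
    exact key _ _ e ⟨by simpa using (ccw_smul_iff hΓ (inv_mem hg)).2 h1,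
      by simpa using (ccw_smul_iff hΓ (inv_mem hg)).2 h2⟩
  · have e := (edge_smul_iff (inv_mem hg)).2 hu
    intro ⟨h1, h2⟩
    exact key _ _ (edge_symm e) ⟨by simpa using (ccw_smul_iff hΓ (inv_mem hg)).2 h2,
      by simpa using (ccw_smul_iff hΓ (inv_mem hg)).2 h1⟩

theorem not_cross_new (hΓ : IsSurfaceGroup Γ) (h : T.Square a b c d i x w y z)
    {p r u v : OnePoint ℝ} (hp : h.newEdge p r) (hu : h.newEdge u v) :
    ¬ (Ccw p r u ∧ Ccw r p v) := by
  have key : ∀ u v, h.newEdge u v → ¬ (Ccw w z u ∧ Ccw z w v) := by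
    rintro u v huv ⟨h1, h2⟩
    obtain ⟨rfl, rfl⟩ := h.edge_of_cross (fun k p r hk hp h' =>
      h.not_cross_old hΓ hk huv (edge_symm hp) (h'.1.cross_symm h'.2)) h1 h2
    exact h.not_edge_newEdge h.diag huv
  obtain ⟨g, hg, hp⟩ := hp
  have e := h.newEdge_smul hu (inv_mem hg)
  rintro ⟨h1, h2⟩
  rw [← ccw_smul_iff hΓ (inv_mem hg)] at h1 h2
  rcases hp with ⟨rfl, rfl⟩ | ⟨rfl, rfl⟩
  · exact key _ _ e ⟨by simpa using h1, by simpa using h2⟩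
  · exact key _ _ (h.newEdge_symm e) ⟨by simpa using h2, by simpa using h1⟩

/-- The lifts of the arcs after the diagonal exchange. -/
def flipEdge (h : T.Square a b c d i x w y z) (j : Fin n) (u v : OnePoint ℝ) : Prop :=
  (j ≠ i ∧ T.edge j u v) ∨ (j = i ∧ h.newEdge u v)

theorem flipEdge_of_ne (h : T.Square a b c d i x w y z) {j : Fin n} (hj : j ≠ i)
    {u v : OnePoint ℝ} : h.flipEdge j u v ↔ T.edge j u v := by
  simp [flipEdge, hj]

theorem flipEdge_self (h : T.Square a b c d i x w y z) {u v : OnePoint ℝ} :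
    h.flipEdge i u v ↔ h.newEdge u v := by
  simp [flipEdge]

theorem flipEdge_symm (h : T.Square a b c d i x w y z) {j : Fin n} {u v : OnePoint ℝ}
    (h' : h.flipEdge j u v) : h.flipEdge j v u :=
  h'.imp (fun h' => ⟨h'.1, edge_symm h'.2⟩) fun h' => ⟨h'.1, h.newEdge_symm h'.2⟩

theorem flipEdge_smul (h : T.Square a b c d i x w y z) {j : Fin n} {u v : OnePoint ℝ}
    (h' : h.flipEdge j u v) {k : GL (Fin 2) ℝ} (hk : k ∈ Γ) :
    h.flipEdge j (k • u) (k • v) :=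
  h'.imp (fun h' => ⟨h'.1, edge_smul h'.2 hk⟩) fun h' => ⟨h'.1, h.newEdge_smul h'.2 hk⟩

theorem flip_a (h : T.Square a b c d i x w y z) : h.flipEdge a x w := Or.inl ⟨h.ne_a, h.side_a⟩
theorem flip_b (h : T.Square a b c d i x w y z) : h.flipEdge b w y := Or.inl ⟨h.ne_b, h.side_b⟩
theorem flip_c (h : T.Square a b c d i x w y z) : h.flipEdge c y z := Or.inl ⟨h.ne_c, h.side_c⟩
theorem flip_d (h : T.Square a b c d i x w y z) : h.flipEdge d z x := Or.inl ⟨h.ne_d, h.side_d⟩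
theorem flip_i (h : T.Square a b c d i x w y z) : h.flipEdge i w z :=
  Or.inr ⟨rfl, 1, one_mem _, by simp⟩

/-- Triangles after the diagonal exchange, up to the action of `Γ`. -/
theorem flip_triangle (hΓ : IsSurfaceGroup Γ) (h : T.Square a b c d i x w y z) {j : Fin n}
    {u v : OnePoint ℝ} (huv : h.flipEdge j u v) :
    ∃ t, Ccw u v t ∧ (∃ j, h.flipEdge j v t) ∧ ∃ k, h.flipEdge k t u := by
  have tr : ∀ {u v t : OnePoint ℝ} {g : GL (Fin 2) ℝ}, g ∈ Γ → Ccw u v t →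
      (∃ j, h.flipEdge j v t) → (∃ k, h.flipEdge k t u) →
      ∃ t, Ccw (g • u) (g • v) t ∧ (∃ j, h.flipEdge j (g • v) t) ∧
        ∃ k, h.flipEdge k t (g • u) :=
    fun {u v t g} hg h1 ⟨j, h2⟩ ⟨k, h3⟩ => ⟨g • t, h1.smul (hΓ.det_eq_one g hg),
      ⟨j, h.flipEdge_smul h2 hg⟩, ⟨k, h.flipEdge_smul h3 hg⟩⟩
  rcases huv with ⟨hj, huv⟩ | ⟨rfl, g, hg, ⟨rfl, rfl⟩ | ⟨rfl, rfl⟩⟩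
  · obtain ⟨t, ht⟩ := exists_face huv
    obtain ⟨k, hk⟩ := ht.2.2.1
    obtain ⟨l, hl⟩ := ht.2.2.2
    by_cases hki : k = i
    · subst hki
      obtain ⟨g, hg, ⟨rfl, rfl⟩ | ⟨rfl, rfl⟩⟩ := exists_smul_of_edge h.diag hk
      · obtain rfl := h.face₁.smul_apex hΓ ht.rot hg rfl rfl
        exact tr hg h.ccw₄.rot' ⟨_, h.flip_a⟩ ⟨_, h.flip_i⟩
      · obtain rfl := h.face₂.rot'.smul_apex hΓ ht.rot hg rfl rfl
        exact tr hg h.ccw₃ ⟨_, h.flip_c⟩ ⟨_, h.flipEdge_symm h.flip_i⟩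
    by_cases hli : l = i
    · subst hli
      obtain ⟨g, hg, ⟨rfl, rfl⟩ | ⟨rfl, rfl⟩⟩ := exists_smul_of_edge h.diag hl
      · obtain rfl := h.face₁.smul_apex hΓ ht.rot' hg rfl rfl
        exact tr hg h.ccw₃.rot ⟨_, h.flipEdge_symm h.flip_i⟩ ⟨_, h.flip_b⟩
      · obtain rfl := h.face₂.rot'.smul_apex hΓ ht.rot' hg rfl rfl
        exact tr hg h.ccw₄ ⟨_, h.flip_i⟩ ⟨_, h.flip_d⟩
    exact ⟨t, ht.1, ⟨k, Or.inl ⟨hki, hk⟩⟩, ⟨l, Or.inl ⟨hli, hl⟩⟩⟩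
  · exact tr hg h.ccw₄.rot ⟨_, h.flip_d⟩ ⟨_, h.flip_a⟩
  · exact tr hg h.ccw₃.rot' ⟨_, h.flip_b⟩ ⟨_, h.flip_c⟩

/-- The steps between oriented arcs after the diagonal exchange. -/
def FlipStep (h : T.Square a b c d i x w y z) (p r : OnePoint ℝ × OnePoint ℝ) : Prop :=
  (∃ k, h.flipEdge k r.1 r.2) ∧
    (r = (p.2, p.1) ∨ (r.1 = p.2 ∧ Ccw p.1 p.2 r.2 ∧ ∃ k, h.flipEdge k r.2 p.1))

/-- Chains of steps between oriented arcs. -/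
abbrev Linked (h : T.Square a b c d i x w y z) := Relation.ReflTransGen h.FlipStep

theorem linked_reverse (h : T.Square a b c d i x w y z) {j : Fin n} {u v : OnePoint ℝ}
    (h' : h.flipEdge j u v) : h.Linked (u, v) (v, u) :=
  .single ⟨⟨j, h.flipEdge_symm h'⟩, Or.inl rfl⟩

theorem linked_next (h : T.Square a b c d i x w y z) {j k : Fin n} {u v t : OnePoint ℝ}
    (h₀ : Ccw u v t) (h' : h.flipEdge j v t) (h'' : h.flipEdge k t u) :
    h.Linked (u, v) (v, t) :=
  .single ⟨⟨j, h'⟩, Or.inr ⟨rfl, h₀, k, h''⟩⟩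

/-- Steps can be undone: two further steps around a triangle lead back. -/
theorem linked_symm (h : T.Square a b c d i x w y z) {p r : OnePoint ℝ × OnePoint ℝ}
    (hp : ∃ k, h.flipEdge k p.1 p.2) (hpr : h.Linked p r) : h.Linked r p := by
  have key : (∃ k, h.flipEdge k r.1 r.2) ∧ h.Linked r p := by
    induction hpr with
    | refl => exact ⟨hp, .refl⟩
    | @tail r s _ hs ih =>
      obtain ⟨⟨k, hk⟩, ih⟩ := ih
      obtain ⟨⟨l, hl⟩, hs⟩ := hs
      refine ⟨⟨l, hl⟩, .trans ?_ ih⟩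
      obtain ⟨r1, r2⟩ := r
      obtain ⟨s1, s2⟩ := s
      rcases hs with hs | ⟨rfl, h1, m, hm⟩
      · obtain ⟨rfl, rfl⟩ := Prod.ext_iff.1 hs
        exact h.linked_reverse hl
      · exact (h.linked_next h1.rot hm hk).trans (h.linked_next h1.rot' hk hl)
  exact key.2

theorem linked_smul (hΓ : IsSurfaceGroup Γ) (h : T.Square a b c d i x w y z)
    {g : GL (Fin 2) ℝ} (hg : g ∈ Γ) {p r : OnePoint ℝ × OnePoint ℝ} (hpr : h.Linked p r) :
    h.Linked (g • p) (g • r) := by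
  refine hpr.lift _ ?_
  rintro ⟨p1, p2⟩ ⟨r1, r2⟩ ⟨⟨k, hk⟩, hs⟩
  refine ⟨⟨k, h.flipEdge_smul hk hg⟩, hs.imp ?_ ?_⟩
  · rintro hs
    obtain ⟨rfl, rfl⟩ := Prod.ext_iff.1 hs
    rfl
  · rintro ⟨hs, h1, m, hm⟩
    exact ⟨congrArg (g • ·) hs, h1.smul (hΓ.det_eq_one g hg), m, h.flipEdge_smul hm hg⟩

theorem linked_square (h : T.Square a b c d i x w y z) :
    h.Linked (x, w) (z, x) ∧ h.Linked (x, w) (y, z) ∧ h.Linked (x, w) (w, y) ∧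
      h.Linked (x, w) (w, z) := by
  have e1 : h.Linked (x, w) (w, z) := h.linked_next h.ccw₄ h.flip_i h.flip_d
  have e2 : h.Linked (w, z) (z, x) := h.linked_next h.ccw₄.rot h.flip_d h.flip_a
  have e3 : h.Linked (w, z) (z, w) := h.linked_reverse h.flip_i
  have e4 : h.Linked (z, w) (w, y) := h.linked_next h.ccw₃.rot' h.flip_b h.flip_c
  have e5 : h.Linked (w, y) (y, z) :=
    h.linked_next h.ccw₃ h.flip_c (h.flipEdge_symm h.flip_i)
  exact ⟨e1.trans e2, e1.trans (e3.trans (e4.trans e5)), e1.trans (e3.trans e4), e1⟩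

/-- `r` can be reached from `s`; when `r` is a lift of the old diagonal, reaching a side of the
adjacent square is meant. -/
def Reached (h : T.Square a b c d i x w y z) (s r : OnePoint ℝ × OnePoint ℝ) : Prop :=
  (∀ l, l ≠ i → T.edge l r.1 r.2 → h.Linked s r) ∧
    ∀ g ∈ Γ, r = g • (x, y) ∨ r = g • (y, x) → h.Linked s (g • (x, w))

theorem reached_diag (hΓ : IsSurfaceGroup Γ) (h : T.Square a b c d i x w y z)
    {s r : OnePoint ℝ × OnePoint ℝ} {g : GL (Fin 2) ℝ} (hg : g ∈ Γ)
    (hr : r = g • (x, y) ∨ r = g • (y, x)) : h.Reached s r ↔ h.Linked s (g • (x, w)) := by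
  refine ⟨fun h' => h'.2 g hg hr, fun h' => ⟨fun l hl hlr => ?_, fun k hk hkr => ?_⟩⟩
  · rcases hr with rfl | rfl
    · exact absurd (T.edge_inj _ _ _ _ hlr (edge_smul h.diag hg)) hl
    · exact absurd (T.edge_inj _ _ _ _ hlr (edge_smul (edge_symm h.diag) hg)) hl
  · have hu : ((g⁻¹ * k) • x = x ∧ (g⁻¹ * k) • y = y) ∨
        ((g⁻¹ * k) • x = y ∧ (g⁻¹ * k) • y = x) := by
      rcases hr with rfl | rfl <;> rcases hkr with e | e <;>
        obtain ⟨e1, e2⟩ := Prod.ext_iff.1 e <;>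
        simp only [Prod.smul_mk] at e1 e2 <;> simp [mul_smul, ← e1, ← e2]
    rcases hu with hu | hu
    · have := eq_one_of_fix_edge hΓ h.diag (mul_mem (inv_mem hg) hk) hu.1 hu.2
      rwa [← inv_mul_eq_one.1 this]
    · exact (not_swap_edge hΓ h.diag (mul_mem (inv_mem hg) hk) hu.1 hu.2).elim

theorem reached_of_ne (h : T.Square a b c d i x w y z) {s r : OnePoint ℝ × OnePoint ℝ}
    {l : Fin n} (hl : l ≠ i) (hr : T.edge l r.1 r.2) : h.Reached s r ↔ h.Linked s r := by
  refine ⟨fun h' => h'.1 l hl hr, fun h' => ⟨fun _ _ _ => h', ?_⟩⟩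
  rintro g hg (rfl | rfl)
  · exact absurd (T.edge_inj _ _ _ _ hr (edge_smul h.diag hg)) hl
  · exact absurd (T.edge_inj _ _ _ _ hr (edge_smul (edge_symm h.diag) hg)) hl

theorem reached_side (hΓ : IsSurfaceGroup Γ) (h : T.Square a b c d i x w y z)
    {s p : OnePoint ℝ × OnePoint ℝ} {l : Fin n} (hl : l ≠ i) (hr : T.edge l p.1 p.2)
    (hp : h.Linked (x, w) p) {g : GL (Fin 2) ℝ} (hg : g ∈ Γ) :
    h.Reached s (g • p) ↔ h.Linked s (g • (x, w)) := by
  rw [h.reached_of_ne hl (edge_smul hr hg)]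
  have h1 := h.linked_smul hΓ hg hp
  exact ⟨fun h' => h'.trans (h.linked_symm ⟨_, h.flipEdge_smul h.flip_a hg⟩ h1),
    fun h' => h'.trans h1⟩

/-- A triangle one of whose sides is the diagonal is one half of a square. -/
theorem face_cases (hΓ : IsSurfaceGroup Γ) (h : T.Square a b c d i x w y z)
    {u v t : OnePoint ℝ} (hf : T.IsFace u v t) (huv : T.edge i u v) :
    ∃ g ∈ Γ, (u = g • x ∧ v = g • y ∧ t = g • z) ∨ (u = g • y ∧ v = g • x ∧ t = g • w) := by
  obtain ⟨g, hg, ⟨rfl, rfl⟩ | ⟨rfl, rfl⟩⟩ := exists_smul_of_edge h.diag huv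
  · exact ⟨g, hg, Or.inl ⟨rfl, rfl, (h.face₁.smul_apex hΓ hf hg rfl rfl).symm⟩⟩
  · exact ⟨g, hg, Or.inr ⟨rfl, rfl, (h.face₂.rot'.smul_apex hΓ hf hg rfl rfl).symm⟩⟩

/-- Reachability passes from one side of a triangle to the next. A triangle with a lift of the
old diagonal among its sides is one half of a lift of the square, whose sides are all linked. -/
theorem reached_face (hΓ : IsSurfaceGroup Γ) (h : T.Square a b c d i x w y z)
    {s : OnePoint ℝ × OnePoint ℝ} {u v t : OnePoint ℝ} (hf : T.IsFace u v t)
    (hs : h.Reached s (u, v)) : h.Reached s (v, t) := by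
  obtain ⟨q1, q2, q3, -⟩ := h.linked_square
  obtain ⟨j, hj⟩ := hf.2.1
  obtain ⟨k, hk⟩ := hf.2.2.1
  obtain ⟨l, hl⟩ := hf.2.2.2
  have A : ∀ g ∈ Γ, h.Reached s (g • (x, y)) ↔ h.Linked s (g • (x, w)) :=
    fun g hg => h.reached_diag hΓ hg (Or.inl rfl)
  have A' : ∀ g ∈ Γ, h.Reached s (g • (y, x)) ↔ h.Linked s (g • (x, w)) :=
    fun g hg => h.reached_diag hΓ hg (Or.inr rfl)
  have Ba : ∀ g ∈ Γ, h.Reached s (g • (x, w)) ↔ h.Linked s (g • (x, w)) :=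
    fun g hg => h.reached_side hΓ h.ne_a h.side_a .refl hg
  have Bb : ∀ g ∈ Γ, h.Reached s (g • (w, y)) ↔ h.Linked s (g • (x, w)) :=
    fun g hg => h.reached_side hΓ h.ne_b h.side_b q3 hg
  have Bc : ∀ g ∈ Γ, h.Reached s (g • (y, z)) ↔ h.Linked s (g • (x, w)) :=
    fun g hg => h.reached_side hΓ h.ne_c h.side_c q2 hg
  have Bd : ∀ g ∈ Γ, h.Reached s (g • (z, x)) ↔ h.Linked s (g • (x, w)) :=
    fun g hg => h.reached_side hΓ h.ne_d h.side_d q1 hg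
  by_cases hji : j = i
  · subst hji
    obtain ⟨g, hg, ⟨rfl, rfl, rfl⟩ | ⟨rfl, rfl, rfl⟩⟩ := h.face_cases hΓ hf hj
    · exact (Bc g hg).2 ((A g hg).1 hs)
    · exact (Ba g hg).2 ((A' g hg).1 hs)
  by_cases hki : k = i
  · subst hki
    obtain ⟨g, hg, ⟨rfl, rfl, rfl⟩ | ⟨rfl, rfl, rfl⟩⟩ := h.face_cases hΓ hf.rot hk
    · exact (A g hg).2 ((Bd g hg).1 hs)
    · exact (A' g hg).2 ((Bb g hg).1 hs)
  by_cases hli : l = i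
  · subst hli
    obtain ⟨g, hg, ⟨rfl, rfl, rfl⟩ | ⟨rfl, rfl, rfl⟩⟩ := h.face_cases hΓ hf.rot' hl
    · exact (Bd g hg).2 ((Bc g hg).1 hs)
    · exact (Bb g hg).2 ((Ba g hg).1 hs)
  rw [h.reached_of_ne hki hk]
  rw [h.reached_of_ne hji hj] at hs
  exact hs.trans (h.linked_next hf.1 (Or.inl ⟨hki, hk⟩) (Or.inl ⟨hli, hl⟩))

/-- The oriented arcs that remain after the diagonal exchange are linked to each other, by
following a chain of oriented arcs of the initial triangulation and going around the square
each time the chain traverses the old diagonal. -/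
theorem linked_of_edge (hΓ : IsSurfaceGroup Γ) (h : T.Square a b c d i x w y z) {j k : Fin n}
    (hj : j ≠ i) (hk : k ≠ i) {u v s t : OnePoint ℝ} (huv : T.edge j u v) (hst : T.edge k s t) :
    h.Linked (u, v) (s, t) := by
  have key : ∀ r : OnePoint ℝ × OnePoint ℝ, Relation.ReflTransGen T.DartStep (u, v) r →
      (∃ l, T.edge l r.1 r.2) ∧ h.Reached (u, v) r := by
    intro r hr
    induction hr with
    | refl => exact ⟨⟨j, huv⟩, (h.reached_of_ne hj huv).2 .refl⟩
    | @tail p r _ hs ih =>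
      obtain ⟨⟨m, hm⟩, ih⟩ := ih
      obtain ⟨p1, p2⟩ := p
      obtain ⟨r1, r2⟩ := r
      obtain ⟨⟨l, hl⟩, hs⟩ := hs
      refine ⟨⟨l, hl⟩, ?_⟩
      rcases hs with hs | ⟨rfl, h1, o, ho⟩
      · obtain ⟨rfl, rfl⟩ := Prod.ext_iff.1 hs
        by_cases hli : l = i
        · subst hli
          obtain ⟨g, hg, ⟨rfl, rfl⟩ | ⟨rfl, rfl⟩⟩ := exists_smul_of_edge h.diag hl
          · exact (h.reached_diag hΓ hg (Or.inl rfl)).2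
              ((h.reached_diag hΓ hg (Or.inr rfl)).1 ih)
          · exact (h.reached_diag hΓ hg (Or.inr rfl)).2
              ((h.reached_diag hΓ hg (Or.inl rfl)).1 ih)
        · rw [h.reached_of_ne hli hl]
          rw [h.reached_of_ne hli (edge_symm hl)] at ih
          exact ih.trans (h.linked_reverse (Or.inl ⟨hli, edge_symm hl⟩))
      · exact h.reached_face hΓ (isFace_of_edge h1 hm hl ho) ih
  exact (h.reached_of_ne hk hst).1 (key (s, t) (T.connected j u v k s t huv hst)).2

theorem exists_linked_edge (hΓ : IsSurfaceGroup Γ) (h : T.Square a b c d i x w y z) {j : Fin n}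
    {u v : OnePoint ℝ} (huv : h.flipEdge j u v) : ∃ k ≠ i, ∃ s t, T.edge k s t ∧
      h.Linked (u, v) (s, t) ∧ h.Linked (s, t) (u, v) := by
  rcases huv with ⟨hj, huv⟩ | ⟨rfl, g, hg, huv⟩
  · exact ⟨j, hj, u, v, huv, .refl, .refl⟩
  · have e1 := h.linked_smul hΓ hg h.linked_square.2.2.2
    have e2 := e1.trans (h.linked_reverse (h.flipEdge_smul h.flip_i hg))
    have hg' : ∃ k, h.flipEdge k (g • (x, w)).1 (g • (x, w)).2 := ⟨_, h.flipEdge_smul h.flip_a hg⟩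
    refine ⟨a, h.ne_a, g • x, g • w, edge_smul h.side_a hg, ?_⟩
    rcases huv with ⟨rfl, rfl⟩ | ⟨rfl, rfl⟩
    · exact ⟨h.linked_symm hg' e1, e1⟩
    · exact ⟨h.linked_symm hg' e2, e2⟩

/-- The diagonal exchange. -/
def flip (hΓ : IsSurfaceGroup Γ) (h : T.Square a b c d i x w y z) :
    IdealTriangulation Γ n where
  edge := h.flipEdge
  isArc j := by
    by_cases hj : j = i
    · subst hj
      exact ⟨w, z, h.ccw₄.ne₂₃, edge_isCusp h.side_b, edge_isCusp h.side_d, fun u v =>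
        h.flipEdge_self⟩
    · obtain ⟨p, r, h1, h2, h3, h4⟩ := T.isArc j
      exact ⟨p, r, h1, h2, h3, fun u v => (h.flipEdge_of_ne hj).trans (h4 u v)⟩
  edge_inj := by
    rintro j k u v (⟨hj, h1⟩ | ⟨rfl, h1⟩) (⟨hk, h2⟩ | ⟨rfl, h2⟩)
    · exact T.edge_inj _ _ _ _ h1 h2
    · exact absurd h2 (h.not_edge_newEdge h1)
    · exact absurd h1 (h.not_edge_newEdge h2)
    · rfl
  noncrossing := by
    rintro j k p r u v (⟨hj, h1⟩ | ⟨rfl, h1⟩) (⟨hk, h2⟩ | ⟨rfl, h2⟩)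
    · exact T.noncrossing _ _ _ _ _ _ h1 h2
    · exact fun hc => h.not_cross_old hΓ hj h2 (edge_symm h1) (hc.1.cross_symm hc.2)
    · exact h.not_cross_old hΓ hk h1 h2
    · exact h.not_cross_new hΓ h1 h2
  triangle _ _ _ huv := h.flip_triangle hΓ huv
  pos := T.pos
  connected := by
    intro j u v k s t huv hst
    obtain ⟨j', hj', p, r, hpr, h1, -⟩ := h.exists_linked_edge hΓ huv
    obtain ⟨k', hk', p', r', hpr', -, h2⟩ := h.exists_linked_edge hΓ hst
    exact h1.trans ((h.linked_of_edge hΓ hj' hk' hpr hpr').trans h2)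

theorem exists_flip (hΓ : IsSurfaceGroup Γ) (h : T.Square a b c d i x w y z) :
    ∃ T' : IdealTriangulation Γ n, (∀ j, j ≠ i → T'.edge j = T.edge j) ∧ T'.edge i w z :=
  ⟨h.flip hΓ, fun _ hj => funext₂ fun _ _ => propext (h.flipEdge_of_ne hj), h.flip_i⟩

end Square
end IdealTriangulation
end QuantumTeichmuller

namespace QuantumTeichmuller
variable {Γ : Subgroup (GL (Fin 2) ℝ)} {n : ℕ}

namespace IdealTriangulation
variable {T : IdealTriangulation Γ n}

/-! ### Polygons triangulated as a fan -/

/-- A polygon with vertices `p 0, …, p (N - 1)`, in counterclockwise order, triangulated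
as a fan with apex `p 0` by lifts of arcs. Its side from `p k` to `p (k + 1)` is labelled by
`s k`, where `p N = p 0`, and the geodesic from `p 0` to `p j` is labelled by `e j`; the labels of
the diagonals are different from each other and from those of the sides, so that the interior of
the polygon embeds in the surface. -/
structure Fan (T : IdealTriangulation Γ n) (N : ℕ) (p : ℕ → OnePoint ℝ) (e s : ℕ → Fin n) :
    Prop where
  four_le : 4 ≤ N
  wrap : p N = p 0
  ccw : ∀ j k, 1 ≤ j → j < k → k < N → Ccw (p 0) (p j) (p k)
  chord : ∀ j, 1 ≤ j → j < N → T.edge (e j) (p 0) (p j)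
  side : ∀ k, k < N → T.edge (s k) (p k) (p (k + 1))
  chord_inj : ∀ j k, 2 ≤ j → j + 2 ≤ N → 2 ≤ k → k + 2 ≤ N → e j = e k → j = k
  chord_ne_side : ∀ j k, 2 ≤ j → j + 2 ≤ N → k < N → e j ≠ s k

namespace Fan
variable {N : ℕ} {p : ℕ → OnePoint ℝ} {e s : ℕ → Fin n}

theorem side_zero (h : T.Fan N p e s) : s 0 = e 1 :=
  T.edge_inj _ _ _ _ (h.side 0 (by have := h.four_le; omega))
    (h.chord 1 le_rfl (by have := h.four_le; omega))

theorem side_last (h : T.Fan N p e s) : s (N - 1) = e (N - 1) := by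
  have h4 := h.four_le
  have h1 := h.side (N - 1) (by omega)
  rw [Nat.sub_add_cancel (by omega), h.wrap] at h1
  exact T.edge_inj _ _ _ _ (edge_symm h1) (h.chord (N - 1) (by omega) (by omega))

/-- The diagonals of the polygon, with an orientation. -/
def Diag (_ : T.Fan N p e s) (u v : OnePoint ℝ) : Prop :=
  ∃ j, 2 ≤ j ∧ j + 2 ≤ N ∧ ((u = p 0 ∧ v = p j) ∨ (u = p j ∧ v = p 0))

/-- The oriented arcs with a triangle of the polygon on their left. -/
def Inner (h : T.Fan N p e s) (u v : OnePoint ℝ) : Prop :=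
  h.Diag u v ∨ ∃ k, k < N ∧ u = p k ∧ v = p (k + 1)

theorem inner_side (h : T.Fan N p e s) {k : ℕ} (hk : k < N) : h.Inner (p k) (p (k + 1)) :=
  Or.inr ⟨k, hk, rfl, rfl⟩

theorem inner_out (h : T.Fan N p e s) {j : ℕ} (h1 : 1 ≤ j) (h2 : j + 2 ≤ N) :
    h.Inner (p 0) (p j) := by
  rcases h1.eq_or_lt with rfl | h1
  · exact h.inner_side (by omega)
  · exact Or.inl ⟨j, h1, h2, Or.inl ⟨rfl, rfl⟩⟩

theorem inner_in (h : T.Fan N p e s) {j : ℕ} (h1 : 2 ≤ j) (h2 : j < N) :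
    h.Inner (p j) (p 0) := by
  rcases (show j + 1 ≤ N from h2).eq_or_lt with h3 | h3
  · exact Or.inr ⟨j, h2, rfl, by rw [h3, h.wrap]⟩
  · exact Or.inl ⟨j, h1, h3, Or.inr ⟨rfl, rfl⟩⟩

theorem isFace (h : T.Fan N p e s) {j : ℕ} (h1 : 1 ≤ j) (h2 : j + 2 ≤ N) :
    T.IsFace (p 0) (p j) (p (j + 1)) :=
  isFace_of_edge (h.ccw j (j + 1) h1 (by omega) (by omega)) (h.chord j h1 (by omega))
    (h.side j (by omega)) (edge_symm (h.chord (j + 1) (by omega) (by omega)))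

theorem inner_edge (h : T.Fan N p e s) {u v : OnePoint ℝ} (hi : h.Inner u v) :
    T.IsEdge u v := by
  rcases hi with ⟨j, h1, h2, ⟨rfl, rfl⟩ | ⟨rfl, rfl⟩⟩ | ⟨k, hk, rfl, rfl⟩
  · exact ⟨_, h.chord j (by omega) (by omega)⟩
  · exact ⟨_, edge_symm (h.chord j (by omega) (by omega))⟩
  · exact ⟨_, h.side k hk⟩

theorem face_aux (h : T.Fan N p e s) {j : ℕ} (h1 : 1 ≤ j) (h2 : j + 2 ≤ N) :
    h.Diag (p 0) (p j) ∨ h.Diag (p (j + 1)) (p 0) := by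
  have h4 := h.four_le
  rcases h1.eq_or_lt with rfl | h1
  · exact Or.inr ⟨2, le_rfl, by omega, Or.inr ⟨rfl, rfl⟩⟩
  · exact Or.inl ⟨j, h1, h2, Or.inl ⟨rfl, rfl⟩⟩

/-- Each triangle of the polygon has a diagonal among its sides. -/
theorem inner_face (h : T.Fan N p e s) {u v : OnePoint ℝ} (hi : h.Inner u v) :
    ∃ t, T.IsFace u v t ∧ h.Inner v t ∧ h.Inner t u ∧
      (h.Diag u v ∨ h.Diag v t ∨ h.Diag t u) := by
  have h4 := h.four_le
  have A : ∀ j, 1 ≤ j → j + 2 ≤ N → T.IsFace (p 0) (p j) (p (j + 1)) ∧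
      h.Inner (p 0) (p j) ∧ h.Inner (p j) (p (j + 1)) ∧ h.Inner (p (j + 1)) (p 0) ∧
      (h.Diag (p 0) (p j) ∨ h.Diag (p (j + 1)) (p 0)) := fun j h1 h2 =>
    ⟨h.isFace h1 h2, h.inner_out h1 h2, h.inner_side (by omega),
      h.inner_in (by omega) (by omega), h.face_aux h1 h2⟩
  have case₁ : ∀ j, 1 ≤ j → j + 2 ≤ N → ∃ t, T.IsFace (p 0) (p j) t ∧ h.Inner (p j) t ∧
      h.Inner t (p 0) ∧ (h.Diag (p 0) (p j) ∨ h.Diag (p j) t ∨ h.Diag t (p 0)) := by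
    intro j h1 h2
    obtain ⟨a, b, c, d, f⟩ := A j h1 h2
    exact ⟨_, a, c, d, f.imp id Or.inr⟩
  have case₂ : ∀ j, 2 ≤ j → j + 1 ≤ N → ∃ t, T.IsFace (p j) (p 0) t ∧ h.Inner (p 0) t ∧
      h.Inner t (p j) ∧ (h.Diag (p j) (p 0) ∨ h.Diag (p 0) t ∨ h.Diag t (p j)) := by
    intro j h1 h2
    obtain ⟨j, rfl⟩ : ∃ k, j = k + 1 := ⟨j - 1, by omega⟩
    obtain ⟨a, b, c, d, f⟩ := A j (by omega) (by omega)
    exact ⟨_, a.rot', b, c, f.symm.imp id Or.inl⟩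
  rcases hi with ⟨j, h1, h2, ⟨rfl, rfl⟩ | ⟨rfl, rfl⟩⟩ | ⟨k, hk, rfl, rfl⟩
  · exact case₁ j (by omega) h2
  · exact case₂ j h1 (by omega)
  · rcases Nat.eq_zero_or_pos k with rfl | h0
    · exact case₁ 1 le_rfl (by omega)
    rcases (show k + 1 ≤ N from hk).eq_or_lt with h5 | h5
    · rw [h5, h.wrap]
      exact case₂ k (by omega) (by omega)
    · obtain ⟨a, b, c, d, f⟩ := A k h0 h5
      exact ⟨_, a.rot, d, b, Or.inr f.symm⟩

/-- An inner oriented arc labelled by a diagonal is this diagonal. -/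
theorem eq_of_inner (h : T.Fan N p e s) {j : ℕ} (h1 : 2 ≤ j) (h2 : j + 2 ≤ N)
    {u v : OnePoint ℝ} (hi : h.Inner u v) (he : T.edge (e j) u v) :
    (u = p 0 ∧ v = p j) ∨ (u = p j ∧ v = p 0) := by
  rcases hi with ⟨k, h3, h4, hk⟩ | ⟨k, hk, rfl, rfl⟩
  · have : e j = e k := by
      rcases hk with ⟨rfl, rfl⟩ | ⟨rfl, rfl⟩
      · exact T.edge_inj _ _ _ _ he (h.chord k (by omega) (by omega))
      · exact T.edge_inj _ _ _ _ he (edge_symm (h.chord k (by omega) (by omega)))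
    rw [h.chord_inj j k h1 h2 h3 h4 this]
    exact hk
  · exact absurd (T.edge_inj _ _ _ _ he (h.side k hk)) (h.chord_ne_side j k h1 h2 hk)

/-- A deck transformation that maps a diagonal to an inner oriented arc is the identity. -/
theorem eq_one_of_diag (hΓ : IsSurfaceGroup Γ) (h : T.Fan N p e s) {u v : OnePoint ℝ}
    (hd : h.Diag u v) {g : GL (Fin 2) ℝ} (hg : g ∈ Γ) (hi : h.Inner (g • u) (g • v)) :
    g = 1 := by
  obtain ⟨j, h1, h2, hj⟩ := hd
  have hE := h.chord j (by omega) (by omega)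
  rcases hj with ⟨rfl, rfl⟩ | ⟨rfl, rfl⟩
  · rcases h.eq_of_inner h1 h2 hi (edge_smul hE hg) with ⟨a, b⟩ | ⟨a, b⟩
    · exact eq_one_of_fix_edge hΓ hE hg a b
    · exact (not_swap_edge hΓ hE hg a b).elim
  · rcases h.eq_of_inner h1 h2 hi (edge_smul (edge_symm hE) hg) with ⟨a, b⟩ | ⟨a, b⟩
    · exact (not_swap_edge hΓ hE hg b a).elim
    · exact eq_one_of_fix_edge hΓ hE hg b a

/-- The interior of the polygon embeds in the surface. -/
theorem eq_one_of_inner (hΓ : IsSurfaceGroup Γ) (h : T.Fan N p e s) {u v : OnePoint ℝ}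
    (hu : h.Inner u v) {g : GL (Fin 2) ℝ} (hg : g ∈ Γ) (hi : h.Inner (g • u) (g • v)) :
    g = 1 := by
  obtain ⟨t, ht, hvt, htu, hd⟩ := h.inner_face hu
  obtain ⟨t', ht', hvt', htu', -⟩ := h.inner_face hi
  obtain rfl := ht.smul_apex hΓ ht' hg rfl rfl
  rcases hd with hd | hd | hd
  · exact h.eq_one_of_diag hΓ hd hg hi
  · exact h.eq_one_of_diag hΓ hd hg hvt'
  · exact h.eq_one_of_diag hΓ hd hg htu'

theorem vertex_inj (h : T.Fan N p e s) {j k : ℕ} (hj : j < N) (hk : k < N) (hjk : p j = p k) :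
    j = k := by
  have key : ∀ j k, j < k → k < N → p j ≠ p k := by
    intro j k hjk hk
    rcases Nat.eq_zero_or_pos j with rfl | h0
    · exact edge_ne (h.chord k hjk hk)
    · exact (h.ccw j k h0 hjk hk).ne₂₃
  rcases lt_trichotomy j k with h1 | h1 | h1
  · exact absurd hjk (key j k h1 hk)
  · exact h1
  · exact absurd hjk.symm (key k j h1 hj)

/-- Two sides with the same label are glued to each other, reversing their directions. -/
theorem glue (hΓ : IsSurfaceGroup Γ) (h : T.Fan N p e s) {j k : ℕ} (hj : j < N) (hk : k < N)
    (hjk : j ≠ k) (hs : s j = s k) : ∃ g ∈ Γ, p (k + 1) = g • p j ∧ p k = g • p (j + 1) := by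
  have hE := h.side k hk
  rw [← hs] at hE
  obtain ⟨g, hg, ⟨a, b⟩ | ⟨a, b⟩⟩ := exists_smul_of_edge (h.side j hj) hE
  · have : g = 1 := h.eq_one_of_inner hΓ (h.inner_side hj) hg
      (by rw [← a, ← b]; exact h.inner_side hk)
    rw [this, one_smul] at a
    exact absurd (h.vertex_inj hk hj a).symm hjk
  · exact ⟨g, hg, b, a⟩

/-- Two oriented sides are not equivalent. -/
theorem not_smul_side (hΓ : IsSurfaceGroup Γ) (h : T.Fan N p e s) {j k : ℕ} (hj : j < N)
    (hk : k < N) (hjk : j ≠ k) : ∀ g ∈ Γ, ¬ (g • p j = p k ∧ g • p (j + 1) = p (k + 1)) := by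
  rintro g hg ⟨a, b⟩
  have : g = 1 := h.eq_one_of_inner hΓ (h.inner_side hj) hg
    (by rw [a, b]; exact h.inner_side hk)
  rw [this, one_smul] at a
  exact hjk (h.vertex_inj hj hk a)

/-- A label occurs at most twice on the boundary of the polygon. -/
theorem not_three (hΓ : IsSurfaceGroup Γ) (h : T.Fan N p e s) {j k l : ℕ} (hj : j < N)
    (hk : k < N) (hl : l < N) (hjk : j ≠ k) (hjl : j ≠ l) (hkl : k ≠ l) (h1 : s j = s k) :
    s j ≠ s l := by
  intro h2
  obtain ⟨g, hg, a, b⟩ := h.glue hΓ hj hk hjk h1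
  obtain ⟨g', hg', a', b'⟩ := h.glue hΓ hj hl hjl h2
  refine h.not_smul_side hΓ hk hl hkl (g' * g⁻¹) (mul_mem hg' (inv_mem hg)) ⟨?_, ?_⟩
  · rw [b, mul_smul, inv_smul_smul, b']
  · rw [a, mul_smul, inv_smul_smul, a']

/-- If all sides are glued in pairs, `Γ` is generated by the gluing elements. -/
theorem exists_generators (hΓ : IsSurfaceGroup Γ) (h : T.Fan N p e s)
    (hs : ∀ k < N, ∃ m < N, m ≠ k ∧ s m = s k) :
    ∃ S : Finset Γ, 2 * S.card ≤ N ∧ Subgroup.closure (S : Set Γ) = ⊤ := by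
  classical
  have h4 := h.four_le
  have hglue : ∀ l ∈ (Finset.range N).image s, ∃ g : Γ, ∃ j k, j < N ∧ k < N ∧ j ≠ k ∧
      s j = l ∧ s k = l ∧ p (k + 1) = g • p j ∧ p k = g • p (j + 1) := by
    intro l hl
    obtain ⟨j, hj, rfl⟩ := Finset.mem_image.1 hl
    obtain ⟨m, hm, hmj, hsm⟩ := hs j (Finset.mem_range.1 hj)
    obtain ⟨g, hg, a, b⟩ := h.glue hΓ (Finset.mem_range.1 hj) hm hmj.symm hsm.symm
    exact ⟨⟨g, hg⟩, j, m, Finset.mem_range.1 hj, hm, hmj.symm, rfl, hsm, a, b⟩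
  choose! G hG using hglue
  set L := (Finset.range N).image s
  refine ⟨L.image G, ?_, ?_⟩
  · have h1 : L.card • 2 ≤ ∑ l ∈ L, ((Finset.range N).filter fun k => s k = l).card := by
      refine Finset.card_nsmul_le_sum _ _ _ fun l hl => ?_
      obtain ⟨j, hj, rfl⟩ := Finset.mem_image.1 hl
      obtain ⟨m, hm, hmj, hsm⟩ := hs j (Finset.mem_range.1 hj)
      rw [← Finset.card_pair hmj.symm]
      refine Finset.card_le_card fun k hk => ?_
      rcases Finset.mem_insert.1 hk with rfl | hk
      · exact Finset.mem_filter.2 ⟨hj, rfl⟩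
      · rw [Finset.mem_singleton.1 hk]
        exact Finset.mem_filter.2 ⟨Finset.mem_range.2 hm, hsm⟩
    rw [← Finset.card_eq_sum_card_image, Finset.card_range, smul_eq_mul] at h1
    have h2 := Finset.card_image_le (s := L) (f := G)
    omega
  · set H := Subgroup.closure ((L.image G : Finset Γ) : Set Γ)
    have hGH : ∀ l ∈ L, G l ∈ H := fun l hl =>
      Subgroup.subset_closure (Finset.mem_coe.2 (Finset.mem_image_of_mem G hl))
    -- the `H`-translates of the polygon fill up the plane
    have key : ∀ r : OnePoint ℝ × OnePoint ℝ, Relation.ReflTransGen T.DartStep (p 0, p 1) r →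
        ∃ g ∈ H, ∃ u v, h.Inner u v ∧ r = ((g : GL (Fin 2) ℝ) • u, (g : GL (Fin 2) ℝ) • v) := by
      intro r hr
      induction hr with
      | refl => exact ⟨1, one_mem _, p 0, p 1, h.inner_side (by omega), by simp⟩
      | @tail r t _ ht ih =>
        obtain ⟨g, hg, u, v, huv, rfl⟩ := ih
        obtain ⟨t1, t2⟩ := t
        obtain ⟨⟨l, hl⟩, ht | ⟨rfl, h1, m, hm⟩⟩ := ht
        · obtain ⟨rfl, rfl⟩ := Prod.ext_iff.1 ht
          rcases huv with ⟨j, h1, h2, hj⟩ | ⟨k, hk, rfl, rfl⟩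
          · exact ⟨g, hg, v, u, Or.inl ⟨j, h1, h2, hj.symm.imp And.symm And.symm⟩, rfl⟩
          · have hkL : s k ∈ L := Finset.mem_image_of_mem s (Finset.mem_range.2 hk)
            obtain ⟨a, b, ha, hb, hab, hsa, hsb, e1, e2⟩ := hG (s k) hkL
            have hkab : k = a ∨ k = b := by
              by_contra! hne
              exact h.not_three hΓ ha hb hk hab hne.1.symm hne.2.symm (hsa.trans hsb.symm) hsa
            rcases hkab with rfl | rfl
            · refine ⟨g * (G (s k))⁻¹, mul_mem hg (inv_mem (hGH _ hkL)), p b, p (b + 1),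
                h.inner_side hb, ?_⟩
              rw [e1, e2]
              simp [mul_smul, Subgroup.smul_def]
            · refine ⟨g * G (s k), mul_mem hg (hGH _ hkL), p a, p (a + 1),
                h.inner_side ha, ?_⟩
              rw [e1, e2]
              simp [mul_smul, Subgroup.smul_def]
        · obtain ⟨t, ht, hvt, -⟩ := h.inner_face huv
          dsimp only at h1 hl hm
          obtain ⟨o, ho⟩ := h.inner_edge huv
          have hf : T.IsFace ((g : GL (Fin 2) ℝ) • u) ((g : GL (Fin 2) ℝ) • v) t2 :=
            isFace_of_edge h1 (edge_smul ho g.2) hl hm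
          obtain rfl := ht.smul_apex hΓ hf g.2 rfl rfl
          exact ⟨g, hg, v, t, hvt, rfl⟩
    rw [eq_top_iff]
    rintro ⟨g, hg⟩ -
    have h01 := h.side 0 (by omega)
    obtain ⟨k, hk, u, v, huv, he⟩ := key (g • p 0, g • p 1)
      (T.connected _ _ _ _ _ _ h01 (edge_smul h01 hg))
    obtain ⟨e1, e2⟩ := Prod.ext_iff.1 he
    dsimp only at e1 e2
    have := h.eq_one_of_inner hΓ (h.inner_side (k := 0) (by omega))
      (mul_mem (inv_mem k.2) hg) (by
        rw [mul_smul, mul_smul, zero_add, e1, e2, inv_smul_smul, inv_smul_smul]; exact huv)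
    have hkg : k = ⟨g, hg⟩ := Subtype.ext (inv_mul_eq_one.1 this)
    exact hkg ▸ hk

theorem finrank_abelianization_le {G : Type*} [Group G] (S : Finset G)
    (hS : Subgroup.closure (S : Set G) = ⊤) :
    Module.finrank ℤ (Additive (Abelianization G)) ≤ S.card := by
  classical
  let f : G → Additive (Abelianization G) := fun g => Additive.ofMul (Abelianization.of g)
  have hspan : Submodule.span ℤ
      ((S.image f : Finset _) : Set (Additive (Abelianization G))) = ⊤ := by
    rw [eq_top_iff]
    rintro x -
    obtain ⟨g, rfl⟩ : ∃ g, f g = x := by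
      obtain ⟨g, hg⟩ := QuotientGroup.mk_surjective (Additive.toMul x)
      exact ⟨g, hg⟩
    have hg : g ∈ Subgroup.closure (S : Set G) := hS ▸ Subgroup.mem_top g
    induction hg using Subgroup.closure_induction with
    | mem g hg =>
      exact Submodule.subset_span (Finset.mem_coe.2 (Finset.mem_image_of_mem f hg))
    | one => exact (Submodule.span ℤ _).zero_mem
    | mul g k _ _ h1 h2 => exact (Submodule.span ℤ _).add_mem h1 h2
    | inv g _ h1 => exact (Submodule.span ℤ _).neg_mem h1
  rw [← finrank_top ℤ, ← hspan]
  exact (finrank_span_finset_le_card _).trans Finset.card_image_le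

/-- On a surface of Euler characteristic less than `-2`, a fan with fewer than eight vertices has
a side that is not glued to another one. -/
theorem exists_free_side (hΓ : IsSurfaceGroup Γ) (hχ : eulerChar Γ < -2) (h : T.Fan N p e s)
    (hN : N < 8) : ∃ k < N, ∀ m < N, m ≠ k → s m ≠ s k := by
  by_contra! hn
  -- at most three generators, while the first Betti number is at least four
  obtain ⟨S, h1, h2⟩ := h.exists_generators hΓ hn
  have h3 := finrank_abelianization_le S h2
  unfold eulerChar at hχ
  omega

/-- The sequence obtained from `f` by inserting `x` at the position `m`. -/
def insertAt {α : Type*} (f : ℕ → α) (m : ℕ) (x : α) (j : ℕ) : α :=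
  if j < m then f j else if j = m then x else f (j - 1)

/-- A fan with a side that is not glued to another one can be enlarged by the triangle
on the other side, after a diagonal exchange. -/
theorem exists_succ (hΓ : IsSurfaceGroup Γ) (h : T.Fan N p e s) {k : ℕ} (hk : k < N)
    (hfree : ∀ m < N, m ≠ k → s m ≠ s k) :
    ∃ (T' : IdealTriangulation Γ n) (p' : ℕ → OnePoint ℝ) (e' s' : ℕ → Fin n),
      T'.Fan (N + 1) p' e' s' := by
  have h4 := h.four_le
  have hsk := h.side k hk
  obtain ⟨v, hv⟩ := exists_face (edge_symm hsk)
  obtain ⟨l₁, hl₁⟩ := hv.2.2.1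
  obtain ⟨l₂, hl₂⟩ := hv.2.2.2
  -- the new triangle is not equivalent to a triangle of the polygon
  have hout₀ : ∀ g ∈ Γ, ¬ h.Inner (g • p (k + 1)) (g • p k) := by
    rintro g hg hi
    have he := edge_smul (edge_symm hsk) hg
    rcases hi with ⟨j, h1, h2, hj⟩ | ⟨m, hm, a, b⟩
    · have : e j = s k := by
        rcases hj with ⟨a, b⟩ | ⟨a, b⟩ <;> rw [a, b] at he
        · exact T.edge_inj _ _ _ _ (h.chord j (by omega) (by omega)) he
        · exact T.edge_inj _ _ _ _ (edge_symm (h.chord j (by omega) (by omega))) he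
      exact h.chord_ne_side j k h1 h2 hk this
    · rw [a, b] at he
      have : s m = s k := T.edge_inj _ _ _ _ (h.side m hm) he
      have hmk : m = k := by
        by_contra hne
        exact hfree m hm hne this
      subst hmk
      exact not_swap_edge hΓ hsk hg b a
  have hout : ∀ g ∈ Γ, ¬ h.Inner (g • p k) (g • v) ∧ ¬ h.Inner (g • v) (g • p (k + 1)) := by
    refine fun g hg => ⟨fun hi => ?_, fun hi => ?_⟩
    · obtain ⟨t, ht, h1, h2, -⟩ := h.inner_face hi
      obtain rfl := hv.rot.smul_apex hΓ ht hg rfl rfl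
      exact hout₀ g hg h2
    · obtain ⟨t, ht, h1, h2, -⟩ := h.inner_face hi
      obtain rfl := hv.rot'.smul_apex hΓ ht hg rfl rfl
      exact hout₀ g hg h1
  have hl₁e : ∀ j, 2 ≤ j → j + 2 ≤ N → e j ≠ l₁ := by
    rintro j h1 h2 rfl
    obtain ⟨g, hg, ⟨a, b⟩ | ⟨a, b⟩⟩ := exists_smul_of_edge hl₁ (h.chord j (by omega) (by omega))
    · exact (hout g hg).1 (Or.inl ⟨j, h1, h2, Or.inl ⟨a.symm, b.symm⟩⟩)
    · exact (hout g hg).1 (Or.inl ⟨j, h1, h2, Or.inr ⟨b.symm, a.symm⟩⟩)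
  have hl₂e : ∀ j, 2 ≤ j → j + 2 ≤ N → e j ≠ l₂ := by
    rintro j h1 h2 rfl
    obtain ⟨g, hg, ⟨a, b⟩ | ⟨a, b⟩⟩ := exists_smul_of_edge hl₂ (h.chord j (by omega) (by omega))
    · exact (hout g hg).2 (Or.inl ⟨j, h1, h2, Or.inl ⟨a.symm, b.symm⟩⟩)
    · exact (hout g hg).2 (Or.inl ⟨j, h1, h2, Or.inr ⟨b.symm, a.symm⟩⟩)
  have hl₁s : l₁ ≠ s k := by
    rintro rfl
    obtain ⟨g, hg, ⟨a, b⟩ | ⟨a, b⟩⟩ := exists_smul_of_edge hl₁ hsk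
    · exact (hout g hg).1 (a ▸ b ▸ h.inner_side hk)
    · have := hv.rot.smul_apex hΓ hv hg b.symm a.symm
      exact not_rotate_face hΓ hv.1 (inv_mem hg) (inv_smul_eq_iff.2 b) (inv_smul_eq_iff.2 a)
        (inv_smul_eq_iff.2 this.symm)
  have hl₂s : l₂ ≠ s k := by
    rintro rfl
    obtain ⟨g, hg, ⟨a, b⟩ | ⟨a, b⟩⟩ := exists_smul_of_edge hl₂ hsk
    · exact (hout g hg).2 (a ▸ b ▸ h.inner_side hk)
    · have := hv.rot'.smul_apex hΓ hv hg b.symm a.symm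
      exact not_rotate_face hΓ hv.1 hg a.symm this b.symm
  have he : ∀ j, 1 ≤ j → j < N → k ≠ 0 → k + 1 ≠ N → e j ≠ s k := by
    intro j h1 h2 h3 h5
    rcases h1.eq_or_lt with rfl | h1
    · rw [← h.side_zero]; exact hfree 0 (by omega) h3.symm
    rcases (show j + 1 ≤ N from h2).eq_or_lt with h6 | h6
    · obtain rfl : j = N - 1 := by omega
      rw [← h.side_last]; exact hfree _ h2 (by omega)
    · exact h.chord_ne_side j k h1 h6 hk
  have hnew : ∃ (T' : IdealTriangulation Γ n) (x : Fin n),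
      (∀ j, (k ≠ 0 → k + 1 ≠ N → j ≠ s k) → T'.edge j = T.edge j) ∧ T'.edge x (p 0) v ∧
      (k ≠ 0 → k + 1 ≠ N → x = s k) := by
    by_cases hk0 : k = 0
    · exact ⟨T, l₁, fun _ _ => rfl, hk0 ▸ hl₁, fun hk => absurd hk0 hk⟩
    by_cases hkN : k + 1 = N
    · refine ⟨T, l₂, fun _ _ => rfl, ?_, fun _ hk => absurd hkN hk⟩
      rw [← h.wrap, ← hkN]; exact edge_symm hl₂
    have hq : T.Square l₁ l₂ (e (k + 1)) (e k) (s k) (p k) v (p (k + 1)) (p 0) :=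
      ⟨(h.ccw k (k + 1) (by omega) (by omega) (by omega)).rot, hv.1, hsk, hl₁, hl₂,
        edge_symm (h.chord (k + 1) (by omega) (by omega)), h.chord k (by omega) hk, hl₁s, hl₂s,
        he _ (by omega) (by omega) hk0 hkN, he _ (by omega) hk hk0 hkN⟩
    obtain ⟨T', h1, h2⟩ := hq.exists_flip hΓ
    exact ⟨T', s k, fun j hj => h1 j (hj hk0 hkN), edge_symm h2, fun _ _ => rfl⟩
  obtain ⟨T', x, hT', hx, hx'⟩ := hnew
  have c1 : 1 ≤ k → Ccw (p 0) (p k) v := by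
    intro h1
    by_cases hkN : k + 1 = N
    · have := hv.1; rw [hkN, h.wrap] at this; exact this
    · exact (Ccw.trans hv.1.rot (h.ccw k (k + 1) h1 (by omega) (by omega)).rot).rot'
  have c2 : k + 1 < N → Ccw (p 0) v (p (k + 1)) := by
    intro h1
    by_cases hk0 : k = 0
    · subst hk0; exact hv.1.rot'.rot'
    · exact (Ccw.trans_last hv.1.rot (h.ccw k (k + 1) (by omega) (by omega) h1).rot).rot'
  -- the diagonals of the new fan: the side `s k` has become one of them
  obtain ⟨c, hc⟩ : ∃ c, ∀ j, 2 ≤ j → j + 1 ≤ N →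
      (j = c ∧ insertAt e (k + 1) x j = s k) ∨ (j < c ∧ j + 2 ≤ N ∧ insertAt e (k + 1) x j = e j) ∨
        (c < j ∧ 3 ≤ j ∧ insertAt e (k + 1) x j = e (j - 1)) := by
    by_cases hk0 : k = 0
    · refine ⟨2, fun j h1 h2 => ?_⟩
      rcases h1.eq_or_lt with rfl | h1
      · exact Or.inl ⟨rfl, by simp [insertAt, hk0, h.side_zero]⟩
      · exact Or.inr (Or.inr ⟨h1, h1, by
          rw [insertAt, if_neg (by omega), if_neg (by omega)]⟩)
    by_cases hkN : k + 1 = N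
    · obtain rfl : k = N - 1 := by omega
      refine ⟨N - 1, fun j h1 h2 => ?_⟩
      have : insertAt e (N - 1 + 1) x j = e j := by rw [insertAt, if_pos (by omega)]
      rw [this]
      rcases h2.eq_or_lt with h3 | h3
      · obtain rfl : j = N - 1 := by omega
        exact Or.inl ⟨rfl, h.side_last.symm⟩
      · exact Or.inr (Or.inl ⟨by omega, by omega, rfl⟩)
    · refine ⟨k + 1, fun j h1 h2 => ?_⟩
      rcases lt_trichotomy j (k + 1) with h3 | h3 | h3
      · exact Or.inr (Or.inl ⟨h3, by omega, by rw [insertAt, if_pos h3]⟩)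
      · exact Or.inl ⟨h3, by simp [insertAt, h3, hx' hk0 hkN]⟩
      · exact Or.inr (Or.inr ⟨h3, by omega, by
          rw [insertAt, if_neg (by omega), if_neg (by omega)]⟩)
  have hside : ∀ j, j < N + 1 → (∃ m < N, m ≠ k ∧
      insertAt (Function.update s k l₁) (k + 1) l₂ j = s m ∧
      insertAt p (k + 1) v j = p m ∧ insertAt p (k + 1) v (j + 1) = p (m + 1)) ∨
      (insertAt (Function.update s k l₁) (k + 1) l₂ j = l₁ ∧
        insertAt p (k + 1) v j = p k ∧ insertAt p (k + 1) v (j + 1) = v) ∨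
      (insertAt (Function.update s k l₁) (k + 1) l₂ j = l₂ ∧
        insertAt p (k + 1) v j = v ∧ insertAt p (k + 1) v (j + 1) = p (k + 1)) := by
    intro j hj
    rcases lt_trichotomy j k with h1 | h1 | h1
    · refine Or.inl ⟨j, by omega, by omega, ?_, ?_, ?_⟩
      · rw [insertAt, if_pos (by omega), Function.update_of_ne (by omega)]
      · rw [insertAt, if_pos (by omega)]
      · rw [insertAt, if_pos (by omega)]
    · subst h1
      refine Or.inr (Or.inl ⟨?_, ?_, ?_⟩) <;> simp [insertAt]
    · rcases (show k + 1 ≤ j from h1).eq_or_lt with h1 | h1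
      · subst h1
        refine Or.inr (Or.inr ⟨?_, ?_, ?_⟩) <;> simp [insertAt]
      · refine Or.inl ⟨j - 1, by omega, by omega, ?_, ?_, ?_⟩
        · rw [insertAt, if_neg (by omega), if_neg (by omega), Function.update_of_ne (by omega)]
        · rw [insertAt, if_neg (by omega), if_neg (by omega)]
        · rw [insertAt, if_neg (by omega), if_neg (by omega)]
          congr 1; omega
  refine ⟨T', insertAt p (k + 1) v, insertAt e (k + 1) x,
    insertAt (Function.update s k l₁) (k + 1) l₂, ⟨by omega, ?_, ?_, ?_, ?_, ?_, ?_⟩⟩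
  · rw [insertAt, if_neg (by omega), if_neg (by omega), insertAt, if_pos (by omega)]
    exact h.wrap
  · intro j m h1 h2 h3
    have h0 : insertAt p (k + 1) v 0 = p 0 := by rw [insertAt, if_pos (by omega)]
    rw [h0]
    unfold insertAt
    split_ifs
    all_goals try omega
    · exact h.ccw j m (by omega) (by omega) (by omega)
    · rcases (show j ≤ k by omega).eq_or_lt with rfl | h5
      · exact c1 (by omega)
      · exact Ccw.trans (h.ccw j k h1 h5 hk) (c1 (by omega))
    · exact h.ccw j (m - 1) (by omega) (by omega) (by omega)
    · rcases (show k + 1 ≤ m - 1 by omega).eq_or_lt with h5 | h5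
      · rw [← h5]; exact c2 (by omega)
      · exact Ccw.trans (c2 (by omega)) (h.ccw (k + 1) (m - 1) (by omega) h5 (by omega))
    · exact h.ccw (j - 1) (m - 1) (by omega) (by omega) (by omega)
  · intro j h1 h2
    have h0 : insertAt p (k + 1) v 0 = p 0 := by rw [insertAt, if_pos (by omega)]
    rw [h0]
    unfold insertAt
    split_ifs
    · rw [hT' _ (he j h1 (by omega))]; exact h.chord j h1 (by omega)
    · exact hx
    · rw [hT' _ (he (j - 1) (by omega) (by omega))]
      exact h.chord (j - 1) (by omega) (by omega)
  · intro j hj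
    rcases hside j hj with ⟨m, hm, hmk, a, b, c⟩ | ⟨a, b, c⟩ | ⟨a, b, c⟩ <;> rw [a, b, c]
    · rw [hT' _ fun _ _ => hfree m hm hmk]; exact h.side m hm
    · rw [hT' _ fun _ _ => hl₁s]; exact hl₁
    · rw [hT' _ fun _ _ => hl₂s]; exact hl₂
  · intro j m h1 h2 h3 h5 hjm
    rcases hc j h1 (by omega) with ⟨a, d⟩ | ⟨a, b, d⟩ | ⟨a, b, d⟩ <;>
      rcases hc m h3 (by omega) with ⟨a', d'⟩ | ⟨a', b', d'⟩ | ⟨a', b', d'⟩ <;>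
      rw [d, d'] at hjm
    · omega
    · exact absurd hjm.symm (h.chord_ne_side _ _ h3 b' hk)
    · exact absurd hjm.symm (h.chord_ne_side _ _ (by omega) (by omega) hk)
    · exact absurd hjm (h.chord_ne_side _ _ h1 b hk)
    · exact h.chord_inj _ _ h1 b h3 b' hjm
    · have := h.chord_inj _ _ h1 b (by omega) (by omega) hjm; omega
    · exact absurd hjm (h.chord_ne_side _ _ (by omega) (by omega) hk)
    · have := h.chord_inj _ _ (by omega) (by omega) h3 b' hjm; omega
    · have := h.chord_inj _ _ (by omega) (by omega) (by omega) (by omega) hjm; omega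
  · intro j m h1 h2 h3 hjm
    have h5 : ∀ l, 2 ≤ l → l + 2 ≤ N →
        insertAt (Function.update s k l₁) (k + 1) l₂ m ≠ e l := by
      intro l h6 h7 h8
      rcases hside m h3 with ⟨m', hm', hmk, a, -⟩ | ⟨a, -⟩ | ⟨a, -⟩ <;> rw [a] at h8
      · exact h.chord_ne_side l m' h6 h7 hm' h8.symm
      · exact hl₁e l h6 h7 h8.symm
      · exact hl₂e l h6 h7 h8.symm
    rcases hc j h1 (by omega) with ⟨a, b⟩ | ⟨a, b, d⟩ | ⟨a, b, d⟩
    · rw [b] at hjm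
      rcases hside m h3 with ⟨m', hm', hmk, a, -⟩ | ⟨a, -⟩ | ⟨a, -⟩ <;> rw [a] at hjm
      · exact hfree m' hm' hmk hjm.symm
      · exact hl₁s hjm.symm
      · exact hl₂s hjm.symm
    · exact h5 j h1 b (hjm ▸ d)
    · exact h5 (j - 1) (by omega) (by omega) (hjm ▸ d)

/-- A fan with at most eight vertices can be enlarged to an octagon. -/
theorem exists_octagon (hΓ : IsSurfaceGroup Γ) (hχ : eulerChar Γ < -2) (h : T.Fan N p e s)
    (hN : N ≤ 8) : ∃ (T' : IdealTriangulation Γ n) (p' : ℕ → OnePoint ℝ) (e' s' : ℕ → Fin n),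
      T'.Fan 8 p' e' s' := by
  induction hm : 8 - N generalizing N T p e s with
  | zero =>
    obtain rfl : N = 8 := by omega
    exact ⟨T, p, e, s, h⟩
  | succ m ih =>
    obtain ⟨k, hk, hfree⟩ := h.exists_free_side hΓ hχ (by omega)
    obtain ⟨T', p', e', s', h'⟩ := h.exists_succ hΓ hk hfree
    exact ih h' (by omega) (by omega)

end Fan

namespace EmbeddedExchange
variable {T' : IdealTriangulation Γ n} {a b c d i : Fin n}

theorem exists_square (h : T.EmbeddedExchange T' a b c d i) :
    ∃ x w y z, T.Square a b c d i x w y z ∧ T'.edge i w z := by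
  obtain ⟨hd, -, x, w, y, z, h1, h2, h3, h4, h5, h6, h7, h8⟩ := h
  simp at hd
  exact ⟨x, w, y, z, ⟨h1, h2, h3, h4, h5, h6, h7, by tauto, by tauto, by tauto, by tauto⟩, h8⟩

/-- The square of an embedded diagonal exchange is a fan with four vertices, that can be enlarged
to an octagon. -/
theorem exists_octagon (hΓ : IsSurfaceGroup Γ) (hχ : eulerChar Γ < -2)
    (h : T.EmbeddedExchange T' a b c d i) :
    ∃ (T' : IdealTriangulation Γ n) (p : ℕ → OnePoint ℝ) (e s : ℕ → Fin n),
      T'.Fan 8 p e s := by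
  obtain ⟨x, w, y, z, hq, -⟩ := h.exists_square
  let p : ℕ → OnePoint ℝ := fun k =>
    match k with | 0 => x | 1 => w | 2 => y | 3 => z | _ => x
  let s : ℕ → Fin n := fun k => match k with | 0 => a | 1 => b | 2 => c | _ => d
  let e : ℕ → Fin n := fun k => match k with | 1 => a | 2 => i | _ => d
  have hf : T.Fan 4 p e s := by
    refine ⟨le_rfl, rfl, ?_, ?_, ?_, ?_, ?_⟩
    · intro j k h1 h2 h3
      interval_cases k <;> interval_cases j
      · exact hq.ccw₂.rot
      · exact hq.ccw₄
      · exact hq.ccw₁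
    · intro j h1 h2
      interval_cases j
      · exact hq.side_a
      · exact hq.diag
      · exact edge_symm hq.side_d
    · intro j h1
      interval_cases j
      · exact hq.side_a
      · exact hq.side_b
      · exact hq.side_c
      · exact hq.side_d
    · intros; omega
    · intro j k h1 h2 h3
      obtain rfl : j = 2 := by omega
      interval_cases k
      · exact hq.ne_a.symm
      · exact hq.ne_b.symm
      · exact hq.ne_c.symm
      · exact hq.ne_d.symm
  exact hf.exists_octagon hΓ hχ (by norm_num)

end EmbeddedExchange
end IdealTriangulation
end QuantumTeichmuller

namespace QuantumTeichmuller
variable {Γ : Subgroup (GL (Fin 2) ℝ)} {n : ℕ}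

namespace IdealTriangulation
variable {T T' : IdealTriangulation Γ n}

/-! ### Adjacency numbers around an embedded square -/

/-- Variant of `sigma_eq` in terms of labels. -/
theorem sigma_eq_labels (hΓ : IsSurfaceGroup Γ) {i l m l' m' : Fin n}
    {x y z x' y' z' : OnePoint ℝ}
    (hc : Ccw x y z) (hi : T.edge i x y) (hl : T.edge l x z) (hm : T.edge m y z)
    (hc' : Ccw x' y' z') (hi' : T.edge i x' y') (hl' : T.edge l' x' z') (hm' : T.edge m' y' z')
    (hne : ∀ g ∈ Γ, ¬ (g • x = x' ∧ g • y = y')) (j : Fin n) :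
    T.sigma i j = (if j = l then 1 else 0) + (if j = l' then 1 else 0)
      - (if j = m then 1 else 0) - (if j = m' then 1 else 0) := by
  classical
  rw [sigma_eq hΓ hi (isFace_of_edge hc hi hm (edge_symm hl)) hi'
    (isFace_of_edge hc' hi' hm' (edge_symm hl')) hne]
  simp only [edge_iff_of_edge hl, edge_iff_of_edge hm, edge_iff_of_edge hl',
    edge_iff_of_edge hm']

/-- The adjacency numbers of an arc with the sides of the two triangles on both sides of
one of its lifts. -/
theorem sigma_eq_two_faces (hΓ : IsSurfaceGroup Γ) {i l m l' m' : Fin n}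
    {x y z z' : OnePoint ℝ} (hc : Ccw x y z) (hi : T.edge i x y) (hl : T.edge l x z)
    (hm : T.edge m y z) (hc' : Ccw y x z') (hl' : T.edge l' y z') (hm' : T.edge m' x z')
    (j : Fin n) : T.sigma i j = (if j = l then 1 else 0) + (if j = l' then 1 else 0)
      - (if j = m then 1 else 0) - (if j = m' then 1 else 0) :=
  sigma_eq_labels hΓ hc hi hl hm hc' (edge_symm hi) hl' hm' (not_smul_reverse hΓ hi) j

theorem edge_eq_of_common {i j : Fin n} {x y : OnePoint ℝ} (h : T.edge i x y)
    (h' : T'.edge j x y) : T.edge i = T'.edge j := by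
  funext u v
  refine propext ⟨fun hu => ?_, fun hu => ?_⟩
  · obtain ⟨g, hg, ⟨rfl, rfl⟩ | ⟨rfl, rfl⟩⟩ := exists_smul_of_edge h hu
    · exact edge_smul h' hg
    · exact edge_smul (edge_symm h') hg
  · obtain ⟨g, hg, ⟨rfl, rfl⟩ | ⟨rfl, rfl⟩⟩ := exists_smul_of_edge h' hu
    · exact edge_smul h hg
    · exact edge_smul (edge_symm h) hg

namespace EmbeddedExchange
variable {a b c d i : Fin n}

/-- The inverse of a diagonal exchange is a diagonal exchange, with the labels of the sides
rotated. -/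
theorem rotate (h : T.EmbeddedExchange T' a b c d i) : T'.EmbeddedExchange T b c d a i := by
  have hd := h.distinct
  obtain ⟨x, w, y, z, hq, hn⟩ := h.exists_square
  refine ⟨?_, fun j hj => (h.others j hj).symm, w, y, z, x, hq.ccw₄.rot, hq.ccw₃.rot', hn,
    ?_, ?_, ?_, ?_, edge_symm hq.diag⟩
  · simp only [List.nodup_cons, List.mem_cons, List.not_mem_nil, or_false, not_or,
      List.nodup_nil, and_true, not_false_eq_true] at hd ⊢
    tauto
  · rw [h.others _ hq.ne_b]; exact hq.side_b
  · rw [h.others _ hq.ne_c]; exact hq.side_c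
  · rw [h.others _ hq.ne_d]; exact hq.side_d
  · rw [h.others _ hq.ne_a]; exact hq.side_a

theorem sigma_diag (hΓ : IsSurfaceGroup Γ) (h : T.EmbeddedExchange T' a b c d i) (j : Fin n) :
    T.sigma i j = (if j = d then 1 else 0) + (if j = b then 1 else 0)
      - (if j = c then 1 else 0) - (if j = a then 1 else 0) := by
  obtain ⟨x, w, y, z, hq, -⟩ := h.exists_square
  exact sigma_eq_two_faces hΓ hq.ccw₁ hq.diag (edge_symm hq.side_d) hq.side_c hq.ccw₂
    (edge_symm hq.side_b) hq.side_a j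

/-- The triangle across the side `a` of the square is not affected by the diagonal exchange. -/
theorem outer_face (hΓ : IsSurfaceGroup Γ) (h : T.EmbeddedExchange T' a b c d i)
    {x w y z : OnePoint ℝ} (hq : T.Square a b c d i x w y z) {t : OnePoint ℝ}
    (ht : T.IsFace w x t) {l m : Fin n} (hl : T.edge l x t) (hm : T.edge m w t) :
    l ≠ i ∧ m ≠ i := by
  have hd := h.distinct
  simp only [List.nodup_cons, List.mem_cons, List.not_mem_nil, or_false, not_or,
      List.nodup_nil, and_true, not_false_eq_true] at hd
  have key : ∀ g ∈ Γ, g • x ≠ w ∨ g • w ≠ x := fun g hg => by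
    by_contra! hn
    exact not_swap_edge hΓ hq.side_a hg hn.1 hn.2
  have hlab : ∀ {g : GL (Fin 2) ℝ} {u v u' v' : OnePoint ℝ} {k : Fin n}, g ∈ Γ → T.edge k u v →
      T.edge a u' v' → u' = g • u → v' = g • v → a = k := by
    rintro g u v u' v' k hg hk ha rfl rfl
    exact T.edge_inj _ _ _ _ ha (edge_smul hk hg)
  have ha := edge_symm hq.side_a
  constructor
  · rintro rfl
    obtain ⟨g, hg, ⟨e1, e2, e3⟩ | ⟨e1, e2, e3⟩⟩ := hq.face_cases hΓ ht.rot hl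
    · have := hlab hg hq.side_d ha e3 e1; tauto
    · have := hlab hg hq.side_b ha e3 e1; tauto
  · rintro rfl
    obtain ⟨g, hg, ⟨e1, e2, e3⟩ | ⟨e1, e2, e3⟩⟩ := hq.face_cases hΓ ht.rot' (edge_symm hm)
    · have := hlab hg hq.side_c ha e2 e3; tauto
    · rcases key g hg with h1 | h1
      · exact h1 e2.symm
      · exact h1 e3.symm

/-- The change of the adjacency numbers of the side `a` under the diagonal exchange. -/
theorem sigma_side (hΓ : IsSurfaceGroup Γ) (h : T.EmbeddedExchange T' a b c d i) (j : Fin n) :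
    T'.sigma a j = T.sigma a j + (if j = d then 1 else 0) + (if j = b then 1 else 0)
      - 2 * (if j = i then 1 else 0) := by
  obtain ⟨x, w, y, z, hq, hn⟩ := h.exists_square
  obtain ⟨t, ht⟩ := exists_face (edge_symm hq.side_a)
  obtain ⟨l, hl⟩ := ht.2.2.1
  obtain ⟨m, hm⟩ := ht.2.2.2
  obtain ⟨hli, hmi⟩ := h.outer_face hΓ hq ht hl (edge_symm hm)
  have e : ∀ {k u v}, k ≠ i → T.edge k u v → T'.edge k u v := fun hk hE => by
    rw [h.others _ hk]; exact hE
  rw [sigma_eq_two_faces hΓ hq.ccw₂.rot hq.side_a hq.diag hq.side_b ht.1 (edge_symm hm) hl,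
    sigma_eq_two_faces hΓ hq.ccw₄ (e hq.ne_a hq.side_a) (e hq.ne_d (edge_symm hq.side_d)) hn
      ht.1 (e hmi (edge_symm hm)) (e hli hl)]
  ring

/-- The square seen from the other end of its diagonal. -/
theorem rotate_twice (h : T.EmbeddedExchange T' a b c d i) : T.EmbeddedExchange T' c d a b i :=
  h.rotate.rotate

/-- The adjacency numbers of the sides with the arcs outside the square do not change. -/
theorem sigma_outer (hΓ : IsSurfaceGroup Γ) (h : T.EmbeddedExchange T' a b c d i) {e : Fin n}
    (he : e ∉ [a, b, c, d, i]) : T'.sigma a e = T.sigma a e ∧ T'.sigma b e = T.sigma b e ∧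
      T'.sigma c e = T.sigma c e ∧ T'.sigma d e = T.sigma d e := by
  simp only [List.mem_cons, List.not_mem_nil, or_false, not_or] at he
  obtain ⟨h1, h2, h3, h4, h5⟩ := he
  have r1 := h.sigma_side hΓ e
  have r2 := h.rotate.sigma_side hΓ e
  have r3 := h.rotate_twice.sigma_side hΓ e
  have r4 := h.rotate_twice.rotate.sigma_side hΓ e
  simp only [h1, h2, h3, h4, h5, if_false] at r1 r2 r3 r4
  refine ⟨?_, ?_, ?_, ?_⟩ <;> linarith

end EmbeddedExchange

/-! ### Diagonal exchanges in convex polygons -/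

/-- The points `p 0, …, p (N - 1)` are the vertices of a convex polygon, in counterclockwise
order. -/
def Convex (p : ℕ → OnePoint ℝ) (N : ℕ) : Prop :=
  ∀ j k l, j < k → k < l → l < N → Ccw (p j) (p k) (p l)

theorem Fan.convex {N : ℕ} {p : ℕ → OnePoint ℝ} {e s : ℕ → Fin n} (h : T.Fan N p e s) :
    Convex p N := by
  intro j k l h1 h2 h3
  rcases Nat.eq_zero_or_pos j with rfl | h0
  · exact h.ccw k l h1 h2 h3
  · exact Ccw.trans_last (h.ccw j k h0 h1 (by omega)) (h.ccw k l (by omega) h2 h3)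

/-- Diagonal exchange in the square with vertices `p j`, `p k`, `p l`, `p m`. -/
theorem exists_exchange (hΓ : IsSurfaceGroup Γ) {p : ℕ → OnePoint ℝ} {N : ℕ} (hp : Convex p N)
    {a b c d i : Fin n} (j k l m : ℕ) (h1 : j < k) (h2 : k < l) (h3 : l < m) (h4 : m < N)
    (hi : T.edge i (p j) (p l)) (ha : T.edge a (p j) (p k)) (hb : T.edge b (p k) (p l))
    (hc : T.edge c (p l) (p m)) (hd : T.edge d (p j) (p m))
    (hai : a ≠ i) (hbi : b ≠ i) (hci : c ≠ i) (hdi : d ≠ i) :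
    ∃ T' : IdealTriangulation Γ n, T'.edge i (p k) (p m) ∧
      (∀ r u v, T.edge r u v → r ≠ i → T'.edge r u v) ∧
      ([a, b, c, d, i].Nodup → T.EmbeddedExchange T' a b c d i) := by
  have hq : T.Square a b c d i (p j) (p k) (p l) (p m) :=
    ⟨hp j l m (by omega) h3 h4, (hp j k l h1 h2 (by omega)).rot', hi, ha, hb, hc, edge_symm hd,
      hai, hbi, hci, hdi⟩
  obtain ⟨T', e1, e2⟩ := hq.exists_flip hΓ
  exact ⟨T', e2, fun r u v hr hri => by rw [e1 r hri]; exact hr, fun hnd =>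
    ⟨hnd, e1, _, _, _, _, hq.ccw₁, hq.ccw₂, hi, ha, hb, hc, edge_symm hd, e2⟩⟩

theorem Convex.tri {p : ℕ → OnePoint ℝ} {N : ℕ} (hp : Convex p N) (j k l : ℕ)
    (h1 : j < k := by norm_num) (h2 : k < l := by norm_num) (h3 : l < N := by norm_num) :
    Ccw (p j) (p k) (p l) := hp j k l h1 h2 h3

/-- The adjacency numbers of the diagonal `p j`, `p l` of a square. -/
theorem sigma_diag_out (hΓ : IsSurfaceGroup Γ) {p : ℕ → OnePoint ℝ} {N : ℕ} (hp : Convex p N)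
    {a b c d i : Fin n} (j k l m : ℕ) (hi : T.edge i (p j) (p l)) (ha : T.edge a (p j) (p k))
    (hb : T.edge b (p k) (p l)) (hc : T.edge c (p l) (p m)) (hd : T.edge d (p j) (p m))
    (r : Fin n) (h1 : j < k := by norm_num) (h2 : k < l := by norm_num)
    (h3 : l < m := by norm_num) (h4 : m < N := by norm_num) :
    T.sigma i r = (if r = d then 1 else 0) + (if r = b then 1 else 0)
      - (if r = c then 1 else 0) - (if r = a then 1 else 0) :=
  sigma_eq_two_faces hΓ (hp j l m (by omega) h3 h4) hi hd hc
    (hp j k l (by omega) h2 (by omega)).rot' (edge_symm hb) ha r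

/-- The adjacency numbers of the diagonal `p k`, `p m` of a square. -/
theorem sigma_diag_in (hΓ : IsSurfaceGroup Γ) {p : ℕ → OnePoint ℝ} {N : ℕ} (hp : Convex p N)
    {a b c d i : Fin n} (j k l m : ℕ) (hi : T.edge i (p k) (p m)) (ha : T.edge a (p j) (p k))
    (hb : T.edge b (p k) (p l)) (hc : T.edge c (p l) (p m)) (hd : T.edge d (p j) (p m))
    (r : Fin n) (h1 : j < k := by norm_num) (h2 : k < l := by norm_num)
    (h3 : l < m := by norm_num) (h4 : m < N := by norm_num) :
    T.sigma i r = (if r = a then 1 else 0) + (if r = c then 1 else 0)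
      - (if r = d then 1 else 0) - (if r = b then 1 else 0) :=
  sigma_eq_two_faces hΓ (hp j k m (by omega) (by omega) h4).rot hi (edge_symm ha) (edge_symm hd)
    (hp k l m h2 h3 h4).rot' (edge_symm hc) hb r

/-! ### Pentagons -/

/-- An embedded ideal pentagon with vertices `v₀, …, v₄`, in counterclockwise order, triangulated
by its diagonals `v₀ v₂`, labelled by `i`, and `v₀ v₃`, labelled by `j`. -/
structure Pentagon (T : IdealTriangulation Γ n) (l₀ l₁ l₂ l₃ l₄ i j : Fin n)
    (v₀ v₁ v₂ v₃ v₄ : OnePoint ℝ) : Prop where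
  nodup : [l₀, l₁, l₂, l₃, l₄, i, j].Nodup
  ccw₁ : Ccw v₀ v₁ v₂
  ccw₂ : Ccw v₀ v₂ v₃
  ccw₃ : Ccw v₀ v₃ v₄
  side₀ : T.edge l₀ v₀ v₁
  side₁ : T.edge l₁ v₁ v₂
  side₂ : T.edge l₂ v₂ v₃
  side₃ : T.edge l₃ v₃ v₄
  side₄ : T.edge l₄ v₄ v₀
  diag_i : T.edge i v₀ v₂
  diag_j : T.edge j v₀ v₃

namespace Pentagon
variable {l₀ l₁ l₂ l₃ l₄ i j : Fin n} {v₀ v₁ v₂ v₃ v₄ : OnePoint ℝ}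

/-- A diagonal exchange in a pentagon. -/
theorem exists_step (hΓ : IsSurfaceGroup Γ)
    (h : T.Pentagon l₀ l₁ l₂ l₃ l₄ i j v₀ v₁ v₂ v₃ v₄) :
    ∃ T' : IdealTriangulation Γ n, T.EmbeddedExchange T' i l₂ l₃ l₄ j ∧
      T'.Pentagon l₂ l₃ l₄ l₀ l₁ j i v₂ v₃ v₄ v₀ v₁ := by
  have hd := h.nodup
  simp only [List.nodup_cons, List.mem_cons, List.not_mem_nil, or_false, not_or,
      List.nodup_nil, and_true, not_false_eq_true] at hd
  have hq : T.Square i l₂ l₃ l₄ j v₀ v₂ v₃ v₄ :=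
    ⟨h.ccw₃, h.ccw₂.rot', h.diag_j, h.diag_i, h.side₂, h.side₃, h.side₄,
      by tauto, by tauto, by tauto, by tauto⟩
  obtain ⟨T', e1, e2⟩ := hq.exists_flip hΓ
  have e : ∀ {r u v}, r ≠ j → T.edge r u v → T'.edge r u v := fun hr h => by rw [e1 _ hr]; exact h
  refine ⟨T', ⟨?_, e1, _, _, _, _, hq.ccw₁, hq.ccw₂, h.diag_j, h.diag_i, h.side₂, h.side₃,
    h.side₄, e2⟩, ⟨?_, hq.ccw₃, hq.ccw₄.rot, ?_, e (by tauto) h.side₂, e (by tauto) h.side₃,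
    e (by tauto) h.side₄, e (by tauto) h.side₀, e (by tauto) h.side₁, e2,
    edge_symm (e (by tauto) h.diag_i)⟩⟩
  · simp only [List.nodup_cons, List.mem_cons, List.not_mem_nil, or_false, not_or,
      List.nodup_nil, and_true, not_false_eq_true]
    grind
  · simp only [List.nodup_cons, List.mem_cons, List.not_mem_nil, or_false, not_or,
      List.nodup_nil, and_true, not_false_eq_true]
    grind
  · exact h.ccw₁.rot'

/-- The five diagonal exchanges of a pentagon exchange the labels of its two diagonals. -/
theorem exists_cycle (hΓ : IsSurfaceGroup Γ)
    (h : T.Pentagon l₀ l₁ l₂ l₃ l₄ i j v₀ v₁ v₂ v₃ v₄) :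
    ∃ T₁ T₂ T₃ T₄ : IdealTriangulation Γ n,
      T.EmbeddedExchange T₁ i l₂ l₃ l₄ j ∧ T₁.EmbeddedExchange T₂ j l₄ l₀ l₁ i ∧
      T₂.EmbeddedExchange T₃ i l₁ l₂ l₃ j ∧ T₃.EmbeddedExchange T₄ j l₃ l₄ l₀ i ∧
      T₄.EmbeddedExchange (T.reindex (Equiv.swap i j)) i l₀ l₁ l₂ j := by
  obtain ⟨T₁, e₁, h₁⟩ := h.exists_step hΓ
  obtain ⟨T₂, e₂, h₂⟩ := h₁.exists_step hΓ
  obtain ⟨T₃, e₃, h₃⟩ := h₂.exists_step hΓ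
  obtain ⟨T₄, e₄, h₄⟩ := h₃.exists_step hΓ
  obtain ⟨T₅, e₅, h₅⟩ := h₄.exists_step hΓ
  have : T₅ = T.reindex (Equiv.swap i j) := by
    refine IdealTriangulation.ext (funext fun k => ?_)
    show T₅.edge k = T.edge (Equiv.swap i j k)
    by_cases hi : k = i
    · subst hi
      rw [Equiv.swap_apply_left]
      exact edge_eq_of_common h₅.diag_j h.diag_j
    by_cases hj : k = j
    · subst hj
      rw [Equiv.swap_apply_right]
      exact edge_eq_of_common h₅.diag_i h.diag_i
    · rw [Equiv.swap_apply_of_ne_of_ne hi hj, e₅.others k hj, e₄.others k hi, e₃.others k hj,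
        e₂.others k hi, e₁.others k hj]
  exact ⟨T₁, T₂, T₃, T₄, e₁, e₂, e₃, e₄, this ▸ e₅⟩

end Pentagon

/-! ### Special squares in an octagon

Suitable squares and pentagons are obtained by exchanging some of the diagonals of a fan with
vertices `p 0, …, p 7`. In the proofs, `Er_jk` locates the geodesic from `p j` to `p k` and its
label after `r` diagonal exchanges. -/

/-- A row `w` of integers such that a vector with vanishing first coordinate that is orthogonal to
all cyclic rotations of `w` vanishes. When `w` consists of the adjacency numbers of the sides of a
square with an arc `λ_e`, undoing and repeating the diagonal exchange rotates `w`; the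
conjugations by the corresponding generators then determine the exponents of the last three sides
in a monomial from which the first side is absent. -/
def Separating (w₀ w₁ w₂ w₃ : ℤ) : Prop :=
  ∀ v₁ v₂ v₃ : ℤ, w₁ * v₁ + w₂ * v₂ + w₃ * v₃ = 0 → w₂ * v₁ + w₃ * v₂ + w₀ * v₃ = 0 →
    w₃ * v₁ + w₀ * v₂ + w₁ * v₃ = 0 → w₀ * v₁ + w₁ * v₂ + w₂ * v₃ = 0 →
    v₁ = 0 ∧ v₂ = 0 ∧ v₃ = 0

/-- A diagonal exchange whose square has no two sides that are adjacent outside the square, and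
whose adjacency numbers with some other arc `λ_e` are separating. -/
def HasSeparatingSquare (Γ : Subgroup (GL (Fin 2) ℝ)) (n : ℕ) : Prop :=
  ∃ (T T' : IdealTriangulation Γ n) (a b c d i e : Fin n), T.EmbeddedExchange T' a b c d i ∧
    e ∉ [a, b, c, d, i] ∧ T.sigma a b = -1 ∧ T.sigma a c = 0 ∧ T.sigma a d = 0 ∧
    T.sigma b c = 0 ∧ T.sigma b d = 0 ∧ T.sigma c d = -1 ∧
    Separating (T.sigma a e) (T.sigma b e) (T.sigma c e) (T.sigma d e)

/-- A diagonal exchange one side of whose square is, among the sides of the square, the only one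
with a non-zero adjacency number with some other arc `λ_e`. -/
def HasUnitSquare (Γ : Subgroup (GL (Fin 2) ℝ)) (n : ℕ) : Prop :=
  ∃ (T T' : IdealTriangulation Γ n) (a b c d i e : Fin n), T.EmbeddedExchange T' a b c d i ∧
    e ∉ [a, b, c, d, i] ∧ T.sigma a e ≠ 0 ∧ T.sigma b e = 0 ∧ T.sigma c e = 0 ∧
    T.sigma d e = 0

/-- There is an embedded pentagon. -/
def HasPentagon (Γ : Subgroup (GL (Fin 2) ℝ)) (n : ℕ) : Prop :=
  ∃ (T : IdealTriangulation Γ n) (l₀ l₁ l₂ l₃ l₄ i j : Fin n) (v₀ v₁ v₂ v₃ v₄ : OnePoint ℝ),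
    T.Pentagon l₀ l₁ l₂ l₃ l₄ i j v₀ v₁ v₂ v₃ v₄

namespace Fan
variable {p : ℕ → OnePoint ℝ} {e s : ℕ → Fin n}

theorem side_cases {N : ℕ} (hΓ : IsSurfaceGroup Γ) (h : T.Fan N p e s) {j : ℕ} (hj : j < N) :
    (∀ k < N, k ≠ j → s j ≠ s k) ∨
      ∃ m < N, m ≠ j ∧ s j = s m ∧ ∀ k < N, k ≠ j → k ≠ m → s j ≠ s k := by
  by_cases hn : ∃ m < N, m ≠ j ∧ s j = s m
  · obtain ⟨m, hm, hmj, hs⟩ := hn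
    exact Or.inr ⟨m, hm, hmj, hs, fun k hk hkj hkm =>
      h.not_three hΓ hj hm hk hmj.symm hkj.symm hkm.symm hs⟩
  · push Not at hn
    exact Or.inl hn

/-- The diagonals of an octagon are different from each other and from its sides. -/
theorem octagon_labels (h : T.Fan 8 p e s) :
    (∀ {j k}, 2 ≤ j → j ≤ 6 → 2 ≤ k → k ≤ 6 → (e j = e k ↔ j = k)) ∧
    (∀ {j k}, 2 ≤ j → j ≤ 6 → k < 8 → (e j = s k ↔ False)) ∧
    ∀ {j k}, 2 ≤ j → j ≤ 6 → k < 8 → (s k = e j ↔ False) :=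
  ⟨fun h1 h2 h3 h4 =>
    ⟨h.chord_inj _ _ h1 (by omega) h3 (by omega), fun h => h ▸ rfl⟩,
    fun h1 h2 h3 => iff_of_false (h.chord_ne_side _ _ h1 (by omega) h3) id,
    fun h1 h2 h3 => iff_of_false (h.chord_ne_side _ _ h1 (by omega) h3).symm id⟩

theorem octagon_side (h : T.Fan 8 p e s) {k : ℕ} (hk : k < 8 := by norm_num) :
    T.edge (s k) (p k) (p (k + 1)) := h.side k hk

theorem octagon_side_last (h : T.Fan 8 p e s) : T.edge (s 7) (p 0) (p 7) := by
  rw [← h.wrap]; exact edge_symm (h.side 7 (by norm_num))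

theorem octagon_chord (h : T.Fan 8 p e s) {k : ℕ} (h1 : 1 ≤ k := by norm_num)
    (h2 : k < 8 := by norm_num) : T.edge (e k) (p 0) (p k) := h.chord k h1 h2

/-- The square on the even vertices of an octagon, and an arc `λ_f` that is not one of the diagonals
of the fan. Each side of the square cuts off a triangle with two sides of the octagon. -/
theorem even_square (hΓ : IsSurfaceGroup Γ) (h : T.Fan 8 p e s) (f : Fin n)
    (hf : ∀ j, 2 ≤ j → j ≤ 6 → f ≠ e j)
    (hw : Separating ((if f = s 1 then 1 else 0) - if f = s 0 then 1 else 0)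
      ((if f = s 3 then 1 else 0) - if f = s 2 then 1 else 0)
      ((if f = s 5 then 1 else 0) - if f = s 4 then 1 else 0)
      ((if f = s 7 then 1 else 0) - if f = s 6 then 1 else 0)) :
    HasSeparatingSquare Γ n := by
  have hf' : ∀ {j}, 2 ≤ j → j ≤ 6 → (f = e j ↔ False) := fun h1 h2 =>
    iff_of_false (hf _ h1 h2) id
  obtain ⟨T1, n1, k1, x1⟩ := exists_exchange hΓ h.convex 0 2 3 4 (by norm_num) (by norm_num)
    (by norm_num) (by norm_num) h.octagon_chord h.octagon_chord h.octagon_side h.octagon_side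
    h.octagon_chord (by simp [h.octagon_labels]) (by simp [h.octagon_labels])
    (by simp [h.octagon_labels]) (by simp [h.octagon_labels])
  have E1_01 : T1.edge (s 0) (p 0) (p 1) := k1 _ _ _ h.octagon_side
    (by simp [h.octagon_labels])
  have E1_02 : T1.edge (e 2) (p 0) (p 2) := k1 _ _ _ h.octagon_chord
    (by simp [h.octagon_labels])
  have E1_04 : T1.edge (e 4) (p 0) (p 4) := k1 _ _ _ h.octagon_chord
    (by simp [h.octagon_labels])
  have E1_05 : T1.edge (e 5) (p 0) (p 5) := k1 _ _ _ h.octagon_chord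
    (by simp [h.octagon_labels])
  have E1_06 : T1.edge (e 6) (p 0) (p 6) := k1 _ _ _ h.octagon_chord
    (by simp [h.octagon_labels])
  have E1_07 : T1.edge (s 7) (p 0) (p 7) := k1 _ _ _ h.octagon_side_last
    (by simp [h.octagon_labels])
  have E1_12 : T1.edge (s 1) (p 1) (p 2) := k1 _ _ _ h.octagon_side
    (by simp [h.octagon_labels])
  have E1_23 : T1.edge (s 2) (p 2) (p 3) := k1 _ _ _ h.octagon_side
    (by simp [h.octagon_labels])
  have E1_34 : T1.edge (s 3) (p 3) (p 4) := k1 _ _ _ h.octagon_side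
    (by simp [h.octagon_labels])
  have E1_45 : T1.edge (s 4) (p 4) (p 5) := k1 _ _ _ h.octagon_side
    (by simp [h.octagon_labels])
  have E1_56 : T1.edge (s 5) (p 5) (p 6) := k1 _ _ _ h.octagon_side
    (by simp [h.octagon_labels])
  have E1_67 : T1.edge (s 6) (p 6) (p 7) := k1 _ _ _ h.octagon_side
    (by simp [h.octagon_labels])
  obtain ⟨T2, n2, k2, x2⟩ := exists_exchange hΓ h.convex 0 4 5 6 (by norm_num) (by norm_num)
    (by norm_num) (by norm_num) E1_05 E1_04 E1_45 E1_56 E1_06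
    (by simp [h.octagon_labels]) (by simp [h.octagon_labels])
    (by simp [h.octagon_labels]) (by simp [h.octagon_labels])
  have E2_01 : T2.edge (s 0) (p 0) (p 1) := k2 _ _ _ E1_01
    (by simp [h.octagon_labels])
  have E2_02 : T2.edge (e 2) (p 0) (p 2) := k2 _ _ _ E1_02
    (by simp [h.octagon_labels])
  have E2_04 : T2.edge (e 4) (p 0) (p 4) := k2 _ _ _ E1_04
    (by simp [h.octagon_labels])
  have E2_06 : T2.edge (e 6) (p 0) (p 6) := k2 _ _ _ E1_06
    (by simp [h.octagon_labels])
  have E2_07 : T2.edge (s 7) (p 0) (p 7) := k2 _ _ _ E1_07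
    (by simp [h.octagon_labels])
  have E2_12 : T2.edge (s 1) (p 1) (p 2) := k2 _ _ _ E1_12
    (by simp [h.octagon_labels])
  have E2_23 : T2.edge (s 2) (p 2) (p 3) := k2 _ _ _ E1_23
    (by simp [h.octagon_labels])
  have E2_24 : T2.edge (e 3) (p 2) (p 4) := k2 _ _ _ n1
    (by simp [h.octagon_labels])
  have E2_34 : T2.edge (s 3) (p 3) (p 4) := k2 _ _ _ E1_34
    (by simp [h.octagon_labels])
  have E2_45 : T2.edge (s 4) (p 4) (p 5) := k2 _ _ _ E1_45
    (by simp [h.octagon_labels])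
  have E2_56 : T2.edge (s 5) (p 5) (p 6) := k2 _ _ _ E1_56
    (by simp [h.octagon_labels])
  have E2_67 : T2.edge (s 6) (p 6) (p 7) := k2 _ _ _ E1_67
    (by simp [h.octagon_labels])
  obtain ⟨T3, n3, k3, x3⟩ := exists_exchange hΓ h.convex 0 2 4 6 (by norm_num) (by norm_num)
    (by norm_num) (by norm_num) E2_04 E2_02 E2_24 n2 E2_06
    (by simp [h.octagon_labels]) (by simp [h.octagon_labels])
    (by simp [h.octagon_labels]) (by simp [h.octagon_labels])
  have ra := sigma_diag_out hΓ h.convex 0 1 2 4 E2_02 E2_01 E2_12 E2_24 E2_04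
  have rb := sigma_diag_in hΓ h.convex 0 2 3 4 E2_24 E2_02 E2_23 E2_34 E2_04
  have rc := sigma_diag_in hΓ h.convex 0 4 5 6 n2 E2_04 E2_45 E2_56 E2_06
  have rd := sigma_diag_out hΓ h.convex 0 4 6 7 E2_06 E2_04 n2 E2_67 E2_07
  refine ⟨T2, T3, e 2, e 3, e 5, e 6, e 4, f, x3 (by simp [h.octagon_labels]), ?_, ?_⟩
  · simp [hf']
  · rw [ra, ra, ra, rb, rb, rc, ra, rb, rc, rd]
    simpa [h.octagon_labels, hf'] using hw

/-- In an octagon whose sides `s 0` and `s 5` are glued, the square `p 0`, `p 1`, `p 3`, `p 5` and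
the arc `p 5 p 7` can be used. -/
theorem odd_square_five (hΓ : IsSurfaceGroup Γ) (h : T.Fan 8 p e s)
    (h05 : s 0 = s 5) (h0 : ∀ k < 8, k ≠ 0 → k ≠ 5 → s 0 ≠ s k) :
    HasSeparatingSquare Γ n := by
  obtain ⟨T1, n1, k1, x1⟩ := exists_exchange hΓ h.convex 0 1 2 3 (by norm_num) (by norm_num)
    (by norm_num) (by norm_num) h.octagon_chord h.octagon_side h.octagon_side h.octagon_side
    h.octagon_chord (by simp [h.octagon_labels]) (by simp [h.octagon_labels])
    (by simp [h.octagon_labels]) (by simp [h.octagon_labels])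
  have E1_01 : T1.edge (s 0) (p 0) (p 1) := k1 _ _ _ h.octagon_side
    (by simp [h.octagon_labels])
  have E1_03 : T1.edge (e 3) (p 0) (p 3) := k1 _ _ _ h.octagon_chord
    (by simp [h.octagon_labels])
  have E1_04 : T1.edge (e 4) (p 0) (p 4) := k1 _ _ _ h.octagon_chord
    (by simp [h.octagon_labels])
  have E1_05 : T1.edge (e 5) (p 0) (p 5) := k1 _ _ _ h.octagon_chord
    (by simp [h.octagon_labels])
  have E1_06 : T1.edge (e 6) (p 0) (p 6) := k1 _ _ _ h.octagon_chord
    (by simp [h.octagon_labels])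
  have E1_07 : T1.edge (s 7) (p 0) (p 7) := k1 _ _ _ h.octagon_side_last
    (by simp [h.octagon_labels])
  have E1_12 : T1.edge (s 1) (p 1) (p 2) := k1 _ _ _ h.octagon_side
    (by simp [h.octagon_labels])
  have E1_23 : T1.edge (s 2) (p 2) (p 3) := k1 _ _ _ h.octagon_side
    (by simp [h.octagon_labels])
  have E1_34 : T1.edge (s 3) (p 3) (p 4) := k1 _ _ _ h.octagon_side
    (by simp [h.octagon_labels])
  have E1_45 : T1.edge (s 4) (p 4) (p 5) := k1 _ _ _ h.octagon_side
    (by simp [h.octagon_labels])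
  have E1_56 : T1.edge (s 5) (p 5) (p 6) := k1 _ _ _ h.octagon_side
    (by simp [h.octagon_labels])
  have E1_67 : T1.edge (s 6) (p 6) (p 7) := k1 _ _ _ h.octagon_side
    (by simp [h.octagon_labels])
  obtain ⟨T2, n2, k2, x2⟩ := exists_exchange hΓ h.convex 0 3 4 5 (by norm_num) (by norm_num)
    (by norm_num) (by norm_num) E1_04 E1_03 E1_34 E1_45 E1_05
    (by simp [h.octagon_labels]) (by simp [h.octagon_labels])
    (by simp [h.octagon_labels]) (by simp [h.octagon_labels])
  have E2_01 : T2.edge (s 0) (p 0) (p 1) := k2 _ _ _ E1_01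
    (by simp [h.octagon_labels])
  have E2_03 : T2.edge (e 3) (p 0) (p 3) := k2 _ _ _ E1_03
    (by simp [h.octagon_labels])
  have E2_05 : T2.edge (e 5) (p 0) (p 5) := k2 _ _ _ E1_05
    (by simp [h.octagon_labels])
  have E2_06 : T2.edge (e 6) (p 0) (p 6) := k2 _ _ _ E1_06
    (by simp [h.octagon_labels])
  have E2_07 : T2.edge (s 7) (p 0) (p 7) := k2 _ _ _ E1_07
    (by simp [h.octagon_labels])
  have E2_12 : T2.edge (s 1) (p 1) (p 2) := k2 _ _ _ E1_12
    (by simp [h.octagon_labels])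
  have E2_13 : T2.edge (e 2) (p 1) (p 3) := k2 _ _ _ n1
    (by simp [h.octagon_labels])
  have E2_23 : T2.edge (s 2) (p 2) (p 3) := k2 _ _ _ E1_23
    (by simp [h.octagon_labels])
  have E2_34 : T2.edge (s 3) (p 3) (p 4) := k2 _ _ _ E1_34
    (by simp [h.octagon_labels])
  have E2_45 : T2.edge (s 4) (p 4) (p 5) := k2 _ _ _ E1_45
    (by simp [h.octagon_labels])
  have E2_56 : T2.edge (s 5) (p 5) (p 6) := k2 _ _ _ E1_56
    (by simp [h.octagon_labels])
  have E2_67 : T2.edge (s 6) (p 6) (p 7) := k2 _ _ _ E1_67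
    (by simp [h.octagon_labels])
  obtain ⟨T3, n3, k3, x3⟩ := exists_exchange hΓ h.convex 0 5 6 7 (by norm_num) (by norm_num)
    (by norm_num) (by norm_num) E2_06 E2_05 E2_56 E2_67 E2_07
    (by simp [h.octagon_labels]) (by simp [h.octagon_labels])
    (by simp [h.octagon_labels]) (by simp [h.octagon_labels])
  have E3_01 : T3.edge (s 0) (p 0) (p 1) := k3 _ _ _ E2_01
    (by simp [h.octagon_labels])
  have E3_03 : T3.edge (e 3) (p 0) (p 3) := k3 _ _ _ E2_03
    (by simp [h.octagon_labels])
  have E3_05 : T3.edge (e 5) (p 0) (p 5) := k3 _ _ _ E2_05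
    (by simp [h.octagon_labels])
  have E3_07 : T3.edge (s 7) (p 0) (p 7) := k3 _ _ _ E2_07
    (by simp [h.octagon_labels])
  have E3_12 : T3.edge (s 1) (p 1) (p 2) := k3 _ _ _ E2_12
    (by simp [h.octagon_labels])
  have E3_13 : T3.edge (e 2) (p 1) (p 3) := k3 _ _ _ E2_13
    (by simp [h.octagon_labels])
  have E3_23 : T3.edge (s 2) (p 2) (p 3) := k3 _ _ _ E2_23
    (by simp [h.octagon_labels])
  have E3_34 : T3.edge (s 3) (p 3) (p 4) := k3 _ _ _ E2_34
    (by simp [h.octagon_labels])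
  have E3_35 : T3.edge (e 4) (p 3) (p 5) := k3 _ _ _ n2
    (by simp [h.octagon_labels])
  have E3_45 : T3.edge (s 4) (p 4) (p 5) := k3 _ _ _ E2_45
    (by simp [h.octagon_labels])
  have E3_56 : T3.edge (s 5) (p 5) (p 6) := k3 _ _ _ E2_56
    (by simp [h.octagon_labels])
  have E3_67 : T3.edge (s 6) (p 6) (p 7) := k3 _ _ _ E2_67
    (by simp [h.octagon_labels])
  obtain ⟨T4, n4, k4, x4⟩ := exists_exchange hΓ h.convex 0 1 3 5 (by norm_num) (by norm_num)
    (by norm_num) (by norm_num) E3_03 E3_01 E3_13 E3_35 E3_05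
    (by simp [h.octagon_labels]) (by simp [h.octagon_labels])
    (by simp [h.octagon_labels]) (by simp [h.octagon_labels])
  have rb := sigma_diag_in hΓ h.convex 0 1 2 3 E3_13 E3_01 E3_12 E3_23 E3_03
  have rc := sigma_diag_in hΓ h.convex 0 3 4 5 E3_35 E3_03 E3_34 E3_45 E3_05
  have rd := sigma_diag_out hΓ h.convex 0 3 5 7 E3_05 E3_03 E3_35 n3 E3_07
  have re := sigma_diag_in hΓ h.convex 0 5 6 7 n3 E3_05 E3_56 E3_67 E3_07
  refine ⟨T3, T4, s 0, e 2, e 4, e 5, e 3, e 6, x4 (by simp [h.octagon_labels]), ?_, ?_⟩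
  · simp [h.octagon_labels]
  · rw [sigma_swap (e 2) (s 0), sigma_swap (e 4) (s 0), sigma_swap (e 5) (s 0),
      sigma_swap (e 6) (s 0),
      sigma_swap (e 6) (e 2), sigma_swap (e 6) (e 4), sigma_swap (e 6) (e 5)]
    rw [rb, rb, rb, rc, rc, rd, re, re, re, re]
    simp [h.octagon_labels, h0, ← h05, Separating]

/-- In an octagon whose sides `s 0` and `s 1` are glued, the square `p 0`, `p 1`, `p 4`, `p 6` and
the arc `p 1 p 3` can be used. -/
theorem square_one (hΓ : IsSurfaceGroup Γ) (h : T.Fan 8 p e s)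
    (h01 : s 0 = s 1) (h0 : ∀ k < 8, k ≠ 0 → k ≠ 1 → s 0 ≠ s k) :
    HasSeparatingSquare Γ n := by
  obtain ⟨T1, n1, k1, x1⟩ := exists_exchange hΓ h.convex 0 1 2 3 (by norm_num) (by norm_num)
    (by norm_num) (by norm_num) h.octagon_chord h.octagon_side h.octagon_side h.octagon_side
    h.octagon_chord (by simp [h.octagon_labels]) (by simp [h.octagon_labels])
    (by simp [h.octagon_labels]) (by simp [h.octagon_labels])
  have E1_01 : T1.edge (s 0) (p 0) (p 1) := k1 _ _ _ h.octagon_side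
    (by simp [h.octagon_labels])
  have E1_03 : T1.edge (e 3) (p 0) (p 3) := k1 _ _ _ h.octagon_chord
    (by simp [h.octagon_labels])
  have E1_04 : T1.edge (e 4) (p 0) (p 4) := k1 _ _ _ h.octagon_chord
    (by simp [h.octagon_labels])
  have E1_05 : T1.edge (e 5) (p 0) (p 5) := k1 _ _ _ h.octagon_chord
    (by simp [h.octagon_labels])
  have E1_06 : T1.edge (e 6) (p 0) (p 6) := k1 _ _ _ h.octagon_chord
    (by simp [h.octagon_labels])
  have E1_07 : T1.edge (s 7) (p 0) (p 7) := k1 _ _ _ h.octagon_side_last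
    (by simp [h.octagon_labels])
  have E1_12 : T1.edge (s 1) (p 1) (p 2) := k1 _ _ _ h.octagon_side
    (by simp [h.octagon_labels])
  have E1_23 : T1.edge (s 2) (p 2) (p 3) := k1 _ _ _ h.octagon_side
    (by simp [h.octagon_labels])
  have E1_34 : T1.edge (s 3) (p 3) (p 4) := k1 _ _ _ h.octagon_side
    (by simp [h.octagon_labels])
  have E1_45 : T1.edge (s 4) (p 4) (p 5) := k1 _ _ _ h.octagon_side
    (by simp [h.octagon_labels])
  have E1_56 : T1.edge (s 5) (p 5) (p 6) := k1 _ _ _ h.octagon_side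
    (by simp [h.octagon_labels])
  have E1_67 : T1.edge (s 6) (p 6) (p 7) := k1 _ _ _ h.octagon_side
    (by simp [h.octagon_labels])
  obtain ⟨T2, n2, k2, x2⟩ := exists_exchange hΓ h.convex 0 1 3 4 (by norm_num) (by norm_num)
    (by norm_num) (by norm_num) E1_03 E1_01 n1 E1_34 E1_04
    (by simp [h.octagon_labels]) (by simp [h.octagon_labels])
    (by simp [h.octagon_labels]) (by simp [h.octagon_labels])
  have E2_01 : T2.edge (s 0) (p 0) (p 1) := k2 _ _ _ E1_01
    (by simp [h.octagon_labels])
  have E2_04 : T2.edge (e 4) (p 0) (p 4) := k2 _ _ _ E1_04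
    (by simp [h.octagon_labels])
  have E2_05 : T2.edge (e 5) (p 0) (p 5) := k2 _ _ _ E1_05
    (by simp [h.octagon_labels])
  have E2_06 : T2.edge (e 6) (p 0) (p 6) := k2 _ _ _ E1_06
    (by simp [h.octagon_labels])
  have E2_07 : T2.edge (s 7) (p 0) (p 7) := k2 _ _ _ E1_07
    (by simp [h.octagon_labels])
  have E2_12 : T2.edge (s 1) (p 1) (p 2) := k2 _ _ _ E1_12
    (by simp [h.octagon_labels])
  have E2_13 : T2.edge (e 2) (p 1) (p 3) := k2 _ _ _ n1
    (by simp [h.octagon_labels])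
  have E2_23 : T2.edge (s 2) (p 2) (p 3) := k2 _ _ _ E1_23
    (by simp [h.octagon_labels])
  have E2_34 : T2.edge (s 3) (p 3) (p 4) := k2 _ _ _ E1_34
    (by simp [h.octagon_labels])
  have E2_45 : T2.edge (s 4) (p 4) (p 5) := k2 _ _ _ E1_45
    (by simp [h.octagon_labels])
  have E2_56 : T2.edge (s 5) (p 5) (p 6) := k2 _ _ _ E1_56
    (by simp [h.octagon_labels])
  have E2_67 : T2.edge (s 6) (p 6) (p 7) := k2 _ _ _ E1_67
    (by simp [h.octagon_labels])
  obtain ⟨T3, n3, k3, x3⟩ := exists_exchange hΓ h.convex 0 4 5 6 (by norm_num) (by norm_num)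
    (by norm_num) (by norm_num) E2_05 E2_04 E2_45 E2_56 E2_06
    (by simp [h.octagon_labels]) (by simp [h.octagon_labels])
    (by simp [h.octagon_labels]) (by simp [h.octagon_labels])
  have E3_01 : T3.edge (s 0) (p 0) (p 1) := k3 _ _ _ E2_01
    (by simp [h.octagon_labels])
  have E3_04 : T3.edge (e 4) (p 0) (p 4) := k3 _ _ _ E2_04
    (by simp [h.octagon_labels])
  have E3_06 : T3.edge (e 6) (p 0) (p 6) := k3 _ _ _ E2_06
    (by simp [h.octagon_labels])
  have E3_07 : T3.edge (s 7) (p 0) (p 7) := k3 _ _ _ E2_07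
    (by simp [h.octagon_labels])
  have E3_12 : T3.edge (s 1) (p 1) (p 2) := k3 _ _ _ E2_12
    (by simp [h.octagon_labels])
  have E3_13 : T3.edge (e 2) (p 1) (p 3) := k3 _ _ _ E2_13
    (by simp [h.octagon_labels])
  have E3_14 : T3.edge (e 3) (p 1) (p 4) := k3 _ _ _ n2
    (by simp [h.octagon_labels])
  have E3_23 : T3.edge (s 2) (p 2) (p 3) := k3 _ _ _ E2_23
    (by simp [h.octagon_labels])
  have E3_34 : T3.edge (s 3) (p 3) (p 4) := k3 _ _ _ E2_34
    (by simp [h.octagon_labels])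
  have E3_45 : T3.edge (s 4) (p 4) (p 5) := k3 _ _ _ E2_45
    (by simp [h.octagon_labels])
  have E3_56 : T3.edge (s 5) (p 5) (p 6) := k3 _ _ _ E2_56
    (by simp [h.octagon_labels])
  have E3_67 : T3.edge (s 6) (p 6) (p 7) := k3 _ _ _ E2_67
    (by simp [h.octagon_labels])
  obtain ⟨T4, n4, k4, x4⟩ := exists_exchange hΓ h.convex 0 1 4 6 (by norm_num) (by norm_num)
    (by norm_num) (by norm_num) E3_04 E3_01 E3_14 n3 E3_06
    (by simp [h.octagon_labels]) (by simp [h.octagon_labels])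
    (by simp [h.octagon_labels]) (by simp [h.octagon_labels])
  have rb := sigma_diag_in hΓ h.convex 0 1 3 4 E3_14 E3_01 E3_13 E3_34 E3_04
  have rc := sigma_diag_in hΓ h.convex 0 4 5 6 n3 E3_04 E3_45 E3_56 E3_06
  have rd := sigma_diag_out hΓ h.convex 0 4 6 7 E3_06 E3_04 n3 E3_67 E3_07
  have re := sigma_diag_out hΓ h.convex 1 2 3 4 E3_13 E3_12 E3_23 E3_34 E3_14
  refine ⟨T3, T4, s 0, e 3, e 5, e 6, e 4, e 2, x4 (by simp [h.octagon_labels]), ?_, ?_⟩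
  · simp [h.octagon_labels]
  · rw [sigma_swap (e 3) (s 0), sigma_swap (e 5) (s 0), sigma_swap (e 6) (s 0),
      sigma_swap (e 2) (s 0),
      sigma_swap (e 2) (e 3), sigma_swap (e 2) (e 5), sigma_swap (e 2) (e 6)]
    rw [rb, rb, rb, rc, rc, rd, re, re, re, re]
    simp [h.octagon_labels, h0, ← h01, Separating]

/-- In an octagon whose sides `s 0` and `s 4` are glued, the square `p 0`, `p 1`, `p 3`, `p 6` and
the side `s 5` can be used. -/
theorem square_four (hΓ : IsSurfaceGroup Γ) (h : T.Fan 8 p e s)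
    (h04 : s 0 = s 4) (h0 : ∀ k < 8, k ≠ 0 → k ≠ 4 → s 0 ≠ s k) (h05 : s 5 ≠ s 0)
    (hw : Separating (if s 5 = s 3 then 1 else 0)
      ((if s 5 = s 2 then 1 else 0) - if s 5 = s 1 then 1 else 0) 1
      ((if s 5 = s 7 then 1 else 0) - if s 5 = s 6 then 1 else 0)) :
    HasSeparatingSquare Γ n := by
  obtain ⟨T1, n1, k1, x1⟩ := exists_exchange hΓ h.convex 0 1 2 3 (by norm_num) (by norm_num)
    (by norm_num) (by norm_num) h.octagon_chord h.octagon_side h.octagon_side h.octagon_side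
    h.octagon_chord (by simp [h.octagon_labels]) (by simp [h.octagon_labels])
    (by simp [h.octagon_labels]) (by simp [h.octagon_labels])
  have E1_01 : T1.edge (s 0) (p 0) (p 1) := k1 _ _ _ h.octagon_side
    (by simp [h.octagon_labels])
  have E1_03 : T1.edge (e 3) (p 0) (p 3) := k1 _ _ _ h.octagon_chord
    (by simp [h.octagon_labels])
  have E1_04 : T1.edge (e 4) (p 0) (p 4) := k1 _ _ _ h.octagon_chord
    (by simp [h.octagon_labels])
  have E1_05 : T1.edge (e 5) (p 0) (p 5) := k1 _ _ _ h.octagon_chord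
    (by simp [h.octagon_labels])
  have E1_06 : T1.edge (e 6) (p 0) (p 6) := k1 _ _ _ h.octagon_chord
    (by simp [h.octagon_labels])
  have E1_07 : T1.edge (s 7) (p 0) (p 7) := k1 _ _ _ h.octagon_side_last
    (by simp [h.octagon_labels])
  have E1_12 : T1.edge (s 1) (p 1) (p 2) := k1 _ _ _ h.octagon_side
    (by simp [h.octagon_labels])
  have E1_23 : T1.edge (s 2) (p 2) (p 3) := k1 _ _ _ h.octagon_side
    (by simp [h.octagon_labels])
  have E1_34 : T1.edge (s 3) (p 3) (p 4) := k1 _ _ _ h.octagon_side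
    (by simp [h.octagon_labels])
  have E1_45 : T1.edge (s 4) (p 4) (p 5) := k1 _ _ _ h.octagon_side
    (by simp [h.octagon_labels])
  have E1_56 : T1.edge (s 5) (p 5) (p 6) := k1 _ _ _ h.octagon_side
    (by simp [h.octagon_labels])
  have E1_67 : T1.edge (s 6) (p 6) (p 7) := k1 _ _ _ h.octagon_side
    (by simp [h.octagon_labels])
  obtain ⟨T2, n2, k2, x2⟩ := exists_exchange hΓ h.convex 0 3 4 5 (by norm_num) (by norm_num)
    (by norm_num) (by norm_num) E1_04 E1_03 E1_34 E1_45 E1_05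
    (by simp [h.octagon_labels]) (by simp [h.octagon_labels])
    (by simp [h.octagon_labels]) (by simp [h.octagon_labels])
  have E2_01 : T2.edge (s 0) (p 0) (p 1) := k2 _ _ _ E1_01
    (by simp [h.octagon_labels])
  have E2_03 : T2.edge (e 3) (p 0) (p 3) := k2 _ _ _ E1_03
    (by simp [h.octagon_labels])
  have E2_05 : T2.edge (e 5) (p 0) (p 5) := k2 _ _ _ E1_05
    (by simp [h.octagon_labels])
  have E2_06 : T2.edge (e 6) (p 0) (p 6) := k2 _ _ _ E1_06
    (by simp [h.octagon_labels])
  have E2_07 : T2.edge (s 7) (p 0) (p 7) := k2 _ _ _ E1_07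
    (by simp [h.octagon_labels])
  have E2_12 : T2.edge (s 1) (p 1) (p 2) := k2 _ _ _ E1_12
    (by simp [h.octagon_labels])
  have E2_13 : T2.edge (e 2) (p 1) (p 3) := k2 _ _ _ n1
    (by simp [h.octagon_labels])
  have E2_23 : T2.edge (s 2) (p 2) (p 3) := k2 _ _ _ E1_23
    (by simp [h.octagon_labels])
  have E2_34 : T2.edge (s 3) (p 3) (p 4) := k2 _ _ _ E1_34
    (by simp [h.octagon_labels])
  have E2_45 : T2.edge (s 4) (p 4) (p 5) := k2 _ _ _ E1_45
    (by simp [h.octagon_labels])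
  have E2_56 : T2.edge (s 5) (p 5) (p 6) := k2 _ _ _ E1_56
    (by simp [h.octagon_labels])
  have E2_67 : T2.edge (s 6) (p 6) (p 7) := k2 _ _ _ E1_67
    (by simp [h.octagon_labels])
  obtain ⟨T3, n3, k3, x3⟩ := exists_exchange hΓ h.convex 0 3 5 6 (by norm_num) (by norm_num)
    (by norm_num) (by norm_num) E2_05 E2_03 n2 E2_56 E2_06
    (by simp [h.octagon_labels]) (by simp [h.octagon_labels])
    (by simp [h.octagon_labels]) (by simp [h.octagon_labels])
  have E3_01 : T3.edge (s 0) (p 0) (p 1) := k3 _ _ _ E2_01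
    (by simp [h.octagon_labels])
  have E3_03 : T3.edge (e 3) (p 0) (p 3) := k3 _ _ _ E2_03
    (by simp [h.octagon_labels])
  have E3_06 : T3.edge (e 6) (p 0) (p 6) := k3 _ _ _ E2_06
    (by simp [h.octagon_labels])
  have E3_07 : T3.edge (s 7) (p 0) (p 7) := k3 _ _ _ E2_07
    (by simp [h.octagon_labels])
  have E3_12 : T3.edge (s 1) (p 1) (p 2) := k3 _ _ _ E2_12
    (by simp [h.octagon_labels])
  have E3_13 : T3.edge (e 2) (p 1) (p 3) := k3 _ _ _ E2_13
    (by simp [h.octagon_labels])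
  have E3_23 : T3.edge (s 2) (p 2) (p 3) := k3 _ _ _ E2_23
    (by simp [h.octagon_labels])
  have E3_34 : T3.edge (s 3) (p 3) (p 4) := k3 _ _ _ E2_34
    (by simp [h.octagon_labels])
  have E3_35 : T3.edge (e 4) (p 3) (p 5) := k3 _ _ _ n2
    (by simp [h.octagon_labels])
  have E3_45 : T3.edge (s 4) (p 4) (p 5) := k3 _ _ _ E2_45
    (by simp [h.octagon_labels])
  have E3_56 : T3.edge (s 5) (p 5) (p 6) := k3 _ _ _ E2_56
    (by simp [h.octagon_labels])
  have E3_67 : T3.edge (s 6) (p 6) (p 7) := k3 _ _ _ E2_67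
    (by simp [h.octagon_labels])
  obtain ⟨T4, n4, k4, x4⟩ := exists_exchange hΓ h.convex 0 1 3 6 (by norm_num) (by norm_num)
    (by norm_num) (by norm_num) E3_03 E3_01 E3_13 n3 E3_06
    (by simp [h.octagon_labels]) (by simp [h.octagon_labels])
    (by simp [h.octagon_labels]) (by simp [h.octagon_labels])
  have rb := sigma_diag_in hΓ h.convex 0 1 2 3 E3_13 E3_01 E3_12 E3_23 E3_03
  have rc := sigma_diag_in hΓ h.convex 0 3 5 6 n3 E3_03 E3_35 E3_56 E3_06
  have rd := sigma_diag_out hΓ h.convex 0 3 6 7 E3_06 E3_03 n3 E3_67 E3_07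
  have ra := sigma_eq_labels hΓ (h.convex.tri 0 1 3) E3_01 E3_03 E3_13
    (h.convex.tri 3 4 5).rot (show T3.edge (s 0) (p 4) (p 5) from h04 ▸ E3_45)
    (edge_symm E3_34) (edge_symm E3_35)
    (h.not_smul_side hΓ (by norm_num) (by norm_num) (by norm_num))
  refine ⟨T3, T4, s 0, e 2, e 5, e 6, e 3, s 5, x4 (by simp [h.octagon_labels]), ?_, ?_⟩
  · simp [h.octagon_labels, h05]
  · rw [sigma_swap (e 2) (s 0), sigma_swap (e 5) (s 0), sigma_swap (e 6) (s 0)]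
    rw [rb, rb, rb, rc, rc, rd, ra, rb, rc, rd]
    simpa [h.octagon_labels, h0, ← h04, h05, h05.symm] using hw

/-- The square `p 0`, `p 1`, `p 3`, `p 5`, with the arc `p 0 p 6`, and the pentagon `p 0`, `p 1`,
`p 3`, `p 5`, `p 6`. -/
theorem unit_square (hΓ : IsSurfaceGroup Γ) (h : T.Fan 8 p e s)
    (h5 : s 0 ≠ s 5) (h6 : s 0 ≠ s 6) (h7 : s 0 ≠ s 7) :
    HasUnitSquare Γ n ∧ HasPentagon Γ n := by
  obtain ⟨T1, n1, k1, x1⟩ := exists_exchange hΓ h.convex 0 1 2 3 (by norm_num) (by norm_num)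
    (by norm_num) (by norm_num) h.octagon_chord h.octagon_side h.octagon_side h.octagon_side
    h.octagon_chord (by simp [h.octagon_labels]) (by simp [h.octagon_labels])
    (by simp [h.octagon_labels]) (by simp [h.octagon_labels])
  have E1_01 : T1.edge (s 0) (p 0) (p 1) := k1 _ _ _ h.octagon_side
    (by simp [h.octagon_labels])
  have E1_03 : T1.edge (e 3) (p 0) (p 3) := k1 _ _ _ h.octagon_chord
    (by simp [h.octagon_labels])
  have E1_04 : T1.edge (e 4) (p 0) (p 4) := k1 _ _ _ h.octagon_chord
    (by simp [h.octagon_labels])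
  have E1_05 : T1.edge (e 5) (p 0) (p 5) := k1 _ _ _ h.octagon_chord
    (by simp [h.octagon_labels])
  have E1_06 : T1.edge (e 6) (p 0) (p 6) := k1 _ _ _ h.octagon_chord
    (by simp [h.octagon_labels])
  have E1_07 : T1.edge (s 7) (p 0) (p 7) := k1 _ _ _ h.octagon_side_last
    (by simp [h.octagon_labels])
  have E1_34 : T1.edge (s 3) (p 3) (p 4) := k1 _ _ _ h.octagon_side
    (by simp [h.octagon_labels])
  have E1_45 : T1.edge (s 4) (p 4) (p 5) := k1 _ _ _ h.octagon_side
    (by simp [h.octagon_labels])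
  have E1_56 : T1.edge (s 5) (p 5) (p 6) := k1 _ _ _ h.octagon_side
    (by simp [h.octagon_labels])
  have E1_67 : T1.edge (s 6) (p 6) (p 7) := k1 _ _ _ h.octagon_side
    (by simp [h.octagon_labels])
  obtain ⟨T2, n2, k2, x2⟩ := exists_exchange hΓ h.convex 0 3 4 5 (by norm_num) (by norm_num)
    (by norm_num) (by norm_num) E1_04 E1_03 E1_34 E1_45 E1_05
    (by simp [h.octagon_labels]) (by simp [h.octagon_labels])
    (by simp [h.octagon_labels]) (by simp [h.octagon_labels])
  have E2_01 : T2.edge (s 0) (p 0) (p 1) := k2 _ _ _ E1_01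
    (by simp [h.octagon_labels])
  have E2_03 : T2.edge (e 3) (p 0) (p 3) := k2 _ _ _ E1_03
    (by simp [h.octagon_labels])
  have E2_05 : T2.edge (e 5) (p 0) (p 5) := k2 _ _ _ E1_05
    (by simp [h.octagon_labels])
  have E2_06 : T2.edge (e 6) (p 0) (p 6) := k2 _ _ _ E1_06
    (by simp [h.octagon_labels])
  have E2_07 : T2.edge (s 7) (p 0) (p 7) := k2 _ _ _ E1_07
    (by simp [h.octagon_labels])
  have E2_13 : T2.edge (e 2) (p 1) (p 3) := k2 _ _ _ n1
    (by simp [h.octagon_labels])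
  have E2_56 : T2.edge (s 5) (p 5) (p 6) := k2 _ _ _ E1_56
    (by simp [h.octagon_labels])
  have E2_67 : T2.edge (s 6) (p 6) (p 7) := k2 _ _ _ E1_67
    (by simp [h.octagon_labels])
  obtain ⟨T3, n3, k3, x3⟩ := exists_exchange hΓ h.convex 0 1 3 5 (by norm_num) (by norm_num)
    (by norm_num) (by norm_num) E2_03 E2_01 E2_13 n2 E2_05
    (by simp [h.octagon_labels]) (by simp [h.octagon_labels])
    (by simp [h.octagon_labels]) (by simp [h.octagon_labels])
  have re := sigma_diag_out hΓ h.convex 0 5 6 7 E2_06 E2_05 E2_56 E2_67 E2_07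
  have hx := x3 (by simp [h.octagon_labels])
  have he : e 6 ∉ [s 0, e 2, e 4, e 5, e 3] := by
    simp [h.octagon_labels]
  obtain ⟨o1, o2, o3, o4⟩ := hx.sigma_outer hΓ he
  refine ⟨⟨T3, T2, e 5, s 0, e 2, e 4, e 3, e 6, hx.rotate_twice.rotate, ?_, ?_⟩,
    ⟨T2, s 0, e 2, e 4, s 5, e 6, e 3, e 5, p 0, p 1, p 3, p 5, p 6, ?_,
      h.convex.tri 0 1 3, h.convex.tri 0 3 5, h.convex.tri 0 5 6, E2_01, E2_13, n2, E2_56,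
      edge_symm E2_06, E2_03, E2_05⟩⟩
  · simp [h.octagon_labels]
  · rw [o1, o2, o3, o4, sigma_swap (e 6) (s 0), sigma_swap (e 6) (e 2), sigma_swap (e 6) (e 4),
      sigma_swap (e 6) (e 5), re, re, re, re]
    simp [h.octagon_labels, h5, h6, h7]
  · simp [h.octagon_labels, h5]

/-- The square `p 0`, `p 1`, `p 4`, `p 6`, with the arc `p 1 p 3`, and the pentagon `p 4`, `p 6`,
`p 0`, `p 1`, `p 3`. -/
theorem unit_square' (hΓ : IsSurfaceGroup Γ) (h : T.Fan 8 p e s)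
    (h1 : s 0 ≠ s 1) (h2 : s 0 ≠ s 2) (h3 : s 0 ≠ s 3) :
    HasUnitSquare Γ n ∧ HasPentagon Γ n := by
  obtain ⟨T1, n1, k1, x1⟩ := exists_exchange hΓ h.convex 0 1 2 3 (by norm_num) (by norm_num)
    (by norm_num) (by norm_num) h.octagon_chord h.octagon_side h.octagon_side h.octagon_side
    h.octagon_chord (by simp [h.octagon_labels]) (by simp [h.octagon_labels])
    (by simp [h.octagon_labels]) (by simp [h.octagon_labels])
  have E1_01 : T1.edge (s 0) (p 0) (p 1) := k1 _ _ _ h.octagon_side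
    (by simp [h.octagon_labels])
  have E1_03 : T1.edge (e 3) (p 0) (p 3) := k1 _ _ _ h.octagon_chord
    (by simp [h.octagon_labels])
  have E1_04 : T1.edge (e 4) (p 0) (p 4) := k1 _ _ _ h.octagon_chord
    (by simp [h.octagon_labels])
  have E1_05 : T1.edge (e 5) (p 0) (p 5) := k1 _ _ _ h.octagon_chord
    (by simp [h.octagon_labels])
  have E1_06 : T1.edge (e 6) (p 0) (p 6) := k1 _ _ _ h.octagon_chord
    (by simp [h.octagon_labels])
  have E1_12 : T1.edge (s 1) (p 1) (p 2) := k1 _ _ _ h.octagon_side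
    (by simp [h.octagon_labels])
  have E1_23 : T1.edge (s 2) (p 2) (p 3) := k1 _ _ _ h.octagon_side
    (by simp [h.octagon_labels])
  have E1_34 : T1.edge (s 3) (p 3) (p 4) := k1 _ _ _ h.octagon_side
    (by simp [h.octagon_labels])
  have E1_45 : T1.edge (s 4) (p 4) (p 5) := k1 _ _ _ h.octagon_side
    (by simp [h.octagon_labels])
  have E1_56 : T1.edge (s 5) (p 5) (p 6) := k1 _ _ _ h.octagon_side
    (by simp [h.octagon_labels])
  obtain ⟨T2, n2, k2, x2⟩ := exists_exchange hΓ h.convex 0 1 3 4 (by norm_num) (by norm_num)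
    (by norm_num) (by norm_num) E1_03 E1_01 n1 E1_34 E1_04
    (by simp [h.octagon_labels]) (by simp [h.octagon_labels])
    (by simp [h.octagon_labels]) (by simp [h.octagon_labels])
  have E2_01 : T2.edge (s 0) (p 0) (p 1) := k2 _ _ _ E1_01
    (by simp [h.octagon_labels])
  have E2_04 : T2.edge (e 4) (p 0) (p 4) := k2 _ _ _ E1_04
    (by simp [h.octagon_labels])
  have E2_05 : T2.edge (e 5) (p 0) (p 5) := k2 _ _ _ E1_05
    (by simp [h.octagon_labels])
  have E2_06 : T2.edge (e 6) (p 0) (p 6) := k2 _ _ _ E1_06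
    (by simp [h.octagon_labels])
  have E2_12 : T2.edge (s 1) (p 1) (p 2) := k2 _ _ _ E1_12
    (by simp [h.octagon_labels])
  have E2_13 : T2.edge (e 2) (p 1) (p 3) := k2 _ _ _ n1
    (by simp [h.octagon_labels])
  have E2_23 : T2.edge (s 2) (p 2) (p 3) := k2 _ _ _ E1_23
    (by simp [h.octagon_labels])
  have E2_34 : T2.edge (s 3) (p 3) (p 4) := k2 _ _ _ E1_34
    (by simp [h.octagon_labels])
  have E2_45 : T2.edge (s 4) (p 4) (p 5) := k2 _ _ _ E1_45
    (by simp [h.octagon_labels])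
  have E2_56 : T2.edge (s 5) (p 5) (p 6) := k2 _ _ _ E1_56
    (by simp [h.octagon_labels])
  obtain ⟨T3, n3, k3, x3⟩ := exists_exchange hΓ h.convex 0 4 5 6 (by norm_num) (by norm_num)
    (by norm_num) (by norm_num) E2_05 E2_04 E2_45 E2_56 E2_06
    (by simp [h.octagon_labels]) (by simp [h.octagon_labels])
    (by simp [h.octagon_labels]) (by simp [h.octagon_labels])
  have E3_01 : T3.edge (s 0) (p 0) (p 1) := k3 _ _ _ E2_01
    (by simp [h.octagon_labels])
  have E3_04 : T3.edge (e 4) (p 0) (p 4) := k3 _ _ _ E2_04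
    (by simp [h.octagon_labels])
  have E3_06 : T3.edge (e 6) (p 0) (p 6) := k3 _ _ _ E2_06
    (by simp [h.octagon_labels])
  have E3_12 : T3.edge (s 1) (p 1) (p 2) := k3 _ _ _ E2_12
    (by simp [h.octagon_labels])
  have E3_13 : T3.edge (e 2) (p 1) (p 3) := k3 _ _ _ E2_13
    (by simp [h.octagon_labels])
  have E3_14 : T3.edge (e 3) (p 1) (p 4) := k3 _ _ _ n2
    (by simp [h.octagon_labels])
  have E3_23 : T3.edge (s 2) (p 2) (p 3) := k3 _ _ _ E2_23
    (by simp [h.octagon_labels])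
  have E3_34 : T3.edge (s 3) (p 3) (p 4) := k3 _ _ _ E2_34
    (by simp [h.octagon_labels])
  obtain ⟨T4, n4, k4, x4⟩ := exists_exchange hΓ h.convex 0 1 4 6 (by norm_num) (by norm_num)
    (by norm_num) (by norm_num) E3_04 E3_01 E3_14 n3 E3_06
    (by simp [h.octagon_labels]) (by simp [h.octagon_labels])
    (by simp [h.octagon_labels]) (by simp [h.octagon_labels])
  have re := sigma_diag_out hΓ h.convex 1 2 3 4 E3_13 E3_12 E3_23 E3_34 E3_14
  have hx := x4 (by simp [h.octagon_labels])
  have he : e 2 ∉ [s 0, e 3, e 5, e 6, e 4] := by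
    simp [h.octagon_labels]
  obtain ⟨o1, o2, o3, o4⟩ := hx.sigma_outer hΓ he
  refine ⟨⟨T4, T3, e 3, e 5, e 6, s 0, e 4, e 2, hx.rotate, ?_, ?_⟩,
    ⟨T3, e 5, e 6, s 0, e 2, s 3, e 4, e 3, p 4, p 6, p 0, p 1, p 3, ?_,
      (h.convex.tri 0 4 6).rot, (h.convex.tri 0 1 4).rot', (h.convex.tri 1 3 4).rot', n3,
      edge_symm E3_06, E3_01, E3_13, E3_34, edge_symm E3_04, edge_symm E3_14⟩⟩
  · simp [h.octagon_labels]
  · rw [o1, o2, o3, o4, sigma_swap (e 2) (s 0), sigma_swap (e 2) (e 3), sigma_swap (e 2) (e 5),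
      sigma_swap (e 2) (e 6), re, re, re, re]
    simp [h.octagon_labels, h1, h2, h3]
  · simp [h.octagon_labels, h3]

theorem hasUnitSquare (hΓ : IsSurfaceGroup Γ) (h : T.Fan 8 p e s) :
    HasUnitSquare Γ n ∧ HasPentagon Γ n := by
  rcases h.side_cases hΓ (j := 0) (by norm_num) with h0 | ⟨m, hm, hm0, hs, h0⟩
  · exact h.unit_square hΓ (h0 5 (by norm_num) (by norm_num)) (h0 6 (by norm_num) (by norm_num))
      (h0 7 (by norm_num) (by norm_num))
  · by_cases h4 : m ≤ 4
    · exact h.unit_square hΓ (h0 5 (by norm_num) (by norm_num) (by omega))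
        (h0 6 (by norm_num) (by norm_num) (by omega)) (h0 7 (by norm_num) (by norm_num) (by omega))
    · exact h.unit_square' hΓ (h0 1 (by norm_num) (by norm_num) (by omega))
        (h0 2 (by norm_num) (by norm_num) (by omega)) (h0 3 (by norm_num) (by norm_num) (by omega))

/-- By cases on the side to which `s 0` is glued, and on that of `s 5` if `s 0` is glued to
`s 4`, as the adjacency numbers with the glued sides could cancel. -/
theorem hasSeparatingSquare (hΓ : IsSurfaceGroup Γ) (h : T.Fan 8 p e s) :
    HasSeparatingSquare Γ n := by
  rcases h.side_cases hΓ (j := 0) (by norm_num) with h0 | ⟨m, hm, hm0, hs, h0⟩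
  · refine h.even_square hΓ (s 0) (fun j h1 h2 => by simp [h.octagon_labels, h1, h2]) ?_
    simp [h0, Separating]
  · by_cases h4 : m = 4
    · subst h4
      rcases h.side_cases hΓ (j := 5) (by norm_num) with h5 | ⟨l, hl, hl5, hs', h5⟩
      · refine h.square_four hΓ hs h0 (h5 0 (by norm_num) (by norm_num)) ?_
        simp [h5, Separating]
        omega
      by_cases hl3 : l = 3
      · subst hl3
        refine h.even_square hΓ (s 5) (fun j h1 h2 => by simp [h.octagon_labels, h1, h2]) ?_
        simp [h5, ← hs', Separating]
        omega
      · have hl0 : l ≠ 0 := by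
          rintro rfl
          exact h0 5 (by norm_num) (by norm_num) (by norm_num) hs'.symm
        have hl4 : l ≠ 4 := by
          rintro rfl
          exact h0 5 (by norm_num) (by norm_num) (by norm_num) (hs.trans hs'.symm)
        refine h.square_four hΓ hs h0 (h5 0 (by norm_num) (by norm_num) hl0.symm) ?_
        interval_cases l
        all_goals try omega
        all_goals simp [h5, ← hs', Separating]
        all_goals omega
    · interval_cases m
      · omega
      · exact h.square_one hΓ hs h0
      · refine h.even_square hΓ (s 0) (fun j h1 h2 => by simp [h.octagon_labels, h1, h2]) ?_
        simp [h0, ← hs, Separating]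
      · refine h.even_square hΓ (s 0) (fun j h1 h2 => by simp [h.octagon_labels, h1, h2]) ?_
        simp [h0, ← hs, Separating]
      · omega
      · exact h.odd_square_five hΓ hs h0
      · refine h.even_square hΓ (s 0) (fun j h1 h2 => by simp [h.octagon_labels, h1, h2]) ?_
        simp [h0, ← hs, Separating]
      · refine h.even_square hΓ (s 0) (fun j h1 h2 => by simp [h.octagon_labels, h1, h2]) ?_
        simp [h0, ← hs, Separating]

end Fan

end IdealTriangulation
end QuantumTeichmuller

namespace QuantumTeichmuller
variable {Γ : Subgroup (GL (Fin 2) ℝ)} {n : ℕ}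

namespace IdealTriangulation
variable {T T' : IdealTriangulation Γ n}

/-! ### The discrepancy span of a diagonal exchange -/

theorem Convex.ccw_iff {p : ℕ → OnePoint ℝ} {N : ℕ} (hp : Convex p N) {j k l : ℕ} (hj : j < N)
    (hk : k < N) (hl : l < N) : Ccw (p j) (p k) (p l) ↔
      (j < k ∧ k < l) ∨ (k < l ∧ l < j) ∨ (l < j ∧ j < k) := by
  have key : ∀ {j k l}, j < N → k < N → l < N → j < k → Ccw (p j) (p k) (p l) →
      k < l ∨ l < j := by
    intro j k l hj hk hl hjk h
    rcases lt_trichotomy k l with h1 | rfl | h1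
    · exact Or.inl h1
    · exact absurd rfl h.ne₂₃
    rcases lt_trichotomy l j with h2 | rfl | h2
    · exact Or.inr h2
    · exact absurd rfl h.ne₁₃
    · exact absurd (hp j l k h2 h1 hk).rot' h.asymm
  constructor
  · intro h
    rcases lt_trichotomy j k with h1 | rfl | h1
    · rcases key hj hk hl h1 h with h2 | h2
      · exact Or.inl ⟨h1, h2⟩
      · exact Or.inr (Or.inr ⟨h2, h1⟩)
    · exact absurd rfl h.ne₁₂
    · rcases lt_trichotomy k l with h2 | rfl | h2
      · rcases key hk hl hj h2 h.rot with h3 | h3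
        · exact Or.inr (Or.inl ⟨h2, h3⟩)
        · omega
      · exact absurd rfl h.ne₂₃
      · exact absurd (hp l k j h2 h1 hj).rot h.asymm
  · rintro (⟨h1, h2⟩ | ⟨h1, h2⟩ | ⟨h1, h2⟩)
    · exact hp _ _ _ h1 h2 hl
    · exact (hp _ _ _ h1 h2 hj).rot'
    · exact (hp _ _ _ h1 h2 hk).rot

/-- The vertices of a square, numbered in counterclockwise order. -/
def squareVertex (x w y z : OnePoint ℝ) (k : ℕ) : OnePoint ℝ :=
  match k with
  | 0 => x
  | 1 => w
  | 2 => y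
  | _ => z

namespace Square
variable {a b c d i : Fin n} {x w y z : OnePoint ℝ}

theorem convex (h : T.Square a b c d i x w y z) : Convex (squareVertex x w y z) 4 := by
  intro j k l h1 h2 h3
  interval_cases l
  · omega
  · omega
  · obtain rfl : k = 1 := by omega
    obtain rfl : j = 0 := by omega
    exact h.ccw₂.rot
  · interval_cases k
    · omega
    · obtain rfl : j = 0 := by omega
      exact h.ccw₄
    · interval_cases j
      · exact h.ccw₁
      · exact h.ccw₃

theorem smul (hΓ : IsSurfaceGroup Γ) (h : T.Square a b c d i x w y z) {g : GL (Fin 2) ℝ}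
    (hg : g ∈ Γ) : T.Square a b c d i (g • x) (g • w) (g • y) (g • z) :=
  ⟨h.ccw₁.smul (hΓ.det_eq_one g hg), h.ccw₂.smul (hΓ.det_eq_one g hg), edge_smul h.diag hg,
    edge_smul h.side_a hg, edge_smul h.side_b hg, edge_smul h.side_c hg, edge_smul h.side_d hg,
    h.ne_a, h.ne_b, h.ne_c, h.ne_d⟩

end Square

namespace EmbeddedExchange
variable {a b c d i : Fin n} {x w y z : OnePoint ℝ}

/-- The triangle across the side `b` of the square is not affected by the diagonal exchange. -/
theorem outer_face' (hΓ : IsSurfaceGroup Γ) (h : T.EmbeddedExchange T' a b c d i)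
    (hq : T.Square a b c d i x w y z) {t : OnePoint ℝ}
    (ht : T.IsFace y w t) {l m : Fin n} (hl : T.edge l w t) (hm : T.edge m t y) :
    l ≠ i ∧ m ≠ i := by
  have hd := h.distinct
  simp only [List.nodup_cons, List.mem_cons, List.not_mem_nil, or_false, not_or,
      List.nodup_nil, and_true, not_false_eq_true] at hd
  have hlab : ∀ {g : GL (Fin 2) ℝ} {u v u' v' : OnePoint ℝ} {k : Fin n}, g ∈ Γ → T.edge k u v →
      T.edge b u' v' → u' = g • u → v' = g • v → b = k := by
    rintro g u v u' v' k hg hk ha rfl rfl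
    exact T.edge_inj _ _ _ _ ha (edge_smul hk hg)
  have hb := edge_symm hq.side_b
  constructor
  · rintro rfl
    obtain ⟨g, hg, ⟨e1, e2, e3⟩ | ⟨e1, e2, e3⟩⟩ := hq.face_cases hΓ ht.rot hl
    · have := hlab hg (edge_symm hq.side_d) hq.side_b e1 e3; tauto
    · exact not_swap_edge hΓ hq.side_b hg e3.symm e1.symm
  · rintro rfl
    obtain ⟨g, hg, ⟨e1, e2, e3⟩ | ⟨e1, e2, e3⟩⟩ := hq.face_cases hΓ ht.rot' hm
    · have := hlab hg (edge_symm hq.side_c) hq.side_b e3 e2; tauto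
    · have := hlab hg (edge_symm hq.side_a) hq.side_b e3 e2; tauto

theorem not_common (h : T.EmbeddedExchange T' a b c d i) {x y : OnePoint ℝ}
    (hi : T.edge i x y) (j : Fin n) : ¬ T'.edge j x y := by
  intro hj
  by_cases hji : j = i
  · subst hji
    obtain ⟨x, w, y, z, hq, hn⟩ := h.exists_square
    rw [edge_eq_of_common hj hi] at hn
    exact hq.not_edge _ hn
  · rw [h.others j hji] at hj
    exact hji (T.edge_inj _ _ _ _ hj hi)

/-- The triangles that are removed by a diagonal exchange are those that have the diagonal
as a side. -/
theorem inSpan_iff (h : T.EmbeddedExchange T' a b c d i) {x y z : OnePoint ℝ} :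
    InSpan T T' x y z ↔ T.IsFace x y z ∧ (T.edge i x y ∨ T.edge i y z ∨ T.edge i z x) := by
  refine and_congr_right fun hf => ⟨fun hn => ?_, ?_⟩
  · by_contra! hc
    refine hn ⟨hf.1, ?_, ?_, ?_⟩
    · obtain ⟨k, hk⟩ := hf.2.1
      have : k ≠ i := fun e => hc.1 (e ▸ hk)
      exact ⟨k, by rw [h.others k this]; exact hk⟩
    · obtain ⟨k, hk⟩ := hf.2.2.1
      have : k ≠ i := fun e => hc.2.1 (e ▸ hk)
      exact ⟨k, by rw [h.others k this]; exact hk⟩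
    · obtain ⟨k, hk⟩ := hf.2.2.2
      have : k ≠ i := fun e => hc.2.2 (e ▸ hk)
      exact ⟨k, by rw [h.others k this]; exact hk⟩
  · rintro (hi | hi | hi) ⟨-, ⟨j, hj⟩, ⟨k, hk⟩, l, hl⟩
    · exact h.not_common hi j hj
    · exact h.not_common hi k hk
    · exact h.not_common hi l hl

/-- The six ways to go around one of the two triangles of a square. -/
inductive SquareFace (x w y z : OnePoint ℝ) : OnePoint ℝ → OnePoint ℝ → OnePoint ℝ → Prop
  | xyz : SquareFace x w y z x y z
  | yzx : SquareFace x w y z y z x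
  | zxy : SquareFace x w y z z x y
  | yxw : SquareFace x w y z y x w
  | xwy : SquareFace x w y z x w y
  | wyx : SquareFace x w y z w y x

theorem SquareFace.rot {x w y z u v t : OnePoint ℝ} (h : SquareFace x w y z u v t) :
    SquareFace x w y z v t u := by
  cases h <;> constructor

theorem squareFace_of_inSpan (hΓ : IsSurfaceGroup Γ) (h : T.EmbeddedExchange T' a b c d i)
    (hq : T.Square a b c d i x w y z) {u v t : OnePoint ℝ} (hs : InSpan T T' u v t) :
    ∃ g ∈ Γ, SquareFace (g • x) (g • w) (g • y) (g • z) u v t := by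
  obtain ⟨hf, hi | hi | hi⟩ := h.inSpan_iff.1 hs
  · obtain ⟨g, hg, ⟨rfl, rfl, rfl⟩ | ⟨rfl, rfl, rfl⟩⟩ := hq.face_cases hΓ hf hi
    · exact ⟨g, hg, .xyz⟩
    · exact ⟨g, hg, .yxw⟩
  · obtain ⟨g, hg, ⟨rfl, rfl, rfl⟩ | ⟨rfl, rfl, rfl⟩⟩ := hq.face_cases hΓ hf.rot hi
    · exact ⟨g, hg, .zxy⟩
    · exact ⟨g, hg, .wyx⟩
  · obtain ⟨g, hg, ⟨rfl, rfl, rfl⟩ | ⟨rfl, rfl, rfl⟩⟩ := hq.face_cases hΓ hf.rot' hi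
    · exact ⟨g, hg, .yzx⟩
    · exact ⟨g, hg, .xwy⟩

theorem inSpan_of_squareFace (h : T.EmbeddedExchange T' a b c d i)
    (hq : T.Square a b c d i x w y z) {u v t : OnePoint ℝ} (hs : SquareFace x w y z u v t) :
    InSpan T T' u v t := by
  rw [h.inSpan_iff]
  cases hs
  · exact ⟨hq.face₁, Or.inl hq.diag⟩
  · exact ⟨hq.face₁.rot, Or.inr (Or.inr hq.diag)⟩
  · exact ⟨hq.face₁.rot', Or.inr (Or.inl hq.diag)⟩
  · exact ⟨hq.face₂.rot', Or.inl (edge_symm hq.diag)⟩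
  · exact ⟨hq.face₂, Or.inr (Or.inr (edge_symm hq.diag))⟩
  · exact ⟨hq.face₂.rot, Or.inr (Or.inl (edge_symm hq.diag))⟩

/-- An arc is contained in the span of a diagonal exchange if and only if it is one of the five
arcs of the square. -/
theorem edgeInSpan_iff (hΓ : IsSurfaceGroup Γ) (h : T.EmbeddedExchange T' a b c d i)
    (j : Fin n) : EdgeInSpan T T' j ↔ j ∈ [a, b, c, d, i] := by
  obtain ⟨x, w, y, z, hq, -⟩ := h.exists_square
  simp only [List.mem_cons, List.not_mem_nil, or_false]
  constructor
  · rintro ⟨u, v, t, hs, hj⟩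
    obtain ⟨g, hg, hf⟩ := h.squareFace_of_inSpan hΓ hq hs
    have hq' := hq.smul hΓ hg
    cases hf
    · have := T.edge_inj _ _ _ _ hj hq'.diag; tauto
    · have := T.edge_inj _ _ _ _ hj hq'.side_c; tauto
    · have := T.edge_inj _ _ _ _ hj hq'.side_d; tauto
    · have := T.edge_inj _ _ _ _ hj (edge_symm hq'.diag); tauto
    · have := T.edge_inj _ _ _ _ hj hq'.side_a; tauto
    · have := T.edge_inj _ _ _ _ hj hq'.side_b; tauto
  · have A : ∀ {u v t}, SquareFace x w y z u v t → T.edge j u v → EdgeInSpan T T' j :=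
      fun hf hj => ⟨_, _, _, h.inSpan_of_squareFace hq hf, hj⟩
    rintro (rfl | rfl | rfl | rfl | rfl)
    · exact A .xwy hq.side_a
    · exact A .wyx hq.side_b
    · exact A .yzx hq.side_c
    · exact A .zxy hq.side_d
    · exact A .xyz hq.diag

/-- The span of a diagonal exchange lifts to single squares. -/
theorem spanVertices_eq (hΓ : IsSurfaceGroup Γ) (h : T.EmbeddedExchange T' a b c d i)
    (hq : T.Square a b c d i x w y z) {u v t : OnePoint ℝ} (hf : SquareFace x w y z u v t) :
    spanVertices T T' u v t = squareVertex x w y z '' Set.Iio 4 := by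
  have hin : ∀ {u v t}, SquareFace x w y z u v t → InSpan T T' u v t :=
    fun hf => h.inSpan_of_squareFace hq hf
  have key : ∀ {u' v' t'}, SpanReach T T' u v t u' v' t' → SquareFace x w y z u' v' t' := by
    intro u' v' t' hr
    induction hr with
    | base => exact hf
    | rotate _ ih => exact ih.rot
    | @cross u' v' t' s' _ hs ih =>
      have hs' := h.inSpan_iff.1 hs
      have hh := h.rotate_twice
      cases ih
      · obtain rfl := hs'.1.apex_unique hq.face₂.rot'
        exact .yxw
      · -- across the side `c`
        obtain ⟨hf', hi⟩ := hs'
        obtain ⟨l, hl⟩ := hf'.2.2.1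
        obtain ⟨m, hm⟩ := hf'.2.2.2
        have ho := hh.outer_face hΓ hq.symm hf' hl (edge_symm hm)
        rcases hi with hi | hi | hi
        · exact absurd (T.edge_inj _ _ _ _ (edge_symm hi) hq.side_c) hq.ne_c.symm
        · exact absurd (T.edge_inj _ _ _ _ hl hi) ho.1
        · exact absurd (T.edge_inj _ _ _ _ hm hi) ho.2
      · obtain ⟨hf', hi⟩ := hs'
        obtain ⟨l, hl⟩ := hf'.2.2.1
        obtain ⟨m, hm⟩ := hf'.2.2.2
        have ho := hh.outer_face' hΓ hq.symm hf' hl hm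
        rcases hi with hi | hi | hi
        · exact absurd (T.edge_inj _ _ _ _ (edge_symm hi) hq.side_d) hq.ne_d.symm
        · exact absurd (T.edge_inj _ _ _ _ hl hi) ho.1
        · exact absurd (T.edge_inj _ _ _ _ hm hi) ho.2
      · obtain rfl := hs'.1.apex_unique hq.face₁
        exact .xyz
      · obtain ⟨hf', hi⟩ := hs'
        obtain ⟨l, hl⟩ := hf'.2.2.1
        obtain ⟨m, hm⟩ := hf'.2.2.2
        have ho := h.outer_face hΓ hq hf' hl (edge_symm hm)
        rcases hi with hi | hi | hi
        · exact absurd (T.edge_inj _ _ _ _ (edge_symm hi) hq.side_a) hq.ne_a.symm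
        · exact absurd (T.edge_inj _ _ _ _ hl hi) ho.1
        · exact absurd (T.edge_inj _ _ _ _ hm hi) ho.2
      · obtain ⟨hf', hi⟩ := hs'
        obtain ⟨l, hl⟩ := hf'.2.2.1
        obtain ⟨m, hm⟩ := hf'.2.2.2
        have ho := h.outer_face' hΓ hq hf' hl hm
        rcases hi with hi | hi | hi
        · exact absurd (T.edge_inj _ _ _ _ (edge_symm hi) hq.side_b) hq.ne_b.symm
        · exact absurd (T.edge_inj _ _ _ _ hl hi) ho.1
        · exact absurd (T.edge_inj _ _ _ _ hm hi) ho.2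
  have hr : ∀ {u' v' t'}, SpanReach T T' u v t u' v' t' → SpanReach T T' u v t v' t' u' ∧
      SpanReach T T' u v t t' u' v' := fun h => ⟨h.rotate, h.rotate.rotate⟩
  have h1 : SpanReach T T' u v t x y z := by
    have h₁ : SpanReach T T' u v t y x w → SpanReach T T' u v t x y z := fun hr =>
      hr.cross (hin .xyz)
    have h₀ := SpanReach.base (T := T) (T' := T') (x := u) (y := v) (z := t)
    have h₂ := hr h₀
    cases hf
    · exact h₀
    · exact h₂.2
    · exact h₂.1
    · exact h₁ h₀
    · exact h₁ h₂.2
    · exact h₁ h₂.1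
  have h2 : SpanReach T T' u v t y x w := h1.cross (hin .yxw)
  ext r
  constructor
  · rintro ⟨v', t', hr'⟩
    cases key hr'
    · exact ⟨0, by simp, rfl⟩
    · exact ⟨2, by simp, rfl⟩
    · exact ⟨3, by simp, rfl⟩
    · exact ⟨2, by simp, rfl⟩
    · exact ⟨0, by simp, rfl⟩
    · exact ⟨1, by simp, rfl⟩
  · rintro ⟨k, hk, rfl⟩
    rw [Set.mem_Iio] at hk
    interval_cases k
    · exact ⟨_, _, h1⟩
    · exact ⟨_, _, (hr h2).2⟩
    · exact ⟨_, _, h2⟩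
    · exact ⟨_, _, (hr h1).2⟩

/-- The label of the geodesic between two vertices of a square, as a position in the list
`a, b, c, d, i`; `δ` is the position of the end points of the diagonal. -/
def squareLabel (δ : ℕ) (k l : ℕ) : ℕ :=
  if k + 1 = l then k else if l + 1 = k then l else if (k = 0 ∧ l = 3) ∨ (k = 3 ∧ l = 0) then 3
  else if (k = δ ∧ l = δ + 2) ∨ (k = δ + 2 ∧ l = δ) then 4 else 5

theorem edge_squareVertex_iff (_ : T.EmbeddedExchange T' a b c d i)
    (hq : T.Square a b c d i x w y z) (ha : (a : ℕ) = 0) (hb : (b : ℕ) = 1) (hc : (c : ℕ) = 2)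
    (hd : (d : ℕ) = 3) (hi : (i : ℕ) = 4) {j : Fin n} (hj : (j : ℕ) < 5) {k l : ℕ}
    (hk : k < 4) (hl : l < 4) :
    T.edge j (squareVertex x w y z k) (squareVertex x w y z l) ↔ (j : ℕ) = squareLabel 0 k l := by
  have A : ∀ {m : Fin n} {r : ℕ} {u v : OnePoint ℝ}, T.edge m u v → (m : ℕ) = r →
      (T.edge j u v ↔ (j : ℕ) = r) := by
    rintro m r u v hm rfl
    rw [edge_iff_of_edge hm, Fin.ext_iff]
  have B : ∀ {u v : OnePoint ℝ}, (∀ m, ¬ T.edge m u v) → (T.edge j u v ↔ (j : ℕ) = 5) :=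
    fun hm => iff_of_false (hm j) (by omega)
  have C : ∀ {u : OnePoint ℝ}, (T.edge j u u ↔ (j : ℕ) = 5) :=
    B fun m hm => edge_ne hm rfl
  interval_cases k <;> interval_cases l
  · exact C
  · exact A hq.side_a ha
  · exact A hq.diag hi
  · exact A (edge_symm hq.side_d) hd
  · exact A (edge_symm hq.side_a) ha
  · exact C
  · exact A hq.side_b hb
  · exact B hq.not_edge
  · exact A (edge_symm hq.diag) hi
  · exact A (edge_symm hq.side_b) hb
  · exact C
  · exact A hq.side_c hc
  · exact A hq.side_d hd
  · exact B fun m hm => hq.not_edge m (edge_symm hm)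
  · exact A (edge_symm hq.side_c) hc
  · exact C

theorem edge_squareVertex_iff' (h : T.EmbeddedExchange T' a b c d i)
    (hq : T.Square a b c d i x w y z) (hn : T'.edge i w z) (ha : (a : ℕ) = 0) (hb : (b : ℕ) = 1)
    (hc : (c : ℕ) = 2) (hd : (d : ℕ) = 3) (hi : (i : ℕ) = 4) {j : Fin n} (hj : (j : ℕ) < 5)
    {k l : ℕ} (hk : k < 4) (hl : l < 4) :
    T'.edge j (squareVertex x w y z k) (squareVertex x w y z l) ↔
      (j : ℕ) = squareLabel 1 k l := by
  have A : ∀ {m : Fin n} {r : ℕ} {u v : OnePoint ℝ}, T'.edge m u v → (m : ℕ) = r →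
      (T'.edge j u v ↔ (j : ℕ) = r) := by
    rintro m r u v hm rfl
    rw [edge_iff_of_edge hm, Fin.ext_iff]
  have B : ∀ {u v : OnePoint ℝ}, (∀ m, ¬ T'.edge m u v) → (T'.edge j u v ↔ (j : ℕ) = 5) :=
    fun hm => iff_of_false (hm j) (by omega)
  have C : ∀ {u : OnePoint ℝ}, (T'.edge j u u ↔ (j : ℕ) = 5) :=
    B fun m hm => edge_ne hm rfl
  have S : ∀ {m : Fin n} {u v : OnePoint ℝ}, m ≠ i → T.edge m u v → T'.edge m u v :=
    fun hm he => by rw [h.others _ hm]; exact he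
  have s_a := S hq.ne_a hq.side_a
  have s_b := S hq.ne_b hq.side_b
  have s_c := S hq.ne_c hq.side_c
  have s_d := S hq.ne_d hq.side_d
  interval_cases k <;> interval_cases l
  · exact C
  · exact A s_a ha
  · exact B (h.not_common hq.diag)
  · exact A (edge_symm s_d) hd
  · exact A (edge_symm s_a) ha
  · exact C
  · exact A s_b hb
  · exact A hn hi
  · exact B (h.not_common (edge_symm hq.diag))
  · exact A (edge_symm s_b) hb
  · exact C
  · exact A s_c hc
  · exact A s_d hd
  · exact A (edge_symm hn) hi
  · exact A (edge_symm s_c) hc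
  · exact C

/-- No deck transformation other than the identity preserves a lift of the square. -/
theorem eq_one_of_mapsTo (hΓ : IsSurfaceGroup Γ) (h : T.EmbeddedExchange T' a b c d i)
    (hq : T.Square a b c d i x w y z) (ha : (a : ℕ) = 0) (hb : (b : ℕ) = 1) (hc : (c : ℕ) = 2)
    (hd : (d : ℕ) = 3) (hi : (i : ℕ) = 4) {g : GL (Fin 2) ℝ} (hg : g ∈ Γ)
    (hs : ∀ r ∈ squareVertex x w y z '' Set.Iio 4, g • r ∈ squareVertex x w y z '' Set.Iio 4) :
    g = 1 := by
  obtain ⟨k, hk, e1⟩ := hs x ⟨0, by simp, rfl⟩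
  obtain ⟨l, hl, e2⟩ := hs w ⟨1, by simp, rfl⟩
  rw [Set.mem_Iio] at hk hl
  have he := edge_smul hq.side_a hg
  rw [← e1, ← e2, h.edge_squareVertex_iff hq ha hb hc hd hi (by omega) hk hl, ha] at he
  have hkl : (k = 0 ∧ l = 1) ∨ (k = 1 ∧ l = 0) := by
    unfold squareLabel at he
    split_ifs at he <;> omega
  rcases hkl with ⟨rfl, rfl⟩ | ⟨rfl, rfl⟩
  · exact eq_one_of_fix_edge hΓ hq.side_a hg e1.symm e2.symm
  · exact (not_swap_edge hΓ hq.side_a hg e1.symm e2.symm).elim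

theorem spanIndexed (hΓ : IsSurfaceGroup Γ) (h : T.EmbeddedExchange T' a b c d i)
    (ha : (a : ℕ) = 0) (hb : (b : ℕ) = 1) (hc : (c : ℕ) = 2)
    (hd : (d : ℕ) = 3) (hi : (i : ℕ) = 4) : SpanIndexed 5 T T' := by
  refine ⟨by have := i.2; omega, fun j => ?_, fun j hj => h.others j ?_⟩
  · rw [h.edgeInSpan_iff hΓ]
    simp only [List.mem_cons, List.not_mem_nil, or_false, Fin.ext_iff, ha, hb, hc, hd, hi]
    omega
  · rintro rfl
    omega

/-- Any two diagonal exchanges that are indexed in the same way have diffeomorphic spans. -/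
theorem spanDiffeo (hΓ : IsSurfaceGroup Γ) (h : T.EmbeddedExchange T' a b c d i)
    {U U' : IdealTriangulation Γ n} (h' : U.EmbeddedExchange U' a b c d i)
    (ha : (a : ℕ) = 0) (hb : (b : ℕ) = 1) (hc : (c : ℕ) = 2)
    (hd : (d : ℕ) = 3) (hi : (i : ℕ) = 4) : SpanDiffeo 5 T T' U U' := by
  obtain ⟨x₀, w₀, y₀, z₀, hq₀, hn₀⟩ := h.exists_square
  obtain ⟨x', w', y', z', hq', hn'⟩ := h'.exists_square
  intro u v t hs
  obtain ⟨g, hg, hf⟩ := h.squareFace_of_inSpan hΓ hq₀ hs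
  have hq := hq₀.smul hΓ hg
  have hn := edge_smul hn₀ hg
  set x := g • x₀
  set w := g • w₀
  set y := g • y₀
  set z := g • z₀
  set V := squareVertex x w y z
  set V' := squareVertex x' w' y' z'
  have hV : Set.InjOn V (Set.Iio 4) := by
    intro k hk l hl e
    rw [Set.mem_Iio] at hk hl
    have key : ∀ k l, k < l → l < 4 → V k ≠ V l := fun k l h1 h2 => by
      rcases Nat.eq_zero_or_pos k with rfl | h3
      · interval_cases l
        · exact edge_ne hq.side_a
        · exact edge_ne hq.diag
        · exact (edge_ne hq.side_d).symm
      · exact (hq.convex 0 k l h3 h1 h2).ne₂₃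
    rcases lt_trichotomy k l with h1 | h1 | h1
    · exact absurd e (key k l h1 hl)
    · exact h1
    · exact absurd e.symm (key l k h1 hk)
  have hV' : Set.InjOn V' (Set.Iio 4) := by
    intro k hk l hl e
    rw [Set.mem_Iio] at hk hl
    have key : ∀ k l, k < l → l < 4 → V' k ≠ V' l := fun k l h1 h2 => by
      rcases Nat.eq_zero_or_pos k with rfl | h3
      · interval_cases l
        · exact edge_ne hq'.side_a
        · exact edge_ne hq'.diag
        · exact (edge_ne hq'.side_d).symm
      · exact (hq'.convex 0 k l h3 h1 h2).ne₂₃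
    rcases lt_trichotomy k l with h1 | h1 | h1
    · exact absurd e (key k l h1 hl)
    · exact h1
    · exact absurd e.symm (key l k h1 hk)
  have hφ : ∀ k < 4, V' (Function.invFunOn V (Set.Iio 4) (V k)) = V' k := fun k hk => by
    rw [hV.leftInvOn_invFunOn (Set.mem_Iio.2 hk)]
  refine ⟨fun r => V' (Function.invFunOn V (Set.Iio 4) r), x', y', z', ?_, ?_, ?_, ?_, ?_, ?_⟩
  · exact h'.inSpan_of_squareFace hq' .xyz
  all_goals rw [h.spanVertices_eq hΓ hq hf]
  · rw [h'.spanVertices_eq hΓ hq' .xyz]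
    refine ⟨?_, ?_, ?_⟩
    · rintro _ ⟨k, hk, rfl⟩
      exact ⟨k, hk, (hφ k hk).symm⟩
    · rintro _ ⟨k, hk, rfl⟩ _ ⟨l, hl, rfl⟩ e
      simp only at e
      rw [hφ k hk, hφ l hl] at e
      rw [hV' hk hl e]
    · rintro _ ⟨k, hk, rfl⟩
      exact ⟨V k, ⟨k, hk, rfl⟩, hφ k hk⟩
  · rintro _ ⟨k, hk, rfl⟩ _ ⟨l, hl, rfl⟩ _ ⟨m, hm, rfl⟩ hccw
    simp only
    rw [hφ k hk, hφ l hl, hφ m hm]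
    exact (hq'.convex.ccw_iff hk hl hm).2 ((hq.convex.ccw_iff hk hl hm).1 hccw)
  · rintro j hj _ ⟨k, hk, rfl⟩ _ ⟨l, hl, rfl⟩
    simp only
    rw [hφ k hk, hφ l hl, h.edge_squareVertex_iff hq ha hb hc hd hi hj hk hl,
      h'.edge_squareVertex_iff hq' ha hb hc hd hi hj hk hl,
      h.edge_squareVertex_iff' hq hn ha hb hc hd hi hj hk hl,
      h'.edge_squareVertex_iff' hq' hn' ha hb hc hd hi hj hk hl]
    exact ⟨Iff.rfl, Iff.rfl⟩
  · intro γ hγ hm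
    have := h.eq_one_of_mapsTo hΓ hq ha hb hc hd hi hγ hm
    exact ⟨1, one_mem _, fun r _ => by rw [this, one_smul, one_smul]⟩
  · intro δ hδ hm
    rw [h'.spanVertices_eq hΓ hq' .xyz] at hm
    have := h'.eq_one_of_mapsTo hΓ hq' ha hb hc hd hi hδ hm
    exact ⟨1, one_mem _, fun r hr => by rw [this, one_smul, one_smul]; exact ⟨hr, rfl⟩⟩

end EmbeddedExchange
end IdealTriangulation
end QuantumTeichmuller

namespace QuantumTeichmuller

/-! ### Monomials of Chekhov–Fock algebras -/

section monomials
variable {n k : ℕ} {σ : Fin n → Fin n → ℤ}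

theorem mono_zero (v : Fin n → ℤ) : mono σ v 0 = 0 := by simp [mono]

theorem twist_eq_zero_of_forall {u v : Fin n → ℤ} (h : ∀ i j, j < i → u i = 0 ∨ v j = 0) :
    twist σ u v = 0 := by
  unfold twist
  rw [Finset.sum_eq_zero, mul_zero]
  refine fun i _ => Finset.sum_eq_zero fun j _ => ?_
  split_ifs with hij
  · rcases h i j hij with h | h <;> rw [h] <;> ring
  · rfl

theorem twist_sub_twist (hσ : ∀ i j, σ j i = -σ i j) (u v : Fin n → ℤ) :
    twist σ u v - twist σ v u = 2 * ∑ i, ∑ j, σ i j * u i * v j := by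
  have h1 : twist σ v u = 2 * ∑ i, ∑ j, if i < j then σ j i * v j * u i else 0 := by
    unfold twist; rw [Finset.sum_comm]
  rw [h1]
  unfold twist
  rw [← mul_sub, ← Finset.sum_sub_distrib]
  congr 1
  refine Finset.sum_congr rfl fun i _ => ?_
  rw [← Finset.sum_sub_distrib]
  refine Finset.sum_congr rfl fun j _ => ?_
  rcases lt_trichotomy i j with h | h | h
  · rw [if_neg h.asymm, if_pos h, hσ i j]; ring
  · subst h
    have : σ i i = 0 := by have := hσ i i; omega
    simp [this]
  · rw [if_pos h, if_neg h.asymm]; ring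

theorem mono_mul_comm (hσ : ∀ i j, σ j i = -σ i j) (u v : Fin n → ℤ) (c d : Cq) :
    mono σ u c * mono σ v d
      = q ^ (2 * ∑ i, ∑ j, σ i j * u i * v j) • (mono σ v d * mono σ u c) := by
  rw [mono_mul_mono, mono_mul_mono, smul_mono, ← twist_sub_twist hσ, add_comm v u,
    zpow_sub₀ q_ne_zero]
  congr 1
  field_simp [zpow_ne_zero, q_ne_zero]

theorem mono_single_mul_comm (hσ : ∀ i j, σ j i = -σ i j) (i : Fin n) (v : Fin n → ℤ) (d : Cq) :
    mono σ (Pi.single i 1) 1 * mono σ v d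
      = q ^ (2 * ∑ j, σ i j * v j) • (mono σ v d * mono σ (Pi.single i 1) 1) := by
  rw [mono_mul_comm hσ]
  congr 3
  rw [Finset.sum_eq_single i]
  · simp
  · intro b _ hb
    simp [Pi.single_eq_of_ne hb]
  · simp

/-! ### Gradings -/

/-- The linear map that multiplies the coefficient of each monomial by a weight. -/
def weight (σ : Fin n → Fin n → ℤ) (φ : (Fin n → ℤ) → Cq) : CFAlgebra σ →ₗ[Cq] CFAlgebra σ :=
  (Finsupp.linearCombination Cq fun v => mono σ v (φ v)) ∘ₗ (toLaurent σ).toLinearMap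

theorem weight_mono (φ : (Fin n → ℤ) → Cq) (v : Fin n → ℤ) (c : Cq) :
    weight σ φ (mono σ v c) = mono σ v (φ v * c) := by
  have h : weight σ φ (mono σ v c) = c • mono σ v (φ v) := by simp [weight, mono]
  rw [h, smul_mono, mul_comm]

theorem coeff_weight (φ : (Fin n → ℤ) → Cq) (f : CFAlgebra σ) (v : Fin n → ℤ) :
    coeff σ v (weight σ φ f) = φ v * coeff σ v f := by
  induction f using cf_induction with
  | h0 => simp
  | hadd f g hf hg => rw [map_add, map_add, hf, hg, map_add, mul_add]
  | hm u c =>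
    rw [weight_mono, coeff_mono, coeff_mono]
    split_ifs with h
    · rw [h]
    · simp

/-- The homogeneous component of degree `d` for the grading by the linear form `l` on exponents. -/
def comp (σ : Fin n → Fin n → ℤ) (l : (Fin n → ℤ) →+ ℤ) (d : ℤ) :
    CFAlgebra σ →ₗ[Cq] CFAlgebra σ :=
  weight σ fun v => if l v = d then 1 else 0

theorem coeff_comp (l : (Fin n → ℤ) →+ ℤ) (d : ℤ) (f : CFAlgebra σ) (v : Fin n → ℤ) :
    coeff σ v (comp σ l d f) = if l v = d then coeff σ v f else 0 := by
  rw [comp, coeff_weight]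
  split_ifs <;> simp

theorem comp_mono (l : (Fin n → ℤ) →+ ℤ) (d : ℤ) (v : Fin n → ℤ) (c : Cq) :
    comp σ l d (mono σ v c) = if l v = d then mono σ v c else 0 := by
  rw [comp, weight_mono]
  split_ifs <;> simp [mono_zero]

theorem mem_supp_comp {l : (Fin n → ℤ) →+ ℤ} {d : ℤ} {f : CFAlgebra σ} {v : Fin n → ℤ} :
    v ∈ supp σ (comp σ l d f) ↔ v ∈ supp σ f ∧ l v = d := by
  rw [mem_supp, mem_supp, coeff_comp]
  split_ifs with h <;> simp [h]

theorem comp_eq_zero {l : (Fin n → ℤ) →+ ℤ} {d : ℤ} {f : CFAlgebra σ}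
    (h : ∀ v ∈ supp σ f, l v ≠ d) : comp σ l d f = 0 := by
  by_contra hne
  obtain ⟨v, hv⟩ := supp_nonempty σ hne
  rw [mem_supp_comp] at hv
  exact h v hv.1 hv.2

theorem sum_comp (l : (Fin n → ℤ) →+ ℤ) (f : CFAlgebra σ) {s : Finset ℤ}
    (hs : ∀ v ∈ supp σ f, l v ∈ s) : ∑ d ∈ s, comp σ l d f = f := by
  refine cf_ext σ fun v => ?_
  rw [map_sum]
  simp only [coeff_comp]
  by_cases hv : v ∈ supp σ f
  · rw [Finset.sum_ite_eq, if_pos (hs v hv)]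
  · have : coeff σ v f = 0 := by by_contra hne; exact hv ((mem_supp σ).2 hne)
    simp [this]

theorem exists_comp_ne_zero (l : (Fin n → ℤ) →+ ℤ) {f : CFAlgebra σ} (hf : f ≠ 0) :
    ∃ d, comp σ l d f ≠ 0 := by
  obtain ⟨v, hv⟩ := supp_nonempty σ hf
  refine ⟨l v, fun h => ?_⟩
  have : v ∈ supp σ (comp σ l (l v) f) := mem_supp_comp.2 ⟨hv, rfl⟩
  rw [h, mem_supp] at this
  simp at this

/-- The leading component of a product. -/
theorem comp_mul_of_le (l : (Fin n → ℤ) →+ ℤ) {a b : ℤ} {f g : CFAlgebra σ}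
    (hf : ∀ v ∈ supp σ f, a ≤ l v) (hg : ∀ v ∈ supp σ g, b ≤ l v) :
    comp σ l (a + b) (f * g) = comp σ l a f * comp σ l b g := by
  conv_lhs => rw [sum_mono σ f, sum_mono σ g]
  conv_rhs => rw [sum_mono σ f, sum_mono σ g]
  simp only [Finset.sum_mul, Finset.mul_sum, map_sum]
  refine Finset.sum_congr rfl fun v hv => Finset.sum_congr rfl fun w hw => ?_
  have h1 := hf w hw
  have h2 := hg v hv
  rw [mono_mul_mono, comp_mono, comp_mono, comp_mono, map_add]
  by_cases h3 : l w = a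
  · by_cases h4 : l v = b
    · rw [if_pos h3, if_pos h4, if_pos (by omega), mono_mul_mono]
    · rw [if_neg h4, if_neg (by omega), mul_zero]
  · rw [if_neg h3, if_neg (by omega), zero_mul]

theorem q_pow_ne_one {m : ℕ} (hm : m ≠ 0) : q ^ m ≠ 1 := by
  intro h
  have h1 : algebraMap (Polynomial ℂ) Cq (Polynomial.X ^ m) = algebraMap (Polynomial ℂ) Cq 1 := by
    rw [map_pow, RatFunc.algebraMap_X, map_one, h]
  have h2 := congrArg Polynomial.natDegree (RatFunc.algebraMap_injective ℂ h1)
  simp at h2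
  exact hm h2

theorem q_zpow_ne_one {m : ℤ} (hm : m ≠ 0) : q ^ m ≠ 1 := by
  obtain ⟨k, rfl | rfl⟩ := m.eq_nat_or_neg
  · rw [zpow_natCast]; exact q_pow_ne_one (by simpa using hm)
  · rw [_root_.zpow_neg, zpow_natCast, Ne, inv_eq_one]; exact q_pow_ne_one (by simpa using hm)

theorem q_zpow_injective {a b : ℤ} (h : q ^ a = q ^ b) : a = b := by
  by_contra hne
  refine q_zpow_ne_one (sub_ne_zero.2 hne) ?_
  rw [zpow_sub₀ q_ne_zero, h, div_self (zpow_ne_zero _ q_ne_zero)]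

/-- The rescaling of monomials that describes the conjugation by another generator. -/
def scale (σ : Fin n → Fin n → ℤ) (l : (Fin n → ℤ) →+ ℤ) : CFAlgebra σ →ₗ[Cq] CFAlgebra σ :=
  weight σ fun v => q ^ (2 * l v)

theorem mem_of_sum_eigenvectors {M : Type*} [AddCommGroup M] [Module Cq M] (W : Submodule Cq M)
    (S : M →ₗ[Cq] M) (hS : ∀ x ∈ W, S x ∈ W) (s : Finset ℤ) (y : ℤ → M)
    (hy : ∀ d, S (y d) = q ^ (2 * d) • y d) (hs : ∑ d ∈ s, y d ∈ W) : ∀ d ∈ s, y d ∈ W := by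
  classical
  induction s using Finset.induction_on generalizing y with
  | empty => simp
  | insert t s ht ih =>
    rw [Finset.sum_insert ht] at hs
    have h1 : ∑ d ∈ s, (q ^ (2 * d) - q ^ (2 * t)) • y d ∈ W := by
      have h2 := W.sub_mem (hS _ hs) (W.smul_mem (q ^ (2 * t)) hs)
      convert h2 using 1
      rw [map_add, hy, smul_add, add_sub_add_left_eq_sub, map_sum, Finset.smul_sum,
        ← Finset.sum_sub_distrib]
      exact Finset.sum_congr rfl fun d _ => by rw [hy, sub_smul]
    have h3 : ∀ d ∈ s, y d ∈ W := fun d hd => by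
      have h4 := ih (fun d => (q ^ (2 * d) - q ^ (2 * t)) • y d)
        (fun d => by rw [map_smul, hy, smul_comm]) h1 d hd
      have h5 : q ^ (2 * d) - q ^ (2 * t) ≠ 0 := by
        rw [sub_ne_zero]
        intro h
        have := q_zpow_injective h
        exact ht ((show d = t by omega) ▸ hd)
      exact (W.smul_mem_iff h5).1 h4
    intro d hd
    rcases Finset.mem_insert.1 hd with rfl | hd
    · have := W.sub_mem hs (W.sum_mem h3)
      rwa [add_sub_cancel_right] at this
    · exact h3 d hd

/-- A linear relation between pairs that is preserved by the rescaling is preserved by taking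
homogeneous components. -/
theorem comp_mem_of_scale_mem (l : (Fin n → ℤ) →+ ℤ)
    (W : Submodule Cq (CFAlgebra σ × CFAlgebra σ))
    (hW : ∀ x ∈ W, (scale σ l x.1, scale σ l x.2) ∈ W) {x : CFAlgebra σ × CFAlgebra σ}
    (hx : x ∈ W) (d : ℤ) : (comp σ l d x.1, comp σ l d x.2) ∈ W := by
  classical
  set s := (supp σ x.1 ∪ supp σ x.2).image l
  have hs1 : ∀ v ∈ supp σ x.1, l v ∈ s := fun v hv =>
    Finset.mem_image_of_mem _ (Finset.mem_union_left _ hv)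
  have hs2 : ∀ v ∈ supp σ x.2, l v ∈ s := fun v hv =>
    Finset.mem_image_of_mem _ (Finset.mem_union_right _ hv)
  by_cases hd : d ∈ s
  · refine mem_of_sum_eigenvectors W ((scale σ l).prodMap (scale σ l)) (fun x hx => hW x hx) s
      (fun d => (comp σ l d x.1, comp σ l d x.2)) (fun d => ?_) ?_ d hd
    · have key : ∀ f : CFAlgebra σ,
          scale σ l (comp σ l d f) = q ^ (2 * d) • comp σ l d f := fun f => by
        refine cf_ext σ fun v => ?_
        rw [scale, coeff_weight, map_smul, coeff_comp, smul_eq_mul]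
        split_ifs with h
        · rw [h]
        · simp
      simp [key]
    · have : ∑ d ∈ s, (comp σ l d x.1, comp σ l d x.2) = x := by
        refine Prod.ext ?_ ?_
        · rw [Prod.fst_sum]; exact sum_comp l x.1 hs1
        · rw [Prod.snd_sum]; exact sum_comp l x.2 hs2
      rwa [this]
  · have h1 : comp σ l d x.1 = 0 := comp_eq_zero fun v hv h => hd (h ▸ hs1 v hv)
    have h2 : comp σ l d x.2 = 0 := comp_eq_zero fun v hv h => hd (h ▸ hs2 v hv)
    rw [h1, h2]
    exact W.zero_mem

end monomials

/-! ### Inclusions of Chekhov–Fock algebras -/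

section inclusion
variable {n k : ℕ} (e : Fin k ↪o Fin n) (σ : Fin n → Fin n → ℤ)

/-- Extension of exponents by zero. -/
def extendExp : (Fin k → ℤ) →+ (Fin n → ℤ) where
  toFun v := Function.extend e v 0
  map_zero' := Function.extend_zero _
  map_add' u v := by rw [← Function.extend_add, add_zero]

theorem extendExp_apply (v : Fin k → ℤ) (i : Fin k) : extendExp e v (e i) = v i :=
  e.injective.extend_apply _ _ _

theorem extendExp_apply' (v : Fin k → ℤ) {i : Fin n} (hi : i ∉ Set.range e) :
    extendExp e v i = 0 := Function.extend_apply' _ _ _ hi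

theorem extendExp_injective : Function.Injective (extendExp e) := fun u v h => by
  funext i
  rw [← extendExp_apply e u, h, extendExp_apply]

/-- The restriction of the adjacency numbers to some of the indices. -/
abbrev restrict : Fin k → Fin k → ℤ := fun i j => σ (e i) (e j)

theorem twist_extendExp (u v : Fin k → ℤ) :
    twist σ (extendExp e u) (extendExp e v) = twist (restrict e σ) u v := by
  unfold twist
  congr 1
  refine (Fintype.sum_of_injective e e.injective _ _ (fun i hi => ?_) fun i => ?_).symm
  · refine Finset.sum_eq_zero fun j _ => ?_
    rw [extendExp_apply' e u hi]
    simp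
  · refine Fintype.sum_of_injective e e.injective _ _ (fun j hj => ?_) fun j => ?_
    · rw [extendExp_apply' e v hj]
      simp
    · simp only [extendExp_apply, e.lt_iff_lt]

/-- The inclusion of a Chekhov–Fock algebra in fewer variables. -/
def inclLinear : CFAlgebra (restrict e σ) →ₗ[Cq] CFAlgebra σ :=
  (toLaurent σ).symm.toLinearMap ∘ₗ Finsupp.lmapDomain Cq Cq (extendExp e) ∘ₗ
    (toLaurent (restrict e σ)).toLinearMap

theorem inclLinear_mono (v : Fin k → ℤ) (c : Cq) :
    inclLinear e σ (mono _ v c) = mono σ (extendExp e v) c := by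
  simp [inclLinear, mono, Finsupp.mapDomain_single]

/-- The inclusion of a Chekhov–Fock algebra in fewer variables. -/
def incl : CFAlgebra (restrict e σ) →ₐ[Cq] CFAlgebra σ :=
  AlgHom.ofLinearMap (inclLinear e σ)
    (by rw [one_def, inclLinear_mono, map_zero, one_def])
    (fun f g => by
      induction f using cf_induction with
      | h0 => simp
      | hadd f₁ f₂ h₁ h₂ => rw [add_mul, map_add, h₁, h₂, map_add, add_mul]
      | hm u c =>
        induction g using cf_induction with
        | h0 => simp
        | hadd f₁ f₂ h₁ h₂ => rw [mul_add, map_add, h₁, h₂, map_add, mul_add]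
        | hm v d =>
          rw [mono_mul_mono, inclLinear_mono, inclLinear_mono, inclLinear_mono, mono_mul_mono,
            twist_extendExp, map_add])

theorem incl_mono (v : Fin k → ℤ) (c : Cq) :
    incl e σ (mono _ v c) = mono σ (extendExp e v) c := inclLinear_mono e σ v c

theorem incl_injective : Function.Injective (incl e σ) := by
  have : Function.Injective (inclLinear e σ) :=
    (toLaurent σ).symm.injective.comp
      ((Finsupp.mapDomain_injective (extendExp_injective e)).comp (toLaurent _).injective)
  exact this

end inclusion

/-! ### The fraction division algebra -/

section fractions
variable {n k : ℕ} (σ : Fin n → Fin n → ℤ)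

/-- The inclusion of the Chekhov–Fock algebra in its fraction division algebra. -/
def toField : CFAlgebra σ →ₐ[Cq] CFField σ where
  __ := (OreLocalization.numeratorRingHom : CFAlgebra σ →+* CFField σ)
  commutes' c := by
    simp
    rfl

theorem toField_injective : Function.Injective (toField σ) :=
  OreLocalization.numeratorHom_inj inf_le_left

theorem gen_eq (i : Fin n) : gen σ i = toField σ (mono σ (Pi.single i 1) 1) := rfl

end fractions
end QuantumTeichmuller

namespace QuantumTeichmuller

/-! ### Reduction to rational functions of one variable -/

section polynomials
variable {n : ℕ} {τ τ' : Fin n → Fin n → ℤ}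

theorem mono_single_pow (i : Fin n) (m : ℕ) :
    mono τ (Pi.single i 1) 1 ^ m = mono τ (Pi.single i (m : ℤ)) 1 := by
  induction m with
  | zero => simp [one_def]
  | succ m ih =>
    rw [pow_succ, ih, mono_mul_mono, twist_eq_zero_of_forall, ← Pi.single_add]
    · simp
    · intro j l hl
      by_cases hj : j = i
      · exact Or.inr (Pi.single_eq_of_ne (by rintro rfl; exact hl.ne hj.symm) _)
      · exact Or.inl (Pi.single_eq_of_ne hj _)

theorem exists_aeval_eq (i : Fin n) {f : CFAlgebra τ}
    (hf : ∀ v ∈ supp τ f, ∃ m : ℕ, v = Pi.single i (m : ℤ)) :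
    ∃ α : Polynomial Cq, Polynomial.aeval (mono τ (Pi.single i 1) 1) α = f := by
  have h : f ∈ (Polynomial.aeval (R := Cq) (mono τ (Pi.single i 1) 1)).range := by
    rw [sum_mono τ f]
    refine Subalgebra.sum_mem _ fun v hv => ?_
    obtain ⟨m, rfl⟩ := hf v hv
    refine ⟨Polynomial.C (coeff τ (Pi.single i (m : ℤ)) f) * Polynomial.X ^ m, ?_⟩
    simp [mono_single_pow, Algebra.algebraMap_eq_smul_one, smul_mono]
  exact h

/-- The coefficients of the product of a polynomial in `X_i` with a Laurent polynomial only
involve the adjacency numbers `σ_{ij}` with `j < i`. -/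
theorem toLaurent_aeval_mul (i : Fin n) (hτ : ∀ j < i, τ i j = τ' i j) (α : Polynomial Cq)
    (P : Laurent n) :
    toLaurent τ (Polynomial.aeval (mono τ (Pi.single i 1) 1) α * (toLaurent τ).symm P)
      = toLaurent τ' (Polynomial.aeval (mono τ' (Pi.single i 1) 1) α * (toLaurent τ').symm P) := by
  induction P using Finsupp.induction_linear with
  | zero => simp
  | add P Q hP hQ => simp only [map_add, mul_add, hP, hQ]
  | single v c =>
    induction α using Polynomial.induction_on' with
    | add α β hα hβ => simp only [map_add, add_mul, hα, hβ]
    | monomial m a =>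
      have key : ∀ τ : Fin n → Fin n → ℤ,
          Polynomial.aeval (mono τ (Pi.single i 1) 1) (Polynomial.monomial m a) *
            (toLaurent τ).symm (Finsupp.single v c)
          = mono τ (Pi.single i (m : ℤ) + v) (a * c * q ^ twist τ (Pi.single i (m : ℤ)) v) :=
        fun τ => by
          rw [Polynomial.aeval_monomial, mono_single_pow, Algebra.algebraMap_eq_smul_one,
            smul_mul_assoc, one_mul, smul_mono, mul_one]
          exact mono_mul_mono τ _ _ _ _
      have htw : twist τ (Pi.single i (m : ℤ)) v = twist τ' (Pi.single i (m : ℤ)) v := by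
        unfold twist
        congr 1
        refine Finset.sum_congr rfl fun j _ => Finset.sum_congr rfl fun l _ => ?_
        by_cases hj : j = i
        · subst hj
          split_ifs with hl
          · rw [hτ l hl]
          · rfl
        · simp [Pi.single_eq_of_ne hj]
      rw [key, key, htw]
      rfl

/-- Left multiplication by `X_i` does not reorder variables if `i` is minimal. -/
theorem mono_single_mul_of_le (i : Fin n) (hi : ∀ j, i ≤ j) (P : Laurent n) :
    mono τ (Pi.single i 1) 1 * (toLaurent τ).symm P
      = (toLaurent τ).symm (P.mapDomain (Pi.single i 1 + ·)) := by
  induction P using Finsupp.induction_linear with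
  | zero => simp
  | add P Q hP hQ => rw [Finsupp.mapDomain_add, map_add, map_add, mul_add, hP, hQ]
  | single v c =>
    rw [Finsupp.mapDomain_single]
    refine (mono_mul_mono τ _ _ _ _).trans ?_
    rw [twist_eq_zero_of_forall]
    · simp [mono]
    · intro j l hl
      exact Or.inl (Pi.single_eq_of_ne (ne_of_gt (lt_of_le_of_lt (hi l) hl)) _)

end polynomials

section gradedPairs
variable {n : ℕ} {τ : Fin n → Fin n → ℤ}

theorem exists_homogeneous {ι : Type*} (l : ι → (Fin n → ℤ) →+ ℤ) {P Q : CFAlgebra τ}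
    (hl : ∀ r (A B : CFAlgebra τ), A * P = B * Q →
      ∀ d, comp τ (l r) d A * P = comp τ (l r) d B * Q)
    (hQ : Q ≠ 0) (s : Finset ι) :
    ∃ A B : CFAlgebra τ, A ≠ 0 ∧ A * P = B * Q ∧
      ∀ r ∈ s, ∃ d, ∀ v, v ∈ supp τ A ∨ v ∈ supp τ B → l r v = d := by
  classical
  induction s using Finset.induction_on with
  | empty =>
    obtain ⟨A, B, hA, h⟩ := ore_condition τ P Q hQ
    exact ⟨A, B, hA, h, by simp⟩
  | insert r s _ ih =>
    obtain ⟨A, B, hA, h, hs⟩ := ih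
    obtain ⟨d, hd⟩ := exists_comp_ne_zero (l r) hA
    refine ⟨_, _, hd, hl r A B h d, fun r' hr' => ?_⟩
    rcases Finset.mem_insert.1 hr' with rfl | hr'
    · exact ⟨d, fun v hv => by rcases hv with hv | hv <;> exact (mem_supp_comp.1 hv).2⟩
    · obtain ⟨d', hd'⟩ := hs r' hr'
      exact ⟨d', fun v hv => hd' v (hv.imp (fun h => (mem_supp_comp.1 h).1)
        fun h => (mem_supp_comp.1 h).1)⟩

theorem exists_comp_min (l : (Fin n → ℤ) →+ ℤ) {A : CFAlgebra τ} (hA : A ≠ 0) :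
    ∃ a, comp τ l a A ≠ 0 ∧ ∀ v ∈ supp τ A, a ≤ l v := by
  obtain ⟨v, hv, hmin⟩ := Finset.exists_min_image _ l (supp_nonempty τ hA)
  refine ⟨l v, fun h => ?_, hmin⟩
  have : v ∈ supp τ (comp τ l (l v) A) := mem_supp_comp.2 ⟨hv, rfl⟩
  rw [h, mem_supp] at this
  simp at this

theorem comp_eq_zero_of_lt (l : (Fin n → ℤ) →+ ℤ) {A : CFAlgebra τ} {a d : ℤ} (hd : d < a)
    (h : ∀ v ∈ supp τ A, a ≤ l v) : comp τ l d A = 0 :=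
  comp_eq_zero fun v hv hl => by have := h v hv; omega

end gradedPairs

/-- The linear form with the given coefficients. -/
def linForm {k : ℕ} (w : Fin k → ℤ) : (Fin k → ℤ) →+ ℤ where
  toFun v := ∑ j, w j * v j
  map_zero' := by simp
  map_add' u v := by simp [mul_add, Finset.sum_add_distrib]

theorem linForm_apply {k : ℕ} (w v : Fin k → ℤ) : linForm w v = ∑ j, w j * v j := rfl

/-- Let `ℓ₀, ℓ₁, …` be gradings such that the left fractions with value `P Q⁻¹` in one
Chekhov–Fock algebra are compatible with all of them, and suppose that `z = P Q⁻¹` commutes, in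
another Chekhov–Fock algebra, with an element that detects the exponent of `X₀`. If the
vanishing of `ℓ₀, ℓ₁, …` and of the exponent of `X₀` leaves only the exponent of `X_i` free, then
`z` is a rational function of `X_i` alone, with the same coefficients for both algebras. -/
theorem exists_one_variable {n : ℕ} {ι : Type*} [Finite ι] {τ₀ τ₁ : Fin n → Fin n → ℤ}
    (o i : Fin n) (hτ : ∀ j < i, τ₀ i j = τ₁ i j) (l : ι → (Fin n → ℤ) →+ ℤ)
    (hsep : ∀ v : Fin n → ℤ, v o = 0 → (∀ r, l r v = 0) → ∃ m, v = Pi.single i m)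
    {P Q : Laurent n} (hP : P ≠ 0) (hQ : Q ≠ 0)
    (h₀ : ∀ r (A B : CFAlgebra τ₀), A * (toLaurent τ₀).symm P = B * (toLaurent τ₀).symm Q →
      ∀ d, comp τ₀ (l r) d A * (toLaurent τ₀).symm P = comp τ₀ (l r) d B * (toLaurent τ₀).symm Q)
    {K : Type*} [DivisionRing K] [Algebra Cq K] (φ : CFAlgebra τ₁ →ₐ[Cq] K)
    (hφ : Function.Injective φ) (z : K) (hz : z * φ ((toLaurent τ₁).symm Q)
      = φ ((toLaurent τ₁).symm P))
    (h₁ : ∀ d, z * φ (comp τ₁ (linForm (Pi.single o 1)) d ((toLaurent τ₁).symm Q))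
      = φ (comp τ₁ (linForm (Pi.single o 1)) d ((toLaurent τ₁).symm P))) :
    ∃ α β : Polynomial Cq, α ≠ 0 ∧
      ∀ τ : Fin n → Fin n → ℤ, (∀ j < i, τ i j = τ₁ i j) →
        Polynomial.aeval (mono τ (Pi.single i 1) 1) α * (toLaurent τ).symm P
          = Polynomial.aeval (mono τ (Pi.single i 1) 1) β * (toLaurent τ).symm Q := by
  classical
  set lo : (Fin n → ℤ) →+ ℤ := linForm (Pi.single o 1) with hlo
  have hlo_apply : ∀ v, lo v = v o := fun v => by
    rw [hlo, linForm_apply, Finset.sum_eq_single o]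
    · simp
    · intro b _ hb; simp [Pi.single_eq_of_ne hb]
    · simp
  have hne : ∀ (τ : Fin n → Fin n → ℤ) {R : Laurent n}, R ≠ 0 → (toLaurent τ).symm R ≠ 0 :=
    fun τ R hR h => hR ((toLaurent τ).symm.map_eq_zero_iff.1 h)
  have hsupp : ∀ (τ : Fin n → Fin n → ℤ) (R : Laurent n),
      supp τ ((toLaurent τ).symm R) = R.support := fun τ R => by
    rw [supp, LinearEquiv.apply_symm_apply]
  have hcomp : ∀ (τ : Fin n → Fin n → ℤ) (R : Laurent n) (d : ℤ),
      comp τ lo d ((toLaurent τ).symm R)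
        = (toLaurent τ).symm (R.filter fun v => lo v = d) := fun τ R d => by
    refine cf_ext τ fun v => ?_
    rw [coeff_comp]
    simp only [coeff, LinearMap.comp_apply, LinearEquiv.coe_coe, LinearEquiv.apply_symm_apply,
      Finsupp.lapply_apply, Finsupp.filter_apply]
  have hz0 : z ≠ 0 := by
    rintro rfl
    rw [zero_mul] at hz
    exact hne τ₁ hP (hφ (by rw [← hz, map_zero]))
  -- the lowest components of `P` and `Q`
  obtain ⟨k, hk, hkQ⟩ := exists_comp_min lo (hne τ₁ hQ)
  have hiff : ∀ d, comp τ₁ lo d ((toLaurent τ₁).symm P) = 0 ↔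
      comp τ₁ lo d ((toLaurent τ₁).symm Q) = 0 := fun d => by
    rw [← map_eq_zero_iff φ hφ, ← h₁, mul_eq_zero, or_iff_right hz0, map_eq_zero_iff φ hφ]
  have hkP : ∀ v ∈ P.support, k ≤ lo v := fun v hv => by
    by_contra! hlt
    have h1 := (hiff (lo v)).2 (comp_eq_zero_of_lt lo hlt hkQ)
    have h2 : v ∈ supp τ₁ (comp τ₁ lo (lo v) ((toLaurent τ₁).symm P)) :=
      mem_supp_comp.2 ⟨by rwa [hsupp], rfl⟩
    rw [h1, mem_supp] at h2
    simp at h2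
  have hkP' := mt (hiff k).1 hk
  rw [hsupp] at hkQ
  rw [hcomp] at hk hkP'
  set P' := P.filter fun v => lo v = k
  set Q' := Q.filter fun v => lo v = k
  have hP' : P' ≠ 0 := fun h => hkP' (by rw [h, map_zero])
  have hQ' : Q' ≠ 0 := fun h => hk (by rw [h, map_zero])
  -- homogeneous fractions
  cases nonempty_fintype ι
  obtain ⟨A, B, hA, hAB, hd⟩ := exists_homogeneous l h₀ (hne τ₀ hQ) Finset.univ
  have hB : B ≠ 0 := by
    rintro rfl
    rw [zero_mul, mul_eq_zero] at hAB
    exact hAB.elim hA (hne τ₀ hP)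
  obtain ⟨a, ha, haA⟩ := exists_comp_min lo hA
  obtain ⟨b, hb, hbB⟩ := exists_comp_min lo hB
  have hPA := comp_mul_of_le lo haA (g := (toLaurent τ₀).symm P) (b := k) (by rwa [hsupp])
  have hQB := comp_mul_of_le lo hbB (g := (toLaurent τ₀).symm Q) (b := k) (by rwa [hsupp])
  have hab : a = b := by
    have h1 : ∀ {a b : ℤ} {A B : CFAlgebra τ₀} {P Q : Laurent n},
        A * (toLaurent τ₀).symm P = B * (toLaurent τ₀).symm Q →
        (∀ v ∈ supp τ₀ A, a ≤ lo v) → (∀ v ∈ supp τ₀ B, b ≤ lo v) →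
        (∀ v ∈ P.support, k ≤ lo v) → (∀ v ∈ Q.support, k ≤ lo v) →
        comp τ₀ lo a A ≠ 0 → comp τ₀ lo k ((toLaurent τ₀).symm P) ≠ 0 → b ≤ a := by
      intro a b A B P Q hAB hA hB hP hQ ha hk
      by_contra! hlt
      have h1 := comp_mul_of_le lo hA (g := (toLaurent τ₀).symm P) (b := k) (by rwa [hsupp])
      have h2 := comp_mul_of_le lo (a := a) (fun v hv => hlt.le.trans (hB v hv))
        (g := (toLaurent τ₀).symm Q) (b := k) (by rwa [hsupp])
      rw [← hAB, h1, comp_eq_zero_of_lt lo hlt hB, zero_mul, mul_eq_zero] at h2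
      exact h2.elim ha hk
    refine le_antisymm (h1 hAB.symm hbB haA hkQ hkP hb ?_) (h1 hAB haA hbB hkP hkQ ha ?_)
    · rw [hcomp]; exact hne τ₀ hQ'
    · rw [hcomp]; exact hne τ₀ hP'
  subst hab
  rw [hAB, hQB, hcomp, hcomp] at hPA
  -- the exponents of the lowest components of `A` and `B` only differ in the `i`-th place
  have hlow : ∀ v, v ∈ supp τ₀ (comp τ₀ lo a A) ∨ v ∈ supp τ₀ (comp τ₀ lo a B) →
      lo v = a ∧ (v ∈ supp τ₀ A ∨ v ∈ supp τ₀ B) := by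
    rintro v (hv | hv)
    · exact ⟨(mem_supp_comp.1 hv).2, Or.inl (mem_supp_comp.1 hv).1⟩
    · exact ⟨(mem_supp_comp.1 hv).2, Or.inr (mem_supp_comp.1 hv).1⟩
  have hdiff : ∀ v w, v ∈ supp τ₀ (comp τ₀ lo a A) ∨ v ∈ supp τ₀ (comp τ₀ lo a B) →
      w ∈ supp τ₀ (comp τ₀ lo a A) ∨ w ∈ supp τ₀ (comp τ₀ lo a B) →
      ∃ m, v - w = Pi.single i m := by
    intro v w hv hw
    obtain ⟨h1, h2⟩ := hlow v hv
    obtain ⟨h3, h4⟩ := hlow w hw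
    refine hsep _ ?_ fun r => ?_
    · rw [hlo_apply] at h1 h3
      rw [Pi.sub_apply, h1, h3, sub_self]
    · obtain ⟨d, hd⟩ := hd r (Finset.mem_univ r)
      rw [map_sub, hd v h2, hd w h4, sub_self]
  obtain ⟨u, hu, humin⟩ := Finset.exists_min_image
    (supp τ₀ (comp τ₀ lo a A) ∪ supp τ₀ (comp τ₀ lo a B)) (fun v => v i)
    ((supp_nonempty τ₀ ha).mono Finset.subset_union_left)
  have hshift : ∀ C : CFAlgebra τ₀, supp τ₀ C ⊆
      supp τ₀ (comp τ₀ lo a A) ∪ supp τ₀ (comp τ₀ lo a B) →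
      ∃ α : Polynomial Cq, Polynomial.aeval (mono τ₀ (Pi.single i 1) 1) α = mono τ₀ (-u) 1 * C := by
    intro C hC
    have h : mono τ₀ (-u) 1 * C ∈
        (Polynomial.aeval (R := Cq) (mono τ₀ (Pi.single i 1) 1)).range := by
      conv => enter [2]; rw [sum_mono τ₀ C]
      rw [Finset.mul_sum]
      refine Subalgebra.sum_mem _ fun v hv => ?_
      obtain ⟨m, hm⟩ := hdiff v u (by simpa using hC hv) (by simpa using hu)
      have hm0 : 0 ≤ m := by
        have h1 := humin v (hC hv)
        have h2 := congrFun hm i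
        rw [Pi.single_eq_same, Pi.sub_apply] at h2
        omega
      lift m to ℕ using hm0
      rw [mono_mul_mono, neg_add_eq_sub, hm]
      refine exists_aeval_eq i fun w hw => ⟨m, ?_⟩
      rw [mem_supp, coeff_mono] at hw
      by_contra hne
      exact hw (if_neg fun h => hne h.symm)
    exact h
  obtain ⟨α, hα⟩ := hshift (comp τ₀ lo a A) Finset.subset_union_left
  obtain ⟨β, hβ⟩ := hshift (comp τ₀ lo a B) Finset.subset_union_right
  have hα0 : α ≠ 0 := by
    rintro rfl
    rw [map_zero] at hα
    refine (mul_ne_zero (fun h => ?_) ha) hα.symm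
    have := coeff_mono τ₀ (-u) (-u) (1 : Cq)
    rw [h, map_zero, if_pos rfl] at this
    exact zero_ne_one this
  have htransfer : ∀ {τ τ' : Fin n → Fin n → ℤ} {R S : Laurent n}, (∀ j < i, τ i j = τ' i j) →
      Polynomial.aeval (mono τ (Pi.single i 1) 1) α * (toLaurent τ).symm R
          = Polynomial.aeval (mono τ (Pi.single i 1) 1) β * (toLaurent τ).symm S →
      Polynomial.aeval (mono τ' (Pi.single i 1) 1) α * (toLaurent τ').symm R
          = Polynomial.aeval (mono τ' (Pi.single i 1) 1) β * (toLaurent τ').symm S := by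
    intro τ τ' R S hτ h
    apply (toLaurent τ').injective
    rw [← toLaurent_aeval_mul i hτ, ← toLaurent_aeval_mul i hτ, h]
  have hlowest : Polynomial.aeval (mono τ₁ (Pi.single i 1) 1) α * (toLaurent τ₁).symm P'
      = Polynomial.aeval (mono τ₁ (Pi.single i 1) 1) β * (toLaurent τ₁).symm Q' := by
    refine htransfer hτ ?_
    rw [hα, hβ, mul_assoc, mul_assoc, hPA]
  have hαz : φ (Polynomial.aeval (mono τ₁ (Pi.single i 1) 1) α) * z
      = φ (Polynomial.aeval (mono τ₁ (Pi.single i 1) 1) β) := by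
    have h1 := h₁ k
    rw [hcomp, hcomp] at h1
    refine mul_right_cancel₀ ((map_ne_zero_iff φ hφ).2 (hne τ₁ hQ')) ?_
    rw [mul_assoc, h1, ← map_mul, ← map_mul, hlowest]
  refine ⟨α, β, hα0, fun τ h => htransfer (fun j hj => (h j hj).symm) (hφ ?_)⟩
  rw [map_mul, map_mul, ← hz, ← mul_assoc, hαz]

/-! ### Elements that commute with an outer generator -/

section outer
variable {n k : ℕ} (e : Fin k ↪o Fin n) (σ : Fin n → Fin n → ℤ)

/-- The inclusion of the Chekhov–Fock algebra of some of the variables in the fraction division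
algebra. -/
def toFieldOf : CFAlgebra (restrict e σ) →ₐ[Cq] CFField σ := (toField σ).comp (incl e σ)

theorem toFieldOf_injective : Function.Injective (toFieldOf e σ) :=
  (toField_injective σ).comp (incl_injective e σ)

theorem toFieldOf_gen (i : Fin k) :
    toFieldOf e σ (mono _ (Pi.single i 1) 1) = gen σ (e i) := by
  rw [toFieldOf, AlgHom.comp_apply, incl_mono, gen_eq]
  congr 2
  funext j
  by_cases hj : j ∈ Set.range e
  · obtain ⟨l, rfl⟩ := hj
    rw [extendExp_apply]
    simp [Pi.single_apply]
  · rw [extendExp_apply' e _ hj, Pi.single_eq_of_ne]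
    rintro rfl
    exact hj ⟨i, rfl⟩

theorem evalLaurent_mapDomain (P : Laurent k) :
    evalLaurent σ (P.mapDomain (extendExp e)) = toFieldOf e σ ((toLaurent _).symm P) := rfl

variable {σ}

theorem gen_mul_gen (hσ : ∀ i j, σ j i = -σ i j) (i j : Fin n) :
    gen σ i * gen σ j = q ^ (2 * σ i j) • (gen σ j * gen σ i) := by
  rw [gen_eq, gen_eq, ← map_mul, mono_single_mul_comm hσ, map_smul, map_mul]
  congr 3
  simp [Pi.single_apply]

theorem gen_ne_zero (i : Fin n) : gen σ i ≠ 0 := by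
  rw [gen_eq, map_ne_zero_iff _ (toField_injective σ)]
  intro h
  have := coeff_mono σ (Pi.single i 1) (Pi.single i 1) (1 : Cq)
  rw [h, map_zero, if_pos rfl] at this
  exact zero_ne_one this

/-- Conjugation by a generator rescales monomials. -/
theorem toFieldOf_mul_gen (hσ : ∀ i j, σ j i = -σ i j) (x : Fin n)
    (f : CFAlgebra (restrict e σ)) :
    toFieldOf e σ f * gen σ x
      = gen σ x * toFieldOf e σ (scale _ (linForm fun j => σ (e j) x) f) := by
  induction f using cf_induction with
  | h0 => simp
  | hadd f g hf hg => simp only [map_add, add_mul, mul_add, hf, hg]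
  | hm v c =>
    have h : toField σ (mono σ (extendExp e v) c) * gen σ x
        = q ^ (2 * linForm (fun j => σ (e j) x) v) •
          (gen σ x * toField σ (mono σ (extendExp e v) c)) := by
      rw [gen_eq, ← map_mul, ← map_mul, mono_single_mul_comm hσ, map_smul, smul_smul,
        ← zpow_add₀ q_ne_zero]
      have h0 : 2 * linForm (fun j => σ (e j) x) v + 2 * ∑ j, σ x j * extendExp e v j = 0 := by
        rw [linForm_apply, ← mul_add]
        have h1 : ∑ j, σ (e j) x * v j = ∑ j, σ j x * extendExp e v j :=
          Fintype.sum_of_injective e e.injective _ _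
            (fun j hj => by rw [extendExp_apply' e v hj, mul_zero])
            fun j => by rw [extendExp_apply]
        rw [h1, ← Finset.sum_add_distrib, Finset.sum_eq_zero fun j _ => ?_, mul_zero]
        rw [hσ x j]
        ring
      rw [h0, zpow_zero, one_smul]
    rw [scale, weight_mono, toFieldOf, AlgHom.comp_apply, AlgHom.comp_apply, incl_mono, incl_mono,
      h, ← smul_mono, map_smul, mul_smul_comm]

/-- A left fraction for an element that commutes with a generator can be replaced by its
homogeneous components. -/
theorem comp_left_of_commute (hσ : ∀ i j, σ j i = -σ i j) {x : Fin n} {z : CFField σ}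
    (hz : Commute z (gen σ x)) {A B : CFAlgebra (restrict e σ)}
    (h : toFieldOf e σ A * z = toFieldOf e σ B) (d : ℤ) :
    toFieldOf e σ (comp _ (linForm fun j => σ (e j) x) d A) * z
      = toFieldOf e σ (comp _ (linForm fun j => σ (e j) x) d B) := by
  set l := linForm fun j => σ (e j) x
  let W : Submodule Cq (CFAlgebra (restrict e σ) × CFAlgebra (restrict e σ)) :=
    { carrier := {p | toFieldOf e σ p.1 * z = toFieldOf e σ p.2}
      add_mem' := fun {p r} hp hr => by
        simp only [Set.mem_ofPred_eq, Prod.fst_add, Prod.snd_add, map_add, add_mul] at hp hr ⊢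
        rw [hp, hr]
      zero_mem' := by simp
      smul_mem' := fun c p hp => by
        simp only [Set.mem_ofPred_eq, Prod.smul_fst, Prod.smul_snd, map_smul, smul_mul_assoc]
          at hp ⊢
        rw [hp] }
  refine comp_mem_of_scale_mem l W (fun p hp => ?_) (x := (A, B)) h d
  have hp : toFieldOf e σ p.1 * z = toFieldOf e σ p.2 := hp
  change toFieldOf e σ (scale _ l p.1) * z = toFieldOf e σ (scale _ l p.2)
  refine mul_left_cancel₀ (gen_ne_zero (σ := σ) x) ?_
  rw [← mul_assoc, ← toFieldOf_mul_gen e hσ, ← toFieldOf_mul_gen e hσ, mul_assoc, ← hz.eq,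
    ← mul_assoc, hp]

/-- A right fraction for an element that commutes with a generator can be replaced by its
homogeneous components. -/
theorem comp_right_of_commute (hσ : ∀ i j, σ j i = -σ i j) {x : Fin n} {z : CFField σ}
    (hz : Commute z (gen σ x)) {P Q : CFAlgebra (restrict e σ)}
    (h : z * toFieldOf e σ Q = toFieldOf e σ P) (d : ℤ) :
    z * toFieldOf e σ (comp _ (linForm fun j => σ (e j) x) d Q)
      = toFieldOf e σ (comp _ (linForm fun j => σ (e j) x) d P) := by
  set l := linForm fun j => σ (e j) x
  let W : Submodule Cq (CFAlgebra (restrict e σ) × CFAlgebra (restrict e σ)) :=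
    { carrier := {p | z * toFieldOf e σ p.1 = toFieldOf e σ p.2}
      add_mem' := fun {p r} hp hr => by
        simp only [Set.mem_ofPred_eq, Prod.fst_add, Prod.snd_add, map_add, mul_add] at hp hr ⊢
        rw [hp, hr]
      zero_mem' := by simp
      smul_mem' := fun c p hp => by
        simp only [Set.mem_ofPred_eq, Prod.smul_fst, Prod.smul_snd, map_smul, mul_smul_comm]
          at hp ⊢
        rw [hp] }
  refine comp_mem_of_scale_mem l W (fun p hp => ?_) (x := (Q, P)) h d
  have hp : z * toFieldOf e σ p.1 = toFieldOf e σ p.2 := hp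
  change z * toFieldOf e σ (scale _ l p.1) = toFieldOf e σ (scale _ l p.2)
  refine mul_left_cancel₀ (gen_ne_zero (σ := σ) x) ?_
  rw [← mul_assoc, ← hz.eq, mul_assoc, ← toFieldOf_mul_gen e hσ, ← toFieldOf_mul_gen e hσ,
    ← mul_assoc, hp]

theorem exists_mapDomain_extendExp {P : Laurent n}
    (hP : ∀ v ∈ P.support, ∀ j ∉ Set.range e, v j = 0) :
    ∃ R : Laurent k, P = R.mapDomain (extendExp e) := by
  refine ⟨P.comapDomain (extendExp e) (extendExp_injective e).injOn, ?_⟩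
  rw [Finsupp.mapDomain_comapDomain _ (extendExp_injective e)]
  intro v hv
  refine ⟨fun j => v (e j), ?_⟩
  funext j
  by_cases hj : j ∈ Set.range e
  · obtain ⟨l, rfl⟩ := hj
    rw [extendExp_apply]
  · rw [extendExp_apply' e _ hj, hP v hv j hj]

end outer

end QuantumTeichmuller

namespace QuantumTeichmuller
variable {Γ : Subgroup (GL (Fin 2) ℝ)} {n : ℕ}

/-! ### Diagonal exchanges in standard position -/

theorem exists_perm_extend {k : ℕ} {f g : Fin k → Fin n} (hf : Function.Injective f)
    (hg : Function.Injective g) : ∃ π : Equiv.Perm (Fin n), ∀ j, π (f j) = g j := by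
  classical
  let e : {x // x ∈ Set.range f} ≃ {x // x ∈ Set.range g} :=
    (Equiv.ofInjective f hf).symm.trans (Equiv.ofInjective g hg)
  refine ⟨e.extendSubtype, fun j => ?_⟩
  rw [Equiv.extendSubtype_apply_of_mem _ _ ⟨j, rfl⟩]
  have : (⟨f j, ⟨j, rfl⟩⟩ : {x // x ∈ Set.range f}) = Equiv.ofInjective f hf j := rfl
  rw [this]
  simp [e]

namespace IdealTriangulation
variable {T T' : IdealTriangulation Γ n} {a b c d i : Fin n}

theorem isFace_reindex (π : Equiv.Perm (Fin n)) (x y z : OnePoint ℝ) :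
    (T.reindex π).IsFace x y z ↔ T.IsFace x y z := by
  have h : ∀ x y, (∃ i, (T.reindex π).edge i x y) ↔ ∃ i, T.edge i x y := fun x y =>
    ⟨fun ⟨i, hi⟩ => ⟨π i, hi⟩, fun ⟨i, hi⟩ => ⟨π.symm i, by simpa [reindex] using hi⟩⟩
  simp only [IsFace, h]

theorem sigma_reindex (π : Equiv.Perm (Fin n)) (i j : Fin n) :
    (T.reindex π).sigma i j = T.sigma (π i) (π j) := by
  have h : ∀ i j, (T.reindex π).spikes i j = T.spikes (π i) (π j) := fun i j => by
    unfold spikes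
    simp only [isFace_reindex]
    rfl
  rw [sigma, sigma, h, h]

theorem EmbeddedExchange.reindex {π : Equiv.Perm (Fin n)}
    (h : T.EmbeddedExchange T' (π a) (π b) (π c) (π d) (π i)) :
    (T.reindex π).EmbeddedExchange (T'.reindex π) a b c d i where
  distinct := List.Nodup.of_map π h.distinct
  others j hj := h.others (π j) fun hji => hj (π.injective hji)
  square := h.square

/-- A diagonal exchange whose labels are the first five indices. -/
def StdExchange (e : Fin 5 ↪o Fin n) (T T' : IdealTriangulation Γ n) : Prop :=
  T.EmbeddedExchange T' (e 0) (e 1) (e 2) (e 3) (e 4)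

theorem EmbeddedExchange.exists_std (h : T.EmbeddedExchange T' a b c d i)
    (e : Fin 5 ↪o Fin n) : ∃ π : Equiv.Perm (Fin n),
      (∀ j, π (e j) = ![a, b, c, d, i] j) ∧ StdExchange e (T.reindex π) (T'.reindex π) := by
  have hinj : Function.Injective ![a, b, c, d, i] := by
    have := h.distinct
    rw [← List.nodup_ofFn]
    simpa using this
  obtain ⟨π, hπ⟩ := exists_perm_extend e.injective hinj
  refine ⟨π, hπ, EmbeddedExchange.reindex ?_⟩
  rw [hπ, hπ, hπ, hπ, hπ]
  exact h

theorem not_mem_range_iff {e : Fin 5 ↪o Fin n} {π : Equiv.Perm (Fin n)}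
    (hπ : ∀ j, π (e j) = ![a, b, c, d, i] j) (x : Fin n) :
    π.symm x ∉ Set.range e ↔ x ∉ [a, b, c, d, i] := by
  rw [not_iff_not]
  constructor
  · rintro ⟨j, hj⟩
    have : x = ![a, b, c, d, i] j := by rw [← hπ, hj, Equiv.apply_symm_apply]
    rw [this]
    fin_cases j <;> simp
  · intro hx
    simp only [List.mem_cons, List.not_mem_nil, or_false] at hx
    rcases hx with rfl | rfl | rfl | rfl | rfl
    · exact ⟨0, by rw [Equiv.eq_symm_apply, hπ]; rfl⟩
    · exact ⟨1, by rw [Equiv.eq_symm_apply, hπ]; rfl⟩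
    · exact ⟨2, by rw [Equiv.eq_symm_apply, hπ]; rfl⟩
    · exact ⟨3, by rw [Equiv.eq_symm_apply, hπ]; rfl⟩
    · exact ⟨4, by rw [Equiv.eq_symm_apply, hπ]; rfl⟩

/-- A diagonal exchange as in `HasSeparatingSquare`. -/
structure SeparatedExchange (T T' : IdealTriangulation Γ n) (a b c d i e : Fin n)
    (w₀ w₁ w₂ w₃ : ℤ) : Prop where
  exchange : T.EmbeddedExchange T' a b c d i
  not_mem : e ∉ [a, b, c, d, i]
  ab : T.sigma a b = -1
  ac : T.sigma a c = 0
  ad : T.sigma a d = 0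
  bc : T.sigma b c = 0
  bd : T.sigma b d = 0
  cd : T.sigma c d = -1
  ae : T.sigma a e = w₀
  be : T.sigma b e = w₁
  ce : T.sigma c e = w₂
  de : T.sigma d e = w₃

/-- Undoing a diagonal exchange as in `HasSeparatingSquare` is a diagonal exchange of the same
kind. -/
theorem SeparatedExchange.rotate (hΓ : IsSurfaceGroup Γ) {e : Fin n} {w₀ w₁ w₂ w₃ : ℤ}
    (h : T.SeparatedExchange T' a b c d i e w₀ w₁ w₂ w₃) :
    T'.SeparatedExchange T b c d a i e w₁ w₂ w₃ w₀ := by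
  have hd := h.exchange.distinct
  simp only [List.nodup_cons, List.mem_cons, List.not_mem_nil, or_false, not_or,
    List.nodup_nil, and_true, not_false_eq_true] at hd
  obtain ⟨⟨h1, h2, h3, h4⟩, ⟨h5, h6, h7⟩, ⟨h8, h9⟩, h10⟩ := hd
  have s1 := h.exchange.sigma_side hΓ
  have s2 := h.exchange.rotate_twice.sigma_side hΓ
  have s3 := h.exchange.rotate.sigma_side hΓ
  have so := h.exchange.sigma_outer hΓ h.not_mem
  have ne := h.not_mem
  refine ⟨h.exchange.rotate, ?_, ?_, ?_, ?_, ?_, ?_, ?_, ?_, ?_, ?_, ?_⟩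
  · simp only [List.mem_cons, List.not_mem_nil, or_false, not_or] at ne ⊢
    tauto
  · have := s2 b
    rw [T.sigma_swap b c, h.bc] at this
    rw [T'.sigma_swap c b, this]
    simp [h6, h7]
  · have := s3 d
    rw [h.bd] at this
    simpa [Ne.symm h3, Ne.symm h8, h10] using this.symm
  · have := s1 b
    rw [h.ab] at this
    rw [T'.sigma_swap a b, this]
    simp [h6, h7]
  · have := s2 d
    rw [h.cd] at this
    simp [this, Ne.symm h6, h10]
  · have := s1 c
    rw [h.ac] at this
    rw [T'.sigma_swap a c, this]
    simp [h8, Ne.symm h5, h9]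
  · have := s1 d
    rw [h.ad] at this
    rw [T'.sigma_swap a d, this]
    simp [Ne.symm h6, h10]
  · rw [so.2.1, h.be]
  · rw [so.2.2.1, h.ce]
  · rw [so.2.2.2, h.de]
  · rw [so.1, h.ae]

/-- The adjacency numbers between the sides and the diagonal of a square, if no two sides are
adjacent outside the square. -/
def separatedSigma : Fin 5 → Fin 5 → ℤ :=
  ![![0, -1, 0, 0, 1], ![1, 0, 0, 0, -1], ![0, 0, 0, -1, 1], ![0, 0, 1, 0, -1],
    ![-1, 1, -1, 1, 0]]

theorem sigma_self (j : Fin n) : T.sigma j j = 0 := by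
  have := T.sigma_swap j j
  omega

/-- The adjacency numbers of the diagonal. -/
theorem StdExchange.sigma_four (hΓ : IsSurfaceGroup Γ) {e : Fin 5 ↪o Fin n}
    (h : StdExchange e T T') (j : Fin 5) :
    T.sigma (e 4) (e j) = ![-1, 1, -1, 1, 0] j := by
  rw [EmbeddedExchange.sigma_diag hΓ h]
  fin_cases j <;> simp

theorem StdExchange.sigma_four_outer (hΓ : IsSurfaceGroup Γ) {e : Fin 5 ↪o Fin n}
    (h : StdExchange e T T') {x : Fin n} (hx : x ∉ Set.range e) : T.sigma (e 4) x = 0 := by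
  have hx : ∀ j, x ≠ e j := fun j h => hx ⟨j, h.symm⟩
  rw [EmbeddedExchange.sigma_diag hΓ h]
  simp [hx]

theorem StdExchange.sigma_zero_outer (hΓ : IsSurfaceGroup Γ) {e : Fin 5 ↪o Fin n}
    (h : StdExchange e T T') {x : Fin n} (hx : x ∉ Set.range e) :
    T'.sigma (e 0) x = T.sigma (e 0) x := by
  have hx : ∀ j, x ≠ e j := fun j h => hx ⟨j, h.symm⟩
  rw [EmbeddedExchange.sigma_side hΓ h]
  simp [hx]

theorem StdExchange.symm_sigma_four_outer (hΓ : IsSurfaceGroup Γ) {e : Fin 5 ↪o Fin n}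
    (h : StdExchange e T T') {x : Fin n} (hx : x ∉ Set.range e) : T'.sigma (e 4) x = 0 := by
  have hx : ∀ j, x ≠ e j := fun j h => hx ⟨j, h.symm⟩
  rw [(EmbeddedExchange.rotate h).sigma_diag hΓ]
  simp [hx]

theorem SeparatedExchange.exists_std (hΓ : IsSurfaceGroup Γ) {x : Fin n} {w₀ w₁ w₂ w₃ : ℤ}
    (h : T.SeparatedExchange T' a b c d i x w₀ w₁ w₂ w₃) (e : Fin 5 ↪o Fin n) :
    ∃ (U U' : IdealTriangulation Γ n) (y : Fin n), StdExchange e U U' ∧ y ∉ Set.range e ∧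
      restrict e U.sigma = separatedSigma ∧
      (fun j => U.sigma (e j) y) = ![w₀, w₁, w₂, w₃, 0] := by
  obtain ⟨π, hπ, hs⟩ := h.exchange.exists_std e
  have hy : π.symm x ∉ Set.range e := (not_mem_range_iff hπ x).2 h.not_mem
  refine ⟨_, _, π.symm x, hs, hy, ?_, ?_⟩
  · funext j l
    have h4 := fun l => hs.sigma_four hΓ l
    have h4' : ∀ l, (T.reindex π).sigma (e l) (e 4) = -![-1, 1, -1, 1, 0] l := fun l => by
      rw [sigma_swap, h4]
    have hself := fun l => (T.reindex π).sigma_self (e l)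
    have hab : (T.reindex π).sigma (e 0) (e 1) = -1 := by
      rw [sigma_reindex, hπ, hπ]; exact h.ab
    have hac : (T.reindex π).sigma (e 0) (e 2) = 0 := by
      rw [sigma_reindex, hπ, hπ]; exact h.ac
    have had : (T.reindex π).sigma (e 0) (e 3) = 0 := by
      rw [sigma_reindex, hπ, hπ]; exact h.ad
    have hbc : (T.reindex π).sigma (e 1) (e 2) = 0 := by
      rw [sigma_reindex, hπ, hπ]; exact h.bc
    have hbd : (T.reindex π).sigma (e 1) (e 3) = 0 := by
      rw [sigma_reindex, hπ, hπ]; exact h.bd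
    have hcd : (T.reindex π).sigma (e 2) (e 3) = -1 := by
      rw [sigma_reindex, hπ, hπ]; exact h.cd
    have hba := (T.reindex π).sigma_swap (e 0) (e 1)
    have hca := (T.reindex π).sigma_swap (e 0) (e 2)
    have hda := (T.reindex π).sigma_swap (e 0) (e 3)
    have hcb := (T.reindex π).sigma_swap (e 1) (e 2)
    have hdb := (T.reindex π).sigma_swap (e 1) (e 3)
    have hdc := (T.reindex π).sigma_swap (e 2) (e 3)
    fin_cases j <;> fin_cases l <;>
      simp [restrict, separatedSigma, h4, h4', hself, hab, hac, had, hbc, hbd, hcd, hba, hca, hda,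
        hcb, hdb, hdc]
  · have h4 := hs.sigma_four_outer hΓ hy
    have h' : ∀ j, (T.reindex π).sigma (e j) (π.symm x) = T.sigma (![a, b, c, d, i] j) x :=
      fun j => by rw [sigma_reindex, hπ, Equiv.apply_symm_apply]
    funext j
    fin_cases j
    · exact (h' 0).trans h.ae
    · exact (h' 1).trans h.be
    · exact (h' 2).trans h.ce
    · exact (h' 3).trans h.de
    · exact h4

/-- A family of elements associated to diagonal exchanges in standard position, that are given
by a common rational function and that commute with the generators outside the square, is given
by a rational function in the diagonal only. -/
theorem exists_one_variable_of_commute (hΓ : IsSurfaceGroup Γ) (hsep : HasSeparatingSquare Γ n)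
    (hunit : HasUnitSquare Γ n) (e : Fin 5 ↪o Fin n) {P Q : Laurent 5} (hP : P ≠ 0) (hQ : Q ≠ 0)
    (z : ∀ T _T' : IdealTriangulation Γ n, T.K)
    (hz : ∀ T T', StdExchange e T T' → z T T' * toFieldOf e T.sigma ((toLaurent _).symm Q)
      = toFieldOf e T.sigma ((toLaurent _).symm P))
    (hout : ∀ T T', StdExchange e T T' → ∀ x ∉ Set.range e, Commute (z T T') (T.X x)) :
    ∃ α β : Polynomial Cq, α ≠ 0 ∧ ∀ T T', StdExchange e T T' →
      Polynomial.aeval (T.X (e 4)) α * z T T' = Polynomial.aeval (T.X (e 4)) β := by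
  obtain ⟨T₀, T₀', a, b, c, d, i, x, h0, hx, hab, hac, had, hbc, hbd, hcd, hw⟩ := hsep
  obtain ⟨T₁, T₁', a₁, b₁, c₁, d₁, i₁, x₁, h1, hx₁, hw₁, hb₁, hc₁, hd₁⟩ := hunit
  -- undoing and repeating the exchange rotates the roles of the sides
  set w₀ := T₀.sigma a x
  set w₁ := T₀.sigma b x
  set w₂ := T₀.sigma c x
  set w₃ := T₀.sigma d x
  have r0 : T₀.SeparatedExchange T₀' a b c d i x w₀ w₁ w₂ w₃ :=
    ⟨h0, hx, hab, hac, had, hbc, hbd, hcd, rfl, rfl, rfl, rfl⟩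
  have r1 := r0.rotate hΓ
  have r2 := r1.rotate hΓ
  have r3 := r2.rotate hΓ
  let w : Fin 4 → Fin 5 → ℤ :=
    ![![w₀, w₁, w₂, w₃, 0], ![w₁, w₂, w₃, w₀, 0], ![w₂, w₃, w₀, w₁, 0], ![w₃, w₀, w₁, w₂, 0]]
  have hr : ∀ r : Fin 4, ∃ (U U' : IdealTriangulation Γ n) (y : Fin n), StdExchange e U U' ∧
      y ∉ Set.range e ∧ restrict e U.sigma = separatedSigma ∧
      (fun j => U.sigma (e j) y) = w r := by
    intro r
    fin_cases r
    · exact r0.exists_std hΓ e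
    · exact r1.exists_std hΓ e
    · exact r2.exists_std hΓ e
    · exact r3.exists_std hΓ e
  -- the exchange that detects the exponent of the first side
  obtain ⟨π, hπ, hs⟩ := h1.exists_std e
  set U := T₁.reindex π
  set U' := T₁'.reindex π
  have hy : π.symm x₁ ∉ Set.range e := (not_mem_range_iff hπ x₁).2 hx₁
  have hU : (fun j => U.sigma (e j) (π.symm x₁)) = ![T₁.sigma a₁ x₁, 0, 0, 0, 0] := by
    have h4 := hs.sigma_four_outer hΓ hy
    have h' : ∀ j, U.sigma (e j) (π.symm x₁) = T₁.sigma (![a₁, b₁, c₁, d₁, i₁] j) x₁ :=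
      fun j => by rw [sigma_reindex, hπ, Equiv.apply_symm_apply]
    funext j
    fin_cases j
    · exact h' 0
    · exact (h' 1).trans hb₁
    · exact (h' 2).trans hc₁
    · exact (h' 3).trans hd₁
    · exact h4
  have hrow : ∀ j < (4 : Fin 5), separatedSigma 4 j = restrict e U.sigma 4 j := fun j _ => by
    rw [restrict, hs.sigma_four hΓ j]
    rfl
  have key := exists_one_variable (τ₀ := separatedSigma) (τ₁ := restrict e U.sigma)
    0 4 hrow (fun r => linForm (w r)) ?_ hP hQ ?_ (toFieldOf e U.sigma)
    (toFieldOf_injective e U.sigma) (z U U') (hz U U' hs) ?_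
  · obtain ⟨α, β, hα, h⟩ := key
    refine ⟨α, β, hα, fun T T' hT => ?_⟩
    have h1 := h (restrict e T.sigma) fun j _ => by
      rw [restrict, hT.sigma_four hΓ j, ← hs.sigma_four hΓ j]
    have h2 : toFieldOf e T.sigma ((toLaurent _).symm Q) ≠ 0 := by
      rw [map_ne_zero_iff _ (toFieldOf_injective e T.sigma), Ne, LinearEquiv.map_eq_zero_iff]
      exact hQ
    have h3 := congrArg (toFieldOf e T.sigma) h1
    rw [map_mul, map_mul, ← Polynomial.aeval_algHom_apply, ← Polynomial.aeval_algHom_apply,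
      toFieldOf_gen, ← hz T T' hT, ← mul_assoc] at h3
    exact mul_right_cancel₀ h2 h3
  · intro v h0 hv
    have e0 := hv 0
    have e1 := hv 1
    have e2 := hv 2
    have e3 := hv 3
    simp only [linForm_apply, Fin.sum_univ_five, w] at e0 e1 e2 e3
    simp [h0] at e0 e1 e2 e3
    obtain ⟨v1, v2, v3⟩ := hw (v 1) (v 2) (v 3) e0 e1 e2 e3
    refine ⟨v 4, ?_⟩
    funext j
    fin_cases j <;> simp [h0, v1, v2, v3]
  · intro r A B hAB d
    obtain ⟨V, V', y, hV, hyV, hτ, hl⟩ := hr r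
    rw [← hl]
    revert A B
    rw [← hτ]
    intro A B hAB
    have hq : toFieldOf e V.sigma ((toLaurent _).symm Q) ≠ 0 := by
      rw [map_ne_zero_iff _ (toFieldOf_injective e V.sigma), Ne, LinearEquiv.map_eq_zero_iff]
      exact hQ
    have h1 : toFieldOf e V.sigma A * z V V' = toFieldOf e V.sigma B := by
      refine mul_right_cancel₀ hq ?_
      rw [mul_assoc, hz V V' hV, ← map_mul, ← map_mul, hAB]
    have h2 := comp_left_of_commute e V.sigma_swap (hout V V' hV y hyV) h1 d
    apply toFieldOf_injective e V.sigma
    rw [map_mul, map_mul, ← h2, mul_assoc, hz V V' hV]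
  · intro d
    have h1 := comp_right_of_commute e U.sigma_swap (hout U U' hs _ hy) (hz U U' hs)
      (T₁.sigma a₁ x₁ * d)
    rw [hU] at h1
    have h2 : ∀ f, comp (restrict e U.sigma) (linForm ![T₁.sigma a₁ x₁, 0, 0, 0, 0])
        (T₁.sigma a₁ x₁ * d) f = comp _ (linForm (Pi.single 0 1)) d f := fun f => by
      refine cf_ext _ fun v => ?_
      rw [coeff_comp, coeff_comp]
      congr 1
      simp [linForm_apply, Fin.sum_univ_five, hw₁]
    rwa [h2, h2] at h1

/-! ### Coordinate changes of diagonal exchanges -/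

/-- The conditions on a family of coordinate change isomorphisms. -/
structure IsCoordinateChange (Ψ : ∀ T T' : IdealTriangulation Γ n, T'.K ≃ₐ[Cq] T.K) : Prop where
  comp : ∀ (T T' T'' : IdealTriangulation Γ n) (x : T''.K), Ψ T T'' x = Ψ T T' (Ψ T' T'' x)
  reindex : ∀ (T : IdealTriangulation Γ n) (π : Equiv.Perm (Fin n)) (i : Fin n),
    Ψ T (T.reindex π) ((T.reindex π).X i) = T.X (π i)
  locality : LocalityCondition Ψ

namespace IsCoordinateChange
variable {Ψ : ∀ T T' : IdealTriangulation Γ n, T'.K ≃ₐ[Cq] T.K}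

theorem of_reindex (hΨ : IsCoordinateChange Ψ) (T T' : IdealTriangulation Γ n)
    (π : Equiv.Perm (Fin n)) (j : Fin n) :
    Ψ T T' (T'.X (π j)) = Ψ T (T.reindex π)
      (Ψ (T.reindex π) (T'.reindex π) ((T'.reindex π).X j)) := by
  rw [← hΨ.reindex T' π j, ← hΨ.comp, ← hΨ.comp]

theorem std_outer (hΨ : IsCoordinateChange Ψ) (hΓ : IsSurfaceGroup Γ) {e : Fin 5 ↪o Fin n}
    (he : ∀ j, (e j : ℕ) = j) (h : StdExchange e T T') {x : Fin n} (hx : x ∉ Set.range e) :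
    Ψ T T' (T'.X x) = T.X x := by
  refine (hΨ.locality 5 T T' (EmbeddedExchange.spanIndexed hΓ h (he 0) (he 1) (he 2) (he 3)
    (he 4))).1 x ?_
  by_contra! hlt
  exact hx ⟨⟨x, hlt⟩, Fin.ext (he _)⟩

/-- The new coordinates of the sides and of the diagonal are given by rational functions that do
not depend on the diagonal exchange. -/
theorem exists_ratio (hΨ : IsCoordinateChange Ψ) (hΓ : IsSurfaceGroup Γ) {e : Fin 5 ↪o Fin n}
    (he : ∀ j, (e j : ℕ) = j) (h : StdExchange e T T') (j : Fin 5) :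
    ∃ P Q : Laurent 5, P ≠ 0 ∧ Q ≠ 0 ∧ ∀ U U', StdExchange e U U' →
      Ψ U U' (U'.X (e j)) * toFieldOf e U.sigma ((toLaurent _).symm Q)
        = toFieldOf e U.sigma ((toLaurent _).symm P) := by
  have hspan : ∀ {U U' : IdealTriangulation Γ n}, StdExchange e U U' → SpanIndexed 5 U U' :=
    fun h => EmbeddedExchange.spanIndexed hΓ h (he 0) (he 1) (he 2) (he 3) (he 4)
  obtain ⟨f, hf, hfU⟩ := (hΨ.locality 5 T T' (hspan h)).2 (e j) (by rw [he]; exact j.2)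
  have hrange : ∀ x ∉ Set.range e, 5 ≤ (x : ℕ) := fun x hx => by
    by_contra! hlt
    exact hx ⟨⟨x, hlt⟩, Fin.ext (he _)⟩
  obtain ⟨P, hP⟩ := exists_mapDomain_extendExp e
    fun v hv x hx => f.num_vars v hv x (hrange x hx)
  obtain ⟨Q, hQ⟩ := exists_mapDomain_extendExp e
    fun v hv x hx => f.den_vars v hv x (hrange x hx)
  have hQ0 : Q ≠ 0 := by
    rintro rfl
    exact f.den_ne_zero (by rw [hQ, Finsupp.mapDomain_zero])
  have main : ∀ U U', StdExchange e U U' →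
      Ψ U U' (U'.X (e j)) * toFieldOf e U.sigma ((toLaurent _).symm Q)
        = toFieldOf e U.sigma ((toLaurent _).symm P) := fun U U' hU => by
    have h1 := hfU U U' (hspan hU)
      (EmbeddedExchange.spanDiffeo hΓ h hU (he 0) (he 1) (he 2) (he 3) (he 4))
    rw [RationalFunction.eval, hP, hQ, evalLaurent_mapDomain, evalLaurent_mapDomain] at h1
    rw [h1, inv_mul_cancel_right₀]
    rw [map_ne_zero_iff _ (toFieldOf_injective e U.sigma), Ne, LinearEquiv.map_eq_zero_iff]
    exact hQ0
  refine ⟨P, Q, ?_, hQ0, main⟩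
  rintro rfl
  have h1 := main T T' h
  rw [map_zero, map_zero, mul_eq_zero, map_eq_zero_iff _ (Ψ T T').injective,
    map_eq_zero_iff _ (toFieldOf_injective e T.sigma), LinearEquiv.map_eq_zero_iff] at h1
  exact h1.elim (gen_ne_zero _) hQ0

/-- The new coordinate of the diagonal, and the quotient of the new and old coordinates of a side,
are rational functions of the old coordinate of the diagonal that do not depend on the diagonal
exchange. -/
theorem exists_transition (hΨ : IsCoordinateChange Ψ) (hΓ : IsSurfaceGroup Γ)
    {e : Fin 5 ↪o Fin n} (he : ∀ j, (e j : ℕ) = j) (h : StdExchange e T T')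
    (hsep : HasSeparatingSquare Γ n) (hunit : HasUnitSquare Γ n) :
    ∃ α β α' β' : Polynomial Cq, α ≠ 0 ∧ α' ≠ 0 ∧
      ∀ (T T' : IdealTriangulation Γ n) (a b c d i : Fin n), T.EmbeddedExchange T' a b c d i →
        Polynomial.aeval (T.X i) α * Ψ T T' (T'.X i) = Polynomial.aeval (T.X i) β ∧
        Polynomial.aeval (T.X i) α' * Ψ T T' (T'.X a) = Polynomial.aeval (T.X i) β' * T.X a := by
  obtain ⟨P, Q, hP, hQ, hPQ⟩ := hΨ.exists_ratio hΓ he h 4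
  obtain ⟨P', Q', hP', hQ', hPQ'⟩ := hΨ.exists_ratio hΓ he h 0
  obtain ⟨α, β, hα, h4⟩ := exists_one_variable_of_commute hΓ hsep hunit e hP hQ
    (fun T T' => Ψ T T' (T'.X (e 4))) hPQ (fun T T' hT x hx => by
      have h1 := gen_mul_gen T'.sigma_swap (e 4) x
      rw [hT.symm_sigma_four_outer hΓ hx, mul_zero, zpow_zero, one_smul] at h1
      have h2 := congrArg (Ψ T T') h1
      rw [map_mul, map_mul, hΨ.std_outer hΓ he hT hx] at h2
      exact h2)
  obtain ⟨α', β', hα', h0⟩ := exists_one_variable_of_commute hΓ hsep hunit e hP'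
    (Q := Q'.mapDomain (Pi.single 0 1 + ·))
    (by
      intro h
      exact hQ' (Finsupp.mapDomain_injective (add_right_injective _)
        (h.trans Finsupp.mapDomain_zero.symm)))
    (fun T T' => Ψ T T' (T'.X (e 0)) * (T.X (e 0))⁻¹)
    (fun T T' hT => by
      rw [← mono_single_mul_of_le 0 (fun j => Fin.zero_le j), map_mul, toFieldOf_gen, mul_assoc,
        inv_mul_cancel_left₀ (gen_ne_zero _), hPQ' T T' hT])
    (fun T T' hT x hx => by
      have h1 := gen_mul_gen T'.sigma_swap (e 0) x
      have h2 := congrArg (Ψ T T') h1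
      rw [map_mul, map_smul, map_mul, hΨ.std_outer hΓ he hT hx, hT.sigma_zero_outer hΓ hx] at h2
      have h3 := gen_mul_gen T.sigma_swap (e 0) x
      have h4 : (T.X (e 0))⁻¹ * T.X x
          = (q ^ (2 * T.sigma (e 0) x))⁻¹ • (T.X x * (T.X (e 0))⁻¹) := by
        rw [inv_mul_eq_iff_eq_mul₀ (gen_ne_zero _), mul_smul_comm, ← mul_assoc, h3,
          smul_mul_assoc, mul_assoc, mul_inv_cancel₀ (gen_ne_zero _), mul_one, smul_smul,
          inv_mul_cancel₀ (zpow_ne_zero _ q_ne_zero), one_smul]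
      change _ * _ = _ * _
      rw [mul_assoc, h4, mul_smul_comm, ← mul_assoc, h2, smul_mul_assoc, smul_smul,
        inv_mul_cancel₀ (zpow_ne_zero _ q_ne_zero), one_smul, mul_assoc])
  refine ⟨α, β, α', β', hα, hα', fun T T' a b c d i hT => ?_⟩
  obtain ⟨π, hπ, hs⟩ := hT.exists_std e
  have hi : π (e 4) = i := hπ 4
  have ha : π (e 0) = a := hπ 0
  have h1 := congrArg (Ψ T (T.reindex π)) (h4 _ _ hs)
  have h2 := congrArg (Ψ T (T.reindex π)) (h0 _ _ hs)
  rw [map_mul, ← Polynomial.aeval_algHom_apply, ← Polynomial.aeval_algHom_apply,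
    ← hΨ.of_reindex, hΨ.reindex, hi] at h1
  rw [map_mul, ← Polynomial.aeval_algHom_apply, ← Polynomial.aeval_algHom_apply, map_mul,
    ← hΨ.of_reindex, map_inv₀, hΨ.reindex, hΨ.reindex, hi, ha, ← mul_assoc,
    mul_inv_eq_iff_eq_mul₀ (gen_ne_zero _)] at h2
  exact ⟨h1, h2⟩

end IsCoordinateChange

end IdealTriangulation
end QuantumTeichmuller

namespace QuantumTeichmuller

/-! ### Rational functions evaluated in division algebras -/

section ratEval
open Polynomial
variable {F : Type*} [Field F] {K : Type*} [DivisionRing K] [Algebra F K]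

theorem aeval_ne_zero {x : K} (hx : Transcendental F x) {p : F[X]} (hp : p ≠ 0) :
    aeval x p ≠ 0 := fun h => hp ((transcendental_iff.1 hx) p h)

theorem commute_aeval (x : K) (p r : F[X]) : Commute (aeval x p) (aeval x r) := by
  rw [Commute, SemiconjBy, ← map_mul, ← map_mul, mul_comm]

theorem aeval_ratio_eq {x : K} (hx : Transcendental F x) {p r p' r' : F[X]} (hr : r ≠ 0)
    (hr' : r' ≠ 0) (h : p * r' = p' * r) :
    aeval x p * (aeval x r)⁻¹ = aeval x p' * (aeval x r')⁻¹ := by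
  rw [mul_inv_eq_iff_eq_mul₀ (aeval_ne_zero hx hr), mul_assoc,
    ((commute_aeval x r r').inv_right₀.eq).symm, ← mul_assoc, ← map_mul, ← h, map_mul,
    mul_inv_cancel_right₀ (aeval_ne_zero hx hr')]

theorem aeval_ratio_mul (x : K) (p r p' r' : F[X]) :
    aeval x p * (aeval x r)⁻¹ * (aeval x p' * (aeval x r')⁻¹)
      = aeval x (p * p') * (aeval x (r * r'))⁻¹ := by
  rw [mul_assoc, ← mul_assoc _ (aeval x p'), ← ((commute_aeval x p' r).inv_right₀).eq, map_mul,
    mul_comm r, map_mul, _root_.mul_inv_rev]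
  simp only [mul_assoc]

theorem aeval_ratio_add {x : K} (hx : Transcendental F x) (p p' : F[X]) {r r' : F[X]}
    (hr : r ≠ 0) (hr' : r' ≠ 0) :
    aeval x p * (aeval x r)⁻¹ + aeval x p' * (aeval x r')⁻¹
      = aeval x (p * r' + r * p') * (aeval x (r * r'))⁻¹ := by
  have h1 : aeval x p * (aeval x r)⁻¹ = aeval x (p * r') * (aeval x (r * r'))⁻¹ :=
    aeval_ratio_eq hx hr (mul_ne_zero hr hr') (by ring)
  have h2 : aeval x p' * (aeval x r')⁻¹ = aeval x (r * p') * (aeval x (r * r'))⁻¹ :=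
    aeval_ratio_eq hx hr' (mul_ne_zero hr hr') (by ring)
  rw [h1, h2, ← add_mul, ← map_add]

/-- The value at a transcendental element of a division algebra of a rational function in one
variable. -/
def ratEval (x : K) (hx : Transcendental F x) : RatFunc F →ₐ[F] K where
  toFun f := aeval x f.num * (aeval x f.denom)⁻¹
  map_one' := by simp
  map_zero' := by simp
  map_mul' f g := by
    rw [aeval_ratio_mul]
    refine aeval_ratio_eq hx (f * g).denom_ne_zero (mul_ne_zero f.denom_ne_zero g.denom_ne_zero) ?_
    rw [RatFunc.num_denom_mul]
  map_add' f g := by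
    rw [aeval_ratio_add hx _ _ f.denom_ne_zero g.denom_ne_zero]
    refine aeval_ratio_eq hx (f + g).denom_ne_zero (mul_ne_zero f.denom_ne_zero g.denom_ne_zero) ?_
    rw [RatFunc.num_denom_add]
  commutes' c := by
    rw [RatFunc.algebraMap_eq_C, RatFunc.num_C, RatFunc.denom_C]
    simp

variable {x : K} (hx : Transcendental F x)

theorem ratEval_algebraMap (p : F[X]) :
    ratEval x hx (algebraMap F[X] (RatFunc F) p) = aeval x p := by
  change aeval x _ * (aeval x _)⁻¹ = _
  simp

theorem ratEval_X : ratEval x hx RatFunc.X = x := by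
  rw [← RatFunc.algebraMap_X, ratEval_algebraMap, aeval_X]

theorem eq_ratEval_div {p r : F[X]} (hr : r ≠ 0) {y : K} (h : aeval x r * y = aeval x p) :
    y = ratEval x hx (algebraMap F[X] _ p / algebraMap F[X] _ r) := by
  have h1 : ratEval x hx (algebraMap F[X] _ r) ≠ 0 := by
    rw [ratEval_algebraMap]; exact aeval_ne_zero hx hr
  apply mul_left_cancel₀ h1
  rw [← map_mul, mul_div_cancel₀ _ (RatFunc.algebraMap_ne_zero hr), ratEval_algebraMap,
    ratEval_algebraMap, h]

/-- Semiconjugations extend to rational functions. -/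
theorem semiconjBy_ratEval {u y : K} {hx : Transcendental F x} {hy : Transcendental F y}
    (h : SemiconjBy u x y) (f : RatFunc F) :
    SemiconjBy u (ratEval x hx f) (ratEval y hy f) := by
  have hp : ∀ p : F[X], SemiconjBy u (aeval x p) (aeval y p) := fun p => by
    induction p using Polynomial.induction_on' with
    | add p r hp hr => rw [map_add, map_add]; exact hp.add_right hr
    | monomial m a =>
      rw [aeval_monomial, aeval_monomial]
      exact SemiconjBy.mul_right (Algebra.commutes a u).symm (h.pow_right m)
  exact (hp _).mul_right (hp _).inv_right₀

theorem algHom_ratEval {L : Type*} [DivisionRing L] [Algebra F L] (φ : K →ₐ[F] L) {y : L}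
    (hy : Transcendental F y) (h : φ x = y) (f : RatFunc F) :
    φ (ratEval x hx f) = ratEval y hy f := by
  subst h
  change φ (aeval x _ * (aeval x _)⁻¹) = aeval (φ x) _ * (aeval (φ x) _)⁻¹
  rw [map_mul, map_inv₀, Polynomial.aeval_algHom_apply, Polynomial.aeval_algHom_apply]

theorem Transcendental.algHom {L : Type*} [DivisionRing L] [Algebra F L] (φ : K →ₐ[F] L)
    (h : Transcendental F x) : Transcendental F (φ x) :=
  transcendental_iff.2 fun p hp => transcendental_iff.1 h p <| by
    rwa [Polynomial.aeval_algHom_apply, map_eq_zero_iff φ φ.toRingHom.injective] at hp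

theorem ratEval_congr {y : K} (hy : Transcendental F y) (h : x = y) (f : RatFunc F) :
    ratEval x hx f = ratEval y hy f := by
  subst h; rfl

theorem ratFunc_induction {P : RatFunc F → Prop} (h : ∀ p r : F[X], r ≠ 0 →
    P (algebraMap F[X] _ p / algebraMap F[X] _ r)) (f : RatFunc F) : P f := by
  rw [← RatFunc.num_div_denom f]
  exact h _ _ f.denom_ne_zero

theorem transcendental_unit_smul_X (a : Fˣ) :
    Transcendental F ((a : F) • (RatFunc.X : RatFunc F)) := fun h => by
  have h1 := h.smul (a⁻¹ : F)
  rw [smul_smul, inv_mul_cancel₀ a.ne_zero, one_smul] at h1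
  exact RatFunc.transcendental_X h1

theorem transcendental_unit_smul_X_inv (a : Fˣ) :
    Transcendental F ((a : F) • (RatFunc.X : RatFunc F)⁻¹) := fun h => by
  have h1 := h.smul (a⁻¹ : F)
  rw [smul_smul, inv_mul_cancel₀ a.ne_zero, one_smul] at h1
  have h2 := h1.inv
  rw [inv_inv] at h2
  exact RatFunc.transcendental_X h2

/-- The substitution `f(X) ↦ f(a X)`. -/
def dilate (a : Fˣ) : RatFunc F →ₐ[F] RatFunc F :=
  ratEval ((a : F) • RatFunc.X) (transcendental_unit_smul_X a)

/-- The substitution `f(X) ↦ f(a X⁻¹)`. -/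
def flip (a : Fˣ) : RatFunc F →ₐ[F] RatFunc F :=
  ratEval ((a : F) • RatFunc.X⁻¹) (transcendental_unit_smul_X_inv a)

theorem dilate_X (a : Fˣ) : dilate a RatFunc.X = (a : F) • (RatFunc.X : RatFunc F) := ratEval_X _

theorem flip_X (a : Fˣ) : flip a RatFunc.X = (a : F) • (RatFunc.X : RatFunc F)⁻¹ := ratEval_X _

theorem ratEval_dilate (a : Fˣ) {y : K} (hy : Transcendental F y) (h : y = (a : F) • x)
    (f : RatFunc F) : ratEval x hx (dilate a f) = ratEval y hy f :=
  algHom_ratEval _ _ _ (by rw [map_smul, ratEval_X, h]) f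

theorem ratEval_flip (a : Fˣ) {y : K} (hy : Transcendental F y) (h : y = (a : F) • x⁻¹)
    (f : RatFunc F) : ratEval x hx (flip a f) = ratEval y hy f :=
  algHom_ratEval _ _ _ (by rw [map_smul, map_inv₀, ratEval_X, h]) f

theorem transcendental_unit_smul (hx : Transcendental F x) (a : Fˣ) :
    Transcendental F ((a : F) • x) := by
  have := Transcendental.algHom (ratEval x hx) (transcendental_unit_smul_X a)
  rwa [map_smul, ratEval_X] at this

theorem transcendental_unit_smul_inv (hx : Transcendental F x) (a : Fˣ) :
    Transcendental F ((a : F) • x⁻¹) := by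
  have := Transcendental.algHom (ratEval x hx) (transcendental_unit_smul_X_inv a)
  rwa [map_smul, map_inv₀, ratEval_X] at this

theorem dilate_dilate (a b : Fˣ) (f : RatFunc F) : dilate a (dilate b f) = dilate (a * b) f :=
  have h : ((a * b : Fˣ) : F) • (RatFunc.X : RatFunc F) = (b : F) • (a : F) • RatFunc.X := by
    rw [smul_smul, Units.val_mul, mul_comm (a : F)]
  ratEval_dilate (transcendental_unit_smul_X a) b (transcendental_unit_smul_X (a * b)) h f

theorem dilate_flip (a b : Fˣ) (f : RatFunc F) : dilate a (flip b f) = flip (b * a⁻¹) f :=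
  ratEval_flip _ _ _ (by
    rw [smul_inv₀, smul_smul, Units.val_mul, Units.val_inv_eq_inv_val]) f

theorem flip_dilate (a b : Fˣ) (f : RatFunc F) : flip a (dilate b f) = flip (a * b) f :=
  have h : ((a * b : Fˣ) : F) • (RatFunc.X : RatFunc F)⁻¹ = (b : F) • (a : F) • RatFunc.X⁻¹ := by
    rw [smul_smul, Units.val_mul, mul_comm (a : F)]
  ratEval_dilate (transcendental_unit_smul_X_inv a) b (transcendental_unit_smul_X_inv (a * b)) h f

theorem ratEval_X_self (f : RatFunc F) :
    ratEval (RatFunc.X : RatFunc F) (RatFunc.transcendental_X (K := F)) f = f := by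
  induction f using ratFunc_induction with
  | h p r hr =>
    rw [map_div₀, ratEval_algebraMap, ratEval_algebraMap, RatFunc.aeval_X_left_eq_algebraMap,
      RatFunc.aeval_X_left_eq_algebraMap]

theorem flip_flip (a b : Fˣ) (f : RatFunc F) : flip a (flip b f) = dilate (b * a⁻¹) f :=
  ratEval_flip _ _ _ (by
    rw [smul_inv₀, inv_inv, smul_smul, Units.val_mul, Units.val_inv_eq_inv_val]) f

theorem dilate_one (f : RatFunc F) : dilate 1 f = f := by
  have h : ((1 : Fˣ) : F) • (RatFunc.X : RatFunc F) = RatFunc.X := by rw [Units.val_one, one_smul]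
  exact (ratEval_congr _ (RatFunc.transcendental_X (K := F)) h f).trans (ratEval_X_self f)

end ratEval
end QuantumTeichmuller

namespace QuantumTeichmuller

/-! ### Expansions of rational functions at the origin -/

section expansions
open Polynomial
variable {F : Type*} [Field F]

theorem unit_smul_zpow {K : Type*} [DivisionRing K] [Algebra F K] (a : Fˣ) (x : K) (e : ℤ) :
    ((a : F) • x) ^ e = ((a ^ e : Fˣ) : F) • x ^ e := by
  rw [Algebra.smul_def, (Algebra.commute_algebraMap_left (a : F) x).mul_zpow, ← map_zpow₀,
    ← Algebra.smul_def, Units.val_zpow_eq_zpow_val]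

/-- The rational functions without pole at `0`. -/
def regular (F : Type*) [Field F] : Subalgebra F (RatFunc F) where
  carrier := {f | ∃ p d : F[X], d.coeff 0 ≠ 0 ∧
    f * algebraMap F[X] (RatFunc F) d = algebraMap F[X] (RatFunc F) p}
  mul_mem' := by
    rintro f g ⟨p, d, hd, h⟩ ⟨p', d', hd', h'⟩
    refine ⟨p * p', d * d', ?_, ?_⟩
    · rw [mul_coeff_zero]; exact mul_ne_zero hd hd'
    · rw [map_mul, map_mul, ← h, ← h']; ring
  add_mem' := by
    rintro f g ⟨p, d, hd, h⟩ ⟨p', d', hd', h'⟩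
    refine ⟨p * d' + p' * d, d * d', ?_, ?_⟩
    · rw [mul_coeff_zero]; exact mul_ne_zero hd hd'
    · rw [map_mul, map_add, map_mul, map_mul, ← h, ← h']; ring
  algebraMap_mem' c := by
    refine ⟨C c, 1, by simp, ?_⟩
    rw [map_one, mul_one, RatFunc.algebraMap_C]
    rfl

theorem algebraMap_mem_regular (p : F[X]) : algebraMap F[X] (RatFunc F) p ∈ regular F :=
  ⟨p, 1, by simp, by simp⟩

theorem X_mem_regular : (RatFunc.X : RatFunc F) ∈ regular F := by
  rw [← RatFunc.algebraMap_X]; exact algebraMap_mem_regular _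

theorem dilate_algebraMap (a : Fˣ) (p : F[X]) :
    dilate a (algebraMap F[X] (RatFunc F) p)
      = algebraMap F[X] (RatFunc F) (p.comp (C (a : F) * X)) := by
  rw [dilate, ratEval_algebraMap, ← RatFunc.aeval_X_left_eq_algebraMap, aeval_comp, map_mul,
    aeval_C, aeval_X, Algebra.smul_def]

theorem dilate_mem_regular (a : Fˣ) {f : RatFunc F} (hf : f ∈ regular F) :
    dilate a f ∈ regular F := by
  obtain ⟨p, d, hd, h⟩ := hf
  refine ⟨p.comp (C (a : F) * X), d.comp (C (a : F) * X), ?_, by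
    rw [← dilate_algebraMap, ← map_mul, h, dilate_algebraMap]⟩
  rw [coeff_zero_eq_eval_zero, eval_comp]
  simpa [coeff_zero_eq_eval_zero] using hd

/-- The rational functions with value `1` at `0`. -/
def IsOneUnit (u : RatFunc F) : Prop := ∃ r ∈ regular F, u = 1 + RatFunc.X * r

theorem isOneUnit_one : IsOneUnit (1 : RatFunc F) := ⟨0, zero_mem _, by simp⟩

namespace IsOneUnit
variable {u v : RatFunc F}

theorem mul (hu : IsOneUnit u) (hv : IsOneUnit v) : IsOneUnit (u * v) := by
  obtain ⟨r, hr, rfl⟩ := hu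
  obtain ⟨s, hs, rfl⟩ := hv
  exact ⟨r + s + RatFunc.X * (r * s),
    add_mem (add_mem hr hs) (mul_mem X_mem_regular (mul_mem hr hs)), by ring⟩

theorem mem_regular (hu : IsOneUnit u) : u ∈ regular F := by
  obtain ⟨r, hr, rfl⟩ := hu
  exact add_mem (one_mem _) (mul_mem X_mem_regular hr)

theorem exists_ratio (hu : IsOneUnit u) : ∃ p d : F[X], p.coeff 0 ≠ 0 ∧ d.coeff 0 ≠ 0 ∧
    u * algebraMap F[X] (RatFunc F) d = algebraMap F[X] (RatFunc F) p := by
  obtain ⟨r, ⟨p, d, hd, h⟩, rfl⟩ := hu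
  refine ⟨d + X * p, d, by simpa using hd, hd, ?_⟩
  rw [add_mul, mul_assoc, h, map_add, map_mul, RatFunc.algebraMap_X, one_mul]

theorem ne_zero (hu : IsOneUnit u) : u ≠ 0 := by
  obtain ⟨p, d, hp, hd, h⟩ := hu.exists_ratio
  rintro rfl
  rw [zero_mul] at h
  have := (map_eq_zero_iff _ (RatFunc.algebraMap_injective F)).1 h.symm
  simp [this] at hp

theorem inv (hu : IsOneUnit u) : IsOneUnit u⁻¹ := by
  have h0 := hu.ne_zero
  obtain ⟨p, d, hp, hd, h⟩ := hu.exists_ratio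
  have hp0 : algebraMap F[X] (RatFunc F) p ≠ 0 :=
    RatFunc.algebraMap_ne_zero (by rintro rfl; simp at hp)
  have hinv : u⁻¹ ∈ regular F := by
    refine ⟨d, p, hp, ?_⟩
    rw [← h, inv_mul_cancel_left₀ h0]
  obtain ⟨r, hr, hu'⟩ := hu
  refine ⟨-(r * u⁻¹), neg_mem (mul_mem hr hinv), ?_⟩
  apply mul_left_cancel₀ h0
  rw [mul_inv_cancel₀ h0, mul_add, mul_one, mul_neg, mul_neg]
  have h1 : u * (RatFunc.X * (r * u⁻¹)) = RatFunc.X * r := by field_simp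
  rw [h1, hu']; ring

theorem dilate (a : Fˣ) (hu : IsOneUnit u) : IsOneUnit (dilate a u) := by
  obtain ⟨r, hr, rfl⟩ := hu
  refine ⟨(a : F) • QuantumTeichmuller.dilate a r,
    Subalgebra.smul_mem _ (dilate_mem_regular a hr) _, ?_⟩
  rw [map_add, map_one, map_mul, dilate_X, smul_mul_assoc, mul_smul_comm]

end IsOneUnit

/-- The Laurent expansion at `0`. -/
def toLaurentSeries (F : Type*) [Field F] : RatFunc F →+* LaurentSeries F :=
  RatFunc.liftRingHom ((HahnSeries.ofPowerSeries ℤ F).comp coeToPowerSeries.ringHom)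
    (nonZeroDivisors_le_comap_nonZeroDivisors_of_injective _
      (HahnSeries.ofPowerSeries_injective.comp (Polynomial.coe_injective F)))

theorem toLaurentSeries_algebraMap (p : F[X]) :
    toLaurentSeries F (algebraMap F[X] _ p)
      = HahnSeries.ofPowerSeries ℤ F (p : PowerSeries F) :=
  RatFunc.liftRingHom_algebraMap _ _ _

theorem toLaurentSeries_X : toLaurentSeries F RatFunc.X = HahnSeries.single 1 1 := by
  rw [← RatFunc.algebraMap_X, toLaurentSeries_algebraMap, Polynomial.coe_X,
    HahnSeries.ofPowerSeries_X]

/-- The coefficient of `X ^ N` in the Laurent expansion at `0`. -/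
def laurentCoeff (N : ℤ) : RatFunc F →ₗ[F] F where
  toFun f := (toLaurentSeries F f).coeff N
  map_add' f g := by simp
  map_smul' c f := by
    rw [RatFunc.smul_eq_C_mul, map_mul, ← RatFunc.algebraMap_C, toLaurentSeries_algebraMap,
      Polynomial.coe_C, HahnSeries.ofPowerSeries_C, HahnSeries.C_mul_eq_smul]
    rfl

theorem laurentCoeff_zpow (N e : ℤ) :
    laurentCoeff N ((RatFunc.X : RatFunc F) ^ e) = if N = e then 1 else 0 := by
  change (toLaurentSeries F (RatFunc.X ^ e)).coeff N = _
  rw [map_zpow₀, toLaurentSeries_X, ← RatFunc.single_zpow, HahnSeries.coeff_single]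
  split_ifs <;> rfl

theorem laurentCoeff_zpow_mul {N e : ℤ} (h : N < e) {r : RatFunc F} (hr : r ∈ regular F) :
    laurentCoeff N (RatFunc.X ^ e * r) = 0 := by
  obtain ⟨p, d, hd, hpd⟩ := hr
  have h1 : (d : PowerSeries F) * (d : PowerSeries F)⁻¹ = 1 :=
    PowerSeries.mul_inv_cancel _ (by simpa using hd)
  have h2 : toLaurentSeries F r
      = HahnSeries.ofPowerSeries ℤ F ((p : PowerSeries F) * (d : PowerSeries F)⁻¹) := by
    have h3 := congrArg (toLaurentSeries F) hpd
    rw [map_mul, toLaurentSeries_algebraMap, toLaurentSeries_algebraMap] at h3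
    rw [map_mul, ← h3, mul_assoc, ← map_mul, h1, map_one, mul_one]
  change (toLaurentSeries F (RatFunc.X ^ e * r)).coeff N = 0
  rw [map_mul, map_zpow₀, h2, toLaurentSeries_X, ← RatFunc.single_zpow,
    show N = (N - e) + e by ring, HahnSeries.coeff_single_mul_add, one_mul,
    PowerSeries.coeff_coe, if_pos (by omega)]

/-- The expansion of `f` at `0` starts with `β X ^ e`. -/
def HasLead (f : RatFunc F) (e : ℤ) (β : F) : Prop :=
  ∃ u, IsOneUnit u ∧ f = β • (RatFunc.X ^ e * u)

namespace HasLead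
variable {f g : RatFunc F} {e e' : ℤ} {β β' : F}

theorem zpow (e : ℤ) : HasLead ((RatFunc.X : RatFunc F) ^ e) e 1 :=
  ⟨1, isOneUnit_one, by simp⟩

theorem one : HasLead (1 : RatFunc F) 0 1 := ⟨1, isOneUnit_one, by simp⟩

theorem mul (hf : HasLead f e β) (hg : HasLead g e' β') : HasLead (f * g) (e + e') (β * β') := by
  obtain ⟨u, hu, rfl⟩ := hf
  obtain ⟨v, hv, rfl⟩ := hg
  refine ⟨u * v, hu.mul hv, ?_⟩
  rw [smul_mul_smul_comm, zpow_add₀ RatFunc.X_ne_zero]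
  congr 1
  ring

theorem inv (hf : HasLead f e β) : HasLead f⁻¹ (-e) β⁻¹ := by
  obtain ⟨u, hu, rfl⟩ := hf
  refine ⟨u⁻¹, hu.inv, ?_⟩
  rw [smul_inv₀, _root_.mul_inv, _root_.zpow_neg]

theorem smul (c : F) (hf : HasLead f e β) : HasLead (c • f) e (c * β) := by
  obtain ⟨u, hu, rfl⟩ := hf
  exact ⟨u, hu, by rw [smul_smul]⟩

theorem dilate (a : Fˣ) (hf : HasLead f e β) :
    HasLead (dilate a f) e (((a ^ e : Fˣ) : F) * β) := by
  obtain ⟨u, hu, rfl⟩ := hf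
  refine ⟨_, hu.dilate a, ?_⟩
  rw [map_smul, map_mul, map_zpow₀, dilate_X, unit_smul_zpow, smul_mul_assoc, smul_smul,
    mul_comm β]

theorem laurentCoeff (hf : HasLead f e β) : laurentCoeff e f = β := by
  obtain ⟨u, ⟨r, hr, rfl⟩, rfl⟩ := hf
  rw [map_smul, mul_add, mul_one, map_add, laurentCoeff_zpow, if_pos rfl, ← mul_assoc,
    ← zpow_add_one₀ RatFunc.X_ne_zero, laurentCoeff_zpow_mul (by omega) hr]
  simp

theorem laurentCoeff_lt (hf : HasLead f e β) {N : ℤ} (hN : N < e) :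
    QuantumTeichmuller.laurentCoeff N f = 0 := by
  obtain ⟨u, hu, rfl⟩ := hf
  rw [map_smul, laurentCoeff_zpow_mul hN hu.mem_regular, smul_zero]

theorem order_unique (hf : HasLead f e β) (hβ : β ≠ 0) (hf' : HasLead f e' β') (hβ' : β' ≠ 0) :
    e = e' := by
  rcases lt_trichotomy e e' with h | h | h
  · exact absurd (hf.laurentCoeff.symm.trans (hf'.laurentCoeff_lt h)) hβ
  · exact h
  · exact absurd (hf'.laurentCoeff.symm.trans (hf.laurentCoeff_lt h)) hβ'

theorem coeff_unique (hf : HasLead f e β) (hf' : HasLead f e β') : β = β' :=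
  hf.laurentCoeff.symm.trans hf'.laurentCoeff

theorem ne_zero (hf : HasLead f e β) (hβ : β ≠ 0) : f ≠ 0 := by
  rintro rfl
  exact hβ (by rw [← hf.laurentCoeff, map_zero])

theorem prod_range (f : ℕ → RatFunc F) (β : ℕ → F) (h : ∀ j, HasLead (f j) e (β j)) (l : ℕ) :
    HasLead (∏ j ∈ Finset.range l, f j) (e * l) (∏ j ∈ Finset.range l, β j) := by
  induction l with
  | zero => simpa using one
  | succ l ih =>
    rw [Finset.prod_range_succ, Finset.prod_range_succ]
    have := ih.mul (h l)
    rwa [show e * l + e = e * ((l + 1 : ℕ) : ℤ) by push_cast; ring] at this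

end HasLead

theorem exists_X_pow_mul {p : F[X]} (hp : p ≠ 0) :
    ∃ (k : ℕ) (r : F[X]), p = X ^ k * r ∧ r.coeff 0 ≠ 0 := by
  obtain ⟨r, hr, hdvd⟩ := exists_eq_pow_rootMultiplicity_mul_and_not_dvd p hp 0
  rw [map_zero, sub_zero] at hr hdvd
  exact ⟨_, r, hr, fun h => hdvd (X_dvd_iff.2 h)⟩

theorem isOneUnit_div {p d : F[X]} (hp : p.coeff 0 = 1) (hd : d.coeff 0 = 1) :
    IsOneUnit (algebraMap F[X] (RatFunc F) p / algebraMap F[X] (RatFunc F) d) := by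
  have h : ∀ {p : F[X]}, p.coeff 0 = 1 → IsOneUnit (algebraMap F[X] (RatFunc F) p) :=
    fun {p} hp => ⟨_, algebraMap_mem_regular p.divX, by
      conv_lhs => rw [← divX_mul_X_add p, hp]
      simp [mul_comm, add_comm]⟩
  rw [div_eq_mul_inv]
  exact (h hp).mul (h hd).inv

/-- A non-zero rational function is the product of a power of `X` and a quotient of polynomials
with non-zero constant terms. -/
theorem exists_ratio {f : RatFunc F} (hf : f ≠ 0) : ∃ (e : ℤ) (p d : F[X]),
    p.coeff 0 ≠ 0 ∧ d.coeff 0 = 1 ∧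
    f = RatFunc.X ^ e * (algebraMap F[X] (RatFunc F) p / algebraMap F[X] (RatFunc F) d) := by
  obtain ⟨k, p, hp, hp0⟩ := exists_X_pow_mul (RatFunc.num_ne_zero hf)
  obtain ⟨l, d, hd, hd0⟩ := exists_X_pow_mul f.denom_ne_zero
  refine ⟨k - l, C (d.coeff 0)⁻¹ * p, C (d.coeff 0)⁻¹ * d, ?_, ?_, ?_⟩
  · rw [mul_coeff_zero, coeff_C_zero]
    exact mul_ne_zero (inv_ne_zero hd0) hp0
  · rw [mul_coeff_zero, coeff_C_zero, inv_mul_cancel₀ hd0]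
  · have hC : algebraMap F[X] (RatFunc F) (C (d.coeff 0)⁻¹) ≠ 0 :=
      RatFunc.algebraMap_ne_zero (C_ne_zero.2 (inv_ne_zero hd0))
    conv_lhs => rw [← RatFunc.num_div_denom f, hp, hd]
    rw [map_mul, map_mul, map_mul, map_mul, mul_div_mul_left _ _ hC, map_pow, map_pow,
      RatFunc.algebraMap_X, zpow_sub₀ RatFunc.X_ne_zero, zpow_natCast, zpow_natCast,
      mul_div_mul_comm]

theorem hasLead_ratio (e : ℤ) {p d : F[X]} (hp : p.coeff 0 ≠ 0) (hd : d.coeff 0 = 1) :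
    HasLead (RatFunc.X ^ e * (algebraMap F[X] (RatFunc F) p / algebraMap F[X] (RatFunc F) d)) e
      (p.coeff 0) := by
  refine ⟨_, isOneUnit_div (p := C (p.coeff 0)⁻¹ * p) ?_ hd, ?_⟩
  · rw [mul_coeff_zero, coeff_C_zero, inv_mul_cancel₀ hp]
  · have hC : RatFunc.C (p.coeff 0) * RatFunc.C (p.coeff 0)⁻¹ = 1 := by
      rw [← map_mul, mul_inv_cancel₀ hp, map_one]
    rw [map_mul, RatFunc.algebraMap_C, RatFunc.smul_eq_C_mul]
    calc _ = RatFunc.C (p.coeff 0) * RatFunc.C (p.coeff 0)⁻¹ * (RatFunc.X ^ e *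
          (algebraMap F[X] (RatFunc F) p / algebraMap F[X] (RatFunc F) d)) := by rw [hC, one_mul]
      _ = _ := by ring

theorem exists_hasLead {f : RatFunc F} (hf : f ≠ 0) : ∃ e β, β ≠ 0 ∧ HasLead f e β := by
  obtain ⟨e, p, d, hp, hd, rfl⟩ := exists_ratio hf
  exact ⟨e, _, hp, hasLead_ratio e hp hd⟩

/-- A rational function that is invariant under a dilation of infinite order is constant. -/
theorem eq_const_of_dilate_eq {a : Fˣ} (ha : ∀ m : ℤ, a ^ m = 1 → m = 0) {f : RatFunc F}
    (hf : dilate a f = f) : ∃ k : F, f = k • (1 : RatFunc F) := by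
  have key : ∀ f : RatFunc F, dilate a f = f → f ≠ 0 → ∃ β, β ≠ 0 ∧ HasLead f 0 β := by
    intro f hf h0
    obtain ⟨e, β, hβ, h⟩ := exists_hasLead h0
    have h1 := h.dilate a
    rw [hf] at h1
    have h2 := h.coeff_unique h1
    have h3 : a ^ e = 1 := by
      rw [eq_comm, mul_eq_right₀ hβ] at h2
      exact Units.ext h2
    rw [ha e h3] at h
    exact ⟨β, hβ, h⟩
  by_cases h0 : f = 0
  · exact ⟨0, by rw [h0, zero_smul]⟩
  obtain ⟨β, hβ, u, ⟨r, hr, rfl⟩, h⟩ := key f hf h0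
  refine ⟨β, ?_⟩
  by_contra hne
  obtain ⟨β', hβ', h'⟩ := key (f - β • 1) (by rw [map_sub, hf, map_smul, map_one])
    (sub_ne_zero.2 hne)
  refine hβ' (h'.laurentCoeff.symm.trans ?_)
  rw [h, zpow_zero, one_mul, smul_add, add_sub_cancel_left, map_smul]
  have := laurentCoeff_zpow_mul (N := 0) (e := 1) (by norm_num) hr
  rw [zpow_one] at this
  rw [this, smul_zero]

/-- An eigenvector of a dilation of infinite order is a monomial. -/
theorem eq_zpow_of_dilate_eq {a : Fˣ} (ha : ∀ m : ℤ, a ^ m = 1 → m = 0) {f : RatFunc F} {N : ℤ}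
    (hf : dilate a f = ((a ^ N : Fˣ) : F) • f) : ∃ k : F, f = k • (RatFunc.X : RatFunc F) ^ N := by
  obtain ⟨k, hk⟩ := eq_const_of_dilate_eq ha (f := f * RatFunc.X ^ (-N)) (by
    rw [map_mul, hf, map_zpow₀, dilate_X, unit_smul_zpow, smul_mul_smul_comm,
      ← Units.val_mul, ← _root_.zpow_add, add_neg_cancel, zpow_zero, Units.val_one, one_smul])
  refine ⟨k, ?_⟩
  rw [_root_.zpow_neg, mul_inv_eq_iff_eq_mul₀ (zpow_ne_zero _ RatFunc.X_ne_zero), smul_mul_assoc,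
    one_mul] at hk
  exact hk

end expansions
end QuantumTeichmuller

namespace QuantumTeichmuller

/-! ### Normal ordering of two skew-commuting variables -/

section pairs
open Polynomial
variable {F : Type*} [Field F] {K : Type*} [DivisionRing K] [Algebra F K]

/-- Two elements with `B A = Q A B` and without further relation. -/
structure QuantumPair (Q : Fˣ) (A B : K) : Prop where
  comm : B * A = (Q : F) • (A * B)
  indep : LinearIndependent F fun v : ℤ × ℤ => B ^ v.1 * A ^ v.2

theorem transcendental_of_linearIndependent {x : K}
    (h : LinearIndependent F fun k : ℕ => x ^ k) : Transcendental F x := by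
  rw [transcendental_iff]
  intro p hp
  rw [aeval_eq_sum_range] at hp
  ext k
  rw [coeff_zero]
  by_cases hk : k < p.natDegree + 1
  · exact linearIndependent_iff'.1 h _ _ hp k (Finset.mem_range.2 hk)
  · exact coeff_eq_zero_of_natDegree_lt (by omega)

namespace QuantumPair
variable {Q : Fˣ} {A B : K}

theorem transcendental_left (h : QuantumPair Q A B) : Transcendental F A :=
  transcendental_of_linearIndependent <| by
    have := h.indep.comp (fun k : ℕ => ((0 : ℤ), (k : ℤ))) fun a b hab => by simpa using hab
    simpa [Function.comp_def] using this

theorem transcendental_right (h : QuantumPair Q A B) : Transcendental F B :=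
  transcendental_of_linearIndependent <| by
    have := h.indep.comp (fun k : ℕ => ((k : ℤ), (0 : ℤ))) fun a b hab => by simpa using hab
    simpa [Function.comp_def] using this

theorem left_ne_zero (h : QuantumPair Q A B) : A ≠ 0 := by
  rintro rfl
  exact h.transcendental_left isAlgebraic_zero

theorem right_ne_zero (h : QuantumPair Q A B) : B ≠ 0 := by
  rintro rfl
  exact h.transcendental_right isAlgebraic_zero

theorem map {L : Type*} [DivisionRing L] [Algebra F L] (φ : K →ₐ[F] L) (h : QuantumPair Q A B) :
    QuantumPair Q (φ A) (φ B) where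
  comm := by rw [← map_mul, h.comm, map_smul, map_mul]
  indep := by
    have := h.indep.map' φ.toLinearMap (LinearMap.ker_eq_bot.2 φ.toRingHom.injective)
    simpa [Function.comp_def] using this

theorem inv (h : QuantumPair Q A B) : QuantumPair Q A⁻¹ B⁻¹ where
  comm := by
    have h1 := congrArg (·⁻¹) h.comm
    simp only [_root_.mul_inv_rev, smul_inv₀] at h1
    rw [h1, smul_smul, mul_inv_cancel₀ Q.ne_zero, one_smul]
  indep := by
    have := h.indep.comp (fun v : ℤ × ℤ => -v) neg_injective
    simpa [Function.comp_def, _root_.inv_zpow'] using this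

theorem left_mul_right (h : QuantumPair Q A B) : A * B = ((Q⁻¹ : Fˣ) : F) • (B * A) := by
  rw [h.comm, smul_smul, ← Units.val_mul, inv_mul_cancel, Units.val_one, one_smul]

theorem semiconjBy_left_zpow (h : QuantumPair Q A B) (n : ℤ) :
    SemiconjBy (A ^ n) B (((Q ^ (-n) : Fˣ) : F) • B) := by
  have h1 : SemiconjBy B (((Q⁻¹ : Fˣ) : F) • A) A := by
    rw [SemiconjBy, mul_smul_comm, ← h.left_mul_right]
  have h2 : SemiconjBy B ((((Q⁻¹ : Fˣ) : F) • A) ^ n) (A ^ n) := h1.zpow_right₀ n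
  rw [unit_smul_zpow, SemiconjBy, _root_.inv_zpow', mul_smul_comm] at h2
  rw [SemiconjBy, smul_mul_assoc, h2]

theorem semiconjBy_right_zpow (h : QuantumPair Q A B) (n : ℤ) :
    SemiconjBy (B ^ n) (((Q ^ (-n) : Fˣ) : F) • A) A := by
  have h1 : SemiconjBy A B (((Q⁻¹ : Fˣ) : F) • B) := by
    rw [SemiconjBy, smul_mul_assoc, ← h.left_mul_right]
  have h2 : SemiconjBy A (B ^ n) ((((Q⁻¹ : Fˣ) : F) • B) ^ n) := h1.zpow_right₀ n
  rw [unit_smul_zpow, SemiconjBy, _root_.inv_zpow', smul_mul_assoc] at h2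
  rw [SemiconjBy, mul_smul_comm, h2]

theorem zpow_mul_zpow (h : QuantumPair Q A B) (k l : ℤ) :
    A ^ k * B ^ l = ((Q ^ (-(k * l)) : Fˣ) : F) • (B ^ l * A ^ k) := by
  have h1 := (h.semiconjBy_left_zpow k).zpow_right₀ l
  rw [unit_smul_zpow, SemiconjBy, smul_mul_assoc, ← _root_.zpow_mul, neg_mul] at h1
  exact h1

/-- The value of a rational function at `A`. -/
abbrev evalLeft (h : QuantumPair Q A B) : RatFunc F →ₐ[F] K := ratEval A h.transcendental_left

/-- The value of a rational function at `B`. -/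
abbrev evalRight (h : QuantumPair Q A B) : RatFunc F →ₐ[F] K := ratEval B h.transcendental_right

theorem evalLeft_zpow (h : QuantumPair Q A B) (n : ℤ) : h.evalLeft (RatFunc.X ^ n) = A ^ n := by
  rw [map_zpow₀, ratEval_X]

theorem evalRight_zpow (h : QuantumPair Q A B) (n : ℤ) : h.evalRight (RatFunc.X ^ n) = B ^ n := by
  rw [map_zpow₀, ratEval_X]

theorem zpow_mul_evalRight (h : QuantumPair Q A B) (n : ℤ) (f : RatFunc F) :
    A ^ n * h.evalRight f = h.evalRight (dilate (Q ^ (-n)) f) * A ^ n := by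
  rw [evalRight, ratEval_dilate _ _ (transcendental_unit_smul h.transcendental_right _) rfl]
  exact semiconjBy_ratEval (h.semiconjBy_left_zpow n) f

theorem evalLeft_mul_zpow (h : QuantumPair Q A B) (n : ℤ) (f : RatFunc F) :
    h.evalLeft f * B ^ n = B ^ n * h.evalLeft (dilate (Q ^ (-n)) f) := by
  conv_rhs => rw [evalLeft,
    ratEval_dilate _ _ (transcendental_unit_smul h.transcendental_left _) rfl]
  exact (semiconjBy_ratEval (h.semiconjBy_right_zpow n) f).symm

/-- A relation between products of functions of `B` and of `A` can be contracted with any linear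
form in the second variable. -/
theorem contract_eq_zero (h : QuantumPair Q A B) {ι : Type*} (s : Finset ι) (f g : ι → RatFunc F)
    (h0 : ∑ i ∈ s, h.evalRight (f i) * h.evalLeft (g i) = 0) (μ : RatFunc F →ₗ[F] F) :
    ∑ i ∈ s, μ (g i) • f i = 0 := by
  obtain ⟨D, hD⟩ := IsLocalization.exist_integer_multiples F[X]⁰ s f
  obtain ⟨E, hE⟩ := IsLocalization.exist_integer_multiples F[X]⁰ s g
  choose! P hP using hD
  choose! R hR using hE
  have hD0 : algebraMap F[X] (RatFunc F) D ≠ 0 :=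
    RatFunc.algebraMap_ne_zero (nonZeroDivisors.ne_zero D.2)
  have hE0 : algebraMap F[X] (RatFunc F) E ≠ 0 :=
    RatFunc.algebraMap_ne_zero (nonZeroDivisors.ne_zero E.2)
  have hsum : ∑ i ∈ s, aeval B (P i) * aeval A (R i) = 0 := by
    have h1 : h.evalRight (algebraMap F[X] _ D) *
        (∑ i ∈ s, h.evalRight (f i) * h.evalLeft (g i)) * h.evalLeft (algebraMap F[X] _ E) = 0 := by
      rw [h0, mul_zero, zero_mul]
    rw [Finset.mul_sum, Finset.sum_mul] at h1
    rw [← h1]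
    refine Finset.sum_congr rfl fun i hi => ?_
    have hp := hP i hi
    have hr := hR i hi
    rw [Algebra.smul_def] at hp hr
    rw [← mul_assoc, mul_assoc, ← map_mul, ← map_mul, mul_comm (g i)]
    erw [← hp, ← hr]
    rw [ratEval_algebraMap, ratEval_algebraMap]
  obtain ⟨θ, hθ⟩ := LinearMap.exists_leftInverse_of_injective _
    (linearIndependent_iff_ker.1 h.indep)
  have hθ' : ∀ v : ℤ × ℤ, θ (B ^ v.1 * A ^ v.2) = Finsupp.single v 1 := fun v => by
    have := LinearMap.congr_fun hθ (Finsupp.single v 1)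
    simpa using this
  have hcoeff : ∀ (p r : F[X]) (j k : ℕ),
      θ (aeval B p * aeval A r) ((j : ℤ), (k : ℤ)) = p.coeff j * r.coeff k := by
    intro p r j k
    induction p using Polynomial.induction_on' with
    | add p p' hp hp' => rw [map_add, add_mul, map_add, Finsupp.add_apply, hp, hp', coeff_add,
        add_mul]
    | monomial m a =>
      induction r using Polynomial.induction_on' with
      | add r r' hr hr' => rw [map_add, mul_add, map_add, Finsupp.add_apply, hr, hr', coeff_add,
          mul_add]
      | monomial l b =>
        have h1 := hθ' ((m : ℤ), (l : ℤ))
        simp only [zpow_natCast] at h1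
        rw [aeval_monomial, aeval_monomial, ← Algebra.smul_def, ← Algebra.smul_def,
          smul_mul_smul_comm, map_smul, h1, coeff_monomial, coeff_monomial, Finsupp.smul_apply,
          Finsupp.single_apply, smul_eq_mul]
        simp only [Prod.mk.injEq, Nat.cast_inj]
        by_cases hm : m = j <;> by_cases hl : l = k <;> simp [hm, hl]
  have hzero : ∀ j, ∑ i ∈ s, (P i).coeff j • R i = 0 := fun j => by
    ext k
    have h1 := congrArg (fun x => θ x ((j : ℤ), (k : ℤ))) hsum
    simp only [map_sum, map_zero, Finsupp.coe_zero, Pi.zero_apply, Finsupp.finsetSum_apply,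
      hcoeff] at h1
    rw [finsetSum_coeff, coeff_zero, ← h1]
    exact Finset.sum_congr rfl fun i _ => by rw [coeff_smul, smul_eq_mul]
  have hpoly : ∑ i ∈ s, μ (g i) • P i = 0 := by
    ext j
    rw [finsetSum_coeff, coeff_zero]
    have h1 : ∑ i ∈ s, (P i).coeff j • g i = 0 := by
      apply mul_left_cancel₀ hE0
      rw [mul_zero, Finset.mul_sum]
      have h2 := congrArg (algebraMap F[X] (RatFunc F)) (hzero j)
      rw [map_sum, map_zero] at h2
      rw [← h2]
      refine Finset.sum_congr rfl fun i hi => ?_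
      have hr := hR i hi
      rw [Algebra.smul_def] at hr
      rw [mul_smul_comm]
      erw [← hr]
      rw [Polynomial.smul_eq_C_mul, map_mul, RatFunc.algebraMap_C, ← RatFunc.smul_eq_C_mul]
    have h3 := congrArg μ h1
    rw [map_sum, map_zero] at h3
    rw [← h3]
    refine Finset.sum_congr rfl fun i _ => ?_
    rw [map_smul, coeff_smul, smul_eq_mul, smul_eq_mul, mul_comm]
  apply mul_left_cancel₀ hD0
  rw [mul_zero, Finset.mul_sum]
  have h2 := congrArg (algebraMap F[X] (RatFunc F)) hpoly
  rw [map_sum, map_zero] at h2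
  rw [← h2]
  refine Finset.sum_congr rfl fun i hi => ?_
  have hp := hP i hi
  rw [Algebra.smul_def] at hp
  rw [mul_smul_comm]
  erw [← hp]
  rw [Polynomial.smul_eq_C_mul, map_mul, RatFunc.algebraMap_C, ← RatFunc.smul_eq_C_mul]

theorem contract_eq (h : QuantumPair Q A B) {ι : Type*} (s : Finset ι) (f g f' g' : ι → RatFunc F)
    (h0 : ∑ i ∈ s, h.evalRight (f i) * h.evalLeft (g i)
      = ∑ i ∈ s, h.evalRight (f' i) * h.evalLeft (g' i)) (μ : RatFunc F →ₗ[F] F) :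
    ∑ i ∈ s, μ (g i) • f i = ∑ i ∈ s, μ (g' i) • f' i := by
  have h1 := h.contract_eq_zero (s.disjSum s) (Sum.elim f fun i => -f' i) (Sum.elim g g')
    (by rw [Finset.sum_disjSum]; simp [h0]) μ
  rw [Finset.sum_disjSum] at h1
  simpa [← sub_eq_add_neg, sub_eq_zero] using h1

/-- The function `F_k` in `(f(B) A ^ s) ^ k = F_k(B) A ^ (s k)`. -/
def orderedProd (Q : Fˣ) (s : ℤ) (f : RatFunc F) (k : ℕ) : RatFunc F :=
  ∏ j ∈ Finset.range k, dilate (Q ^ (-(s * j))) f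

theorem mul_zpow_pow (h : QuantumPair Q A B) (s : ℤ) (f : RatFunc F) (k : ℕ) :
    (h.evalRight f * A ^ s) ^ k = h.evalRight (orderedProd Q s f k) * A ^ (s * k) := by
  induction k with
  | zero => simp [orderedProd]
  | succ k ih =>
    rw [pow_succ, ih, mul_assoc, ← mul_assoc (A ^ _), h.zpow_mul_evalRight, mul_assoc, ← mul_assoc,
      ← map_mul, ← zpow_add₀ h.left_ne_zero, orderedProd, orderedProd, Finset.prod_range_succ]
    congr 2
    push_cast
    ring

theorem zpow_mul_pow (h : QuantumPair Q A B) (s : ℤ) (f : RatFunc F) (l : ℕ) :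
    (B ^ s * h.evalLeft f) ^ l = B ^ (s * l) * h.evalLeft (orderedProd Q s f l) := by
  induction l with
  | zero => simp [orderedProd]
  | succ l ih =>
    rw [pow_succ, ih, mul_assoc, ← mul_assoc (h.evalLeft _), h.evalLeft_mul_zpow, mul_assoc,
      ← mul_assoc, ← map_mul, ← zpow_add₀ h.right_ne_zero, orderedProd, orderedProd,
      Finset.prod_range_succ', map_prod]
    congr 2
    · push_cast; ring
    · congr 1
      · refine Finset.prod_congr rfl fun j _ => ?_
        rw [dilate_dilate, ← _root_.zpow_add]
        congr 3
        push_cast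
        ring
      · simp [dilate_one]

/-- Normal ordering: a product of polynomials in `f(B) A ^ s` and in `B ^ s f(A)` is written as a
sum of products of functions of `B` on the left and functions of `A` on the right. -/
theorem aeval_mul_aeval (h : QuantumPair Q A B) {s : ℤ} (hs : s * s = 1) (f φ ψ : RatFunc F)
    (p r : F[X]) {M : ℕ} (hp : p.natDegree < M) (hr : r.natDegree < M) :
    aeval (h.evalRight f * A ^ s) p * h.evalRight φ * h.evalLeft ψ *
        aeval (B ^ s * h.evalLeft f) r
      = ∑ x ∈ Finset.range M ×ˢ Finset.range M,
        h.evalRight ((p.coeff x.1 * r.coeff x.2 * (Q ^ (-(x.1 * x.2 : ℤ)) : Fˣ)) •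
          (orderedProd Q s f x.1 * dilate (Q ^ (-(s * x.1))) φ * RatFunc.X ^ (s * x.2))) *
        h.evalLeft
          (RatFunc.X ^ (s * x.1) * (dilate (Q ^ (-(s * x.2))) ψ * orderedProd Q s f x.2)) := by
  rw [aeval_eq_sum_range' hp, aeval_eq_sum_range' hr, Finset.sum_mul, Finset.sum_mul,
    Finset.sum_mul, Finset.sum_product]
  refine Finset.sum_congr rfl fun k _ => ?_
  rw [Finset.mul_sum]
  refine Finset.sum_congr rfl fun l _ => ?_
  rw [h.mul_zpow_pow, h.zpow_mul_pow]
  simp only [map_smul, map_mul, evalLeft_zpow, evalRight_zpow, smul_mul_assoc, mul_smul_comm,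
    smul_smul]
  have h1 : A ^ (s * (k : ℤ)) * B ^ (s * (l : ℤ))
      = ((Q ^ (-(k * l : ℤ)) : Fˣ) : F) • (B ^ (s * (l : ℤ)) * A ^ (s * (k : ℤ))) := by
    have e : s * (k : ℤ) * (s * (l : ℤ)) = k * l := by linear_combination (k : ℤ) * l * hs
    rw [h.zpow_mul_zpow, e]
  calc _ = (r.coeff l * p.coeff k) • (h.evalRight (orderedProd Q s f k) *
        (A ^ (s * (k : ℤ)) * h.evalRight φ) * (h.evalLeft ψ * B ^ (s * (l : ℤ))) *
        h.evalLeft (orderedProd Q s f l)) := by simp only [mul_assoc]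
    _ = (r.coeff l * p.coeff k) • (h.evalRight (orderedProd Q s f k) *
        h.evalRight (dilate (Q ^ (-(s * (k : ℤ)))) φ) * (A ^ (s * (k : ℤ)) * B ^ (s * (l : ℤ))) *
        h.evalLeft (dilate (Q ^ (-(s * (l : ℤ)))) ψ) * h.evalLeft (orderedProd Q s f l)) := by
      rw [h.zpow_mul_evalRight, h.evalLeft_mul_zpow]
      simp only [mul_assoc]
    _ = _ := by
      rw [h1]
      simp only [smul_mul_assoc, mul_smul_comm, smul_smul, mul_assoc]
      congr 1
      ring

/-- Contraction of a relation between normally ordered products. -/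
theorem contract_aeval (h : QuantumPair Q A B) {s : ℤ} (hs : s * s = 1)
    (f φ ψ φ' ψ' : RatFunc F) (p r p' r' : F[X]) {M : ℕ} (hp : p.natDegree < M)
    (hr : r.natDegree < M) (hp' : p'.natDegree < M) (hr' : r'.natDegree < M)
    (h0 : aeval (h.evalRight f * A ^ s) p * h.evalRight φ * h.evalLeft ψ *
        aeval (B ^ s * h.evalLeft f) r
      = aeval (h.evalRight f * A ^ s) p' * h.evalRight φ' * h.evalLeft ψ' *
        aeval (B ^ s * h.evalLeft f) r') (μ : RatFunc F →ₗ[F] F) :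
    ∑ k ∈ Finset.range M, ∑ l ∈ Finset.range M,
        (p.coeff k * r.coeff l * (Q ^ (-(k * l : ℤ)) : Fˣ) *
          μ (RatFunc.X ^ (s * k) * (dilate (Q ^ (-(s * l))) ψ * orderedProd Q s f l))) •
          (orderedProd Q s f k * dilate (Q ^ (-(s * k))) φ * RatFunc.X ^ (s * l))
      = ∑ k ∈ Finset.range M, ∑ l ∈ Finset.range M,
        (p'.coeff k * r'.coeff l * (Q ^ (-(k * l : ℤ)) : Fˣ) *
          μ (RatFunc.X ^ (s * k) * (dilate (Q ^ (-(s * l))) ψ' * orderedProd Q s f l))) •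
          (orderedProd Q s f k * dilate (Q ^ (-(s * k))) φ' * RatFunc.X ^ (s * l)) := by
  rw [h.aeval_mul_aeval hs f φ ψ p r hp hr, h.aeval_mul_aeval hs f φ' ψ' p' r' hp' hr'] at h0
  have h1 := h.contract_eq _ _ _ _ _ h0 μ
  rw [Finset.sum_product, Finset.sum_product] at h1
  simp only [smul_smul] at h1
  have e : ∀ a b : F, a * b = b * a := mul_comm
  convert! h1 using 4 <;> rw [e]

end QuantumPair
end pairs
end QuantumTeichmuller

namespace QuantumTeichmuller

/-! ### The functional equations of a diagonal exchange -/

section equations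
open Polynomial
variable {F : Type*} [Field F]

theorem flip_algebraMap (p : F[X]) : flip 1 (algebraMap F[X] (RatFunc F) p)
    = RatFunc.X ^ (-(p.natDegree : ℤ)) * algebraMap F[X] (RatFunc F) p.reverse := by
  have hX : (RatFunc.X : RatFunc F) ≠ 0 := RatFunc.X_ne_zero
  let _ := invertibleOfNonzero (inv_ne_zero hX)
  have h := eval₂_reverse_mul_pow (algebraMap F (RatFunc F)) (RatFunc.X : RatFunc F)⁻¹ p
  rw [invOf_eq_inv, inv_inv] at h
  rw [flip, ratEval_algebraMap, Units.val_one, one_smul, aeval_def, ← h,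
    ← RatFunc.aeval_X_left_eq_algebraMap, aeval_def, _root_.zpow_neg, zpow_natCast, inv_pow,
    mul_comm]

theorem flip_eq_dilate (a : Fˣ) (f : RatFunc F) : flip a f = dilate a⁻¹ (flip 1 f) := by
  rw [dilate_flip, inv_inv, one_mul]

/-- The expansion at infinity. -/
theorem hasLead_flip_div {p d : F[X]} (hp : p ≠ 0) (hd : d ≠ 0) :
    HasLead (flip 1 (algebraMap F[X] (RatFunc F) p / algebraMap F[X] (RatFunc F) d))
      (-((p.natDegree : ℤ) - d.natDegree)) (p.leadingCoeff / d.leadingCoeff) := by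
  have h : ∀ {p : F[X]}, p ≠ 0 → HasLead (flip 1 (algebraMap F[X] (RatFunc F) p))
      (-(p.natDegree : ℤ)) p.leadingCoeff := fun {p} hp => by
    have h1 := hasLead_ratio (F := F) (-(p.natDegree : ℤ)) (p := p.reverse) (d := 1)
      (by rw [coeff_zero_reverse]; exact leadingCoeff_ne_zero.2 hp) (by simp)
    rwa [map_one, div_one, ← flip_algebraMap, coeff_zero_reverse] at h1
  rw [map_div₀, div_eq_mul_inv, div_eq_mul_inv]
  have := (h hp).mul (h hd).inv
  rwa [show -((p.natDegree : ℤ) - d.natDegree) = -(p.natDegree : ℤ) + - -(d.natDegree : ℤ) by ring]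

/-- The functional equation that expresses how a diagonal exchange affects the commutation of the
coordinates of two consecutive sides of the square. -/
def SideRelation (Q c : Fˣ) (g : RatFunc F) : Prop :=
  g * flip c g = (Q : F) • (dilate Q⁻¹ g * flip (c * Q⁻¹) g)

/-- The functional equation that comes from the relation between the five diagonal exchanges of a
pentagon. Here `Y = c g(B) A⁻¹` and `Z = c B⁻¹ g(A)` are the coordinates of the diagonals after two
and after four exchanges. -/
def PentagonRelation {K : Type*} [DivisionRing K] [Algebra F K] {Q : Fˣ} {A B : K}
    (h : QuantumPair Q A B) (c : Fˣ) (g : RatFunc F) : Prop :=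
  ∃ (Y Z : K) (hY : Transcendental F Y) (hZ : Transcendental F Z),
    Y = (c : F) • (h.evalRight g * A⁻¹) ∧ Z = (c : F) • (B⁻¹ * h.evalLeft g) ∧
      ratEval Y hY g * B⁻¹ = A⁻¹ * ratEval Z hZ g

/-- The sum of the orders of vanishing at the origin and of growth at infinity. -/
theorem SideRelation.order_add_order {Q c : Fˣ} {g : RatFunc F} (h : SideRelation Q c g)
    (hQ : ∀ m : ℤ, Q ^ m = 1 → m = 0) {e δ : ℤ} {β α : F} (hβ : β ≠ 0) (hα : α ≠ 0)
    (h0 : HasLead g e β) (h1 : HasLead (flip 1 g) (-δ) α) : e + δ = 1 := by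
  unfold SideRelation at h
  rw [flip_eq_dilate c, flip_eq_dilate (c * Q⁻¹)] at h
  have hl := h0.mul (h1.dilate c⁻¹)
  have hr := ((h0.dilate Q⁻¹).mul (h1.dilate (c * Q⁻¹)⁻¹)).smul (Q : F)
  rw [← h] at hr
  have h2 := hl.coeff_unique hr
  have h3 : β * α * ((Q ^ (1 - e - δ) : Fˣ) : F) = β * α := by
    have hc : (((c⁻¹ ^ (-δ) : Fˣ)) : F) ≠ 0 := Units.ne_zero _
    apply mul_right_cancel₀ hc
    have e1 : Q ^ (1 - e - δ) * c⁻¹ ^ (-δ) = Q * (Q⁻¹ ^ e * ((c * Q⁻¹)⁻¹ ^ (-δ))) := by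
      rw [_root_.mul_inv_rev, inv_inv, _root_.mul_zpow, _root_.inv_zpow' Q, ← mul_assoc,
        ← mul_assoc, show 1 - e - δ = 1 + -e + -δ by ring, _root_.zpow_add, _root_.zpow_add,
        zpow_one]
    have e2 := congrArg (Units.val) e1
    simp only [Units.val_mul] at e2
    linear_combination (β * α) * e2 - h2
  rw [mul_eq_left₀ (mul_ne_zero hβ hα)] at h3
  have := hQ _ (Units.ext h3)
  omega

/-- The function `1 / g(Q⁻¹ X⁻¹)`. This symmetry of the functional equations exchanges the origin
and infinity. -/
def opposite (Q : Fˣ) (g : RatFunc F) : RatFunc F := (flip Q⁻¹ g)⁻¹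

theorem opposite_opposite (Q : Fˣ) (g : RatFunc F) : opposite Q (opposite Q g) = g := by
  rw [opposite, opposite, map_inv₀, inv_inv, flip_flip, inv_inv, inv_mul_cancel, dilate_one]

theorem flip_opposite (Q a : Fˣ) (g : RatFunc F) :
    flip a (opposite Q g) = (dilate (Q⁻¹ * a⁻¹) g)⁻¹ := by
  rw [opposite, map_inv₀, flip_flip]

theorem SideRelation.opposite {Q c : Fˣ} {g : RatFunc F} (h : SideRelation Q c g) :
    SideRelation Q c⁻¹ (opposite Q g) := by
  have h1 := congrArg (flip 1) h
  rw [map_mul, map_smul, map_mul, flip_flip, flip_flip, flip_dilate, one_mul, inv_one, mul_one,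
    mul_one] at h1
  unfold SideRelation
  rw [flip_opposite, flip_opposite, QuantumTeichmuller.opposite, map_inv₀, dilate_flip, inv_inv,
    show Q⁻¹ * Q⁻¹⁻¹ = 1 by simp, show Q⁻¹ * (c⁻¹ * Q⁻¹)⁻¹ = c by simp, mul_comm Q⁻¹ c]
  rw [← _root_.mul_inv, ← _root_.mul_inv, h1, smul_inv₀, smul_smul, mul_inv_cancel₀ Q.ne_zero,
    one_smul]

section
variable {K : Type*} [DivisionRing K] [Algebra F K] {Q c : Fˣ} {A B : K}

/-- The pentagon relation passes to inverses of `A`, `B`, `Y` and `Z`. -/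
theorem PentagonRelation.opposite {h : QuantumPair Q A B} {g : RatFunc F}
    (hp : PentagonRelation h c g) : PentagonRelation h.inv c⁻¹ (opposite Q g) := by
  obtain ⟨Y, Z, hY, hZ, hY', hZ', hp⟩ := hp
  have hA := h.left_ne_zero
  have hB := h.right_ne_zero
  -- the new arguments are the inverses of the old ones
  have hflipA : ∀ f : RatFunc F, h.inv.evalLeft (flip Q⁻¹ f) = h.evalLeft (dilate Q⁻¹ f) :=
    fun f => by
      rw [QuantumPair.evalLeft, QuantumPair.evalLeft,
        ratEval_flip _ _ (transcendental_unit_smul h.transcendental_left Q⁻¹) (by rw [inv_inv]),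
        ratEval_dilate _ _ (transcendental_unit_smul h.transcendental_left Q⁻¹) rfl]
  have hflipB : ∀ f : RatFunc F, h.inv.evalRight (flip Q⁻¹ f) = h.evalRight (dilate Q⁻¹ f) :=
    fun f => by
      rw [QuantumPair.evalRight, QuantumPair.evalRight,
        ratEval_flip _ _ (transcendental_unit_smul h.transcendental_right Q⁻¹) (by rw [inv_inv]),
        ratEval_dilate _ _ (transcendental_unit_smul h.transcendental_right Q⁻¹) rfl]
  have hYinv : Transcendental F Y⁻¹ := by
    simpa using transcendental_unit_smul_inv hY 1
  have hZinv : Transcendental F Z⁻¹ := by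
    simpa using transcendental_unit_smul_inv hZ 1
  have hQY := transcendental_unit_smul hY Q⁻¹
  have hQZ := transcendental_unit_smul hZ Q⁻¹
  have hr := h.zpow_mul_evalRight (-1) (dilate Q⁻¹ g)
  have hl := h.evalLeft_mul_zpow (-1) g
  refine ⟨Y⁻¹, Z⁻¹, hYinv, hZinv, ?_, ?_, ?_⟩
  · rw [hY', QuantumTeichmuller.opposite, map_inv₀, hflipB, smul_inv₀, inv_inv,
      Units.val_inv_eq_inv_val, _root_.mul_inv_rev, inv_inv]
    congr 1
    rw [neg_neg, zpow_one, dilate_dilate, mul_inv_cancel, dilate_one, _root_.zpow_neg_one] at hr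
    have h1 := congrArg (·⁻¹) hr
    simpa using h1.symm
  · rw [hZ', QuantumTeichmuller.opposite, map_inv₀, hflipA, smul_inv₀, inv_inv,
      Units.val_inv_eq_inv_val, _root_.mul_inv_rev, inv_inv]
    congr 1
    have hl' := h.evalLeft_mul_zpow (-1) (dilate Q⁻¹ g)
    rw [neg_neg, zpow_one, dilate_dilate, mul_inv_cancel, dilate_one, _root_.zpow_neg_one] at hl'
    have h1 := congrArg (·⁻¹) hl'
    simpa using h1.symm
  · have hsY : SemiconjBy B Y (((Q⁻¹ : Fˣ) : F) • Y) := by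
      have h1 := h.zpow_mul_zpow (-1) 1
      have h2 : B * h.evalRight g = h.evalRight g * B := by
        have := congrArg h.evalRight (mul_comm RatFunc.X g)
        rwa [map_mul, map_mul, ratEval_X] at this
      rw [_root_.zpow_neg_one, zpow_one, show -(-1 * 1 : ℤ) = 1 by norm_num, zpow_one] at h1
      rw [SemiconjBy, hY', mul_smul_comm, ← mul_assoc, h2, smul_mul_assoc, smul_mul_assoc,
        mul_assoc, mul_assoc, h1, mul_smul_comm, smul_comm, smul_smul ((Q⁻¹ : Fˣ) : F),
        ← Units.val_mul, inv_mul_cancel, Units.val_one, one_smul]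
    have hsZ : SemiconjBy A (((Q⁻¹ : Fˣ) : F) • Z) Z := by
      have h1 := h.zpow_mul_zpow 1 (-1)
      have h2 : A * h.evalLeft g = h.evalLeft g * A := by
        have := congrArg h.evalLeft (mul_comm RatFunc.X g)
        rwa [map_mul, map_mul, ratEval_X] at this
      rw [_root_.zpow_neg_one, zpow_one, show -(1 * -1 : ℤ) = 1 by norm_num, zpow_one] at h1
      rw [SemiconjBy, hZ', mul_smul_comm, mul_smul_comm, ← mul_assoc, h1, smul_mul_assoc,
        smul_mul_assoc, mul_assoc, mul_assoc, h2, smul_comm (c : F), smul_smul ((Q⁻¹ : Fˣ) : F),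
        ← Units.val_mul, inv_mul_cancel, Units.val_one, one_smul]
    have e1 := semiconjBy_ratEval (hx := hY) (hy := hQY) hsY g
    have e2 := semiconjBy_ratEval (hx := hQZ) (hy := hZ) hsZ g
    have e3 : ratEval Y⁻¹ hYinv (flip Q⁻¹ g) = ratEval _ hQY g :=
      ratEval_flip _ _ _ (by rw [inv_inv]) g
    have e4 : ratEval Z⁻¹ hZinv (flip Q⁻¹ g) = ratEval _ hQZ g :=
      ratEval_flip _ _ _ (by rw [inv_inv]) g
    rw [QuantumTeichmuller.opposite, map_inv₀, map_inv₀, e3, e4, inv_inv, inv_inv]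
    have h1 := congrArg (·⁻¹) hp
    simp only [_root_.mul_inv_rev, inv_inv] at h1
    rw [← (e1.inv_right₀).eq, h1, (e2.inv_right₀).eq]

end
end equations
end QuantumTeichmuller

namespace QuantumTeichmuller

/-! ### Solutions of the functional equations: the behavior at infinity -/

section infinity
open Polynomial
variable {F : Type*} [Field F]

theorem algHom_algebraMap_eq_sum {L : Type*} [DivisionRing L] [Algebra F L]
    (φ : RatFunc F →ₐ[F] L) {p : F[X]} {M : ℕ} (hp : p.natDegree < M) :
    φ (algebraMap F[X] (RatFunc F) p)
      = ∑ l ∈ Finset.range M, p.coeff l • φ RatFunc.X ^ l := by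
  rw [← RatFunc.aeval_X_left_eq_algebraMap, ← aeval_algHom_apply, aeval_eq_sum_range' hp]

theorem flip_algebraMap_eq_sum (a : Fˣ) {p : F[X]} {M : ℕ} (hp : p.natDegree < M) :
    flip a (algebraMap F[X] (RatFunc F) p)
      = ∑ l ∈ Finset.range M, (p.coeff l * ((a ^ l : Fˣ) : F)) • RatFunc.X ^ (-(l : ℤ)) := by
  rw [algHom_algebraMap_eq_sum _ hp]
  refine Finset.sum_congr rfl fun l _ => ?_
  rw [flip_X, _root_.smul_pow, smul_smul, Units.val_pow_eq_pow_val, _root_.zpow_neg, zpow_natCast,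
    inv_pow]

theorem HasLead.orderedProd {f : RatFunc F} {e : ℤ} {β : F} (hf : HasLead f e β) (Q : Fˣ) (s : ℤ)
    (l : ℕ) : HasLead (QuantumPair.orderedProd Q s f l) (e * l)
      (∏ j ∈ Finset.range l, (((Q ^ (-(s * j))) ^ e : Fˣ) : F) * β) :=
  HasLead.prod_range _ _ (fun _ => hf.dilate _) l

/-- A double sum whose terms have orders that decrease strictly in each index: its expansion starts
with the term of the largest indices. -/
theorem sum_corner {e ε N : ℤ} (he : e < 0) (p r : F[X]) {M : ℕ} (hp : p.natDegree < M)
    (hr : r.natDegree < M) (a γ : ℕ → ℕ → F) (t v : ℕ → ℕ → RatFunc F)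
    (ht : ∀ k l, HasLead (t k l) (-k + e * l + ε) (γ k l))
    (hN : N ≤ -p.natDegree + e * r.natDegree + ε) :
    ∑ k ∈ Finset.range M, ∑ l ∈ Finset.range M,
        (p.coeff k * r.coeff l * a k l * laurentCoeff N (t k l)) • v k l
      = (p.leadingCoeff * r.leadingCoeff * a p.natDegree r.natDegree *
          laurentCoeff N (t p.natDegree r.natDegree)) • v p.natDegree r.natDegree := by
  have key : ∀ k l, k ≠ p.natDegree ∨ l ≠ r.natDegree →
      p.coeff k * r.coeff l * a k l * laurentCoeff N (t k l) = 0 := by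
    intro k l h
    by_cases hk : p.natDegree < k
    · rw [coeff_eq_zero_of_natDegree_lt hk]; ring
    by_cases hl : r.natDegree < l
    · rw [coeff_eq_zero_of_natDegree_lt hl]; ring
    rw [(ht k l).laurentCoeff_lt, mul_zero]
    have h1 : e * r.natDegree ≤ e * l :=
      mul_le_mul_of_nonpos_left (by exact_mod_cast not_lt.1 hl) he.le
    rcases h with h | h
    · omega
    · have : e * r.natDegree < e * l := mul_lt_mul_of_neg_left (by omega) he
      omega
  rw [Finset.sum_eq_single p.natDegree, Finset.sum_eq_single r.natDegree]
  · rfl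
  · intro l _ hl; rw [key _ _ (Or.inr hl), zero_smul]
  · intro h; exact absurd (Finset.mem_range.2 hr) h
  · intro k _ hk
    exact Finset.sum_eq_zero fun l _ => by rw [key _ _ (Or.inl hk), zero_smul]
  · intro h; exact absurd (Finset.mem_range.2 hp) h

variable {K : Type*} [DivisionRing K] [Algebra F K] {Q c : Fˣ} {A B : K}

theorem ratEval_div {x : K} (hx : Transcendental F x) (p d : F[X]) :
    ratEval x hx (algebraMap F[X] (RatFunc F) p / algebraMap F[X] (RatFunc F) d)
      = aeval x p * (aeval x d)⁻¹ := by
  rw [div_eq_mul_inv, map_mul, map_inv₀, ratEval_algebraMap, ratEval_algebraMap]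

theorem ratEval_div' {x : K} (hx : Transcendental F x) (p d : F[X]) :
    ratEval x hx (algebraMap F[X] (RatFunc F) p / algebraMap F[X] (RatFunc F) d)
      = (aeval x d)⁻¹ * aeval x p := by
  rw [div_eq_mul_inv, mul_comm, map_mul, map_inv₀, ratEval_algebraMap, ratEval_algebraMap]

/-- The pentagon relation without denominators. -/
theorem PentagonRelation.aeval_eq {h : QuantumPair Q A B} {g : RatFunc F}
    (hp : PentagonRelation h c g) {p d : F[X]} (hd : d ≠ 0)
    (hg : g = algebraMap F[X] (RatFunc F) p / algebraMap F[X] (RatFunc F) d) :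
    aeval (h.evalRight ((c : F) • g) * A ^ (-1 : ℤ)) p * h.evalRight (RatFunc.X ^ (-1 : ℤ)) *
        h.evalLeft 1 * aeval (B ^ (-1 : ℤ) * h.evalLeft ((c : F) • g)) d
      = aeval (h.evalRight ((c : F) • g) * A ^ (-1 : ℤ)) d * h.evalRight 1 *
        h.evalLeft (RatFunc.X ^ (-1 : ℤ)) *
        aeval (B ^ (-1 : ℤ) * h.evalLeft ((c : F) • g)) p := by
  obtain ⟨Y, Z, hY, hZ, hY', hZ', hp⟩ := hp
  have e1 : h.evalRight ((c : F) • g) * A ^ (-1 : ℤ) = Y := by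
    rw [hY', map_smul, smul_mul_assoc, _root_.zpow_neg_one]
  have e2 : B ^ (-1 : ℤ) * h.evalLeft ((c : F) • g) = Z := by
    rw [hZ', map_smul, mul_smul_comm, _root_.zpow_neg_one]
  rw [e1, e2, h.evalLeft_zpow, h.evalRight_zpow, map_one, map_one, mul_one, mul_one,
    _root_.zpow_neg_one, _root_.zpow_neg_one]
  have hY0 := aeval_ne_zero hY hd
  have hZ0 := aeval_ne_zero hZ hd
  have e3 : ratEval Y hY g = (aeval Y d)⁻¹ * aeval Y p := by rw [hg, ratEval_div']
  have e4 : ratEval Z hZ g = aeval Z p * (aeval Z d)⁻¹ := by rw [hg, ratEval_div]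
  rw [e3, e4] at hp
  have h1 := congrArg (fun x => aeval Y d * x * aeval Z d) hp
  simp only [mul_assoc, inv_mul_cancel₀ hZ0, mul_one, mul_inv_cancel_left₀ hY0] at h1
  rw [mul_assoc, h1, mul_assoc]

/-- The order `e` at the origin of a solution is not negative: otherwise the expansions in `A` of
both sides of the pentagon relation would start with the corner terms of the double sums, which
have different orders. -/
theorem PentagonRelation.not_neg {h : QuantumPair Q A B} {g : RatFunc F}
    (hp : PentagonRelation h c g) {e : ℤ} {β : F} (hβ : β ≠ 0) (h0 : HasLead g e β)
    {p d : F[X]} (hp0 : p ≠ 0) (hd0 : d ≠ 0)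
    (hg : g = algebraMap F[X] (RatFunc F) p / algebraMap F[X] (RatFunc F) d)
    (he1 : e + ((p.natDegree : ℤ) - d.natDegree) = 1) : ¬ e < 0 := by
  intro he
  have hgne := h0.ne_zero hβ
  set M := max p.natDegree d.natDegree + 1 with hM
  have hpM : p.natDegree < M := by omega
  have hdM : d.natDegree < M := by omega
  have hc := h.contract_aeval (s := -1) (by norm_num) ((c : F) • g) (RatFunc.X ^ (-1 : ℤ)) 1 1
    (RatFunc.X ^ (-1 : ℤ)) p d d p hpM hdM hdM hpM (hp.aeval_eq hd0 hg)
  have hF := fun l => ((h0.smul (c : F)).orderedProd Q (-1) l)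
  have hFne : ∀ l, QuantumPair.orderedProd Q (-1) ((c : F) • g) l ≠ 0 := fun l =>
    Finset.prod_ne_zero_iff.2 fun j _ => (_root_.map_ne_zero _).2 (smul_ne_zero c.ne_zero hgne)
  have ht : ∀ k l : ℕ, HasLead (RatFunc.X ^ (-1 * (k : ℤ)) * (dilate (Q ^ (-(-1 * (l : ℤ)))) 1 *
      QuantumPair.orderedProd Q (-1) ((c : F) • g) l)) (-k + e * l + 0) _ := fun k l => by
    have := (HasLead.zpow (F := F) (-1 * (k : ℤ))).mul (hF l)
    rw [map_one, one_mul]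
    rwa [show -(k : ℤ) + e * l + 0 = -1 * k + e * l by ring]
  have ht' : ∀ k l : ℕ, HasLead (RatFunc.X ^ (-1 * (k : ℤ)) *
      (dilate (Q ^ (-(-1 * (l : ℤ)))) (RatFunc.X ^ (-1 : ℤ)) *
      QuantumPair.orderedProd Q (-1) ((c : F) • g) l)) (-k + e * l + -1) _ := fun k l => by
    have := (HasLead.zpow (F := F) (-1 * (k : ℤ))).mul
      (((HasLead.zpow (F := F) (-1)).dilate (Q ^ (-(-1 * (l : ℤ))))).mul (hF l))
    rwa [show -(k : ℤ) + e * l + -1 = -1 * k + (-1 + e * l) by ring]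
  have hprod : ∀ l : ℕ, ∏ j ∈ Finset.range l,
      (((Q ^ (-(-1 * (j : ℤ)))) ^ e : Fˣ) : F) * ((c : F) * β) ≠ 0 := fun l =>
    Finset.prod_ne_zero_iff.2 fun j _ =>
      mul_ne_zero (Units.ne_zero _) (mul_ne_zero c.ne_zero hβ)
  have hlp := leadingCoeff_ne_zero.2 hp0
  have hld := leadingCoeff_ne_zero.2 hd0
  have hX : ∀ n : ℤ, (RatFunc.X : RatFunc F) ^ n ≠ 0 := fun n => zpow_ne_zero n RatFunc.X_ne_zero
  have hdil : ∀ (a : Fˣ) {f : RatFunc F}, f ≠ 0 → dilate a f ≠ 0 := fun a f hf =>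
    (_root_.map_ne_zero _).2 hf
  rcases lt_trichotomy (-(p.natDegree : ℤ) + e * d.natDegree + 0)
    (-(d.natDegree : ℤ) + e * p.natDegree + -1) with hlt | heq | hlt
  · have h1 := hc (laurentCoeff (-(p.natDegree : ℤ) + e * d.natDegree + 0))
    rw [sum_corner he p d hpM hdM _ _ _ _ ht le_rfl, sum_corner he d p hdM hpM _ _ _ _ ht' hlt.le,
      (ht _ _).laurentCoeff, (ht' _ _).laurentCoeff_lt hlt, mul_zero, zero_smul] at h1
    refine smul_ne_zero ?_ ?_ h1
    · exact mul_ne_zero (mul_ne_zero (mul_ne_zero hlp hld) (Units.ne_zero _))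
        (mul_ne_zero one_ne_zero (hprod _))
    · exact mul_ne_zero (mul_ne_zero (hFne _) (hdil _ (hX _))) (hX _)
  · have h2 : e * e = 0 := by
      have h3 : (p.natDegree : ℤ) = d.natDegree + 1 - e := by linarith
      rw [h3] at heq
      linarith
    nlinarith
  · have h1 := hc (laurentCoeff (-(d.natDegree : ℤ) + e * p.natDegree + -1))
    rw [sum_corner he p d hpM hdM _ _ _ _ ht hlt.le, sum_corner he d p hdM hpM _ _ _ _ ht' le_rfl,
      (ht' _ _).laurentCoeff, (ht _ _).laurentCoeff_lt hlt, mul_zero, zero_smul] at h1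
    refine smul_ne_zero ?_ ?_ h1.symm
    · exact mul_ne_zero (mul_ne_zero (mul_ne_zero hld hlp) (Units.ne_zero _))
        (mul_ne_zero one_ne_zero (mul_ne_zero (mul_ne_zero (Units.ne_zero _) one_ne_zero)
          (hprod _)))
    · exact mul_ne_zero (mul_ne_zero (hFne _) (hdil _ one_ne_zero)) (hX _)

/-- A solution that is regular and non-zero at the origin is, up to a monomial, symmetric under an
inversion of the variable. This is the leading term in `A` of the pentagon relation, which is a
relation between functions of `B`. -/
theorem PentagonRelation.flip_eq {h : QuantumPair Q A B} {g : RatFunc F}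
    (hp : PentagonRelation h c g) {β : Fˣ} (h0 : HasLead g 0 (β : F))
    {p d : F[X]} (hp0 : p ≠ 0) (hd0 : d ≠ 0)
    (hg : g = algebraMap F[X] (RatFunc F) p / algebraMap F[X] (RatFunc F) d)
    (he1 : p.natDegree = d.natDegree + 1) :
    flip (c * β * Q⁻¹) g
      = (p.leadingCoeff / d.leadingCoeff * ((c * Q⁻¹ : Fˣ) : F)) • (RatFunc.X⁻¹ * g) := by
  have hgne := h0.ne_zero β.ne_zero
  set M := p.natDegree + 1 with hM
  have hpM : p.natDegree < M := by omega
  have hdM : d.natDegree < M := by omega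
  -- the lowest order in `A` is `-deg p`, on both sides
  have hc := h.contract_aeval (s := -1) (by norm_num) ((c : F) • g) (RatFunc.X ^ (-1 : ℤ)) 1 1
    (RatFunc.X ^ (-1 : ℤ)) p d d p hpM hdM hdM hpM (hp.aeval_eq hd0 hg)
    (laurentCoeff (-(p.natDegree : ℤ)))
  set G := QuantumPair.orderedProd Q (-1) ((c : F) • g) with hG
  have hF : ∀ l, HasLead (G l) 0 (((c * β) ^ l : Fˣ) : F) := fun l => by
    have := ((h0.smul (c : F)).orderedProd Q (-1) l)
    simpa using this
  have hFne : ∀ l, G l ≠ 0 := fun l => (hF l).ne_zero (Units.ne_zero _)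
  have hlp := leadingCoeff_ne_zero.2 hp0
  have hld := leadingCoeff_ne_zero.2 hd0
  have ht : ∀ k l : ℕ, HasLead (RatFunc.X ^ (-1 * (k : ℤ)) * (dilate (Q ^ (-(-1 * (l : ℤ)))) 1 *
      G l)) (-k) (((c * β) ^ l : Fˣ) : F) := fun k l => by
    have := (HasLead.zpow (F := F) (-1 * (k : ℤ))).mul (hF l)
    rw [map_one, one_mul]
    rwa [show -(k : ℤ) = -1 * k + 0 by ring, ← one_mul (((c * β) ^ l : Fˣ) : F)]
  have ht' : ∀ k l : ℕ, HasLead (RatFunc.X ^ (-1 * (k : ℤ)) *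
      (dilate (Q ^ (-(-1 * (l : ℤ)))) (RatFunc.X ^ (-1 : ℤ)) * G l)) (-k - 1)
      ((Q ^ (-(l : ℤ)) * (c * β) ^ l : Fˣ) : F) := fun k l => by
    have := (HasLead.zpow (F := F) (-1 * (k : ℤ))).mul
      (((HasLead.zpow (F := F) (-1)).dilate (Q ^ (-(-1 * (l : ℤ))))).mul (hF l))
    rw [show -(k : ℤ) - 1 = -1 * k + (-1 + 0) by ring]
    convert! this using 1
    rw [one_mul, mul_one, Units.val_mul, ← _root_.zpow_mul]
    simp
  have hL : ∑ k ∈ Finset.range M, ∑ l ∈ Finset.range M,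
        (p.coeff k * d.coeff l * (Q ^ (-(k * l : ℤ)) : Fˣ) * laurentCoeff (-(p.natDegree : ℤ))
          (RatFunc.X ^ (-1 * (k : ℤ)) * (dilate (Q ^ (-(-1 * (l : ℤ)))) 1 * G l))) •
          (G k * dilate (Q ^ (-(-1 * (k : ℤ)))) (RatFunc.X ^ (-1 : ℤ)) *
            RatFunc.X ^ (-1 * (l : ℤ)))
      = (p.leadingCoeff * ((Q ^ (-(p.natDegree : ℤ)) : Fˣ) : F)) •
        (G p.natDegree * RatFunc.X⁻¹ *
          flip (c * β * Q ^ (-(p.natDegree : ℤ))) (algebraMap F[X] _ d)) := by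
    rw [Finset.sum_eq_single p.natDegree, flip_algebraMap_eq_sum _ hdM, Finset.mul_sum,
      Finset.smul_sum]
    · refine Finset.sum_congr rfl fun l _ => ?_
      rw [(ht _ _).laurentCoeff, map_zpow₀, dilate_X, unit_smul_zpow, _root_.zpow_neg_one]
      simp only [mul_smul_comm, smul_mul_assoc, smul_smul]
      rw [neg_one_mul (l : ℤ), _root_.zpow_neg_one]
      congr 1
      rw [← _root_.zpow_neg, neg_neg,
        mul_pow (c * β), ← zpow_natCast (Q ^ _), ← _root_.zpow_mul, neg_mul, Units.val_mul]
      simp only [leadingCoeff]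
      rw [one_mul, neg_mul]
      ring
    · intro k hk hne
      refine Finset.sum_eq_zero fun l _ => ?_
      rw [(ht _ _).laurentCoeff_lt, mul_zero, zero_smul]
      have := Finset.mem_range.1 hk
      omega
    · intro hh; exact absurd (Finset.mem_range.2 hpM) hh
  have hR : ∑ k ∈ Finset.range M, ∑ l ∈ Finset.range M,
        (d.coeff k * p.coeff l * (Q ^ (-(k * l : ℤ)) : Fˣ) * laurentCoeff (-(p.natDegree : ℤ))
          (RatFunc.X ^ (-1 * (k : ℤ)) * (dilate (Q ^ (-(-1 * (l : ℤ))))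
            (RatFunc.X ^ (-1 : ℤ)) * G l))) •
          (G k * dilate (Q ^ (-(-1 * (k : ℤ)))) 1 * RatFunc.X ^ (-1 * (l : ℤ)))
      = d.leadingCoeff • (G d.natDegree *
          flip (c * β * Q ^ (-(p.natDegree : ℤ))) (algebraMap F[X] _ p)) := by
    rw [Finset.sum_eq_single d.natDegree, flip_algebraMap_eq_sum _ hpM, Finset.mul_sum,
      Finset.smul_sum]
    · refine Finset.sum_congr rfl fun l _ => ?_
      rw [show (-(p.natDegree : ℤ)) = -(d.natDegree : ℤ) - 1 by omega, (ht' _ _).laurentCoeff,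
        map_one, mul_one]
      simp only [mul_smul_comm, smul_smul]
      rw [neg_one_mul]
      congr 1
      rw [mul_pow (c * β), ← zpow_natCast (Q ^ _), ← _root_.zpow_mul,
        show (-(d.natDegree : ℤ) - 1) * l = -(d.natDegree * l) + -l by ring, _root_.zpow_add,
        Units.val_mul, Units.val_mul, Units.val_mul]
      simp only [leadingCoeff]
      ring
    · intro k hk hne
      refine Finset.sum_eq_zero fun l _ => ?_
      by_cases hk' : d.natDegree < k
      · rw [coeff_eq_zero_of_natDegree_lt hk', zero_mul, zero_mul, zero_mul, zero_smul]
      rw [(ht' _ _).laurentCoeff_lt, mul_zero, zero_smul]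
      omega
    · intro hh; exact absurd (Finset.mem_range.2 hdM) hh
  rw [hL, hR] at hc
  have hGs : G p.natDegree = G d.natDegree * dilate (Q ^ (d.natDegree : ℤ)) ((c : F) • g) := by
    rw [he1, hG, QuantumPair.orderedProd, Finset.prod_range_succ]
    simp [QuantumPair.orderedProd]
  have hdne : flip (c * β * Q ^ (-(p.natDegree : ℤ))) (algebraMap F[X] (RatFunc F) d) ≠ 0 :=
    (_root_.map_ne_zero _).2 (RatFunc.algebraMap_ne_zero hd0)
  have h1 : flip (c * β * Q ^ (-(p.natDegree : ℤ))) g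
      = (p.leadingCoeff / d.leadingCoeff * ((c * Q ^ (-(p.natDegree : ℤ)) : Fˣ) : F)) •
        (RatFunc.X⁻¹ * dilate (Q ^ (d.natDegree : ℤ)) g) := by
    conv_lhs => rw [hg, map_div₀]
    rw [div_eq_iff hdne]
    apply mul_left_cancel₀ (hFne d.natDegree)
    apply smul_right_injective _ hld
    simp only
    rw [← hc, hGs]
    simp only [map_smul, mul_smul_comm, smul_mul_assoc, smul_smul]
    congr 1
    · rw [Units.val_mul]; field_simp
    · ring
  have h2 := congrArg (dilate (Q ^ (-(d.natDegree : ℤ)))) h1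
  rw [dilate_flip, map_smul, map_mul, map_inv₀, dilate_X, dilate_dilate, ← _root_.zpow_add,
    neg_add_cancel, zpow_zero, dilate_one, smul_inv₀, smul_mul_assoc, smul_smul] at h2
  convert! h2 using 2
  · congr 1
    rw [mul_assoc (c * β), ← _root_.zpow_neg, ← _root_.zpow_add, he1]
    congr 1
    rw [← _root_.zpow_neg_one]
    congr 1
    push_cast
    ring
  · rw [mul_assoc, ← Units.val_inv_eq_inv_val, ← Units.val_mul, mul_assoc, ← _root_.zpow_neg,
      ← _root_.zpow_add, he1, ← _root_.zpow_neg_one]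
    congr 4
    push_cast
    ring

end infinity
end QuantumTeichmuller

namespace QuantumTeichmuller

/-! ### Solutions of the functional equations: the behavior at the origin -/

section origin
open Polynomial
variable {F : Type*} [Field F]

/-- The expansion of `u` at the origin is `1 + b X ^ m` up to terms of higher degree. -/
def HasJet (m : ℕ) (u : RatFunc F) (b : F) : Prop :=
  ∃ r ∈ regular F, u = 1 + b • RatFunc.X ^ m + RatFunc.X ^ (m + 1) * r

namespace HasJet
variable {m : ℕ} {u v : RatFunc F} {b b' : F}

theorem one : HasJet m (1 : RatFunc F) 0 := ⟨0, zero_mem _, by simp⟩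

theorem mul (hm : 0 < m) (hu : HasJet m u b) (hv : HasJet m v b') : HasJet m (u * v) (b + b') := by
  obtain ⟨r, hr, rfl⟩ := hu
  obtain ⟨s, hs, rfl⟩ := hv
  obtain ⟨m, rfl⟩ : ∃ k, m = k + 1 := ⟨m - 1, by omega⟩
  have hX := X_mem_regular (F := F)
  refine ⟨(b * b') • RatFunc.X ^ m + b • (RatFunc.X ^ (m + 1) * s) + b' • (RatFunc.X ^ (m + 1) * r)
    + r + s + RatFunc.X ^ (m + 2) * (r * s), ?_, ?_⟩
  · have hXm := fun k => pow_mem hX k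
    exact add_mem (add_mem (add_mem (add_mem (add_mem (Subalgebra.smul_mem _ (hXm _) _)
      (Subalgebra.smul_mem _ (mul_mem (hXm _) hs) _))
      (Subalgebra.smul_mem _ (mul_mem (hXm _) hr) _)) hr) hs) (mul_mem (hXm _) (mul_mem hr hs))
  · simp only [RatFunc.smul_eq_C_mul, map_mul, map_add]
    ring

theorem isOneUnit (hm : 0 < m) (hu : HasJet m u b) : IsOneUnit u := by
  obtain ⟨r, hr, rfl⟩ := hu
  obtain ⟨m, rfl⟩ : ∃ k, m = k + 1 := ⟨m - 1, by omega⟩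
  refine ⟨b • RatFunc.X ^ m + RatFunc.X ^ (m + 1) * r, add_mem
    (Subalgebra.smul_mem _ (pow_mem X_mem_regular _) _)
    (mul_mem (pow_mem X_mem_regular _) hr), ?_⟩
  simp only [RatFunc.smul_eq_C_mul]
  ring

theorem inv (hm : 0 < m) (hu : HasJet m u b) : HasJet m u⁻¹ (-b) := by
  have h1 := hu.isOneUnit hm
  have h0 := h1.ne_zero
  have hi := h1.inv.mem_regular
  obtain ⟨r, hr, hu'⟩ := hu
  obtain ⟨m, rfl⟩ : ∃ k, m = k + 1 := ⟨m - 1, by omega⟩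
  have hX := fun k => pow_mem (X_mem_regular (F := F)) k
  refine ⟨u⁻¹ * ((b * b) • RatFunc.X ^ m + b • (RatFunc.X ^ (m + 1) * r) - r), mul_mem hi
    (sub_mem (add_mem (Subalgebra.smul_mem _ (hX _) _)
      (Subalgebra.smul_mem _ (mul_mem (hX _) hr) _)) hr), ?_⟩
  apply mul_left_cancel₀ h0
  rw [mul_inv_cancel₀ h0, mul_add, mul_left_comm u (RatFunc.X ^ _), mul_inv_cancel_left₀ h0, hu']
  simp only [RatFunc.smul_eq_C_mul, map_mul, map_neg]
  ring

theorem dilate (a : Fˣ) (hu : HasJet m u b) : HasJet m (dilate a u) (b * ((a ^ m : Fˣ) : F)) := by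
  obtain ⟨r, hr, rfl⟩ := hu
  refine ⟨((a : F) ^ (m + 1)) • QuantumTeichmuller.dilate a r,
    Subalgebra.smul_mem _ (dilate_mem_regular a hr) _, ?_⟩
  rw [map_add, map_add, map_one, map_smul, map_mul, map_pow, map_pow, dilate_X, _root_.smul_pow,
    _root_.smul_pow, smul_smul, smul_mul_assoc, mul_smul_comm, Units.val_pow_eq_pow_val]

theorem laurentCoeff (hu : HasJet m u b) (k : ℕ) :
    laurentCoeff m (RatFunc.X ^ (k : ℤ) * u) =
      (if k = 0 then b else 0) + if k = m then 1 else 0 := by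
  obtain ⟨r, hr, rfl⟩ := hu
  have h1 : (RatFunc.X : RatFunc F) ^ (k : ℤ) * (1 + b • RatFunc.X ^ m + RatFunc.X ^ (m + 1) * r)
      = RatFunc.X ^ (k : ℤ) + b • RatFunc.X ^ ((m + k : ℕ) : ℤ)
        + RatFunc.X ^ ((m + 1 : ℕ) : ℤ) * (RatFunc.X ^ k * r) := by
    simp only [zpow_natCast, RatFunc.smul_eq_C_mul]
    ring
  rw [h1, map_add, map_add, map_smul, laurentCoeff_zpow, laurentCoeff_zpow,
    laurentCoeff_zpow_mul (by push_cast; omega) (mul_mem (pow_mem X_mem_regular k) hr)]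
  have h2 : ((m : ℤ) = k) ↔ k = m := by omega
  have h3 : ((m : ℤ) = ((m + k : ℕ) : ℤ)) ↔ k = 0 := by omega
  simp only [h2, h3, smul_eq_mul, mul_ite, mul_one, mul_zero, add_zero]
  rw [add_comm]

theorem prod_range (hm : 0 < m) (f : ℕ → RatFunc F) (β : ℕ → F) (h : ∀ j, HasJet m (f j) (β j))
    (l : ℕ) : HasJet m (∏ j ∈ Finset.range l, f j) (∑ j ∈ Finset.range l, β j) := by
  induction l with
  | zero => simpa using one
  | succ l ih =>
    rw [Finset.prod_range_succ, Finset.sum_range_succ]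
    exact ih.mul hm (h l)

end HasJet

theorem exists_hasJet {u : RatFunc F} (hu : IsOneUnit u) (h1 : u ≠ 1) :
    ∃ m b, 0 < m ∧ b ≠ 0 ∧ HasJet m u b ∧ HasLead (u - 1) m b := by
  obtain ⟨e, b, hb, h⟩ := exists_hasLead (sub_ne_zero.2 h1)
  obtain ⟨r, hr, hur⟩ := hu
  have he : 0 < e := by
    by_contra hle
    have h2 := h.laurentCoeff
    have h3 := laurentCoeff_zpow_mul (N := e) (e := 1) (by omega) hr
    rw [zpow_one, ← add_sub_cancel_left 1 (RatFunc.X * r), ← hur, h2] at h3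
    exact hb h3
  lift e to ℕ using he.le
  refine ⟨e, b, by exact_mod_cast he, hb, ?_, h⟩
  obtain ⟨v, ⟨s, hs, rfl⟩, h⟩ := h
  refine ⟨b • s, Subalgebra.smul_mem _ hs _, ?_⟩
  rw [← sub_add_cancel u 1, h, zpow_natCast]
  simp only [RatFunc.smul_eq_C_mul]
  ring

theorem laurentCoeff_algebraMap (n : ℕ) (p : F[X]) :
    laurentCoeff n (algebraMap F[X] (RatFunc F) p) = p.coeff n := by
  induction p using Polynomial.induction_on' with
  | add p r hp hr => rw [map_add, map_add, hp, hr, coeff_add]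
  | monomial k a =>
    rw [← C_mul_X_pow_eq_monomial, map_mul, map_pow, RatFunc.algebraMap_X, RatFunc.algebraMap_C,
      ← RatFunc.smul_eq_C_mul, map_smul, ← zpow_natCast, laurentCoeff_zpow, coeff_C_mul_X_pow]
    simp

/-- A rational function with linear growth at infinity is invariant only under trivial dilations of
the variable. -/
theorem eq_one_of_dilate_eq {α : F} {g : RatFunc F} (hα : α ≠ 0) (h1 : HasLead (flip 1 g) (-1) α)
    {a : Fˣ} (h : dilate a g = g) : a = 1 := by
  have e6 := h1.dilate a⁻¹
  rw [dilate_flip, inv_inv, ← flip_dilate, h] at e6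
  have e7 := e6.coeff_unique h1
  rw [mul_eq_right₀ hα, _root_.zpow_neg_one, inv_inv] at e7
  exact Units.ext e7

/-- The symmetry of a solution under an inversion of the variable forces its value at the origin
to be `1`. -/
theorem SideRelation.value_eq_one {Q c β κ : Fˣ} {α : F} {g : RatFunc F} (h : SideRelation Q c g)
    (hQ : ∀ m : ℤ, Q ^ m = 1 → m = 0) (h0 : HasLead g 0 (β : F)) (hα : α ≠ 0)
    (h1 : HasLead (flip 1 g) (-1) α)
    (hf : flip (c * β * Q⁻¹) g = (κ : F) • (RatFunc.X⁻¹ * g)) : β = 1 := by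
  have hg := h0.ne_zero β.ne_zero
  have hd : ∀ a : Fˣ, dilate a g ≠ 0 := fun a => (_root_.map_ne_zero _).2 hg
  have hX := RatFunc.X_ne_zero (K := F)
  have e1 : flip c g
      = ((κ * (β * Q⁻¹)⁻¹ : Fˣ) : F) • (RatFunc.X⁻¹ * dilate (β * Q⁻¹) g) := by
    have := congrArg (dilate (β * Q⁻¹)) hf
    rw [dilate_flip, map_smul, map_mul, map_inv₀, dilate_X, smul_inv₀, smul_mul_assoc,
      smul_smul, mul_assoc c, mul_inv_cancel_right, ← Units.val_inv_eq_inv_val,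
      ← Units.val_mul] at this
    exact this
  have e2 : flip (c * Q⁻¹) g = ((κ * β⁻¹ : Fˣ) : F) • (RatFunc.X⁻¹ * dilate β g) := by
    have := congrArg (dilate β) hf
    rw [dilate_flip, map_smul, map_mul, map_inv₀, dilate_X, smul_inv₀, smul_mul_assoc,
      smul_smul, mul_right_comm c, mul_inv_cancel_right] at this
    rw [this, Units.val_mul, Units.val_inv_eq_inv_val]
  have e3 : g * dilate (β * Q⁻¹) g = dilate Q⁻¹ g * dilate β g := by
    unfold SideRelation at h
    rw [e1, e2, mul_smul_comm, mul_smul_comm, smul_smul, ← Units.val_mul,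
      show Q * (κ * β⁻¹) = κ * (β * Q⁻¹)⁻¹ by
        rw [_root_.mul_inv_rev, inv_inv]; exact mul_left_comm _ _ _,
      mul_left_comm, mul_left_comm (dilate Q⁻¹ g)] at h
    have h2 := smul_right_injective _ (Units.ne_zero (κ * (β * Q⁻¹)⁻¹)) h
    exact mul_left_cancel₀ (inv_ne_zero hX) h2
  -- `g(β X) / g(X)` is invariant under a dilation of infinite order, and has the value `1` at `0`
  obtain ⟨k, hk⟩ := eq_const_of_dilate_eq (a := Q⁻¹) (f := dilate β g / g)
    (fun m hm => by
      rw [_root_.inv_zpow'] at hm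
      have := hQ _ hm
      omega)
    (by
      rw [map_div₀, dilate_dilate, mul_comm Q⁻¹, div_eq_div_iff (hd _) hg]
      linear_combination e3)
  have e4 : HasLead (dilate β g / g) 0 1 := by
    have := (h0.dilate β).mul h0.inv
    rw [div_eq_mul_inv]
    simpa using this
  have e5 : HasLead (k • (1 : RatFunc F)) 0 (k * 1) := HasLead.one.smul k
  rw [← hk] at e5
  have hk1 : k = 1 := by rw [← mul_one k]; exact e5.coeff_unique e4
  rw [hk1, one_smul, div_eq_one_iff_eq hg] at hk
  exact eq_one_of_dilate_eq hα h1 hk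

end origin
end QuantumTeichmuller

namespace QuantumTeichmuller

/-! ### Solutions of the functional equations: classification -/

section classification
open Polynomial
variable {F : Type*} [Field F]
variable {K : Type*} [DivisionRing K] [Algebra F K] {Q c : Fˣ} {A B : K}

theorem Transcendental.of_semiconjBy {u x y : K} (hu : u ≠ 0) (h : SemiconjBy u x y)
    (hx : Transcendental F x) : Transcendental F y := by
  rw [transcendental_iff] at hx ⊢
  intro p hp
  apply hx
  have h1 : SemiconjBy u (aeval x p) (aeval y p) := by
    clear hp
    induction p using Polynomial.induction_on' with
    | add p r hp hr => rw [map_add, map_add]; exact hp.add_right hr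
    | monomial m a =>
      rw [aeval_monomial, aeval_monomial]
      exact SemiconjBy.mul_right (Algebra.commutes a u).symm (h.pow_right m)
  rw [SemiconjBy, hp, zero_mul] at h1
  exact (mul_eq_zero.1 h1).resolve_left hu

/-- The pentagon relation for a solution that is symmetric under inversion, in terms of
positive powers of the variables. -/
theorem PentagonRelation.of_flip_eq {h : QuantumPair Q A B} {g : RatFunc F}
    (hp : PentagonRelation h c g) (hg : g ≠ 0) {κ : Fˣ}
    (hf : flip (c * Q⁻¹) g = (κ : F) • (RatFunc.X⁻¹ * g)) :
    ∃ (A' B' : K) (hA' : Transcendental F A') (hB' : Transcendental F B'),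
      A' = h.evalRight (dilate Q⁻¹ (dilate Q⁻¹ g)⁻¹) * A ^ (1 : ℤ) ∧
      B' = B ^ (1 : ℤ) * h.evalLeft (dilate Q⁻¹ (dilate Q⁻¹ g)⁻¹) ∧
      ratEval A' hA' (dilate Q⁻¹ g) * h.evalRight (dilate Q⁻¹ g)
        = h.evalLeft (dilate Q⁻¹ g) * ratEval B' hB' (dilate Q⁻¹ g) := by
  obtain ⟨Y, Z, hY, hZ, hY', hZ', hp⟩ := hp
  have hA := h.left_ne_zero
  have hB := h.right_ne_zero
  set γ := dilate Q⁻¹ g with hγ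
  have hγ0 : γ ≠ 0 := (_root_.map_ne_zero _).2 hg
  have hW := transcendental_unit_smul_inv hY (c * Q⁻¹)
  have hV := transcendental_unit_smul_inv hZ (c * Q⁻¹)
  have eY := congrArg (ratEval Y hY) hf
  have eZ := congrArg (ratEval Z hZ) hf
  rw [ratEval_flip hY (c * Q⁻¹) hW rfl, map_smul, map_mul, map_inv₀, ratEval_X] at eY
  rw [ratEval_flip hZ (c * Q⁻¹) hV rfl, mul_comm RatFunc.X⁻¹, map_smul, map_mul, map_inv₀,
    ratEval_X] at eZ
  have hY0 : Y ≠ 0 := by rintro rfl; exact hY isAlgebraic_zero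
  have hZ0 : Z ≠ 0 := by rintro rfl; exact hZ isAlgebraic_zero
  have hAr : ∀ f, A * h.evalRight f = h.evalRight (dilate Q⁻¹ f) * A := fun f => by
    have := h.zpow_mul_evalRight 1 f
    rwa [zpow_one, _root_.zpow_neg_one] at this
  have hBl : ∀ f, h.evalLeft f * B = B * h.evalLeft (dilate Q⁻¹ f) := fun f => by
    have := h.evalLeft_mul_zpow 1 f
    rwa [zpow_one, _root_.zpow_neg_one] at this
  have hAr' : ∀ f, A⁻¹ * h.evalRight (dilate Q⁻¹ f) = h.evalRight f * A⁻¹ := fun f => by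
    rw [inv_mul_eq_iff_eq_mul₀ hA, ← mul_assoc, hAr, mul_inv_cancel_right₀ hA]
  -- the relation in terms of `W = c Q⁻¹ Y⁻¹` and `V = c Q⁻¹ Z⁻¹`
  have key : h.evalRight γ * ratEval _ hW g = ratEval _ hV g * h.evalLeft γ := by
    have e1 : Y * ratEval _ hW g * B⁻¹ = A⁻¹ * (ratEval _ hV g * Z) := by
      rw [eY, eZ, mul_smul_comm, smul_mul_assoc, mul_inv_cancel_left₀ hY0, smul_mul_assoc,
        inv_mul_cancel_right₀ hZ0, mul_smul_comm, hp]
    generalize ratEval _ hW g = w at e1 ⊢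
    generalize ratEval _ hV g = v at e1 ⊢
    rw [hY', hZ'] at e1
    simp only [smul_mul_assoc, mul_smul_comm] at e1
    have e2 := smul_right_injective _ c.ne_zero e1
    rw [← hAr', mul_assoc, mul_assoc] at e2
    have e3 := mul_left_cancel₀ (inv_ne_zero hA) e2
    have e4 := congrArg (· * B) e3
    simp only [mul_assoc, inv_mul_cancel₀ hB, mul_one, hBl, inv_mul_cancel_left₀ hB] at e4
    exact e4
  have hγi : dilate Q⁻¹ g⁻¹ = γ⁻¹ := map_inv₀ _ _
  have hru := (map_ne_zero_iff _ (h.evalRight : RatFunc F →ₐ[F] K).toRingHom.injective).2 hγ0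
  have hlu := (map_ne_zero_iff _ (h.evalLeft : RatFunc F →ₐ[F] K).toRingHom.injective).2 hγ0
  have hQc : ((c * Q⁻¹ : Fˣ) : F) * (c : F)⁻¹ = ((Q⁻¹ : Fˣ) : F) := by
    rw [← Units.val_inv_eq_inv_val, ← Units.val_mul, mul_right_comm, mul_inv_cancel, one_mul]
  set A' := h.evalRight (dilate Q⁻¹ γ⁻¹) * A ^ (1 : ℤ) with hA'
  set B' := B ^ (1 : ℤ) * h.evalLeft (dilate Q⁻¹ γ⁻¹) with hB'
  have eA' : A' = A * h.evalRight γ⁻¹ := by rw [hA', zpow_one, hAr]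
  have eB' : B' = h.evalLeft γ⁻¹ * B := by rw [hB', zpow_one, hBl]
  have sA : SemiconjBy (h.evalRight γ) (((c * Q⁻¹ : Fˣ) : F) • Y⁻¹) (((Q⁻¹ : Fˣ) : F) • A') := by
    rw [SemiconjBy, hY', smul_inv₀, _root_.mul_inv_rev, inv_inv, ← map_inv₀, hAr, hγi, smul_smul,
      hQc, mul_smul_comm, ← mul_assoc, ← map_mul, mul_inv_cancel₀ hγ0, map_one, one_mul, eA',
      smul_mul_assoc, mul_assoc, ← map_mul, inv_mul_cancel₀ hγ0, map_one, mul_one]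
  have sB : SemiconjBy (h.evalLeft γ) (((Q⁻¹ : Fˣ) : F) • B') (((c * Q⁻¹ : Fˣ) : F) • Z⁻¹) := by
    rw [SemiconjBy, hZ', smul_inv₀, _root_.mul_inv_rev, inv_inv, ← map_inv₀, hBl, hγi, smul_smul,
      hQc, mul_smul_comm, eB', ← mul_assoc, ← map_mul, mul_inv_cancel₀ hγ0, map_one, one_mul,
      smul_mul_assoc, mul_assoc, ← map_mul, inv_mul_cancel₀ hγ0, map_one, mul_one]
  have hQQ : ∀ x : K, (Q : F) • ((Q⁻¹ : Fˣ) : F) • x = x := fun x => by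
    rw [smul_smul, ← Units.val_mul, mul_inv_cancel, Units.val_one, one_smul]
  have sB' : SemiconjBy (h.evalLeft γ)⁻¹ (((c * Q⁻¹ : Fˣ) : F) • Z⁻¹) (((Q⁻¹ : Fˣ) : F) • B') :=
    sB.inv_symm_left₀
  have hQA' := Transcendental.of_semiconjBy hru sA hW
  have hQB' := Transcendental.of_semiconjBy (inv_ne_zero hlu) sB' hV
  have htA' : Transcendental F A' := by
    have := transcendental_unit_smul hQA' Q
    rwa [hQQ] at this
  have htB' : Transcendental F B' := by
    have := transcendental_unit_smul hQB' Q
    rwa [hQQ] at this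
  refine ⟨A', B', htA', htB', rfl, rfl, ?_⟩
  rw [hγ, ratEval_dilate htA' Q⁻¹ hQA' rfl, ratEval_dilate htB' Q⁻¹ hQB' rfl, ← hγ,
    ← (semiconjBy_ratEval (hx := hW) (hy := hQA') sA g).eq, key,
    (semiconjBy_ratEval (hx := hQB') (hy := hV) sB g).eq]

theorem dilate_algebraMap_eq_sum (a : Fˣ) {p : F[X]} {M : ℕ} (hp : p.natDegree < M) :
    dilate a (algebraMap F[X] (RatFunc F) p)
      = ∑ l ∈ Finset.range M, (p.coeff l * ((a ^ l : Fˣ) : F)) • RatFunc.X ^ (l : ℤ) := by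
  rw [algHom_algebraMap_eq_sum _ hp]
  refine Finset.sum_congr rfl fun l _ => ?_
  rw [dilate_X, _root_.smul_pow, smul_smul, Units.val_pow_eq_pow_val, zpow_natCast]

theorem sum_two_rows {V : Type*} [AddCommGroup V] [Module F V] {m M : ℕ} (hm : m < M)
    (w : ℕ → ℕ → F) (β : ℕ → F) (v : ℕ → ℕ → V) :
    ∑ k ∈ Finset.range M, ∑ l ∈ Finset.range M,
        (w k l * ((if k = 0 then β l else 0) + if k = m then 1 else 0)) • v k l
      = ∑ l ∈ Finset.range M, (w 0 l * β l) • v 0 l + ∑ l ∈ Finset.range M, w m l • v m l := by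
  simp only [mul_add, add_smul, Finset.sum_add_distrib]
  congr 1
  · rw [Finset.sum_eq_single 0]
    · simp
    · intro k _ hk; simp [hk]
    · intro h; exact absurd (Finset.mem_range.2 (by omega)) h
  · rw [Finset.sum_eq_single m]
    · simp
    · intro k _ hk; simp [hk]
    · intro h; exact absurd (Finset.mem_range.2 hm) h

theorem sum_pow_mul_one_sub (b θ : F) (l : ℕ) (h : θ ≠ 1) :
    ∑ j ∈ Finset.range l, -b * θ * θ ^ j = b * θ / (1 - θ) * (θ ^ l - 1) := by
  have h1 : 1 - θ ≠ 0 := sub_ne_zero.2 (Ne.symm h)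
  induction l with
  | zero => simp
  | succ l ih =>
    rw [Finset.sum_range_succ, ih]
    field_simp
    ring

/-- Let `b X ^ m` be the first non-constant term in the expansion at the origin of a solution `γ`.
The coefficient of `A ^ m` in the pentagon relation shows that the product of `γ(Q ^ j X)` over
`j < m` has no terms other than a constant and a multiple of `X ^ m`. -/
theorem prod_dilate_eq (h : QuantumPair Q A B) (hQ : ∀ m : ℤ, Q ^ m = 1 → m = 0)
    {γ : RatFunc F} {p d : F[X]} (hp0 : p.coeff 0 = 1) (hd0 : d.coeff 0 = 1)
    (hγ : γ = algebraMap F[X] (RatFunc F) p / algebraMap F[X] (RatFunc F) d)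
    (hrel : aeval (h.evalRight (dilate Q⁻¹ γ⁻¹) * A ^ (1 : ℤ)) p * h.evalRight γ * h.evalLeft 1 *
        aeval (B ^ (1 : ℤ) * h.evalLeft (dilate Q⁻¹ γ⁻¹)) d
      = aeval (h.evalRight (dilate Q⁻¹ γ⁻¹) * A ^ (1 : ℤ)) d * h.evalRight 1 * h.evalLeft γ *
        aeval (B ^ (1 : ℤ) * h.evalLeft (dilate Q⁻¹ γ⁻¹)) p)
    {m : ℕ} {b : F} (hm : 0 < m) (hb : b ≠ 0) (hj : HasJet m γ b) (hl : HasLead (γ - 1) m b) :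
    ∃ k : F, ∏ j ∈ Finset.range m, dilate (Q ^ (j : ℤ)) γ = 1 + k • RatFunc.X ^ m := by
  have hγ0 := (hj.isOneUnit hm).ne_zero
  have hd00 : d ≠ 0 := by rintro rfl; simp at hd0
  have hD0 : algebraMap F[X] (RatFunc F) d ≠ 0 := RatFunc.algebraMap_ne_zero hd00
  set θ : Fˣ := Q ^ (-(m : ℤ)) with hθ
  have hθ1 : (θ : F) ≠ 1 := by
    intro h1
    have := hQ _ (Units.ext h1 : θ = 1)
    omega
  have hθ1' : 1 - (θ : F) ≠ 0 := sub_ne_zero.2 (Ne.symm hθ1)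
  -- the coefficient of `A ^ m` in the normally ordered relation
  obtain ⟨M, hpM, hdM, hmM⟩ : ∃ M, p.natDegree < M ∧ d.natDegree < M ∧ m < M :=
    ⟨p.natDegree + d.natDegree + m + 1, by omega, by omega, by omega⟩
  have hc := h.contract_aeval (s := 1) (by norm_num) (dilate Q⁻¹ γ⁻¹) γ 1 1 γ p d d p hpM hdM hdM
    hpM hrel (laurentCoeff (m : ℤ))
  set G := QuantumPair.orderedProd Q 1 (dilate Q⁻¹ γ⁻¹) with hG
  set c₁ := b * θ / (1 - θ) with hc₁
  have hθpow : ∀ l : ℕ, ((Q ^ (-(1 * (l : ℤ)))) ^ m : Fˣ) = θ ^ l := fun l => by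
    rw [hθ, ← zpow_natCast, ← zpow_natCast, ← _root_.zpow_mul, ← _root_.zpow_mul]
    congr 1
    ring
  have hQθ : (Q⁻¹ ^ m : Fˣ) = θ := by rw [hθ, _root_.zpow_neg, zpow_natCast, inv_pow]
  have hGj : ∀ l, HasJet m (G l) (c₁ * ((θ : F) ^ l - 1)) := fun l => by
    have := HasJet.prod_range hm _ _
      (fun j : ℕ => ((hj.inv hm).dilate Q⁻¹).dilate (Q ^ (-(1 * (j : ℤ))))) l
    simp only [map_inv₀] at this
    rw [hG, QuantumPair.orderedProd, hc₁, ← sum_pow_mul_one_sub _ _ _ hθ1]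
    simp only [map_inv₀]
    convert this using 2 with j
    rw [hθpow, hQθ, Units.val_pow_eq_pow_val]
  have hcL : ∀ k l : ℕ, laurentCoeff (m : ℤ) (RatFunc.X ^ (1 * (k : ℤ)) *
      (dilate (Q ^ (-(1 * (l : ℤ)))) 1 * G l))
      = (if k = 0 then c₁ * ((θ : F) ^ l - 1) else 0) + if k = m then 1 else 0 := fun k l => by
    rw [map_one, one_mul, one_mul, (hGj l).laurentCoeff]
  have hcR : ∀ k l : ℕ, laurentCoeff (m : ℤ) (RatFunc.X ^ (1 * (k : ℤ)) *
      (dilate (Q ^ (-(1 * (l : ℤ)))) γ * G l))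
      = (if k = 0 then b * (θ : F) ^ l + c₁ * ((θ : F) ^ l - 1) else 0) +
        if k = m then 1 else 0 := fun k l => by
    have h1 := (hj.dilate (Q ^ (-(1 * (l : ℤ))))).mul hm (hGj l)
    rw [hθpow, Units.val_pow_eq_pow_val] at h1
    rw [one_mul, h1.laurentCoeff]
  simp only [hcL, hcR] at hc
  rw [sum_two_rows hmM (fun k l => p.coeff k * d.coeff l * ((Q ^ (-(k * l : ℤ)) : Fˣ) : F)),
    sum_two_rows hmM (fun k l => d.coeff k * p.coeff l * ((Q ^ (-(k * l : ℤ)) : Fˣ) : F))] at hc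
  set P := algebraMap F[X] (RatFunc F) p with hP
  set D := algebraMap F[X] (RatFunc F) d with hD
  have hQm : ∀ l : ℕ, ((Q ^ (-(m * l : ℤ)) : Fˣ) : F) = ((θ ^ l : Fˣ) : F) := fun l => by
    rw [← hθpow, ← zpow_natCast, ← _root_.zpow_mul]
    congr 2
    ring
  have hdP : ∀ a : Fˣ, ∑ l ∈ Finset.range M, (p.coeff l * ((a ^ l : Fˣ) : F)) •
      (RatFunc.X : RatFunc F) ^ (l : ℤ) = dilate a P := fun a =>
    (dilate_algebraMap_eq_sum a hpM).symm
  have hdD : ∀ a : Fˣ, ∑ l ∈ Finset.range M, (d.coeff l * ((a ^ l : Fˣ) : F)) •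
      (RatFunc.X : RatFunc F) ^ (l : ℤ) = dilate a D := fun a =>
    (dilate_algebraMap_eq_sum a hdM).symm
  have hD1 := hdD 1
  have hP1 := hdP 1
  rw [dilate_one, eq_comm] at hD1 hP1
  have hG0 : G 0 = 1 := by simp [hG, QuantumPair.orderedProd]
  have r1 : ∑ l ∈ Finset.range M, (p.coeff 0 * d.coeff l * ((Q ^ (-((0 : ℕ) * l : ℤ)) : Fˣ) : F) *
        (c₁ * ((θ : F) ^ l - 1))) • (G 0 * dilate (Q ^ (-(1 * ((0 : ℕ) : ℤ)))) γ *
          RatFunc.X ^ (1 * (l : ℤ))) = c₁ • (γ * (dilate θ D - D)) := by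
    conv_rhs => rw [← hdD θ, hD1, ← Finset.sum_sub_distrib, Finset.mul_sum,
      Finset.smul_sum]
    refine Finset.sum_congr rfl fun l _ => ?_
    rw [hp0, hG0, ← sub_smul, mul_smul_comm, smul_smul]
    simp only [Nat.cast_zero, zero_mul, mul_zero, neg_zero, zpow_zero, dilate_one, one_mul,
      Units.val_one, mul_one, one_pow, Units.val_pow_eq_pow_val]
    congr 1
    ring
  have r2 : ∑ l ∈ Finset.range M, (p.coeff m * d.coeff l * ((Q ^ (-(m * l : ℤ)) : Fˣ) : F)) •
        (G m * dilate (Q ^ (-(1 * (m : ℤ)))) γ * RatFunc.X ^ (1 * (l : ℤ)))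
      = p.coeff m • (G m * dilate θ γ * dilate θ D) := by
    rw [← hdD, Finset.mul_sum, Finset.smul_sum]
    refine Finset.sum_congr rfl fun l _ => ?_
    rw [hQm, one_mul, one_mul, mul_smul_comm, smul_smul, mul_assoc (p.coeff m)]
  have r3 : ∑ l ∈ Finset.range M, (d.coeff 0 * p.coeff l * ((Q ^ (-((0 : ℕ) * l : ℤ)) : Fˣ) : F) *
        (b * (θ : F) ^ l + c₁ * ((θ : F) ^ l - 1))) • (G 0 * dilate (Q ^ (-(1 * ((0 : ℕ) : ℤ)))) 1 *
          RatFunc.X ^ (1 * (l : ℤ))) = (b + c₁) • dilate θ P - c₁ • P := by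
    conv_rhs => rw [← hdP θ, hP1, Finset.smul_sum, Finset.smul_sum,
      ← Finset.sum_sub_distrib]
    refine Finset.sum_congr rfl fun l _ => ?_
    rw [hd0, hG0, map_one, smul_smul, smul_smul, ← sub_smul]
    simp only [Nat.cast_zero, zero_mul, neg_zero, zpow_zero, one_mul,
      Units.val_one, mul_one, one_pow, Units.val_pow_eq_pow_val]
    congr 1
    ring
  have r4 : ∑ l ∈ Finset.range M, (d.coeff m * p.coeff l * ((Q ^ (-(m * l : ℤ)) : Fˣ) : F)) •
        (G m * dilate (Q ^ (-(1 * (m : ℤ)))) 1 * RatFunc.X ^ (1 * (l : ℤ)))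
      = d.coeff m • (G m * dilate θ P) := by
    rw [← hdP, Finset.mul_sum, Finset.smul_sum]
    refine Finset.sum_congr rfl fun l _ => ?_
    rw [hQm, one_mul, map_one, mul_one, mul_smul_comm, smul_smul, mul_assoc (d.coeff m),
      one_mul]
  rw [r1, r2, r3, r4] at hc
  have hPγ : P = γ * D := by rw [hγ, div_mul_cancel₀ _ hD0]
  have hPθ : dilate θ P = dilate θ γ * dilate θ D := by rw [hPγ, map_mul]
  have hpd : p.coeff m = d.coeff m + b := by
    have h1 : HasLead D 0 1 := by
      have := hasLead_ratio (F := F) 0 (p := d) (d := 1) (by rw [hd0]; exact one_ne_zero) (by simp)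
      rwa [hd0, map_one, div_one, zpow_zero, one_mul] at this
    have h2 := (hl.mul h1).laurentCoeff
    rw [sub_mul, one_mul, ← hPγ, map_sub, add_zero, mul_one, laurentCoeff_algebraMap,
      laurentCoeff_algebraMap] at h2
    rw [← h2]; ring
  have hDθ : dilate θ D ≠ 0 := (_root_.map_ne_zero _).2 hD0
  have e1 : c₁ • γ + b • (G m * dilate θ γ) = (b + c₁) • dilate θ γ := by
    apply mul_right_cancel₀ hDθ
    rw [hPθ, hpd] at hc
    rw [hPγ] at hc
    simp only [RatFunc.smul_eq_C_mul, map_add] at hc ⊢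
    linear_combination hc
  -- a `Q`-difference equation for the product `S`, with monomial solutions for `S - 1`
  set S := ∏ j ∈ Finset.range m, dilate (Q ^ (j : ℤ)) γ with hS
  have hSθ : dilate θ S = ∏ j ∈ Finset.range m, dilate (Q ^ ((j : ℤ) - m)) γ := by
    rw [hS, map_prod]
    refine Finset.prod_congr rfl fun j _ => ?_
    rw [dilate_dilate, hθ, ← _root_.zpow_add]
    congr 3
    ring
  have hSθQ : dilate Q (dilate θ S) =
      ∏ j ∈ Finset.range m, dilate (Q ^ (((j + 1 : ℕ) : ℤ) - m)) γ := by
    rw [hSθ, map_prod]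
    refine Finset.prod_congr rfl fun j _ => ?_
    rw [dilate_dilate, ← _root_.zpow_one_add]
    congr 3
    push_cast
    ring
  have hGS : G m * dilate θ S = 1 := by
    rw [hSθ, ← Finset.prod_range_reflect, hG, QuantumPair.orderedProd, ← Finset.prod_mul_distrib]
    refine Finset.prod_eq_one fun j hj => ?_
    have := Finset.mem_range.1 hj
    rw [dilate_dilate, ← _root_.zpow_neg_one Q, ← _root_.zpow_add, map_inv₀,
      show -(1 * (j : ℤ)) + -1 = ((m - 1 - j : ℕ) : ℤ) - m by omega]
    exact inv_mul_cancel₀ ((_root_.map_ne_zero _).2 hγ0)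
  have hshift : γ * dilate θ S = dilate θ γ * dilate Q (dilate θ S) := by
    have h1 := Finset.prod_range_succ (fun j : ℕ => dilate (Q ^ ((j : ℤ) - m)) γ) m
    rw [Finset.prod_range_succ', ← hSθQ, ← hSθ, sub_self, zpow_zero, dilate_one] at h1
    rw [mul_comm, ← h1, mul_comm, hθ]
    simp
  have hγθ : dilate θ γ ≠ 0 := (_root_.map_ne_zero _).2 hγ0
  have e2 : c₁ • dilate Q (dilate θ S) + b • (1 : RatFunc F) = (b + c₁) • dilate θ S := by
    apply mul_left_cancel₀ hγθ
    simp only [RatFunc.smul_eq_C_mul, map_add] at e1 ⊢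
    linear_combination (dilate θ S) * e1 - RatFunc.C c₁ * hshift
      - RatFunc.C b * dilate θ γ * hGS
  have e3 : dilate Q (dilate θ S - 1) = ((Q ^ (m : ℤ) : Fˣ) : F) • (dilate θ S - 1) := by
    have hθQ : (Q ^ (m : ℤ) : Fˣ) = θ⁻¹ := by rw [hθ, _root_.zpow_neg, inv_inv]
    have hb' : c₁ * (1 - θ) = b * θ := by rw [hc₁]; field_simp
    have hc₁0 : c₁ ≠ 0 := div_ne_zero (mul_ne_zero hb θ.ne_zero) hθ1'
    have hb2 : b + c₁ = c₁ * ((θ⁻¹ : Fˣ) : F) := by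
      rw [hc₁, Units.val_inv_eq_inv_val]
      have := θ.ne_zero
      field_simp
      ring
    have hb3 : b = c₁ * ((θ⁻¹ : Fˣ) : F) - c₁ := by rw [← hb2]; ring
    rw [hb2] at e2
    rw [hb3] at e2
    rw [hθQ, map_sub, map_one]
    apply smul_right_injective _ hc₁0
    simp only [RatFunc.smul_eq_C_mul, map_mul, map_sub] at e2 ⊢
    linear_combination e2
  obtain ⟨k, hk⟩ := eq_zpow_of_dilate_eq hQ e3
  have h4 := congrArg (dilate θ⁻¹) hk
  rw [map_sub, map_one, dilate_dilate, inv_mul_cancel, dilate_one, map_smul, map_zpow₀, dilate_X,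
    unit_smul_zpow, smul_smul, sub_eq_iff_eq_add', zpow_natCast, zpow_natCast] at h4
  exact ⟨_, h4⟩

/-- A solution without zero at the origin is a polynomial of degree one. -/
theorem PentagonRelation.eq_one_add_smul_X {h : QuantumPair Q A B} {g : RatFunc F}
    (hp : PentagonRelation h c g) (hs : SideRelation Q c g) (hQ : ∀ m : ℤ, Q ^ m = 1 → m = 0)
    (hζ : ∀ m : ℕ, 0 < m → ∃ ζ : Fˣ, IsPrimitiveRoot ζ m) {e : ℤ} (he : e ≤ 0) {β : F}
    (hβ : β ≠ 0) (h0 : HasLead g e β) :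
    ∃ k : Fˣ, g = 1 + (k : F) • RatFunc.X ∧ k * k * c = Q := by
  have hg := h0.ne_zero hβ
  obtain ⟨e', p, d, hp0, hd0, hpd⟩ := exists_ratio hg
  have hlead := hasLead_ratio e' hp0 hd0
  rw [← hpd] at hlead
  obtain rfl := h0.order_unique hβ hlead hp0
  have hpn : p ≠ 0 := by rintro rfl; simp at hp0
  have hdn : d ≠ 0 := by rintro rfl; simp at hd0
  have hdn' : X ^ (-e).toNat * d ≠ 0 := mul_ne_zero (pow_ne_zero _ X_ne_zero) hdn
  have hg' : g =
      algebraMap F[X] (RatFunc F) p / algebraMap F[X] (RatFunc F) (X ^ (-e).toNat * d) := by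
    rw [hpd, map_mul, map_pow, RatFunc.algebraMap_X, ← zpow_natCast, Int.toNat_of_nonneg (by omega),
      _root_.zpow_neg, div_mul_eq_div_div_swap, div_inv_eq_mul, mul_comm]
  have hflip := hasLead_flip_div hpn hdn'
  rw [← hg'] at hflip
  have hα : p.leadingCoeff / (X ^ (-e).toNat * d).leadingCoeff ≠ 0 :=
    div_ne_zero (leadingCoeff_ne_zero.2 hpn) (leadingCoeff_ne_zero.2 hdn')
  have hord := hs.order_add_order hQ hβ hα h0 hflip
  have hnn := hp.not_neg hβ h0 hpn hdn' hg' hord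
  obtain rfl : e = 0 := by omega
  simp only [neg_zero, Int.toNat_zero, pow_zero, one_mul] at hg' hflip hα hord
  have hdeg : p.natDegree = d.natDegree + 1 := by omega
  rw [hdeg] at hflip
  simp only [Nat.cast_add, Nat.cast_one, add_sub_cancel_left] at hflip
  set β' : Fˣ := Units.mk0 _ hp0 with hβ'
  have h0' : HasLead g 0 (β' : F) := hlead
  set κ : Fˣ := Units.mk0 _ hα * (c * Q⁻¹) with hκ
  have hf : flip (c * β' * Q⁻¹) g = (κ : F) • (RatFunc.X⁻¹ * g) :=
    hp.flip_eq h0' hpn hdn hg' hdeg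
  have hβ1 := hs.value_eq_one hQ h0' hα hflip hf
  rw [hβ1, mul_one] at hf
  rw [hβ1, Units.val_one] at h0'
  have hp1 : p.coeff 0 = 1 := by
    have := congrArg Units.val hβ1
    rwa [hβ', Units.val_mk0, Units.val_one] at this
  obtain ⟨A', B', hA', hB', eA', eB', hrel⟩ := hp.of_flip_eq hg hf
  set γ := dilate Q⁻¹ g with hγ
  have hγu : IsOneUnit γ := by
    obtain ⟨u, hu, hgu⟩ := h0'
    rw [one_smul, zpow_zero, one_mul] at hgu
    rw [hγ, hgu]
    exact hu.dilate _
  have hγflip : HasLead (flip 1 γ) (-1)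
      (((Q ^ (-1 : ℤ) : Fˣ) : F) * (p.leadingCoeff / d.leadingCoeff)) := by
    have := hflip.dilate Q
    rwa [dilate_flip, one_mul, ← one_mul Q⁻¹, ← flip_dilate] at this
  have hαγ : ((Q ^ (-1 : ℤ) : Fˣ) : F) * (p.leadingCoeff / d.leadingCoeff) ≠ 0 :=
    mul_ne_zero (Units.ne_zero _) hα
  have hγ1 : γ ≠ 1 := by
    intro h1
    rw [h1, map_one] at hγflip
    have := hγflip.order_unique hαγ HasLead.one one_ne_zero
    omega
  obtain ⟨m, b, hm, hb, hj, hl⟩ := exists_hasJet hγu hγ1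
  -- `γ` as a quotient of polynomials
  have hC : (C ((Q⁻¹ : Fˣ) : F) * X : F[X]).coeff 0 = 0 := by simp
  have hp0' : (p.comp (C ((Q⁻¹ : Fˣ) : F) * X)).coeff 0 = 1 := by
    rw [coeff_zero_eq_eval_zero, eval_comp]
    simpa [← coeff_zero_eq_eval_zero] using hp1
  have hd0' : (d.comp (C ((Q⁻¹ : Fˣ) : F) * X)).coeff 0 = 1 := by
    rw [coeff_zero_eq_eval_zero, eval_comp]
    simpa [← coeff_zero_eq_eval_zero] using hd0
  have hγr : γ = algebraMap F[X] (RatFunc F) (p.comp (C ((Q⁻¹ : Fˣ) : F) * X)) /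
      algebraMap F[X] (RatFunc F) (d.comp (C ((Q⁻¹ : Fˣ) : F) * X)) := by
    rw [hγ, hg', map_div₀, dilate_algebraMap, dilate_algebraMap]
  generalize p.comp (C ((Q⁻¹ : Fˣ) : F) * X) = P at hp0' hγr
  generalize d.comp (C ((Q⁻¹ : Fˣ) : F) * X) = D at hd0' hγr
  have hDn : D ≠ 0 := by rintro rfl; simp at hd0'
  have hA0 := aeval_ne_zero hA' hDn
  have hB0 := aeval_ne_zero hB' hDn
  have eA : ratEval A' hA' γ = (aeval A' D)⁻¹ * aeval A' P := by rw [hγr, ratEval_div']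
  have eB : ratEval B' hB' γ = aeval B' P * (aeval B' D)⁻¹ := by rw [hγr, ratEval_div]
  rw [eA, eB] at hrel
  have hrel' : aeval A' P * h.evalRight γ * h.evalLeft 1 * aeval B' D
      = aeval A' D * h.evalRight 1 * h.evalLeft γ * aeval B' P := by
    have h1 := congrArg (fun x => aeval A' D * x * aeval B' D) hrel
    simp only [mul_assoc, inv_mul_cancel₀ hB0, mul_one, mul_inv_cancel_left₀ hA0] at h1
    simp only [map_one, mul_one, mul_assoc, h1]
  rw [eA', eB'] at hrel'
  obtain ⟨k, hk⟩ := prod_dilate_eq h hQ hp0' hd0' hγr hrel' hm hb hj hl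
  -- a dilation by a root of unity fixes the product, hence `γ`
  obtain ⟨ζ, hζm⟩ := hζ m hm
  have hγ0 := hγu.ne_zero
  have hdγ : ∀ a : Fˣ, dilate a γ ≠ 0 := fun a => (_root_.map_ne_zero _).2 hγ0
  set S := ∏ j ∈ Finset.range m, dilate (Q ^ (j : ℤ)) γ with hS
  have hS0 : S ≠ 0 := Finset.prod_ne_zero_iff.2 fun j _ => hdγ _
  have hSζ : dilate ζ S = S := by
    rw [hk, map_add, map_one, map_smul, map_pow, dilate_X, _root_.smul_pow,
      ← Units.val_pow_eq_pow_val, hζm.pow_eq_one, Units.val_one, one_smul]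
  have hshift : dilate Q S * γ = S * dilate (Q ^ (m : ℤ)) γ := by
    have h1 := Finset.prod_range_succ (fun j : ℕ => dilate (Q ^ (j : ℤ)) γ) m
    rw [Finset.prod_range_succ', Nat.cast_zero, zpow_zero, dilate_one, ← hS] at h1
    rw [← h1, hS, map_prod]
    congr 1
    refine Finset.prod_congr rfl fun j _ => ?_
    rw [dilate_dilate, ← _root_.zpow_one_add, Nat.cast_add, Nat.cast_one, add_comm]
  have hshiftζ : dilate Q S * dilate ζ γ = S * dilate (Q ^ (m : ℤ)) (dilate ζ γ) := by
    have h1 := congrArg (dilate ζ) hshift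
    have h2 : ∀ (a : Fˣ) (f : RatFunc F), dilate ζ (dilate a f) = dilate a (dilate ζ f) :=
      fun a f => by rw [dilate_dilate, mul_comm, ← dilate_dilate]
    rw [map_mul, map_mul, h2 Q, hSζ, h2 (Q ^ (m : ℤ))] at h1
    exact h1
  obtain ⟨t, ht⟩ := eq_const_of_dilate_eq (a := Q ^ (m : ℤ)) (f := dilate ζ γ / γ)
    (fun n hn => by
      rw [← _root_.zpow_mul] at hn
      have := hQ _ hn
      rcases mul_eq_zero.1 this with h1 | h1
      · omega
      · exact h1)
    (by
      rw [map_div₀, div_eq_div_iff (hdγ _) hγ0]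
      apply mul_left_cancel₀ hS0
      linear_combination dilate ζ γ * hshift - γ * hshiftζ)
  have hone : HasLead (dilate ζ γ / γ) 0 1 := by
    have h1 : HasLead γ 0 1 := ⟨γ, hγu, by rw [zpow_zero, one_mul, one_smul]⟩
    have := (h1.dilate ζ).mul h1.inv
    rw [div_eq_mul_inv]
    simpa using this
  have hone' : HasLead (t • (1 : RatFunc F)) 0 (t * 1) := HasLead.one.smul t
  rw [← ht, mul_one] at hone'
  rw [hone'.coeff_unique hone, one_smul, div_eq_one_iff_eq hγ0] at ht
  have hζ1 := eq_one_of_dilate_eq hαγ hγflip ht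
  rw [hζ1] at hζm
  obtain rfl : m = 1 := (Nat.dvd_one.1 (hζm.dvd_of_pow_eq_one 1 (by simp)))
  rw [hS, Finset.prod_range_one, Nat.cast_zero, zpow_zero, dilate_one, pow_one] at hk
  have hgk : g = 1 + (k * (Q : F)) • RatFunc.X := by
    have h1 := congrArg (dilate Q) hk
    rwa [hγ, dilate_dilate, mul_inv_cancel, dilate_one, map_add, map_one, map_smul, dilate_X,
      smul_smul] at h1
  -- the inversion symmetry determines the constants
  generalize k * (Q : F) = k at hgk
  rw [hgk, map_add, map_one, map_smul, flip_X, smul_smul] at hf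
  have hX := RatFunc.X_ne_zero (K := F)
  have hf' : (1 : RatFunc F) + (k * ((c * Q⁻¹ : Fˣ) : F)) • RatFunc.X ^ (-1 : ℤ)
      = (κ : F) • RatFunc.X ^ (-1 : ℤ) + ((κ : F) * k) • (1 : RatFunc F) := by
    rw [_root_.zpow_neg_one, hf, mul_add, mul_one, mul_smul_comm, inv_mul_cancel₀ hX, smul_add,
      smul_smul]
  have c0 := congrArg (laurentCoeff 0) hf'
  have c1 := congrArg (laurentCoeff (-1)) hf'
  rw [← zpow_zero (RatFunc.X : RatFunc F)] at c0 c1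
  simp only [map_add, map_smul, laurentCoeff_zpow] at c0 c1
  norm_num at c0 c1
  have hk0 : k ≠ 0 := by rintro rfl; simp at c0
  refine ⟨Units.mk0 k hk0, by rw [Units.val_mk0]; exact hgk, Units.ext ?_⟩
  have hQ0 := Q.ne_zero
  rw [← c1] at c0
  rw [Units.val_mul, Units.val_mul, Units.val_mk0]
  field_simp at c0
  linear_combination -c0

/-- The solutions of the two functional equations. The symmetry `opposite` maps those with a zero at
the origin to those without. -/
theorem PentagonRelation.classification {h : QuantumPair Q A B} {g : RatFunc F}
    (hp : PentagonRelation h c g) (hs : SideRelation Q c g) (hg : g ≠ 0)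
    (hQ : ∀ m : ℤ, Q ^ m = 1 → m = 0) (hζ : ∀ m : ℕ, 0 < m → ∃ ζ : Fˣ, IsPrimitiveRoot ζ m) :
    (∃ k : Fˣ, g = 1 + (k : F) • RatFunc.X ∧ k * k * c = Q) ∨
    ∃ k : Fˣ, g = (1 + ((k * Q⁻¹ : Fˣ) : F) • RatFunc.X⁻¹)⁻¹ ∧ k * k = Q * c := by
  obtain ⟨e, β, hβ, h0⟩ := exists_hasLead hg
  rcases le_or_gt e 0 with he | he
  · exact Or.inl (hp.eq_one_add_smul_X hs hQ hζ he hβ h0)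
  · right
    have hfg : flip 1 g ≠ 0 := (_root_.map_ne_zero _).2 hg
    obtain ⟨δ, α, hα, h1⟩ := exists_hasLead hfg
    have hord := hs.order_add_order hQ hβ hα h0 (by rwa [neg_neg] : HasLead (flip 1 g) (- -δ) α)
    have h2 : HasLead (QuantumTeichmuller.opposite Q g) (-δ) (((Q ^ δ : Fˣ) : F) * α)⁻¹ := by
      have := (h1.dilate Q).inv
      rwa [dilate_flip, one_mul] at this
    obtain ⟨k, hk, hkc⟩ := hp.opposite.eq_one_add_smul_X hs.opposite hQ hζ (by omega)
      (inv_ne_zero (mul_ne_zero (Units.ne_zero _) hα)) h2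
    refine ⟨k, ?_, ?_⟩
    · rw [← opposite_opposite Q g, hk, QuantumTeichmuller.opposite, map_add, map_one, map_smul,
        flip_X, smul_smul, Units.val_mul]
    · rw [← hkc, inv_mul_cancel_right]

end classification
end QuantumTeichmuller

namespace QuantumTeichmuller

/-! ### Generators of Chekhov–Fock algebras and their rescalings -/

section generators
variable {n : ℕ} {σ : Fin n → Fin n → ℤ}

theorem gen_zpow (i : Fin n) (m : ℤ) : gen σ i ^ m = toField σ (mono σ (Pi.single i m) 1) := by
  obtain ⟨k, rfl | rfl⟩ := m.eq_nat_or_neg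
  · rw [zpow_natCast, gen_eq, ← map_pow, mono_single_pow]
  · rw [_root_.zpow_neg, zpow_natCast, gen_eq, ← map_pow, mono_single_pow]
    apply inv_eq_of_mul_eq_one_right
    rw [← map_mul, mono_mul_mono, ← Pi.single_add, twist_eq_zero_of_forall]
    · rw [add_neg_cancel, Pi.single_zero, zpow_zero, one_mul, one_mul, ← one_def, map_one]
    · intro j l hl
      by_cases hj : j = i
      · exact Or.inr (Pi.single_eq_of_ne (by rintro rfl; exact hl.ne hj.symm) _)
      · exact Or.inl (Pi.single_eq_of_ne hj _)

/-- Monomials with different exponents are linearly independent. -/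
theorem linearIndependent_mono {ι : Type*} {v : ι → Fin n → ℤ} (hv : Function.Injective v)
    (u : ι → Cqˣ) : LinearIndependent Cq fun k => toField σ (mono σ (v k) (u k)) := by
  have h1 : LinearIndependent Cq fun k => Finsupp.single (v k) (1 : Cq) := by
    have := (Finsupp.basisSingleOne (R := Cq) (ι := Fin n → ℤ)).linearIndependent.comp v hv
    simpa [Function.comp_def] using this
  have h2 := (h1.units_smul u).map' ((toField σ).toLinearMap ∘ₗ (toLaurent σ).symm.toLinearMap)
    (LinearMap.ker_eq_bot.2 ((toField_injective σ).comp (toLaurent σ).symm.injective))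
  convert! h2 using 2 with k
  simp [mono, Units.smul_def]

theorem linearIndependent_gen_zpow {i j : Fin n} (hij : i ≠ j) :
    LinearIndependent Cq fun v : ℤ × ℤ => gen σ i ^ v.1 * gen σ j ^ v.2 := by
  have h : Function.Injective fun v : ℤ × ℤ => (Pi.single i v.1 + Pi.single j v.2 : Fin n → ℤ) := by
    intro v w hvw
    have h1 := congrFun hvw i
    have h2 := congrFun hvw j
    simp only [Pi.add_apply, Pi.single_eq_same, Pi.single_eq_of_ne hij, Pi.single_eq_of_ne hij.symm,
      add_zero, zero_add] at h1 h2
    exact Prod.ext h1 h2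
  convert! linearIndependent_mono (σ := σ) h fun v => Units.mk0
    (q ^ twist σ (Pi.single i v.1) (Pi.single j v.2)) (zpow_ne_zero _ q_ne_zero) using 2 with v
  rw [gen_zpow, gen_zpow, ← map_mul, mono_mul_mono, one_mul, one_mul, Units.val_mk0]

theorem transcendental_gen (i : Fin n) : Transcendental Cq (gen σ i) := by
  apply transcendental_of_linearIndependent
  convert! linearIndependent_mono (σ := σ) (v := fun k : ℕ => Pi.single i (k : ℤ))
    (fun k l hkl => by simpa using congrFun hkl i) (fun _ => 1) using 2 with k
  rw [← zpow_natCast, gen_zpow, Units.val_one]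

/-- The linear map that multiplies each generator by `ξ` and raises it to the power `ε`. -/
def rescaleLinear (σ : Fin n → Fin n → ℤ) (ξ : Cqˣ) (ε : ℤ) : CFAlgebra σ →ₗ[Cq] CFAlgebra σ :=
  (Finsupp.linearCombination Cq fun v : Fin n → ℤ =>
    mono σ (ε • v) ((ξ ^ ∑ i, v i : Cqˣ) : Cq)) ∘ₗ (toLaurent σ).toLinearMap

theorem rescaleLinear_mono (ξ : Cqˣ) (ε : ℤ) (v : Fin n → ℤ) (c : Cq) :
    rescaleLinear σ ξ ε (mono σ v c) = mono σ (ε • v) (c * ((ξ ^ ∑ i, v i : Cqˣ) : Cq)) := by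
  rw [rescaleLinear, LinearMap.comp_apply, mono, LinearEquiv.coe_coe, LinearEquiv.apply_symm_apply,
    Finsupp.linearCombination_single, smul_mono]

theorem twist_smul_smul {ε : ℤ} (hε : ε * ε = 1) (v w : Fin n → ℤ) :
    twist σ (ε • v) (ε • w) = twist σ v w := by
  unfold twist
  congr 1
  refine Finset.sum_congr rfl fun i _ => Finset.sum_congr rfl fun j _ => ?_
  split_ifs
  · simp only [Pi.smul_apply, smul_eq_mul]
    linear_combination σ i j * v i * w j * hε
  · rfl

/-- The endomorphism that multiplies each generator by `ξ` and raises it to the power `ε = ±1`. -/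
def rescale (σ : Fin n → Fin n → ℤ) (ξ : Cqˣ) {ε : ℤ} (hε : ε * ε = 1) :
    CFAlgebra σ →ₐ[Cq] CFAlgebra σ :=
  AlgHom.ofLinearMap (rescaleLinear σ ξ ε)
    (by rw [one_def, rescaleLinear_mono]; simp)
    (fun f g => by
      induction f using cf_induction with
      | h0 => simp
      | hadd f₁ f₂ h₁ h₂ => rw [add_mul, map_add, h₁, h₂, map_add, add_mul]
      | hm u c =>
        induction g using cf_induction with
        | h0 => simp
        | hadd f₁ f₂ h₁ h₂ => rw [mul_add, map_add, h₁, h₂, map_add, mul_add]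
        | hm v d =>
          rw [mono_mul_mono, rescaleLinear_mono, rescaleLinear_mono, rescaleLinear_mono,
            mono_mul_mono, twist_smul_smul hε, smul_add]
          congr 1
          simp only [Pi.add_apply, Finset.sum_add_distrib, _root_.zpow_add, Units.val_mul]
          ring)

theorem rescale_mono (ξ : Cqˣ) {ε : ℤ} (hε : ε * ε = 1) (v : Fin n → ℤ) (c : Cq) :
    rescale σ ξ hε (mono σ v c) = mono σ (ε • v) (c * ((ξ ^ ∑ i, v i : Cqˣ) : Cq)) :=
  rescaleLinear_mono ξ ε v c

theorem rescale_rescale {ξ ξ' : Cqˣ} {ε : ℤ} (hε : ε * ε = 1) (hξ : ξ' * ξ ^ ε = 1)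
    (f : CFAlgebra σ) : rescale σ ξ hε (rescale σ ξ' hε f) = f := by
  induction f using cf_induction with
  | h0 => simp
  | hadd f g hf hg => rw [map_add, map_add, hf, hg]
  | hm v c =>
    rw [rescale_mono, rescale_mono, smul_smul, hε, one_smul, mul_assoc, ← Units.val_mul]
    simp only [Pi.smul_apply, smul_eq_mul, ← Finset.mul_sum]
    rw [_root_.zpow_mul, ← _root_.mul_zpow, hξ, _root_.one_zpow, Units.val_one, mul_one]

/-- The extension of an injective homomorphism to the fraction division algebra. -/
def liftField {L : Type*} [DivisionRing L] [Algebra Cq L] (f : CFAlgebra σ →ₐ[Cq] L)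
    (hf : Function.Injective f) : CFField σ →ₐ[Cq] L where
  __ := OreLocalization.universalHom (S := (CFAlgebra σ)⁰) f.toRingHom
    { toFun s := Units.mk0 (f s)
        ((map_ne_zero_iff f hf).2 (nonZeroDivisors.ne_zero s.2))
      map_one' := by ext; simp
      map_mul' s t := by ext; simp }
    (fun s => rfl)
  commutes' c := by
    have h1 := OreLocalization.universalHom_commutes (S := (CFAlgebra σ)⁰) (f := f.toRingHom)
      { toFun s := Units.mk0 (f s) ((map_ne_zero_iff f hf).2 (nonZeroDivisors.ne_zero s.2))
        map_one' := by ext; simp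
        map_mul' s t := by ext; simp } (fun s => rfl) (r := algebraMap Cq _ c)
    have h2 : (algebraMap Cq (CFField σ) c) = toField σ (algebraMap Cq _ c) :=
      ((toField σ).commutes c).symm
    rw [h2]
    exact h1.trans (f.commutes c)

theorem liftField_toField {L : Type*} [DivisionRing L] [Algebra Cq L] (f : CFAlgebra σ →ₐ[Cq] L)
    (hf : Function.Injective f) (x : CFAlgebra σ) : liftField f hf (toField σ x) = f x :=
  OreLocalization.universalHom_commutes _ _ _

theorem exists_toField_mul_eq (x : CFField σ) :
    ∃ r s : CFAlgebra σ, s ≠ 0 ∧ toField σ s * x = toField σ r := by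
  induction x using OreLocalization.ind with
  | _ r s =>
    exact ⟨r, s, nonZeroDivisors.ne_zero s.2, OreLocalization.mul_cancel⟩

theorem algHom_ext {L : Type*} [DivisionRing L] [Algebra Cq L] {f g : CFField σ →ₐ[Cq] L}
    (h : ∀ x, f (toField σ x) = g (toField σ x)) : f = g := by
  ext x
  obtain ⟨r, s, hs, hx⟩ := exists_toField_mul_eq x
  have h0 : f (toField σ s) ≠ 0 :=
    (map_ne_zero_iff f f.toRingHom.injective).2 ((map_ne_zero_iff _ (toField_injective σ)).2 hs)
  have h1 := congrArg f hx
  have h2 := congrArg g hx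
  rw [map_mul] at h1 h2
  apply mul_left_cancel₀ h0
  rw [h1, h, h, h2]

theorem toField_rescale_injective (σ : Fin n → Fin n → ℤ) (ξ : Cqˣ) {ε : ℤ} (hε : ε * ε = 1) :
    Function.Injective ((toField σ).comp (rescale σ ξ hε)) := by
  intro f g h
  have h1 := congrArg (rescale σ (ξ ^ (-ε)) hε) (toField_injective σ h)
  have h2 : ξ * (ξ ^ (-ε)) ^ ε = 1 := by
    rw [← _root_.zpow_mul, neg_mul, hε, _root_.zpow_neg_one, mul_inv_cancel]
  simp only [RingHom.coe_coe, rescale_rescale hε h2] at h1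
  exact h1

/-- The extension of `rescale` to the fraction division algebra. -/
def rescaleHom (σ : Fin n → Fin n → ℤ) (ξ : Cqˣ) {ε : ℤ} (hε : ε * ε = 1) :
    CFField σ →ₐ[Cq] CFField σ :=
  liftField ((toField σ).comp (rescale σ ξ hε)) (toField_rescale_injective σ ξ hε)

theorem rescaleHom_toField (ξ : Cqˣ) {ε : ℤ} (hε : ε * ε = 1) (f : CFAlgebra σ) :
    rescaleHom σ ξ hε (toField σ f) = toField σ (rescale σ ξ hε f) := liftField_toField _ _ _

theorem rescaleHom_comp {ξ ξ' : Cqˣ} {ε : ℤ} (hε : ε * ε = 1) (hξ : ξ' * ξ ^ ε = 1) :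
    (rescaleHom σ ξ hε).comp (rescaleHom σ ξ' hε) = AlgHom.id Cq _ :=
  algHom_ext fun x => by
    rw [AlgHom.comp_apply, rescaleHom_toField, rescaleHom_toField, rescale_rescale hε hξ,
      AlgHom.id_apply]

/-- The automorphism that maps each generator `X_i` to `ξ X_i ^ ε`, where `ε = ±1`. -/
def rescaleField (σ : Fin n → Fin n → ℤ) (ξ : Cqˣ) {ε : ℤ} (hε : ε * ε = 1) :
    CFField σ ≃ₐ[Cq] CFField σ :=
  AlgEquiv.ofAlgHom (rescaleHom σ ξ hε) (rescaleHom σ (ξ ^ (-ε)) hε)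
    (rescaleHom_comp hε (by rw [← _root_.zpow_add, neg_add_cancel, zpow_zero]))
    (rescaleHom_comp hε (by
      rw [← _root_.zpow_mul, neg_mul, hε, _root_.zpow_neg_one, mul_inv_cancel]))

theorem rescaleField_apply (ξ : Cqˣ) {ε : ℤ} (hε : ε * ε = 1) (x : CFField σ) :
    rescaleField σ ξ hε x = rescaleHom σ ξ hε x := rfl

theorem rescaleField_gen (ξ : Cqˣ) {ε : ℤ} (hε : ε * ε = 1) (i : Fin n) :
    rescaleField σ ξ hε (gen σ i) = (ξ : Cq) • gen σ i ^ ε := by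
  rw [gen_zpow, gen_eq]
  rw [rescaleField_apply, rescaleHom_toField, rescale_mono, ← map_smul, smul_mono]
  congr 2
  · rw [← Pi.single_smul, smul_eq_mul, mul_one]
  · rw [Finset.sum_pi_single']
    simp

end generators
end QuantumTeichmuller

namespace QuantumTeichmuller
variable {Γ : Subgroup (GL (Fin 2) ℝ)} {n : ℕ}

/-! ### The transition functions of a diagonal exchange -/

section evaluation
variable {F : Type*} [Field F] {K : Type*} [DivisionRing K] [Algebra F K] {x u v : K}
  (hx : Transcendental F x) {Q c : Fˣ} {g H : RatFunc F}

theorem ratEval_injective : Function.Injective (ratEval x hx) :=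
  (ratEval x hx).toRingHom.injective

theorem ratEval_ne_zero (hg : g ≠ 0) : ratEval x hx g ≠ 0 :=
  (map_ne_zero_iff _ (ratEval_injective hx)).2 hg

theorem ratEval_inv (g : RatFunc F) : ratEval x hx g⁻¹ = (ratEval x hx g)⁻¹ := map_inv₀ _ _

theorem mul_ratEval (h : SemiconjBy u x ((Q : F) • x)) (f : RatFunc F) :
    u * ratEval x hx f = ratEval x hx (dilate Q f) * u := by
  rw [ratEval_dilate _ _ (transcendental_unit_smul hx Q) rfl]
  exact semiconjBy_ratEval h f

theorem flip_ne_zero (a : Fˣ) (hg : g ≠ 0) : flip a g ≠ 0 := (_root_.map_ne_zero _).2 hg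

/-- The transition function of a diagonal is a monomial, since it skew-commutes with a side. -/
theorem eq_smul_X_inv (hQ : ∀ m : ℤ, Q ^ m = 1 → m = 0) (hu : u ≠ 0)
    (hux : SemiconjBy u x ((Q : F) • x)) (hg : g ≠ 0) (hH : H ≠ 0)
    (h : ratEval x hx g * u * ratEval x hx H
      = ((Q⁻¹ : Fˣ) : F) • (ratEval x hx H * (ratEval x hx g * u))) :
    ∃ c : Fˣ, H = (c : F) • RatFunc.X⁻¹ := by
  rw [mul_assoc, mul_ratEval hx hux, ← mul_assoc, ← mul_assoc, ← map_mul, ← map_mul,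
    ← smul_mul_assoc, ← map_smul] at h
  have h1 := ratEval_injective hx (mul_right_cancel₀ hu h)
  obtain ⟨k, hk⟩ := eq_zpow_of_dilate_eq hQ (f := H) (N := -1) (by
    apply mul_left_cancel₀ hg
    rw [h1, mul_smul_comm, mul_comm g, _root_.zpow_neg_one])
  have hk0 : k ≠ 0 := by
    rintro rfl
    rw [zero_smul] at hk
    exact hH hk
  exact ⟨Units.mk0 k hk0, by rw [hk, _root_.zpow_neg_one, Units.val_mk0]⟩

/-- The functional equation expresses the commutation relation of the coordinates of two
consecutive sides after the exchange, for which the exponent of `Q` has increased by one. -/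
theorem SideRelation.of_commutation (hu : u ≠ 0) (hv : v ≠ 0)
    (hux : SemiconjBy u x ((Q : F) • x)) (hvx : SemiconjBy v x (((Q⁻¹ : Fˣ) : F) • x))
    (hg : g ≠ 0) {s : ℤ} (huv : u * v = ((Q ^ s : Fˣ) : F) • (v * u))
    (h : ratEval x hx g * u * (ratEval x hx (flip c g)⁻¹ * v)
      = ((Q ^ (s + 1) : Fˣ) : F) •
        (ratEval x hx (flip c g)⁻¹ * v * (ratEval x hx g * u))) : SideRelation Q c g := by
  have hf := flip_ne_zero c hg
  rw [mul_assoc, ← mul_assoc u, mul_ratEval hx hux, mul_assoc _ v, ← mul_assoc v,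
    mul_ratEval hx hvx, mul_assoc _ u, mul_assoc _ v, huv, _root_.zpow_add, zpow_one,
    ← mul_assoc, ← mul_assoc, ← map_mul, ← map_mul, mul_smul_comm,
    ← smul_mul_assoc, ← smul_mul_assoc, ← map_smul, ← map_smul] at h
  have e2 := ratEval_injective hx (mul_right_cancel₀ (mul_ne_zero hv hu) h)
  rw [Units.val_mul, ← smul_smul] at e2
  have e3 := smul_right_injective _ (Units.ne_zero (Q ^ s)) e2
  have hf' := flip_ne_zero (c * Q⁻¹) hg
  rw [map_inv₀, dilate_flip, ← div_eq_mul_inv, div_eq_iff hf', smul_mul_assoc] at e3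
  refine (congrArg (· * flip c g) e3).trans ?_
  rw [smul_mul_assoc]
  congr 1
  field_simp

end evaluation

/-- The quantum parameter `q²`, as a unit. -/
def qSq : Cqˣ := Units.mk0 (q ^ 2) (pow_ne_zero 2 q_ne_zero)

theorem qSq_zpow (m : ℤ) : ((qSq ^ m : Cqˣ) : Cq) = q ^ (2 * m) := by
  rw [Units.val_zpow_eq_zpow_val, qSq, Units.val_mk0, _root_.zpow_mul]
  rfl

theorem qSq_zpow_eq_one {m : ℤ} (h : qSq ^ m = 1) : m = 0 := by
  by_contra hm
  have h1 := qSq_zpow m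
  rw [h, Units.val_one] at h1
  exact q_zpow_ne_one (m := 2 * m) (by omega) h1.symm

theorem exists_isPrimitiveRoot {m : ℕ} (hm : 0 < m) : ∃ ζ : Cqˣ, IsPrimitiveRoot ζ m := by
  have h1 := (Complex.isPrimitiveRoot_exp m hm.ne').map_of_injective
    (f := algebraMap ℂ Cq) (algebraMap ℂ Cq).injective
  obtain ⟨u, hu⟩ := h1.isUnit hm.ne'
  rw [← hu] at h1
  exact ⟨u, IsPrimitiveRoot.coe_units_iff.1 h1⟩

namespace IdealTriangulation
variable {T T' : IdealTriangulation Γ n} {a b c d i : Fin n}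

theorem X_mul_X (T : IdealTriangulation Γ n) (i j : Fin n) :
    T.X i * T.X j = ((qSq ^ T.sigma i j : Cqˣ) : Cq) • (T.X j * T.X i) := by
  rw [qSq_zpow]
  exact gen_mul_gen T.sigma_swap i j

theorem X_ne_zero (T : IdealTriangulation Γ n) (i : Fin n) : T.X i ≠ 0 := gen_ne_zero i

/-- The value of a rational function at the generator of the `i`-th arc. -/
abbrev evalAt (T : IdealTriangulation Γ n) (i : Fin n) : RatFunc Cq →ₐ[Cq] T.K :=
  ratEval (T.X i) (transcendental_gen i)

/-- The adjacency numbers of the diagonal with the sides change sign, and those of two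
consecutive sides change by one. -/
theorem EmbeddedExchange.sigma_side_diag (hΓ : IsSurfaceGroup Γ)
    (h : T.EmbeddedExchange T' a b c d i) : T.sigma a i = 1 ∧ T.sigma b i = -1 ∧
      T'.sigma a i = -1 ∧ T'.sigma a b = T.sigma a b + 1 := by
  have hd := h.distinct
  simp only [List.nodup_cons, List.mem_cons, List.not_mem_nil, or_false, not_or,
    List.nodup_nil, and_true, not_false_eq_true] at hd
  obtain ⟨⟨h1, h2, h3, h4⟩, ⟨h5, h6, h7⟩, ⟨h8, h9⟩, h10⟩ := hd
  have sa := h.sigma_diag hΓ a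
  have sb := h.sigma_diag hΓ b
  have s1 := h.sigma_side hΓ i
  have s2 := h.sigma_side hΓ b
  simp only [h1, h2, h3, h5, h6, h7, Ne.symm h1, Ne.symm h7, Ne.symm h10,
    if_true, if_false] at sa sb s1 s2
  have e1 := T.sigma_swap i a
  have e2 := T.sigma_swap i b
  refine ⟨by omega, by omega, by omega, by omega⟩

/-- The coordinate change of every diagonal exchange is given by `X_i' ↦ c X_i⁻¹` and
`X_a' ↦ g(X_i) X_a`. -/
def HasTransition (Ψ : ∀ T T' : IdealTriangulation Γ n, T'.K ≃ₐ[Cq] T.K) (c : Cqˣ)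
    (g : RatFunc Cq) : Prop :=
  ∀ (T T' : IdealTriangulation Γ n) (a b c' d i : Fin n), T.EmbeddedExchange T' a b c' d i →
    Ψ T T' (T'.X i) = (c : Cq) • (T.X i)⁻¹ ∧ Ψ T T' (T'.X a) = T.evalAt i g * T.X a

namespace IsCoordinateChange
variable {Ψ : ∀ T T' : IdealTriangulation Γ n, T'.K ≃ₐ[Cq] T.K}

theorem self (hΨ : IsCoordinateChange Ψ) (T : IdealTriangulation Γ n) (x : T.K) : Ψ T T x = x :=
  (Ψ T T).injective (hΨ.comp T T T x).symm

theorem symm_apply (hΨ : IsCoordinateChange Ψ) (T T' : IdealTriangulation Γ n) (x : T.K) :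
    Ψ T T' (Ψ T' T x) = x := by rw [← hΨ.comp, hΨ.self]

/-- The new coordinate of the diagonal is a rational function `H` of the old one, that
skew-commutes with the coordinates of the sides, so that it is a monomial. -/
theorem exists_hasTransition (hΨ : IsCoordinateChange Ψ) (hΓ : IsSurfaceGroup Γ)
    (hχ : eulerChar Γ < -2) (h : T.EmbeddedExchange T' a b c d i) :
    ∃ (c : Cqˣ) (g : RatFunc Cq), g ≠ 0 ∧ HasTransition Ψ c g := by
  have h5 : 5 ≤ n := by
    have := h.distinct.length_le_card
    simpa using this
  obtain ⟨U, p, e', s, hU⟩ := h.exists_octagon hΓ hχ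
  have he : ∀ j, ((Fin.castLEOrderEmb h5 j : Fin n) : ℕ) = j := fun j => rfl
  obtain ⟨π, -, hstd⟩ := h.exists_std (Fin.castLEOrderEmb h5)
  obtain ⟨α, β, α', β', hα, hα', htr⟩ := hΨ.exists_transition hΓ he hstd
    (hU.hasSeparatingSquare hΓ) (hU.hasUnitSquare hΓ).1
  set H : RatFunc Cq := algebraMap _ _ β / algebraMap _ _ α with hH
  set g : RatFunc Cq := algebraMap _ _ β' / algebraMap _ _ α' with hg
  have main : ∀ (T T' : IdealTriangulation Γ n) (a b c' d i : Fin n),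
      T.EmbeddedExchange T' a b c' d i → Ψ T T' (T'.X i) = T.evalAt i H ∧
        Ψ T T' (T'.X a) = T.evalAt i g * T.X a := fun T T' a b c' d i hT => by
    obtain ⟨e1, e2⟩ := htr T T' a b c' d i hT
    refine ⟨eq_ratEval_div _ hα e1, ?_⟩
    have e3 := eq_ratEval_div (transcendental_gen (σ := T.sigma) i) hα'
      (y := Ψ T T' (T'.X a) * (T.X a)⁻¹) (by
        rw [← mul_assoc, e2, mul_inv_cancel_right₀ (X_ne_zero T a)])
    rw [mul_inv_eq_iff_eq_mul₀ (X_ne_zero T a)] at e3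
    exact e3
  obtain ⟨m1, m2⟩ := main T T' a b c d i h
  have hne : ∀ j, Ψ T T' (T'.X j) ≠ 0 := fun j =>
    (map_ne_zero_iff _ (Ψ T T').injective).2 (X_ne_zero T' j)
  have hH0 : H ≠ 0 := by
    intro h0
    rw [h0, map_zero] at m1
    exact hne i m1
  have hg0 : g ≠ 0 := by
    intro h0
    rw [h0, map_zero, zero_mul] at m2
    exact hne a m2
  obtain ⟨s1, s2, s3, s4⟩ := h.sigma_side_diag hΓ
  obtain ⟨k, hk⟩ := eq_smul_X_inv (transcendental_gen (σ := T.sigma) i)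
    (fun m => qSq_zpow_eq_one) (X_ne_zero T a)
    (by rw [SemiconjBy, X_mul_X, s1, zpow_one, smul_mul_assoc]) hg0 hH0 (by
      have e1 := congrArg (Ψ T T') (X_mul_X T' a i)
      rw [map_mul, map_smul, map_mul, m1, m2, s3, _root_.zpow_neg_one] at e1
      exact e1)
  refine ⟨k, g, hg0, fun T T' a b c' d i hT => ⟨?_, (main T T' a b c' d i hT).2⟩⟩
  rw [(main T T' a b c' d i hT).1, hk, map_smul, ratEval_inv, ratEval_X]

variable {c₀ : Cqˣ} {g : RatFunc Cq}

/-- The coordinate change of the second side, from the inverse diagonal exchange. -/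
theorem apply_second (hΨ : IsCoordinateChange Ψ) (hg : g ≠ 0) (ht : HasTransition Ψ c₀ g)
    (h : T.EmbeddedExchange T' a b c d i) :
    Ψ T T' (T'.X b) = T.evalAt i (flip c₀ g)⁻¹ * T.X b := by
  have h1 := congrArg (Ψ T T') (ht T' T b c d a i h.rotate).2
  have h2 : Ψ T T' (T'.evalAt i g) = T.evalAt i (flip c₀ g) := by
    rw [evalAt, evalAt,
      ratEval_flip _ c₀ (transcendental_unit_smul_inv (transcendental_gen i) c₀) rfl]
    exact algHom_ratEval _ (Ψ T T' : T'.K →ₐ[Cq] T.K) _ (ht T T' a b c d i h).1 g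
  rw [hΨ.symm_apply, map_mul, h2] at h1
  rw [h1, ratEval_inv, inv_mul_cancel_left₀]
  exact ratEval_ne_zero _ (flip_ne_zero c₀ hg)

/-- The coordinates of two consecutive sides satisfy their commutation relation after the
exchange. -/
theorem sideRelation (hΨ : IsCoordinateChange Ψ) (hΓ : IsSurfaceGroup Γ) (hg : g ≠ 0)
    (ht : HasTransition Ψ c₀ g) (h : T.EmbeddedExchange T' a b c d i) :
    SideRelation qSq c₀ g := by
  obtain ⟨s1, s2, s3, s4⟩ := h.sigma_side_diag hΓ
  refine SideRelation.of_commutation (transcendental_gen (σ := T.sigma) i) (X_ne_zero T a)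
    (X_ne_zero T b) ?_ ?_ hg (X_mul_X T a b) ?_
  · rw [SemiconjBy, X_mul_X, s1, zpow_one, smul_mul_assoc]
  · rw [SemiconjBy, X_mul_X, s2, _root_.zpow_neg_one, smul_mul_assoc]
  · have e1 := congrArg (Ψ T T') (X_mul_X T' a b)
    rwa [map_mul, map_smul, map_mul, (ht T T' a b c d i h).2, hΨ.apply_second hg ht h, s4] at e1

end IsCoordinateChange
end IdealTriangulation
end QuantumTeichmuller

namespace QuantumTeichmuller
variable {Γ : Subgroup (GL (Fin 2) ℝ)} {n : ℕ}

/-! ### The pentagon relation -/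

section cycle
variable {F : Type*} [Field F] {K : Type*} [DivisionRing K] [Algebra F K] {Q c : Fˣ} {A B : K}

theorem QuantumPair.unit_smul_left (h : QuantumPair Q A B) (c : Fˣ) :
    QuantumPair Q ((c : F) • A) B where
  comm := by rw [mul_smul_comm, h.comm, smul_mul_assoc, smul_comm]
  indep := by
    convert! h.indep.units_smul fun v : ℤ × ℤ => c ^ v.2 using 2 with v
    rw [unit_smul_zpow, mul_smul_comm, Pi.smul_apply', Units.smul_def]

theorem smul_smul_inv_inv (c : Fˣ) (x : K) : (c : F) • ((c : F) • x⁻¹)⁻¹ = x := by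
  rw [smul_inv₀, inv_inv, smul_smul, mul_inv_cancel₀ c.ne_zero, one_smul]

/-- A cycle of five coordinate changes of the variables yields the pentagon relation. -/
theorem PentagonRelation.of_cycle (h : QuantumPair Q A B) {g : RatFunc F}
    {u Y Z W : K} (hY : Transcendental F Y) (hZ : Transcendental F Z) (hW : W ≠ 0)
    (h1 : B = h.evalLeft g * u) (h2 : Y = h.evalRight g * ((c : F) • A⁻¹))
    (h3 : W = ratEval Y hY g * ((c : F) • B⁻¹)) (h4 : u = (c : F) • Z⁻¹)
    (h5 : A = ratEval Z hZ g * ((c : F) • W⁻¹)) : PentagonRelation h c g := by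
  have hA := h.left_ne_zero
  refine ⟨Y, Z, hY, hZ, by rw [h2, mul_smul_comm], ?_, ?_⟩
  · have hu : u ≠ 0 := by
      rintro rfl
      exact h.right_ne_zero (h1.trans (mul_zero _))
    have e1 : B⁻¹ * h.evalLeft g = u⁻¹ := by
      rw [inv_mul_eq_iff_eq_mul₀ h.right_ne_zero, eq_mul_inv_iff_mul_eq₀ hu]
      exact h1.symm
    rw [e1, h4, smul_smul_inv_inv]
  · rw [mul_smul_comm] at h3 h5
    apply smul_right_injective _ c.ne_zero
    simp only
    rw [← h3, ← mul_smul_comm, eq_inv_mul_iff_mul_eq₀ hA]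
    conv_lhs => rw [h5]
    rw [smul_mul_assoc, inv_mul_cancel_right₀ hW]

theorem ratEval_one_add {x : K} (hx : Transcendental F x) (k : F) :
    ratEval x hx (1 + k • RatFunc.X) = 1 + k • x := by
  rw [map_add, map_one, map_smul, ratEval_X]

theorem ratEval_one_add_inv {x : K} (hx : Transcendental F x) (k : F) :
    ratEval x hx (1 + k • RatFunc.X⁻¹)⁻¹ = (1 + k • x⁻¹)⁻¹ := by
  rw [map_inv₀, map_add, map_one, map_smul, map_inv₀, ratEval_X]

theorem ratEval_flip_one_add {x : K} (hx : Transcendental F x) (c : Fˣ) (k : F) :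
    ratEval x hx (flip c (1 + k • RatFunc.X))⁻¹ = (1 + (k * c) • x⁻¹)⁻¹ := by
  rw [map_inv₀, ratEval_flip hx c (transcendental_unit_smul_inv hx c) rfl, ratEval_one_add,
    smul_smul]

theorem ratEval_flip_one_add_inv {x : K} (hx : Transcendental F x) (c : Fˣ) (k : F) :
    ratEval x hx (flip c (1 + k • RatFunc.X⁻¹)⁻¹)⁻¹ = 1 + (k * (c : F)⁻¹) • x := by
  rw [map_inv₀, ratEval_flip hx c (transcendental_unit_smul_inv hx c) rfl, ratEval_one_add_inv,
    inv_inv, smul_inv₀, inv_inv, smul_smul]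

end cycle

namespace IdealTriangulation
namespace IsCoordinateChange
variable {Ψ : ∀ T T' : IdealTriangulation Γ n, T'.K ≃ₐ[Cq] T.K} {c₀ : Cqˣ} {g : RatFunc Cq}
  {T U U' : IdealTriangulation Γ n} {a b c d i : Fin n}

/-- The effect of a diagonal exchange `U → U'` in the coordinates of `T`. -/
theorem step (hΨ : IsCoordinateChange Ψ) (ht : HasTransition Ψ c₀ g)
    (h : U.EmbeddedExchange U' a b c d i) (hx : Transcendental Cq (Ψ T U (U.X i))) :
    Ψ T U' (U'.X i) = (c₀ : Cq) • (Ψ T U (U.X i))⁻¹ ∧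
      Ψ T U' (U'.X a) = ratEval (Ψ T U (U.X i)) hx g * Ψ T U (U.X a) := by
  obtain ⟨h1, h2⟩ := ht U U' a b c d i h
  rw [hΨ.comp T U U', hΨ.comp T U U', h1, h2, map_smul, map_inv₀, map_mul]
  refine ⟨rfl, ?_⟩
  congr 1
  exact algHom_ratEval _ (Ψ T U : U.K →ₐ[Cq] T.K) _ rfl g

theorem transcendental_apply (Ψ : ∀ T T' : IdealTriangulation Γ n, T'.K ≃ₐ[Cq] T.K)
    (T U : IdealTriangulation Γ n) (i : Fin n) : Transcendental Cq (Ψ T U (U.X i)) :=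
  Transcendental.algHom (Ψ T U : U.K →ₐ[Cq] T.K) (transcendental_gen i)

/-- The generators of adjacent arcs satisfy no relation other than their skew-commutation. -/
theorem quantumPair_gen {σ : Fin n → Fin n → ℤ} (hσ : ∀ i j, σ j i = -σ i j) {i j : Fin n}
    (hij : i ≠ j) (h : σ j i = 1) : QuantumPair qSq (gen σ j)⁻¹ (gen σ i) where
  comm := by
    have h1 := gen_mul_gen hσ j i
    rw [h, ← qSq_zpow, zpow_one] at h1
    have h2 : gen σ j * gen σ i * (gen σ j)⁻¹ = (qSq : Cq) • gen σ i := by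
      rw [h1, smul_mul_assoc, mul_inv_cancel_right₀ (gen_ne_zero j)]
    rw [← mul_smul_comm, ← h2, mul_assoc, inv_mul_cancel_left₀ (gen_ne_zero j)]
  indep := by
    have := (linearIndependent_gen_zpow (σ := σ) hij).comp (fun v : ℤ × ℤ => (v.1, -v.2))
      (fun v w hvw => by
        have h1 := congrArg Prod.fst hvw
        have h2 := congrArg Prod.snd hvw
        exact Prod.ext h1 (neg_injective h2))
    simpa [Function.comp_def, _root_.inv_zpow'] using this

/-- The five diagonal exchanges of a pentagon lead back to the initial triangulation, with the
labels `i` and `j` of the diagonals exchanged. -/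
theorem exists_pentagonRelation (hΨ : IsCoordinateChange Ψ) (hΓ : IsSurfaceGroup Γ)
    (ht : HasTransition Ψ c₀ g) (hP : HasPentagon Γ n) :
    ∃ (T : IdealTriangulation Γ n) (A B : T.K) (h : QuantumPair qSq A B),
      PentagonRelation h c₀ g := by
  obtain ⟨T, l₀, l₁, l₂, l₃, l₄, i, j, v₀, v₁, v₂, v₃, v₄, hp⟩ := hP
  obtain ⟨T₁, T₂, T₃, T₄, e₁, e₂, e₃, e₄, e₅⟩ := hp.exists_cycle hΓ
  have hij : i ≠ j := by
    have := hp.nodup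
    simp only [List.nodup_cons, List.mem_cons, List.not_mem_nil, or_false, not_or] at this
    tauto
  have tr := transcendental_apply Ψ T
  obtain ⟨s1, -, -, -⟩ := e₂.sigma_side_diag hΓ
  have hq := ((quantumPair_gen T₁.sigma_swap hij s1).unit_smul_left c₀).map
    (Ψ T T₁ : T₁.K →ₐ[Cq] T.K)
  obtain ⟨p1, p2⟩ := hΨ.step ht e₁ (tr T j)
  obtain ⟨p3, p4⟩ := hΨ.step ht e₂ (tr T₁ i)
  obtain ⟨p5, p6⟩ := hΨ.step ht e₃ (tr T₂ j)
  obtain ⟨p7, p8⟩ := hΨ.step ht e₄ (tr T₃ i)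
  obtain ⟨p9, p10⟩ := hΨ.step ht e₅ (tr T₄ j)
  rw [hΨ.reindex, Equiv.swap_apply_right] at p9
  rw [hΨ.reindex, Equiv.swap_apply_left, p7] at p10
  rw [p1] at p4
  rw [p3] at p6
  have hA : (Ψ T T₁ : T₁.K →ₐ[Cq] T.K) ((c₀ : Cq) • (gen T₁.sigma j)⁻¹) = Ψ T T (T.X j) := by
    rw [map_smul, map_inv₀]
    change (c₀ : Cq) • (Ψ T T₁ (T₁.X j))⁻¹ = _
    rw [p1, smul_smul_inv_inv]
  rw [hA] at hq
  refine ⟨T, _, _, hq, PentagonRelation.of_cycle hq (u := T.X i) (tr T₂ j) (tr T₄ j)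
    (W := Ψ T T₃ (T₃.X i)) ?_ ?_ p4 p6 p9 ?_⟩
  · exact (map_ne_zero_iff _ (Ψ T T₃).injective).2 (X_ne_zero _ _)
  · rw [hΨ.self T (T.X i)] at p2
    exact p2
  · rw [hΨ.self T (T.X j)]
    exact p10

end IsCoordinateChange
end IdealTriangulation
end QuantumTeichmuller

namespace QuantumTeichmuller
variable {Γ : Subgroup (GL (Fin 2) ℝ)} {n : ℕ}

/-! ### Normalizing the transition functions -/

section normalization
variable {F : Type*} [Field F] {K : Type*} [DivisionRing K] [Algebra F K] {φ : K →ₐ[F] K}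
  {ξ Q c : Fˣ} {x u : K} {k r : F}

theorem map_smul_one_add_mul (hx : φ x = ((ξ⁻¹ : Fˣ) : F) • x)
    (hu : φ u = ((ξ⁻¹ : Fˣ) : F) • u) (hr : k = r * ξ) :
    φ ((ξ : F) • ((1 + k • x) * u)) = (1 + r • x) * u := by
  rw [map_smul, map_mul, map_add, map_one, map_smul, hx, hu, mul_smul_comm, smul_smul, smul_smul,
    hr, mul_assoc, Units.mul_inv, one_smul, mul_one]

theorem map_smul_one_add_inv_mul (hx : φ x = ((ξ⁻¹ : Fˣ) : F) • x)
    (hu : φ u = ((ξ⁻¹ : Fˣ) : F) • u) (hr : k * ξ = r) :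
    φ ((ξ : F) • ((1 + k • x⁻¹)⁻¹ * u)) = (1 + r • x⁻¹)⁻¹ * u := by
  rw [map_smul, map_mul, map_inv₀, map_add, map_one, map_smul, map_inv₀, hx, hu, mul_smul_comm,
    smul_smul, Units.mul_inv, one_smul, smul_inv₀, ← Units.val_inv_eq_inv_val, inv_inv,
    smul_smul, hr]

theorem map_smul_smul_inv (hx : φ x = ((ξ⁻¹ : Fˣ) : F) • x) (h : ξ * ξ * c = 1) :
    φ ((ξ : F) • ((c : F) • x⁻¹)) = x⁻¹ := by
  rw [map_smul, map_smul, map_inv₀, hx, smul_inv₀, ← Units.val_inv_eq_inv_val, inv_inv,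
    smul_smul, smul_smul, ← Units.val_mul, ← Units.val_mul, mul_right_comm, h, Units.val_one,
    one_smul]

theorem smul_inv_smul_inv_mul (ξ : Fˣ) (u y : K) : (ξ : F) • (((ξ : F) • u⁻¹)⁻¹ * y) = u * y := by
  rw [← smul_mul_assoc, smul_smul_inv_inv]

theorem SemiconjBy.one_add_smul {y : K} {s : F} (h : SemiconjBy u y (s • y)) (r : F) :
    SemiconjBy u (1 + r • y) (1 + (r * s) • y) := by
  rw [SemiconjBy, mul_add, add_mul, mul_one, one_mul, mul_smul_comm, h.eq, mul_smul,
    smul_mul_assoc, smul_mul_assoc, smul_mul_assoc]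

theorem map_smul_inv_one_add_inv_mul (hx : φ x = (ξ : F) • x⁻¹) (hu : φ u = (ξ : F) • u⁻¹)
    (h : SemiconjBy u x ((Q : F) • x)) (hr : k * (ξ⁻¹ : Fˣ) * Q = r) :
    φ ((ξ : F) • ((1 + k • x⁻¹)⁻¹ * u)⁻¹) = (1 + r • x) * u := by
  rw [_root_.mul_inv_rev, inv_inv, map_smul, map_mul, map_inv₀, map_add, map_one, map_smul,
    map_inv₀, hx, hu, smul_inv_smul_inv_mul, smul_inv₀, inv_inv, smul_smul,
    ← Units.val_inv_eq_inv_val, (SemiconjBy.one_add_smul h _).eq, hr]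

theorem map_smul_inv_one_add_mul (hx : φ x = (ξ : F) • x⁻¹) (hu : φ u = (ξ : F) • u⁻¹)
    (h : SemiconjBy u x (((Q⁻¹ : Fˣ) : F) • x)) (hr : k * ξ * Q = r) :
    φ ((ξ : F) • ((1 + k • x) * u)⁻¹) = (1 + r • x⁻¹)⁻¹ * u := by
  have h' : SemiconjBy u x⁻¹ ((Q : F) • x⁻¹) := by
    have := h.inv_right₀
    rwa [smul_inv₀, ← Units.val_inv_eq_inv_val, inv_inv] at this
  rw [_root_.mul_inv_rev, map_smul, map_mul, map_inv₀, map_inv₀, map_add, map_one, map_smul,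
    hx, hu, smul_inv_smul_inv_mul, smul_smul,
    (SemiconjBy.one_add_smul h' _).inv_right₀.eq, hr]

theorem map_smul_inv_smul_inv (hx : φ x = (ξ : F) • x⁻¹) (h : ξ * ξ = c) :
    φ ((ξ : F) • ((c : F) • x⁻¹)⁻¹) = x⁻¹ := by
  rw [smul_inv₀, inv_inv, map_smul, map_smul, hx, smul_smul, smul_smul,
    ← Units.val_inv_eq_inv_val, ← Units.val_mul, ← Units.val_mul, ← h]
  have : ξ * (ξ * ξ)⁻¹ * ξ = 1 := by
    rw [_root_.mul_inv_rev, mul_inv_cancel_left, inv_mul_cancel]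
  rw [this, Units.val_one, one_smul]

end normalization

section rescaleField
variable {σ : Fin n → Fin n → ℤ}

theorem rescaleField_symm_gen_one (ξ : Cqˣ) (i : Fin n) :
    (rescaleField σ ξ (one_mul (1 : ℤ))).symm (gen σ i) = ((ξ⁻¹ : Cqˣ) : Cq) • gen σ i := by
  rw [AlgEquiv.symm_apply_eq, map_smul, rescaleField_gen, zpow_one, smul_smul, Units.inv_mul,
    one_smul]

theorem rescaleField_symm_gen_neg_one (ξ : Cqˣ) (i : Fin n) :
    (rescaleField σ ξ (neg_one_mul (-1 : ℤ))).symm (gen σ i) = (ξ : Cq) • (gen σ i)⁻¹ := by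
  rw [AlgEquiv.symm_apply_eq, map_smul, map_inv₀, rescaleField_gen, _root_.zpow_neg_one,
    smul_smul_inv_inv]

end rescaleField

/-- The quantum parameter `q`, as a unit. -/
def qUnit : Cqˣ := Units.mk0 q q_ne_zero

theorem qUnit_mul_qUnit : qUnit * qUnit = qSq := Units.ext (sq q).symm

namespace IdealTriangulation

/-- The values `Φ j` for the sides and the diagonal `j` of the square are those of the coordinate
change of Chekhov and Fock. -/
def ChekhovFockFormula (T : IdealTriangulation Γ n) (a b c d i : Fin n) (Φ : Fin n → T.K) : Prop :=
  Φ a = (1 + q • T.X i) * T.X a ∧ Φ b = (1 + q • (T.X i)⁻¹)⁻¹ * T.X b ∧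
  Φ c = (1 + q • T.X i) * T.X c ∧ Φ d = (1 + q • (T.X i)⁻¹)⁻¹ * T.X d ∧
  Φ i = (T.X i)⁻¹

namespace IsCoordinateChange
variable {Ψ : ∀ T T' : IdealTriangulation Γ n, T'.K ≃ₐ[Cq] T.K} {c₀ : Cqˣ} {g : RatFunc Cq}
  {T T' : IdealTriangulation Γ n} {a b c d i : Fin n}

/-- For `g = 1 + k X`, multiplying the generators by `k q⁻¹` normalizes the transition functions. -/
theorem chekhovFockFormula_one (hΨ : IsCoordinateChange Ψ) (hg : g ≠ 0)
    (ht : HasTransition Ψ c₀ g) {k : Cqˣ} (hk : g = 1 + (k : Cq) • RatFunc.X)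
    (hc : k * k * c₀ = qSq) (h : T.EmbeddedExchange T' a b c d i) :
    T.ChekhovFockFormula a b c d i fun j =>
      (rescaleField T.sigma (k * qUnit⁻¹) (one_mul 1)).symm
        (Ψ T T' (rescaleField T'.sigma (k * qUnit⁻¹) (one_mul 1) (T'.X j))) := by
  set ξ := k * qUnit⁻¹ with hξ
  have r1 : (k : Cq) = q * ξ := by
    have : k = qUnit * ξ := by rw [hξ, mul_comm k, mul_inv_cancel_left]
    exact congrArg Units.val this
  have r2 : (k : Cq) * c₀ * ξ = q := by
    have : k * c₀ * ξ = qUnit := by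
      rw [hξ, ← mul_assoc, mul_right_comm k, hc, ← qUnit_mul_qUnit, mul_inv_cancel_right]
    exact congrArg Units.val this
  have r3 : ξ * ξ * c₀ = 1 := by
    rw [hξ, mul_mul_mul_comm, mul_right_comm, hc, ← qUnit_mul_qUnit, ← _root_.mul_inv,
      mul_inv_cancel]
  have hs := rescaleField_symm_gen_one (σ := T.sigma) ξ
  have sides : ∀ {a b c d : Fin n}, T.EmbeddedExchange T' a b c d i →
      (rescaleField T.sigma ξ (one_mul 1)).symm
        (Ψ T T' (rescaleField T'.sigma ξ (one_mul 1) (T'.X a))) = (1 + q • T.X i) * T.X a ∧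
      (rescaleField T.sigma ξ (one_mul 1)).symm
        (Ψ T T' (rescaleField T'.sigma ξ (one_mul 1) (T'.X b)))
          = (1 + q • (T.X i)⁻¹)⁻¹ * T.X b := by
    intro a b c d h
    have e1 := (ht T T' a b c d i h).2
    have e2 := hΨ.apply_second hg ht h
    rw [hk, evalAt, ratEval_one_add] at e1
    rw [hk, evalAt, ratEval_flip_one_add] at e2
    rw [rescaleField_gen, rescaleField_gen, zpow_one, zpow_one, map_smul (Ψ T T'),
      map_smul (Ψ T T'), e1, e2]
    exact ⟨map_smul_one_add_mul (φ := (rescaleField T.sigma ξ _).symm.toAlgHom) (hs i) (hs a) r1,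
      map_smul_one_add_inv_mul (φ := (rescaleField T.sigma ξ _).symm.toAlgHom) (hs i) (hs b) r2⟩
  refine ⟨(sides h).1, (sides h).2, (sides h.rotate_twice).1, (sides h.rotate_twice).2, ?_⟩
  simp only
  rw [rescaleField_gen, zpow_one, map_smul (Ψ T T'), (ht T T' a b c d i h).1]
  exact map_smul_smul_inv (φ := (rescaleField T.sigma ξ _).symm.toAlgHom) (hs i) r3

/-- For `g = (1 + k q⁻² X⁻¹)⁻¹`, replacing each generator `X_j` by `k q⁻¹ X_j⁻¹` normalizes the
transition functions. -/
theorem chekhovFockFormula_neg_one (hΨ : IsCoordinateChange Ψ) (hΓ : IsSurfaceGroup Γ)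
    (hg : g ≠ 0) (ht : HasTransition Ψ c₀ g) {k : Cqˣ}
    (hk : g = (1 + ((k * qSq⁻¹ : Cqˣ) : Cq) • RatFunc.X⁻¹)⁻¹)
    (hc : k * k = qSq * c₀) (h : T.EmbeddedExchange T' a b c d i) :
    T.ChekhovFockFormula a b c d i fun j =>
      (rescaleField T.sigma (k * qUnit⁻¹) (neg_one_mul (-1))).symm
        (Ψ T T' (rescaleField T'.sigma (k * qUnit⁻¹) (neg_one_mul (-1)) (T'.X j))) := by
  set ξ := k * qUnit⁻¹ with hξ
  have r3 : ξ * ξ = c₀ := by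
    rw [hξ, mul_mul_mul_comm, hc, ← qUnit_mul_qUnit, ← _root_.mul_inv, mul_right_comm,
      mul_inv_cancel, one_mul]
  have r0 : k * qSq⁻¹ * ξ⁻¹ * qSq = qUnit := by
    rw [mul_right_comm, inv_mul_cancel_right, hξ, _root_.mul_inv, inv_inv, mul_inv_cancel_left]
  have r1 : ((k * qSq⁻¹ : Cqˣ) : Cq) * (ξ⁻¹ : Cqˣ) * qSq = q := congrArg Units.val r0
  have r2 : ((k * qSq⁻¹ : Cqˣ) : Cq) * (c₀ : Cq)⁻¹ * ξ * qSq = q := by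
    have : k * qSq⁻¹ * c₀⁻¹ * ξ * qSq = qUnit := by
      rw [← r3, mul_assoc (k * qSq⁻¹), _root_.mul_inv, inv_mul_cancel_right, r0]
    refine Eq.trans ?_ (congrArg Units.val this)
    simp only [Units.val_mul, Units.val_inv_eq_inv_val]
  have hs := rescaleField_symm_gen_neg_one (σ := T.sigma) ξ
  have sides : ∀ {a b c d : Fin n}, T.EmbeddedExchange T' a b c d i →
      (rescaleField T.sigma ξ (neg_one_mul (-1))).symm
        (Ψ T T' (rescaleField T'.sigma ξ (neg_one_mul (-1)) (T'.X a)))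
          = (1 + q • T.X i) * T.X a ∧
      (rescaleField T.sigma ξ (neg_one_mul (-1))).symm
        (Ψ T T' (rescaleField T'.sigma ξ (neg_one_mul (-1)) (T'.X b)))
          = (1 + q • (T.X i)⁻¹)⁻¹ * T.X b := by
    intro a b c d h
    obtain ⟨s1, s2, -, -⟩ := h.sigma_side_diag hΓ
    have e1 := (ht T T' a b c d i h).2
    have e2 := hΨ.apply_second hg ht h
    rw [hk, evalAt, ratEval_one_add_inv] at e1
    rw [hk, evalAt, ratEval_flip_one_add_inv] at e2
    rw [rescaleField_gen, rescaleField_gen, _root_.zpow_neg_one, _root_.zpow_neg_one,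
      map_smul (Ψ T T'), map_smul (Ψ T T'), map_inv₀ (Ψ T T'), map_inv₀ (Ψ T T'), e1, e2]
    exact ⟨map_smul_inv_one_add_inv_mul (φ := (rescaleField T.sigma ξ _).symm.toAlgHom)
        (hs i) (hs a) (by rw [SemiconjBy, X_mul_X, s1, zpow_one, smul_mul_assoc]) r1,
      map_smul_inv_one_add_mul (φ := (rescaleField T.sigma ξ _).symm.toAlgHom)
        (hs i) (hs b) (by rw [SemiconjBy, X_mul_X, s2, _root_.zpow_neg_one, smul_mul_assoc]) r2⟩
  refine ⟨(sides h).1, (sides h).2, (sides h.rotate_twice).1, (sides h.rotate_twice).2, ?_⟩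
  simp only
  rw [rescaleField_gen, _root_.zpow_neg_one, map_smul (Ψ T T'), map_inv₀ (Ψ T T'),
    (ht T T' a b c d i h).1]
  exact map_smul_inv_smul_inv (φ := (rescaleField T.sigma ξ _).symm.toAlgHom) (hs i) r3

end IsCoordinateChange
end IdealTriangulation
end QuantumTeichmuller

end

theorem proposition3 {n : ℕ} (Γ : Subgroup (GL (Fin 2) ℝ)) (hΓ : IsSurfaceGroup Γ)
    (hχ : eulerChar Γ < -2)
    (Ψ : ∀ T T' : IdealTriangulation Γ n, T'.K ≃ₐ[Cq] T.K)
    (hcomp : ∀ (T T' T'' : IdealTriangulation Γ n) (x : T''.K),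
      Ψ T T'' x = Ψ T T' (Ψ T' T'' x))
    (hreindex : ∀ (T : IdealTriangulation Γ n) (π : Equiv.Perm (Fin n)) (i : Fin n),
      Ψ T (T.reindex π) ((T.reindex π).X i) = T.X (π i))
    (hlocal : IdealTriangulation.LocalityCondition Ψ) :
    ∃ (ξ : Cq) (ε : ℤ) (Θ : ∀ T : IdealTriangulation Γ n, T.K ≃ₐ[Cq] T.K),
      ξ ≠ 0 ∧ (ε = 1 ∨ ε = -1) ∧
      (∀ (T : IdealTriangulation Γ n) (k : Fin n), Θ T (T.X k) = ξ • T.X k ^ ε) ∧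
      ∀ (T T' : IdealTriangulation Γ n) (a b c d i : Fin n), T.EmbeddedExchange T' a b c d i →
        (Θ T).symm (Ψ T T' (Θ T' (T'.X a))) = (1 + q • T.X i) * T.X a ∧
        (Θ T).symm (Ψ T T' (Θ T' (T'.X b))) = (1 + q • (T.X i)⁻¹)⁻¹ * T.X b ∧
        (Θ T).symm (Ψ T T' (Θ T' (T'.X c))) = (1 + q • T.X i) * T.X c ∧
        (Θ T).symm (Ψ T T' (Θ T' (T'.X d))) = (1 + q • (T.X i)⁻¹)⁻¹ * T.X d ∧
        (Θ T).symm (Ψ T T' (Θ T' (T'.X i))) = (T.X i)⁻¹ := by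
  have hΨ : IdealTriangulation.IsCoordinateChange Ψ := ⟨hcomp, hreindex, hlocal⟩
  -- one exchange provides the octagon; without any, the identity has the required properties
  by_cases hE : ∃ (T T' : IdealTriangulation Γ n) (a b c d i : Fin n),
    T.EmbeddedExchange T' a b c d i
  · obtain ⟨T, T', a, b, c, d, i, h⟩ := hE
    obtain ⟨c₀, g, hg, ht⟩ := hΨ.exists_hasTransition hΓ hχ h
    obtain ⟨U, p, e', s, hU⟩ := h.exists_octagon hΓ hχ
    obtain ⟨S, A, B, hq, hp⟩ := hΨ.exists_pentagonRelation hΓ ht (hU.hasUnitSquare hΓ).2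
    rcases hp.classification (hΨ.sideRelation hΓ hg ht h) hg (fun m => qSq_zpow_eq_one)
      (fun m => exists_isPrimitiveRoot) with ⟨k, hk, hc⟩ | ⟨k, hk, hc⟩
    · exact ⟨_, 1, fun T => rescaleField T.sigma (k * qUnit⁻¹) (one_mul 1), Units.ne_zero _,
        Or.inl rfl, fun T => rescaleField_gen _ _,
        fun T T' a b c d i h => hΨ.chekhovFockFormula_one hg ht hk hc h⟩
    · exact ⟨_, -1, fun T => rescaleField T.sigma (k * qUnit⁻¹) (neg_one_mul (-1)),
        Units.ne_zero _, Or.inr rfl, fun T => rescaleField_gen _ _,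
        fun T T' a b c d i h => hΨ.chekhovFockFormula_neg_one hΓ hg ht hk hc h⟩
  · exact ⟨1, 1, fun T => AlgEquiv.refl, one_ne_zero, Or.inl rfl,
      fun T k => by rw [one_smul, zpow_one, AlgEquiv.coe_refl, id],
      fun T T' a b c d i h => absurd ⟨T, T', a, b, c, d, i, h⟩ hE⟩
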